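/- Let $\chi_4$ be the non-trivial Dirichlet character modulo $4$, $\mu$ the Möbius function, $(a,b)$ and $[a,b]$ the gcd and lcm, and let $p$ always denote a prime. Let $$A=\frac1{\sqrt2}\prod_{p\equiv 3\,(4)}\Big(1-\frac1{p^2}\Big)^{-1/2}.$$ Let $g_1,g_2,g_4,g_7$ be the multiplicative functions (used only at odd squarefree integers) given on odd primes by $g_1(p)=1-\chi_4(p)/p$, $g_7(p)=p+1$, $$g_2(p)=\begin{cases}2-\frac1p & p\equiv1\ (4)\\ \frac1p& p\equiv 3\ (4)\end{cases},\qquad g_4(p)=\begin{cases}\frac{4p^2-3p+1}{p(p+1)} & p\equiv1\ (4)\\ g_2(p)& p\equiv 3\ (4)\end{cases},$$ and let $g_6(p)=\frac{(p-1)^2(2p+1)\log p}{(p+1)(4p^2-3p+1)}$ for $p\equiv 1\ (4)$ and $g_6(p)=\log p$ for $p\equiv3\ (4)$. Fix $\theta>0$. For a large integer $N$ put $v=N^{\theta}$, $D_0=(\log\log N)^3$, $W=\prod_{2<p\le D_0}p$ and $W_1=\prod_{p\le D_0,\ p\equiv1\,(4)}p$. Let $\mathcal S$ be the set of positive integers $a\le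 v$ with $(a,W)=1$ all of whose prime factors are $\equiv1\pmod 4$, and define $$X_{N,W}=\sum_{a\in\mathcal S}\frac{\mu(a)}{a}\log\frac va,\qquad Y_{N,W}=\sum_{\substack{a,b\in\mathcal S\\(a,b)=1}}\frac{\mu(a)\mu(b)}{g_7(a)g_7(b)}\log\frac va\log\frac vb,$$ $$Z^{(1)}_{N,W}=\sum_{a,b\in\mathcal S}\frac{\mu(a)\mu(b)g_4([a,b])}{g_2(a)g_2(b)[a,b]}\log\frac va\log\frac vb,$$ $$Z^{(2)}_{N,W}=\sum_{a,b\in\mathcal S}\frac{\mu(a)\mu(b)g_4([a,b])}{g_2(a)g_2(b)[a,b]}\log\frac va\log\frac vb\sum_{p\mid[a,b]}g_6(p).$$ Then, as $N\to\infty$, $$X_{N,W}=\big(1+O(D_0^{-1})\big)\frac{8A(\log v)^{1/2}}{\pi g_1(W_1)},\qquad Y_{N,W}=\big(1+O(D_0^{-1})\big)\frac{64A^2\log v}{\pi^2g_1(W_1)^2},$$ $$Z^{(1)}_{N,W}=\big(1+O(D_0^{-1})\big)\frac{128A^3(\log v)^{1/2}}{\pi^2g_1(W_1)^3},\qquad Z^{(2)}_{N,W}=-\big(1+O(D_0^{-1})\big)\frac{64A^3(\log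 v)^{3/2}}{\pi^2g_1(W_1)^3},$$ where the implied constants are absolute and the estimates hold for all $N\ge N_0(\theta)$. In particular, since $D_0\to\infty$, each quantity is asymptotic to its stated main term. -/

import Mathlib

namespace SumTwoSquaresSieve

noncomputable section

/-- The extension of a function on the primes to squarefree positive integers by multiplicativity:
`n ↦ ∏_{p ∣ n} f p`. It is only ever used at squarefree arguments (at the other arguments
that occur below, the Möbius factor vanishes). -/
def multExt (f : ℕ → ℝ) (n : ℕ) : ℝ := ∏ p ∈ n.primeFactors, f p

/-- `g₁(p) = 1 - χ₄(p) / p`, with `χ₄` the non-trivial character modulo `4`. -/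
def g₁ : ℕ → ℝ := multExt fun p => 1 - ((ZMod.χ₄ (p : ZMod 4) : ℤ) : ℝ) / (p : ℝ)

/-- The values of `g₂` at odd primes: `2 - 1/p` if `p ≡ 1 (mod 4)`, and `1/p` if `p ≡ 3 (mod 4)`. -/
def g₂Prime (p : ℕ) : ℝ := if p % 4 = 1 then 2 - 1 / (p : ℝ) else 1 / (p : ℝ)

/-- The multiplicative function `g₂`. -/
def g₂ : ℕ → ℝ := multExt g₂Prime

/-- The multiplicative function `g₄`: at an odd prime `p` it is `(4p² - 3p + 1) / (p (p + 1))` if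
`p ≡ 1 (mod 4)`, and `g₂(p)` if `p ≡ 3 (mod 4)`. -/
def g₄ : ℕ → ℝ := multExt fun p =>
  if p % 4 = 1 then (4 * (p : ℝ) ^ 2 - 3 * p + 1) / ((p : ℝ) * (p + 1)) else g₂Prime p

/-- The function `g₆` on odd primes. -/
def g₆ (p : ℕ) : ℝ :=
  if p % 4 = 1 then
    ((p : ℝ) - 1) ^ 2 * (2 * p + 1) * Real.log p / (((p : ℝ) + 1) * (4 * (p : ℝ) ^ 2 - 3 * p + 1))
  else Real.log p

/-- The multiplicative function with `g₇(p) = p + 1`. -/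
def g₇ : ℕ → ℝ := multExt fun p => (p : ℝ) + 1

/-- The Ramanujan–Landau constant `A = 2^{-1/2} ∏_{p ≡ 3 (mod 4)} (1 - p⁻²)^{-1/2}`. -/
def landauA : ℝ :=
  1 / √2 * ∏' p : {p : ℕ // p.Prime ∧ p % 4 = 3}, (1 - 1 / ((p : ℕ) : ℝ) ^ 2) ^ (-(1 / 2) : ℝ)

/-- `D₀ = (log log N)³`. -/
def D₀ (N : ℕ) : ℝ := Real.log (Real.log N) ^ 3

/-- The finite set of primes `p ≤ D₀`. -/
def smallPrimes (N : ℕ) : Finset ℕ := (Finset.range (⌊D₀ N⌋₊ + 1)).filter Nat.Prime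

/-- `W = ∏_{2 < p ≤ D₀} p`. -/
def W (N : ℕ) : ℕ := ∏ p ∈ (smallPrimes N).filter (fun p => 2 < p), p

/-- `W₁ = ∏_{p ≤ D₀, p ≡ 1 (mod 4)} p`. -/
def W₁ (N : ℕ) : ℕ := ∏ p ∈ (smallPrimes N).filter (fun p => p % 4 = 1), p

/-- The range of summation: integers `1 ≤ a ≤ v` coprime to `w`, all of whose prime factors are
`≡ 1 (mod 4)`. -/
def idx (v : ℝ) (w : ℕ) : Finset ℕ :=
  (Finset.Icc 1 ⌊v⌋₊).filter fun a => a.Coprime w ∧ ∀ p ∈ a.primeFactors, p % 4 = 1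

/-- The Möbius function with real values. -/
def mu (a : ℕ) : ℝ := ((ArithmeticFunction.moebius a : ℤ) : ℝ)

/-- `∑ μ(a)/a · log(v/a)`. -/
def X (v : ℝ) (w : ℕ) : ℝ := ∑ a ∈ idx v w, mu a / a * Real.log (v / a)

/-- `∑ μ(a)μ(b)/(g₇(a)g₇(b)) · log(v/a) log(v/b)` over coprime `a, b`. -/
def Y (v : ℝ) (w : ℕ) : ℝ :=
  ∑ a ∈ idx v w, ∑ b ∈ (idx v w).filter (fun b => a.Coprime b),
    mu a * mu b / (g₇ a * g₇ b) * Real.log (v / a) * Real.log (v / b)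

/-- `μ(a)μ(b)g₄([a,b])/(g₂(a)g₂(b)[a,b]) · log(v/a) log(v/b)`. -/
def zTerm (v : ℝ) (a b : ℕ) : ℝ :=
  mu a * mu b * g₄ (a.lcm b) / (g₂ a * g₂ b * (a.lcm b : ℕ)) * Real.log (v / a) * Real.log (v / b)

/-- The sum `Z⁽¹⁾`. -/
def Z1 (v : ℝ) (w : ℕ) : ℝ := ∑ a ∈ idx v w, ∑ b ∈ idx v w, zTerm v a b

/-- The sum `Z⁽²⁾`. -/
def Z2 (v : ℝ) (w : ℕ) : ℝ :=
  ∑ a ∈ idx v w, ∑ b ∈ idx v w, zTerm v a b * ∑ p ∈ (a.lcm b).primeFactors, g₆ p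

/-- `S = (1 + O(δ)) M` with the constant `C`: `S = (1 + ε) M` for some real `|ε| ≤ C δ`. -/
def RelApprox (C δ S M : ℝ) : Prop := ∃ ε : ℝ, |ε| ≤ C * δ ∧ S = (1 + ε) * M

end

end SumTwoSquaresSieve

open SumTwoSquaresSieve

/-! ### Dirichlet convolution and the partial sums of χ₄ and 1 ∗ χ₄ -/

section
namespace SumTwoSquaresSieve
open Finset ArithmeticFunction
open scoped ArithmeticFunction.zeta ArithmeticFunction.Moebius

/-! Put z = ⌊D₀⌋ and L = log v, and let `ff z` be μ(n)/n on the integers composed of primes p ≡ 1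
(mod 4), p > z. Then X is the sum `tt z` of `ff z` against log(v/n). Its generating series behaves
like a square root of 1/(ζ(s)L(s,χ₄)), and the proof avoids the branch point by squaring. Since χ₄ =
1 on the primes concerned, `ff_mul_ff_eq` writes `ff z * ff z` as the Dirichlet inverse of 1 ∗ χ₄
(weighted by 1/n) convolved with a nonnegative function `ee z`, whose sum is 4A²/g₁(W₁)² (`tsum_ee`,
`g₁_W₁`).

For that inverse, the logarithmic sum `kk` tends to 4/π in mean square: its Laplace transform is
1/(w²ζ(1+w)L(1+w,χ₄)). After subtraction of a model with the same pole at 0, this transform is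
bounded near 0 and is O(|t|^{-9/8}) further up, by a 3-4-1 lower bound for the two L-functions
modulo 4 (`exists_norm_LSeries_ge`). Plancherel then bounds the integral of (kk(e^u) − 4/π)²
(`exists_integral_kk_sub_sq_le`). Consequently `vv z`, the logarithmic sum of `ff z * ff z`, is
close in mean square to a constant `cc z`.

To return from the square, use ff = ss ∗ (ff ∗ ff), where `ss z` is the inverse of `ff z`, that is
1/n on the same integers. Hence tt(v) = Σ ss(d) vv(v/d). The sum of `ss z` up to e^u is
g₁(W₁)√u/(2A) up to an error bounded in u: Mertens' theorem for p ≡ 1 (mod 4) and a Tauberian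
argument give the shape, and a Laplace transform with the factorisation of ζ(s)L(s,χ₄) gives the
constant. Cauchy–Schwarz replaces vv by cc at the price of L^{1/4} against the main term √L. This
settles X.

The double sums are handled by an algebra of dilations of functions of (a, b). Each sum is a product
over p of local factors applied to log ⊗ log. The factors of Z⁽¹⁾ agree up to O(p⁻²) with
(1−x/p)²(1−y/p)²/(1−xy/p), and those of Y with (1−x/p)(1−y/p). The total relative error is Σ_{p>z}
O(p⁻²) = O(1/D₀) (`abs_act_prod_sub_le`). The model for Y is tt(v)². The model for Z⁽¹⁾ is `th`, the
sum of ss(d)vv(v/d)², with main term `ka z`·√L.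

In Z⁽²⁾ the condition q | [a,b] removes the constant term of the local factor at q. To first order
the contribution of q is (1 − 2 − 2)/q = −3/q times ka·√(L − log q). With g₆(q) ≈ ½ log q, a
weighted Mertens sum gives −½·ka·L^{3/2}.

All errors are controlled by `hz z`, at most a constant times exp(24 z^{1/4}). As z ≤ (log log N)³,
this is smaller than any power of log N. So only N₀ depends on θ, and C is absolute. -/

/-- The arithmetic function attached to a completely multiplicative function. -/
noncomputable def cm (g : ℕ →*₀ ℝ) : ArithmeticFunction ℝ := ⟨g, map_zero g⟩

/-- The Dirichlet inverse of a completely multiplicative function. -/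
noncomputable def cmInv (g : ℕ →*₀ ℝ) : ArithmeticFunction ℝ := ⟨fun n => mu n * g n, by simp⟩

@[simp] lemma cm_apply (g : ℕ →*₀ ℝ) (n : ℕ) : cm g n = g n := rfl

@[simp] lemma cmInv_apply (g : ℕ →*₀ ℝ) (n : ℕ) : cmInv g n = mu n * g n := rfl

/-- Complete multiplicativity pulls g(n) out of the convolution, leaving the sum of μ over divisors.
-/
lemma cm_mul_cmInv (g : ℕ →*₀ ℝ) : cm g * cmInv g = 1 := by
  ext n
  rcases eq_or_ne n 0 with rfl | hn
  · simp
  have h : (cm g * cmInv g) n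
      = g n * ((((ζ : ArithmeticFunction ℤ) * μ : ArithmeticFunction ℤ) n : ℤ) : ℝ) := by
    rw [mul_apply, mul_apply, Int.cast_sum, Finset.mul_sum]
    refine Finset.sum_congr rfl fun x hx => ?_
    have hx' := Nat.mem_divisorsAntidiagonal.mp hx
    have h1 : x.1 ≠ 0 := fun h => hx'.2 (by rw [← hx'.1, h, zero_mul])
    simp only [cm_apply, cmInv_apply, mu, natCoe_apply, zeta_apply, h1, if_false]
    rw [← hx'.1, map_mul]
    push_cast
    ring
  rw [h, coe_zeta_mul_moebius, one_apply, one_apply]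
  split_ifs with h1
  · simp [h1]
  · simp

/-- `n ↦ f n / n`. -/
noncomputable def til (f : ArithmeticFunction ℝ) : ArithmeticFunction ℝ :=
  ⟨fun n => f n / n, by simp⟩

@[simp] lemma til_apply (f : ArithmeticFunction ℝ) (n : ℕ) : til f n = f n / n := rfl

lemma til_mul (f g : ArithmeticFunction ℝ) : til (f * g) = til f * til g := by
  ext n
  rw [til_apply, mul_apply, mul_apply, Finset.sum_div]
  refine Finset.sum_congr rfl fun x hx => ?_
  have hx' := Nat.mem_divisorsAntidiagonal.mp hx
  rw [til_apply, til_apply, ← hx'.1, Nat.cast_mul, mul_div_mul_comm]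

lemma til_one : til 1 = 1 := by
  ext n
  rw [til_apply, one_apply]
  split_ifs with h <;> simp [h]

/-- `∑_{n ≤ x} c(n) h(x / n)`. -/
noncomputable def ev (c : ArithmeticFunction ℝ) (h : ℝ → ℝ) (x : ℝ) : ℝ :=
  ∑ n ∈ Ioc 0 ⌊x⌋₊, c n * h (x / n)

lemma ev_one (h : ℝ → ℝ) {x : ℝ} (hx : 1 ≤ x) : ev 1 h x = h x := by
  have : 1 ∈ Ioc 0 ⌊x⌋₊ := by
    simp [Nat.one_le_floor_iff, hx]
  rw [ev, Finset.sum_eq_single_of_mem 1 this]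
  · simp
  · intro b _ hb
    simp [one_apply, hb]

/-- Both sides run over pairs (a, b) with ab ≤ x; the ranges match because ⌊⌊x⌋/n⌋ = ⌊x/n⌋. Thus
`ev` is an action of the Dirichlet ring, and every convolution identity below becomes an identity
between weighted sums. -/
lemma ev_mul (c d : ArithmeticFunction ℝ) (h : ℝ → ℝ) (x : ℝ) :
    ev (c * d) h x = ev c (ev d h) x := by
  have e1 : ev (c * d) h x
      = ∑ n ∈ Ioc 0 ⌊x⌋₊, ∑ y ∈ n.divisorsAntidiagonal, c y.1 * d y.2 * h (x / (y.1 * y.2)) := by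
    refine Finset.sum_congr rfl fun n _ => ?_
    rw [mul_apply, Finset.sum_mul]
    refine Finset.sum_congr rfl fun y hy => ?_
    rw [← (Nat.mem_divisorsAntidiagonal.mp hy).1]
    push_cast
    rfl
  have e2 : ev c (ev d h) x = ∑ n ∈ Ioc 0 ⌊x⌋₊, ∑ m ∈ Ioc 0 (⌊x⌋₊ / n),
      c n * d m * h (x / (n * m)) := by
    refine Finset.sum_congr rfl fun n _ => ?_
    rw [ev, Finset.mul_sum, Nat.floor_div_natCast]
    refine Finset.sum_congr rfl fun m _ => ?_
    rw [div_div, mul_assoc]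
  rw [e1, e2, Finset.sum_sigma', Finset.sum_sigma']
  refine Finset.sum_bij' (fun a _ => ⟨a.2.1, a.2.2⟩) (fun a _ => ⟨a.1 * a.2, (a.1, a.2)⟩)
    ?_ ?_ ?_ ?_ ?_
  · rintro ⟨n, a, b⟩ h
    simp only [mem_sigma, mem_Ioc, Nat.mem_divisorsAntidiagonal] at h ⊢
    obtain ⟨⟨h1, h2⟩, h3, h4⟩ := h
    subst h3
    have ha : 0 < a := Nat.pos_of_ne_zero fun h => by simp [h] at h1
    have hb : 0 < b := Nat.pos_of_ne_zero fun h => by simp [h] at h1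
    exact ⟨⟨ha, (Nat.le_mul_of_pos_right a hb).trans h2⟩, hb,
      (Nat.le_div_iff_mul_le ha).mpr (by linarith [mul_comm a b])⟩
  · rintro ⟨n, m⟩ h
    simp only [mem_sigma, mem_Ioc, Nat.mem_divisorsAntidiagonal] at h ⊢
    obtain ⟨⟨h1, h2⟩, h3, h4⟩ := h
    have := (Nat.le_div_iff_mul_le h1).mp h4
    exact ⟨⟨by positivity, by linarith [mul_comm n m]⟩, by simp, by positivity⟩
  · rintro ⟨n, a, b⟩ h
    simp only [mem_sigma, mem_Ioc, Nat.mem_divisorsAntidiagonal] at h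
    obtain ⟨_, h3, _⟩ := h
    subst h3
    rfl
  · rintro ⟨n, m⟩ _
    rfl
  · rintro ⟨n, a, b⟩ _
    rfl

/-- A sum against a nonnegative decreasing weight is controlled by the partial sums. -/
lemma abs_sum_mul_le_of_antitone {c φ : ℕ → ℝ} {m : ℕ} {B : ℝ}
    (hc : ∀ k, |∑ n ∈ Ioc m k, c n| ≤ B) (h0 : ∀ n, 0 ≤ φ n)
    (hφ : ∀ n, m < n → φ (n + 1) ≤ φ n) (N : ℕ) :
    |∑ n ∈ Ioc m N, c n * φ n| ≤ B * φ (m + 1) := by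
  have hB : 0 ≤ B := (abs_nonneg _).trans (hc 0)
  rcases Nat.lt_or_ge m N with h | h
  · have key : |∑ n ∈ Ioc m N, c n * φ n - (∑ n ∈ Ioc m N, c n) * φ N|
        ≤ B * (φ (m + 1) - φ N) := by
      induction N, h using Nat.le_induction with
      | base => simp
      | succ k hk ih =>
        rw [Finset.sum_Ioc_succ_top (by omega), Finset.sum_Ioc_succ_top (by omega)]
        have e : ∑ n ∈ Ioc m k, c n * φ n + c (k + 1) * φ (k + 1)
            - (∑ n ∈ Ioc m k, c n + c (k + 1)) * φ (k + 1)
            = (∑ n ∈ Ioc m k, c n * φ n - (∑ n ∈ Ioc m k, c n) * φ k)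
              + (∑ n ∈ Ioc m k, c n) * (φ k - φ (k + 1)) := by ring
        rw [e]
        have h1 := hφ k (by omega)
        have h2 : |(∑ n ∈ Ioc m k, c n) * (φ k - φ (k + 1))| ≤ B * (φ k - φ (k + 1)) := by
          rw [abs_mul, abs_of_nonneg (sub_nonneg.mpr h1)]
          exact mul_le_mul_of_nonneg_right (hc k) (sub_nonneg.mpr h1)
        refine (abs_add_le _ _).trans ?_
        linarith
    have h2 : |(∑ n ∈ Ioc m N, c n) * φ N| ≤ B * φ N := by
      rw [abs_mul, abs_of_nonneg (h0 N)]
      exact mul_le_mul_of_nonneg_right (hc N) (h0 N)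
    have := abs_sub_abs_le_abs_sub (∑ n ∈ Ioc m N, c n * φ n) ((∑ n ∈ Ioc m N, c n) * φ N)
    linarith
  · rw [Finset.Ioc_eq_empty (by omega)]
    simpa using mul_nonneg hB (h0 _)

/-- Partial summation by induction. The induction hypothesis subtracts the boundary term (Σ a)/√N,
which is itself at most B√N; hence the factor 2. -/
lemma sum_div_sqrt_le {a : ℕ → ℝ} {B : ℝ} (hB : 0 ≤ B)
    (h : ∀ N : ℕ, ∑ n ∈ Ioc 0 N, a n ≤ B * N) (N : ℕ) :
    ∑ n ∈ Ioc 0 N, a n / √n ≤ 2 * B * √N := by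
  have key : ∑ n ∈ Ioc 0 N, a n / √n - (∑ n ∈ Ioc 0 N, a n) / √N ≤ B * √N := by
    induction N with
    | zero => simp
    | succ k ih =>
      rw [Finset.sum_Ioc_succ_top (by omega), Finset.sum_Ioc_succ_top (by omega)]
      set s := √(k : ℝ) with hs
      set t := √((k + 1 : ℕ) : ℝ) with ht
      have ht0 : 0 < t := Real.sqrt_pos.mpr (by positivity)
      have hst : s ≤ t := Real.sqrt_le_sqrt (by push_cast; linarith)
      have hs0 : 0 ≤ s := Real.sqrt_nonneg _
      have hk : (k : ℝ) = s * s := (Real.mul_self_sqrt (by positivity)).symm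
      have h1 := h k
      have h2 : (∑ n ∈ Ioc 0 k, a n) / s - (∑ n ∈ Ioc 0 k, a n) / t ≤ B * (t - s) := by
        rcases hs0.eq_or_lt with h0 | h0
        · have : k = 0 := by
            have : (k : ℝ) = 0 := by rw [hk, ← h0]; simp
            exact_mod_cast this
          subst this
          simpa using mul_nonneg hB (sub_nonneg.mpr hst)
        · have e : (∑ n ∈ Ioc 0 k, a n) / s - (∑ n ∈ Ioc 0 k, a n) / t
              = (∑ n ∈ Ioc 0 k, a n) * ((t - s) / (s * t)) := by
            field_simp
          rw [e]
          calc _ ≤ (B * (s * s)) * ((t - s) / (s * t)) := by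
                rw [← hk]
                exact mul_le_mul_of_nonneg_right h1
                  (div_nonneg (sub_nonneg.mpr hst) (by positivity))
            _ = B * (t - s) * (s / t) := by field_simp
            _ ≤ B * (t - s) * 1 := by
                refine mul_le_mul_of_nonneg_left ((div_le_one ht0).mpr hst)
                  (mul_nonneg hB (sub_nonneg.mpr hst))
            _ = _ := mul_one _
      rw [add_div]
      linarith
  have h2 : (∑ n ∈ Ioc 0 N, a n) / √N ≤ B * √N := by
    refine div_le_of_le_mul₀ (Real.sqrt_nonneg _) (by positivity) ?_
    rw [mul_assoc, Real.mul_self_sqrt (by positivity)]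
    exact h N
  linarith

/-- The non-trivial character modulo `4`, as a real-valued completely multiplicative function. -/
noncomputable def chi : ℕ →*₀ ℝ where
  toFun n := ((ZMod.χ₄ (n : ZMod 4) : ℤ) : ℝ)
  map_zero' := by simp
  map_one' := by simp
  map_mul' a b := by push_cast; rw [map_mul]; push_cast; rfl

lemma chi_apply (n : ℕ) : chi n = ((ZMod.χ₄ (n : ZMod 4) : ℤ) : ℝ) := rfl

lemma chi_eq (n : ℕ) : chi n = if n % 4 = 1 then 1 else if n % 4 = 3 then -1 else 0 := by
  rw [chi_apply, ZMod.χ₄_nat_eq_if_mod_four]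
  split_ifs <;> first | omega | simp

lemma abs_chi_le (n : ℕ) : |chi n| ≤ 1 := by
  rw [chi_eq]; split_ifs <;> simp

lemma sum_chi (k : ℕ) : ∑ n ∈ Ioc 0 k, chi n = if k % 4 = 1 ∨ k % 4 = 2 then 1 else 0 := by
  induction k with
  | zero => simp
  | succ k ih =>
    rw [Finset.sum_Ioc_succ_top (by omega), ih, chi_eq]
    split_ifs <;> first | omega | norm_num

lemma abs_sum_chi_le (m k : ℕ) : |∑ n ∈ Ioc m k, chi n| ≤ 1 := by
  rcases Nat.lt_or_ge k m with h | h
  · rw [Finset.Ioc_eq_empty (by omega)]; simp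
  · have := Finset.sum_Ioc_consecutive (fun n => chi n) (Nat.zero_le m) h
    rw [sum_chi, sum_chi] at this
    rw [eq_sub_of_add_eq' this]
    split_ifs <;> simp

lemma sum_chi_div_eq (k : ℕ) :
    ∑ n ∈ Ioc 0 (2 * k), chi n / n = ∑ i ∈ range k, (-1 : ℝ) ^ i / (2 * i + 1) := by
  induction k with
  | zero => simp
  | succ k ih =>
    rw [show 2 * (k + 1) = 2 * k + 1 + 1 by ring, Finset.sum_Ioc_succ_top (by omega),
      Finset.sum_Ioc_succ_top (by omega), ih, Finset.sum_range_succ, chi_eq, chi_eq]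
    have h2 : ¬ (2 * k + 1 + 1) % 4 = 1 ∧ ¬ (2 * k + 1 + 1) % 4 = 3 := by omega
    rw [if_neg h2.1, if_neg h2.2]
    rcases Nat.even_or_odd k with hk | hk
    · rw [if_pos (by obtain ⟨j, rfl⟩ := hk; omega), hk.neg_one_pow]
      push_cast; ring
    · rw [if_neg (by obtain ⟨j, rfl⟩ := hk; omega), if_pos (by obtain ⟨j, rfl⟩ := hk; omega),
        hk.neg_one_pow]
      push_cast; ring

/-- The limit is Leibniz's series. The tail pairs χ₄, whose block sums are at most 1, with the
decreasing weight 1/n, so its first weight 1/(m+1) bounds it. -/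
lemma abs_sum_chi_div_sub_le (m : ℕ) :
    |∑ n ∈ Ioc 0 m, chi n / n - Real.pi / 4| ≤ 1 / (m + 1) := by
  have h := Real.tendsto_sum_pi_div_four
  simp_rw [← sum_chi_div_eq] at h
  have h2 : Filter.Tendsto (fun k => |∑ n ∈ Ioc 0 m, chi n / n - ∑ n ∈ Ioc 0 (2 * k), chi n / n|)
      Filter.atTop (nhds |∑ n ∈ Ioc 0 m, chi n / n - Real.pi / 4|) :=
    (tendsto_const_nhds.sub h).abs
  refine le_of_tendsto h2 (Filter.eventually_atTop.mpr ⟨m, fun k hk => ?_⟩)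
  have := Finset.sum_Ioc_consecutive (fun n => chi n / n) (Nat.zero_le m)
    (show m ≤ 2 * k by omega)
  rw [← this, sub_add_cancel_left, abs_neg]
  have := abs_sum_mul_le_of_antitone (c := fun n => chi n) (φ := fun n => 1 / (n : ℝ)) (m := m)
    (B := 1) (abs_sum_chi_le m) (fun n => by positivity)
    (fun n hn => one_div_le_one_div_of_le (by exact_mod_cast (Nat.zero_le m).trans_lt hn)
      (by push_cast; linarith)) (2 * k)
  simpa [div_eq_mul_inv] using this

/-- The convolution `1 * χ₄`. -/
noncomputable def rr : ArithmeticFunction ℝ := (ζ : ArithmeticFunction ℝ) * cm chi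

/-- The Dirichlet inverse of `1 * χ₄`. -/
noncomputable def nu : ArithmeticFunction ℝ := (μ : ArithmeticFunction ℝ) * cmInv chi

lemma rr_mul_nu : rr * nu = 1 := by
  rw [rr, nu, mul_mul_mul_comm, cm_mul_cmInv, coe_zeta_mul_coe_moebius, one_mul]

lemma sum_rr (N : ℕ) : ∑ n ∈ Ioc 0 N, rr n = ∑ d ∈ Ioc 0 N, chi d * (N / d : ℕ) := by
  rw [rr, mul_comm, sum_Ioc_mul_zeta_eq_sum]
  rfl

/-- Partial sums of `1 * χ₄`. -/
lemma abs_sum_rr_sub_le (N : ℕ) : |∑ n ∈ Ioc 0 N, rr n - Real.pi / 4 * N| ≤ 3 * √N := by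
  rw [sum_rr]
  -- Hyperbola method cut at √N. For d ≤ m the integer parts are dropped at a cost of 1 each; for d
  -- > m the character cancels against the decreasing ⌊N/d⌋; completing the Leibniz series costs
  -- N/(m+1). Each of the three errors is at most √N.
  set m := Nat.sqrt N with hm
  have hm1 : (m : ℝ) ≤ √N := by
    apply Real.le_sqrt_of_sq_le
    have := Nat.sqrt_le' N
    exact_mod_cast this
  have hm2 : √N ≤ (m : ℝ) + 1 := by
    apply Real.sqrt_le_iff.mpr ⟨by positivity, ?_⟩
    have := (Nat.lt_succ_sqrt' N).le
    exact_mod_cast this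
  have hmN : m ≤ N := Nat.sqrt_le_self N
  have hNm : (N : ℝ) / (m + 1) ≤ √N := by
    rw [div_le_iff₀ (by positivity)]
    calc (N : ℝ) = √N * √N := (Real.mul_self_sqrt (by positivity)).symm
      _ ≤ _ := by gcongr
  rw [← Finset.sum_Ioc_consecutive _ (Nat.zero_le m) hmN]
  have h1 : |∑ d ∈ Ioc 0 m, chi d * (N / d : ℕ) - N * ∑ d ∈ Ioc 0 m, chi d / d| ≤ m := by
    rw [Finset.mul_sum, ← Finset.sum_sub_distrib]
    refine (Finset.abs_sum_le_sum_abs _ _).trans ?_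
    calc _ ≤ ∑ d ∈ Ioc 0 m, (1 : ℝ) := by
          refine Finset.sum_le_sum fun d hd => ?_
          have hd0 : 0 < d := (Finset.mem_Ioc.mp hd).1
          have : chi d * (N / d : ℕ) - N * (chi d / d) = chi d * ((N / d : ℕ) - (N : ℝ) / d) := by
            ring
          rw [this, abs_mul]
          have h3 : ((N / d : ℕ) : ℝ) ≤ (N : ℝ) / d := Nat.cast_div_le
          have h4 : (N : ℝ) / d < (N / d : ℕ) + 1 := by
            rw [div_lt_iff₀ (by positivity)]
            have := Nat.lt_div_mul_add (a := N) hd0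
            have h5 : (N : ℝ) < (N / d : ℕ) * d + d := by exact_mod_cast this
            linarith
          have h5 : |((N / d : ℕ) : ℝ) - (N : ℝ) / d| ≤ 1 := by
            rw [abs_le]; constructor <;> linarith
          calc _ ≤ 1 * 1 := mul_le_mul (abs_chi_le d) h5 (abs_nonneg _) zero_le_one
            _ = 1 := one_mul 1
      _ = m := by simp
  have h2 : |∑ d ∈ Ioc m N, chi d * (N / d : ℕ)| ≤ √N := by
    have := abs_sum_mul_le_of_antitone (c := fun n => chi n) (φ := fun d => ((N / d : ℕ) : ℝ))
      (m := m) (B := 1) (abs_sum_chi_le m) (fun n => by positivity)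
      (fun n hn => by exact_mod_cast Nat.div_le_div_left (by omega) (by omega)) N
    refine this.trans ?_
    rw [one_mul]
    refine le_trans Nat.cast_div_le ?_
    push_cast
    exact hNm
  have h3 : |N * ∑ d ∈ Ioc 0 m, chi d / d - Real.pi / 4 * N| ≤ √N := by
    have := abs_sum_chi_div_sub_le m
    rw [show N * ∑ d ∈ Ioc 0 m, chi d / d - Real.pi / 4 * N
      = N * (∑ d ∈ Ioc 0 m, chi d / d - Real.pi / 4) by ring, abs_mul, Nat.abs_cast]
    calc _ ≤ N * (1 / ((m : ℝ) + 1)) := by gcongr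
      _ = (N : ℝ) / (m + 1) := by ring
      _ ≤ _ := hNm
  rw [abs_le] at *
  constructor <;> linarith

end SumTwoSquaresSieve
end

/-! ### The Dirichlet inverse of 1 ∗ χ₄ and its logarithmic sum -/

section
namespace SumTwoSquaresSieve
open Finset ArithmeticFunction
open scoped ArithmeticFunction.zeta ArithmeticFunction.Moebius

lemma isMultiplicative_cm (g : ℕ →*₀ ℝ) : (cm g).IsMultiplicative :=
  ⟨by simp, fun _ => by simp⟩

lemma isMultiplicative_cmInv (g : ℕ →*₀ ℝ) : (cmInv g).IsMultiplicative := by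
  refine ⟨by simp [mu], fun {m n} h => ?_⟩
  simp only [cmInv_apply, mu, isMultiplicative_moebius.map_mul_of_coprime h, map_mul]
  push_cast
  ring

lemma isMultiplicative_rr : rr.IsMultiplicative :=
  isMultiplicative_zeta.natCast.mul (isMultiplicative_cm chi)

lemma isMultiplicative_nu : nu.IsMultiplicative :=
  isMultiplicative_moebius.intCast.mul (isMultiplicative_cmInv chi)

lemma rr_prime_pow {p : ℕ} (hp : p.Prime) (k : ℕ) :
    rr (p ^ k) = ∑ j ∈ range (k + 1), chi p ^ j := by
  rw [rr, coe_zeta_mul_apply, Nat.sum_divisors_prime_pow hp]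
  simp

/-- These are the coefficients of the local factor (1 − X)(1 − χ₄(p)X). -/
lemma nu_prime_pow {p : ℕ} (hp : p.Prime) (k : ℕ) :
    nu (p ^ k) = if k = 0 then 1 else if k = 1 then -1 - chi p else if k = 2 then chi p else 0 := by
  have h0 : ∀ j : ℕ, 2 ≤ j → μ (p ^ j) = 0 := fun j hj => by
    rw [moebius_apply_prime_pow hp (by omega), if_neg (by omega)]
  have h1 : μ p = -1 := moebius_apply_prime hp
  rw [nu, mul_apply, Nat.sum_divisorsAntidiagonal (f := fun a b => (μ : ArithmeticFunction ℝ) a *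
    cmInv chi b), Nat.sum_divisors_prime_pow hp]
  have hdiv : ∀ j ∈ range (k + 1), p ^ k / p ^ j = p ^ (k - j) := fun j hj =>
    Nat.pow_div (by have := Finset.mem_range.mp hj; omega) hp.pos
  rw [Finset.sum_congr rfl fun j hj => by rw [hdiv j hj]]
  rcases k with _ | _ | _ | k
  · simp [mu]
  · simp [Finset.sum_range_succ, mu, h1]
    ring
  · simp [Finset.sum_range_succ, mu, h1, h0 2 le_rfl]
  · have : ∀ j ∈ range (k + 1 + 1 + 1 + 1), ((μ : ArithmeticFunction ℝ) (p ^ j)) *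
        (cmInv chi) (p ^ (k + 1 + 1 + 1 - j)) = 0 := fun j hj => by
      rcases Nat.lt_or_ge j 2 with h | h
      · simp [mu, h0 (k + 1 + 1 + 1 - j) (by omega)]
      · simp [h0 j h]
    rw [Finset.sum_eq_zero this]
    simp

lemma rr_prime_pow_nonneg {p : ℕ} (hp : p.Prime) (k : ℕ) : 0 ≤ rr (p ^ k) := by
  rw [rr_prime_pow hp, chi_eq]
  split_ifs
  · positivity
  · rw [neg_one_geom_sum]; split_ifs <;> simp
  · positivity

lemma rr_nonneg (n : ℕ) : 0 ≤ rr n := by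
  rcases eq_or_ne n 0 with rfl | hn
  · simp
  rw [isMultiplicative_rr.multiplicative_factorization _ hn]
  exact Finset.prod_nonneg fun p hp => rr_prime_pow_nonneg (Nat.prime_of_mem_primeFactors hp) _

/-- By multiplicativity only prime powers matter. There is equality at exponent 1, the inequality
|χ| ≤ 1 + χ + χ² at exponent 2, and beyond that `nu` vanishes. -/
lemma abs_nu_le (n : ℕ) : |nu n| ≤ rr n := by
  rcases eq_or_ne n 0 with rfl | hn
  · simp
  rw [isMultiplicative_rr.multiplicative_factorization _ hn,
    isMultiplicative_nu.multiplicative_factorization _ hn, Finsupp.prod, Finsupp.prod,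
    Finset.abs_prod]
  refine Finset.prod_le_prod (fun _ _ => abs_nonneg _) fun p hp => ?_
  have hp' := Nat.prime_of_mem_primeFactors hp
  generalize n.factorization p = k
  rw [nu_prime_pow hp', rr_prime_pow hp', chi_eq]
  split_ifs
  all_goals try subst k
  all_goals norm_num [Finset.sum_range_succ]
  all_goals try positivity
  rcases Nat.even_or_odd k with h | h
  · simp [h]
  · simp [Nat.not_even_iff_odd.mpr h, h.neg_one_pow]

lemma sum_rr_le (N : ℕ) : ∑ n ∈ Ioc 0 N, rr n ≤ 4 * N := by
  have h := (abs_le.mp (abs_sum_rr_sub_le N)).2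
  have h1 : √(N : ℝ) ≤ N := by
    rcases Nat.eq_zero_or_pos N with rfl | h
    · simp
    · have : (1 : ℝ) ≤ N := by exact_mod_cast h
      rw [Real.sqrt_le_left (by positivity)]
      nlinarith
  have h2 : Real.pi / 4 * N ≤ 1 * N :=
    mul_le_mul_of_nonneg_right (by linarith [Real.pi_le_four]) (by positivity)
  linarith

/-- Partial sums of `1 * χ₄` at the integer part of a quotient. -/
lemma abs_sum_rr_div_sub_le {N n : ℕ} (hn : 0 < n) (hnN : n ≤ N) :
    |∑ m ∈ Ioc 0 (N / n), rr m - Real.pi / 4 * (N / n : ℝ)| ≤ 4 * (√N / √n) := by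
  have h1 := abs_sum_rr_sub_le (N / n)
  have h3 : ((N / n : ℕ) : ℝ) ≤ (N : ℝ) / n := Nat.cast_div_le
  have h4 : (N : ℝ) / n < (N / n : ℕ) + 1 := by
    rw [div_lt_iff₀ (by positivity)]
    have := Nat.lt_div_mul_add (a := N) hn
    have h5 : (N : ℝ) < (N / n : ℕ) * n + n := by exact_mod_cast this
    linarith
  have h5 : √((N / n : ℕ) : ℝ) ≤ √N / √n := by
    rw [← Real.sqrt_div (by positivity)]
    exact Real.sqrt_le_sqrt h3
  have h6 : 1 ≤ √(N : ℝ) / √n := by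
    rw [← Real.sqrt_div (by positivity), Real.one_le_sqrt, one_le_div (by positivity)]
    exact_mod_cast hnN
  have h7 : |Real.pi / 4 * ((N / n : ℕ) : ℝ) - Real.pi / 4 * (N / n : ℝ)| ≤ 1 := by
    rw [← mul_sub, abs_mul, abs_of_pos (by positivity)]
    have : |((N / n : ℕ) : ℝ) - (N : ℝ) / n| ≤ 1 := by
      rw [abs_le]; constructor <;> linarith
    calc _ ≤ (1 : ℝ) * 1 := by
          gcongr
          linarith [Real.pi_le_four]
      _ = 1 := one_mul 1
  calc _ ≤ _ := abs_sub_le _ (Real.pi / 4 * ((N / n : ℕ) : ℝ)) _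
    _ ≤ 3 * √((N / n : ℕ) : ℝ) + 1 := add_le_add h1 h7
    _ ≤ _ := by linarith

/-- The classical argument for Σ μ(n)/n: expand 1 = Σ ν(n) Σ_{m ≤ N/n} r(m) and replace the inner
sum by its mean (π/4)N/n. The errors 4√(N/n) total at most 32N, and 33/(π/4) < 44 because π > 3. -/
lemma abs_sum_nu_div_le (N : ℕ) : |∑ n ∈ Ioc 0 N, nu n / n| ≤ 44 := by
  rcases Nat.eq_zero_or_pos N with rfl | hN
  · simp
  have hN' : (0 : ℝ) < N := by exact_mod_cast hN
  have h1 : ∑ n ∈ Ioc 0 N, nu n * ∑ m ∈ Ioc 0 (N / n), rr m = 1 := by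
    rw [← sum_Ioc_mul_eq_sum_sum, mul_comm, rr_mul_nu,
      Finset.sum_eq_single_of_mem 1 (by simp; omega)]
    · simp
    · intro b _ hb; simp [one_apply, hb]
  have h2 : |∑ n ∈ Ioc 0 N, nu n * ∑ m ∈ Ioc 0 (N / n), rr m
      - ∑ n ∈ Ioc 0 N, nu n * (Real.pi / 4 * (N / n : ℝ))| ≤ 32 * N := by
    rw [← Finset.sum_sub_distrib]
    calc _ ≤ ∑ n ∈ Ioc 0 N, 4 * √N * (rr n / √n) := by
          refine (Finset.abs_sum_le_sum_abs _ _).trans (Finset.sum_le_sum fun n hn => ?_)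
          obtain ⟨h0, h1⟩ := Finset.mem_Ioc.mp hn
          rw [← mul_sub, abs_mul]
          calc _ ≤ rr n * (4 * (√N / √n)) :=
                mul_le_mul (abs_nu_le n) (abs_sum_rr_div_sub_le h0 h1) (abs_nonneg _) (rr_nonneg n)
            _ = _ := by ring
      _ ≤ 4 * √N * (2 * 4 * √N) := by
          rw [← Finset.mul_sum]
          exact mul_le_mul_of_nonneg_left (sum_div_sqrt_le (by norm_num) sum_rr_le N)
            (by positivity)
      _ = 32 * (√N * √N) := by ring
      _ = 32 * N := by rw [Real.mul_self_sqrt hN'.le]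
  have h3 : ∑ n ∈ Ioc 0 N, nu n * (Real.pi / 4 * (N / n : ℝ))
      = Real.pi / 4 * N * ∑ n ∈ Ioc 0 N, nu n / n := by
    rw [Finset.mul_sum]
    exact Finset.sum_congr rfl fun n _ => by ring
  rw [h1, h3] at h2
  have h4 : |Real.pi / 4 * N * ∑ n ∈ Ioc 0 N, nu n / n| ≤ 33 * N := by
    have : (1 : ℝ) ≤ N := by exact_mod_cast hN
    rw [abs_le] at *
    constructor <;> linarith
  rw [abs_mul, abs_of_pos (by positivity)] at h4
  have h5 : Real.pi / 4 * |∑ n ∈ Ioc 0 N, nu n / n| ≤ 33 := by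
    refine le_of_mul_le_mul_right ?_ hN'
    linarith
  have := Real.pi_gt_three
  nlinarith [abs_nonneg (∑ n ∈ Ioc 0 N, nu n / n)]

/-- Convolutions with the logarithm are Lipschitz on the logarithmic scale when the coefficients
have bounded partial sums. -/
lemma abs_ev_log_sub_le {c : ArithmeticFunction ℝ} {B : ℝ}
    (hc : ∀ k, |∑ n ∈ Ioc 0 k, c n| ≤ B) {x y : ℝ} (hx : 0 < x) (hxy : x ≤ y) :
    |ev c Real.log y - ev c Real.log x| ≤ B * Real.log (y / x) := by
  have hy := hx.trans_le hxy
  have hB : 0 ≤ B := (abs_nonneg _).trans (hc 0)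
  have hl : 0 ≤ Real.log (y / x) := Real.log_nonneg ((one_le_div hx).mpr hxy)
  -- The difference of the two truncated logarithms at n equals log(y/x) capped by log(y/n). It is a
  -- nonnegative weight decreasing in n, so bounded partial sums suffice.
  set φ : ℕ → ℝ := fun n => max 0 (min (Real.log (y / x)) (Real.log (y / n))) with hφ
  have hfl : ⌊x⌋₊ ≤ ⌊y⌋₊ := Nat.floor_le_floor hxy
  have key : ev c Real.log y - ev c Real.log x = ∑ n ∈ Ioc 0 ⌊y⌋₊, c n * φ n := by
    rw [ev, ev, ← Finset.sum_Ioc_consecutive _ (Nat.zero_le _) hfl,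
      ← Finset.sum_Ioc_consecutive _ (Nat.zero_le _) hfl, add_sub_right_comm,
      ← Finset.sum_sub_distrib]
    congr 1
    · refine Finset.sum_congr rfl fun n hn => ?_
      obtain ⟨h0, h1⟩ := Finset.mem_Ioc.mp hn
      have h0' : (0 : ℝ) < n := by exact_mod_cast h0
      have h1' : (n : ℝ) ≤ x := (Nat.le_floor_iff hx.le).mp h1
      have h2 : Real.log (y / x) ≤ Real.log (y / n) :=
        Real.log_le_log (by positivity) (by gcongr)
      simp only [hφ, min_eq_left h2, max_eq_right hl]
      rw [← mul_sub, ← Real.log_div (by positivity) (by positivity)]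
      congr 2
      field_simp
    · refine Finset.sum_congr rfl fun n hn => ?_
      obtain ⟨h0, h1⟩ := Finset.mem_Ioc.mp hn
      have h0' : x < n := (Nat.floor_lt hx.le).mp h0
      have h1' : (n : ℝ) ≤ y := (Nat.le_floor_iff hy.le).mp h1
      have hn0 := hx.trans h0'
      have h2 : Real.log (y / n) ≤ Real.log (y / x) :=
        Real.log_le_log (by positivity) (by gcongr)
      simp only [hφ, min_eq_right h2,
        max_eq_right (Real.log_nonneg ((one_le_div hn0).mpr h1'))]
  rw [key]
  refine (abs_sum_mul_le_of_antitone hc (fun n => le_max_left _ _) (fun n hn => ?_) _).trans ?_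
  · have : Real.log (y / (n + 1 : ℕ)) ≤ Real.log (y / n) :=
      Real.log_le_log (by positivity) (by gcongr; simp)
    exact max_le_max le_rfl (min_le_min le_rfl this)
  · exact mul_le_mul_of_nonneg_left (max_le hl (min_le_left _ _)) hB

/-- The convolution of the Dirichlet inverse of `(1 * χ₄)(n) / n` with the logarithm. -/
noncomputable def kk (x : ℝ) : ℝ := ev (til nu) Real.log x

lemma kk_of_lt {x : ℝ} (hx : x < 1) : kk x = 0 := by
  rw [kk, ev, Nat.floor_eq_zero.mpr hx]; simp

lemma kk_one : kk 1 = 0 := by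
  simp [kk, ev]

lemma abs_kk_sub_le {x y : ℝ} (hx : 0 < x) (hxy : x ≤ y) :
    |kk y - kk x| ≤ 44 * Real.log (y / x) :=
  abs_ev_log_sub_le abs_sum_nu_div_le hx hxy

end SumTwoSquaresSieve
end

/-! ### Truncation of Dirichlet series by partial summation -/

section
namespace SumTwoSquaresSieve
open Finset MeasureTheory
open Complex (I)

section Truncation

variable {a : ℕ → ℂ} {α : ℂ}

lemma norm_natCast_cpow_neg {k : ℕ} (hk : 0 < k) (s : ℂ) :
    ‖(k : ℂ) ^ (-s)‖ = (k : ℝ) ^ (-s.re) := by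
  rw [Complex.norm_natCast_cpow_of_pos hk, Complex.neg_re]

/-- Partial summation over a finite range, for coefficients with mean value `α`. -/
lemma norm_sum_Ioc_sub_le (hS : ∀ t : ℝ, 0 ≤ t → ‖∑ k ∈ Icc 0 ⌊t⌋₊, a k - α * t‖ ≤ 1)
    {s : ℂ} (hs : 1 < s.re) {M b : ℕ} (hM : 0 < M) (hb : M ≤ b) :
    ‖∑ k ∈ Ioc M b, (k : ℂ) ^ (-s) * a k
      - α * ((M : ℂ) ^ (1 - s) - (b : ℂ) ^ (1 - s)) / (s - 1)‖ ≤ (2 + ‖s‖) / M := by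
  have hM0 : (0 : ℝ) < M := by exact_mod_cast hM
  have hMb : (M : ℝ) ≤ b := by exact_mod_cast hb
  have hb0 := hM0.trans_le hMb
  have hs1 : s - 1 ≠ 0 := fun h => by
    have := congrArg Complex.re h; simp at this; linarith
  have hs0 : s ≠ 0 := fun h => by simp [h] at hs; linarith
  have hpos : ∀ t ∈ Set.Icc (M : ℝ) b, 0 < t := fun t ht => hM0.trans_le ht.1
  have hder : ∀ t : ℝ, 0 < t → HasDerivAt (fun t : ℝ => (t : ℂ) ^ (-s)) (-s * (t : ℂ) ^ (-s - 1)) t :=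
    fun t ht => hasDerivAt_ofReal_cpow_const ht.ne' (neg_ne_zero.mpr hs0)
  have hderiv : ∀ t ∈ Set.Icc (M : ℝ) b,
      deriv (fun t : ℝ => (t : ℂ) ^ (-s)) t = -s * (t : ℂ) ^ (-s - 1) :=
    fun t ht => (hder t (hpos t ht)).deriv
  have hcont : ContinuousOn (fun t : ℝ => -s * (t : ℂ) ^ (-s - 1)) (Set.Icc (M : ℝ) b) :=
    continuousOn_const.mul (ContinuousOn.cpow_const (by fun_prop)
      (fun t ht => Or.inl (by simpa using hpos t ht)))
  have hint : IntegrableOn (deriv (fun t : ℝ => (t : ℂ) ^ (-s))) (Set.Icc (M : ℝ) b) :=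
    (hcont.integrableOn_Icc).congr_fun (fun t ht => (hderiv t ht).symm) measurableSet_Icc
  have habel := sum_mul_eq_sub_sub_integral_mul' a hb
    (fun t ht => (hder t (hpos t ht)).differentiableAt) hint
  have hi1 : IntegrableOn (fun t : ℝ => deriv (fun t : ℝ => (t : ℂ) ^ (-s)) t
      * ∑ k ∈ Icc 0 ⌊t⌋₊, a k) (Set.Ioc (M : ℝ) b) :=
    (integrableOn_mul_sum_Icc a hM0.le hint).mono_set Set.Ioc_subset_Icc_self
  have hi2 : IntegrableOn (fun t : ℝ => -s * (t : ℂ) ^ (-s - 1) * (α * t)) (Set.Ioc (M : ℝ) b) :=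
    ((hcont.mul (by fun_prop)).integrableOn_Icc).mono_set Set.Ioc_subset_Icc_self
  have hmain : ∫ t in Set.Ioc (M : ℝ) b, -s * (t : ℂ) ^ (-s - 1) * (α * t)
      = -s * α * (((b : ℂ) ^ (1 - s) - (M : ℂ) ^ (1 - s)) / (1 - s)) := by
    have h1 : ∫ t in Set.Ioc (M : ℝ) b, -s * (t : ℂ) ^ (-s - 1) * (α * t)
        = ∫ t in Set.Ioc (M : ℝ) b, (-s * α) * (t : ℂ) ^ (-s) := by
      refine setIntegral_congr_fun measurableSet_Ioc fun t ht => ?_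
      have ht0 : (t : ℂ) ≠ 0 := by exact_mod_cast (hM0.trans ht.1).ne'
      rw [Complex.cpow_sub _ _ ht0, Complex.cpow_one]
      field_simp
    rw [h1, ← intervalIntegral.integral_of_le hMb, intervalIntegral.integral_const_mul,
      integral_cpow]
    · simp only [Complex.ofReal_natCast, show -s + 1 = 1 - s by ring]
    · right
      refine ⟨fun h => ?_, Set.notMem_uIcc_of_lt hM0 hb0⟩
      have := congrArg Complex.re h
      simp at this; linarith
  -- The linear part αt of the summatory function integrates in closed form to the two boundary
  -- powers. The remainder E has norm at most 1, and as Re s > 1 its integral is at most ‖s‖ times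
  -- the integral of t⁻² from M on.
  set E : ℝ → ℂ := fun t => ∑ k ∈ Icc 0 ⌊t⌋₊, a k - α * t with hE
  have hsplit : ∫ t in Set.Ioc (M : ℝ) b, deriv (fun t : ℝ => (t : ℂ) ^ (-s)) t
      * ∑ k ∈ Icc 0 ⌊t⌋₊, a k = (∫ t in Set.Ioc (M : ℝ) b, -s * (t : ℂ) ^ (-s - 1) * (α * t))
        + ∫ t in Set.Ioc (M : ℝ) b, -s * (t : ℂ) ^ (-s - 1) * E t := by
    rw [← sub_eq_iff_eq_add', ← integral_sub hi1 hi2]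
    refine setIntegral_congr_fun measurableSet_Ioc fun t ht => ?_
    simp only [hderiv t (Set.Ioc_subset_Icc_self ht), hE]
    ring
  have hEint : ‖∫ t in Set.Ioc (M : ℝ) b, -s * (t : ℂ) ^ (-s - 1) * E t‖ ≤ ‖s‖ / M := by
    have hg : IntegrableOn (fun t : ℝ => ‖s‖ * t ^ (-2 : ℝ)) (Set.Ioc (M : ℝ) b) := by
      have : ContinuousOn (fun t : ℝ => ‖s‖ * t ^ (-2 : ℝ)) (Set.Icc (M : ℝ) b) :=
        continuousOn_const.mul (continuousOn_id.rpow_const fun t ht => Or.inl (hpos t ht).ne')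
      exact this.integrableOn_Icc.mono_set Set.Ioc_subset_Icc_self
    refine (norm_integral_le_of_norm_le hg ?_).trans ?_
    · refine (ae_restrict_iff' measurableSet_Ioc).mpr (.of_forall fun t ht => ?_)
      have ht0 := hM0.trans ht.1
      have ht1 : 1 ≤ t := le_trans (by exact_mod_cast hM) ht.1.le
      rw [norm_mul, norm_mul, norm_neg, Complex.norm_cpow_eq_rpow_re_of_pos ht0]
      calc _ ≤ ‖s‖ * t ^ (-s - 1).re * 1 := by
            gcongr
            exact hS t ht0.le
        _ ≤ _ := by
            rw [mul_one]
            refine mul_le_mul_of_nonneg_left ?_ (norm_nonneg s)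
            exact Real.rpow_le_rpow_of_exponent_le ht1 (by simp; linarith)
    · rw [← intervalIntegral.integral_of_le hMb, intervalIntegral.integral_const_mul,
        integral_rpow (Or.inr ⟨by norm_num, Set.notMem_uIcc_of_lt hM0 hb0⟩)]
      norm_num
      rw [Real.rpow_neg_one, Real.rpow_neg_one, div_eq_mul_inv]
      have : 0 < (b : ℝ)⁻¹ := by positivity
      exact mul_le_mul_of_nonneg_left (by linarith) (norm_nonneg s)
  have hbd : ∀ k : ℕ, M ≤ k → ‖(k : ℂ) ^ (-s) * E k‖ ≤ 1 / M := fun k hk => by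
    have hk0 : 0 < k := hM.trans_le hk
    have hk1 : (1 : ℝ) ≤ k := by exact_mod_cast hk0
    rw [norm_mul, norm_natCast_cpow_neg hk0]
    calc _ ≤ (k : ℝ) ^ (-s.re) * 1 := by
          gcongr
          exact_mod_cast hS k (by positivity)
      _ ≤ (k : ℝ) ^ (-1 : ℝ) := by
          rw [mul_one]
          exact Real.rpow_le_rpow_of_exponent_le hk1 (by linarith)
      _ ≤ 1 / M := by
          rw [Real.rpow_neg_one, one_div]
          gcongr
  have hEk : ∀ k : ℕ, ∑ j ∈ Icc 0 k, a j = α * k + E k := fun k => by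
    simp [hE]
  have hpow : ∀ k : ℕ, 0 < k → (k : ℂ) ^ (-s) * k = (k : ℂ) ^ (1 - s) := fun k hk => by
    have : (k : ℂ) ≠ 0 := by exact_mod_cast hk.ne'
    rw [show (1 - s) = -s + 1 by ring, Complex.cpow_add _ _ this, Complex.cpow_one]
  have hform : ∑ k ∈ Ioc M b, (k : ℂ) ^ (-s) * a k
      - α * ((M : ℂ) ^ (1 - s) - (b : ℂ) ^ (1 - s)) / (s - 1)
      = (b : ℂ) ^ (-s) * E b - (M : ℂ) ^ (-s) * E M
        - ∫ t in Set.Ioc (M : ℝ) b, -s * (t : ℂ) ^ (-s - 1) * E t := by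
    have h1 := hpow M hM
    have h2 := hpow b (hM.trans_le hb)
    have hs1' : 1 - s ≠ 0 := fun h => hs1 (by linear_combination -h)
    simp only [Complex.ofReal_natCast] at habel
    rw [habel, hsplit, hmain, hEk, hEk]
    rw [mul_add, mul_add, mul_left_comm _ α, mul_left_comm _ α, h1, h2]
    field_simp
    ring
  rw [hform]
  calc _ ≤ 1 / (M : ℝ) + 1 / M + ‖s‖ / M := by
        refine (norm_sub_le _ _).trans (add_le_add ((norm_sub_le _ _).trans ?_) hEint)
        exact add_le_add (hbd b hb) (hbd M le_rfl)
    _ = _ := by ring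

/-- Truncation of a Dirichlet series whose coefficients have mean value `α`. -/
lemma norm_LSeries_sub_le (h0 : a 0 = 0) (ha : ∀ n, ‖a n‖ ≤ 1)
    (hS : ∀ t : ℝ, 0 ≤ t → ‖∑ k ∈ Icc 0 ⌊t⌋₊, a k - α * t‖ ≤ 1)
    {s : ℂ} (hs : 1 < s.re) {M : ℕ} (hM : 0 < M) :
    ‖LSeries a s - ∑ k ∈ Ioc 0 M, (k : ℂ) ^ (-s) * a k - α * (M : ℂ) ^ (1 - s) / (s - 1)‖
      ≤ (2 + ‖s‖) / M := by
  have hsum : LSeriesSummable a s :=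
    LSeriesSummable_of_bounded_of_one_lt_re (fun n _ => ha n) hs
  have hterm : ∀ n, LSeries.term a s n = (n : ℂ) ^ (-s) * a n := fun n => by
    rcases eq_or_ne n 0 with rfl | hn
    · simp [h0]
    · rw [LSeries.term_of_ne_zero hn, Complex.cpow_neg, div_eq_inv_mul]
  have ht : Filter.Tendsto (fun b : ℕ => ∑ k ∈ Ioc 0 b, (k : ℂ) ^ (-s) * a k) Filter.atTop
      (nhds (LSeries a s)) := by
    have h1 := (hsum.hasSum.tendsto_sum_nat).comp (Filter.tendsto_add_atTop_nat 1)
    refine h1.congr fun b => ?_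
    simp only [Function.comp, hterm]
    rw [Finset.range_eq_Ico, Finset.sum_eq_sum_Ico_succ_bot (by omega)]
    simp only [h0, mul_zero, zero_add]
    exact Finset.sum_congr (by ext; simp; omega) fun _ _ => rfl
  have hb0 : Filter.Tendsto (fun b : ℕ => (b : ℂ) ^ (1 - s)) Filter.atTop (nhds 0) := by
    rw [tendsto_zero_iff_norm_tendsto_zero]
    have h1 : Filter.Tendsto (fun b : ℕ => (b : ℝ) ^ (-(s.re - 1))) Filter.atTop (nhds 0) :=
      (tendsto_rpow_neg_atTop (by linarith)).comp tendsto_natCast_atTop_atTop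
    refine h1.congr' (Filter.eventually_atTop.mpr ⟨1, fun b hb => ?_⟩)
    simp only [Complex.norm_natCast_cpow_of_pos hb]
    simp
  have hlim := ((ht.sub_const (∑ k ∈ Ioc 0 M, (k : ℂ) ^ (-s) * a k)).sub
    (((hb0.const_sub ((M : ℂ) ^ (1 - s))).const_mul α).div_const (s - 1))).norm
  rw [sub_zero] at hlim
  refine le_of_tendsto hlim (Filter.eventually_atTop.mpr ⟨M, fun b hb => ?_⟩)
  have := norm_sum_Ioc_sub_le hS hs hM hb
  rwa [← Finset.sum_Ioc_consecutive _ (Nat.zero_le M) hb, add_sub_cancel_left]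

end Truncation
end SumTwoSquaresSieve
end

/-! ### Growth and variation of L-series close to the line Re s = 1 -/

section
namespace SumTwoSquaresSieve
open Finset MeasureTheory
open Complex (I)

lemma sum_Ioc_inv_le (M : ℕ) : ∑ k ∈ Ioc 0 M, (1 : ℝ) / k ≤ 1 + Real.log M := by
  have h := harmonic_le_one_add_log M
  rw [harmonic_eq_sum_Icc] at h
  push_cast at h
  simpa [one_div, ← Finset.Icc_add_one_left_eq_Ioc] using h

/-- Trades a logarithm for a small power; used with m = 8 for growth and m = 64 for variation. -/
lemma one_add_log_le {y : ℝ} (hy : 0 < y) {m : ℝ} (hm : 1 ≤ m) :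
    1 + Real.log y ≤ m * y ^ (1 / m) := by
  have h1 := Real.add_one_le_exp (Real.log y * (1 / m))
  rw [Real.rpow_def_of_pos hy]
  have h2 : m * (Real.log y * (1 / m) + 1) = Real.log y + m := by field_simp
  nlinarith

/-- The bounds that make up the hypotheses of the truncation lemma. -/
structure HasMean (a : ℕ → ℂ) (α : ℂ) : Prop where
  zero : a 0 = 0
  le_one : ∀ n, ‖a n‖ ≤ 1
  mean_le : ‖α‖ ≤ 1
  sum_le : ∀ t : ℝ, 0 ≤ t → ‖∑ k ∈ Icc 0 ⌊t⌋₊, a k - α * t‖ ≤ 1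

section Bounds

variable {a : ℕ → ℂ} {α : ℂ}

lemma ceil_bounds {y : ℝ} (hy : 1 ≤ y) : 0 < ⌈y⌉₊ ∧ y ≤ ⌈y⌉₊ ∧ (⌈y⌉₊ : ℝ) ≤ 2 * y := by
  refine ⟨Nat.ceil_pos.mpr (by linarith), Nat.le_ceil y, ?_⟩
  have := Nat.ceil_lt_add_one (show 0 ≤ y by linarith)
  linarith

lemma norm_vertical_le {c t : ℝ} (hc : 0 < c) (hc1 : c ≤ 1) : ‖(1 + c + I * t : ℂ)‖ ≤ 2 + |t| := by
  calc _ ≤ ‖(1 + c : ℂ)‖ + ‖(I * t : ℂ)‖ := norm_add_le _ _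
    _ ≤ _ := by
      have : ‖(1 + c : ℂ)‖ = 1 + c := by
        rw [← Complex.ofReal_one, ← Complex.ofReal_add, Complex.norm_real, Real.norm_eq_abs,
          abs_of_pos (by linarith)]
      simp [this]; linarith

lemma vertical_re (c t : ℝ) : (1 + c + I * t : ℂ).re = 1 + c := by simp

lemma abs_le_norm_vertical (c t : ℝ) : |t| ≤ ‖(1 + c + I * t : ℂ) - 1‖ := by
  have := Complex.abs_im_le_norm ((1 + c + I * t : ℂ) - 1)
  simpa using this

lemma norm_natCast_cpow_one_sub_le {c t : ℝ} (hc : 0 < c) {n : ℕ} (hn : 0 < n) :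
    ‖(n : ℂ) ^ (1 - (1 + c + I * t : ℂ))‖ ≤ 1 := by
  rw [Complex.norm_natCast_cpow_of_pos hn]
  refine Real.rpow_le_one_of_one_le_of_nonpos (by exact_mod_cast hn) ?_
  simp; linarith

lemma norm_natCast_cpow_vertical_le {c t : ℝ} (hc : 0 < c) {n : ℕ} (hn : 0 < n) :
    ‖(n : ℂ) ^ (-(1 + c + I * t : ℂ))‖ ≤ 1 / n := by
  rw [norm_natCast_cpow_neg hn, vertical_re, one_div, ← Real.rpow_neg_one]
  exact Real.rpow_le_rpow_of_exponent_le (by exact_mod_cast hn) (by linarith)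

lemma norm_sum_vertical_le (h : HasMean a α) {c t : ℝ} (hc : 0 < c) (M : ℕ) :
    ‖∑ k ∈ Ioc 0 M, (k : ℂ) ^ (-(1 + c + I * t : ℂ)) * a k‖ ≤ 1 + Real.log M := by
  refine (norm_sum_le _ _).trans (le_trans (Finset.sum_le_sum fun k hk => ?_) (sum_Ioc_inv_le M))
  rw [norm_mul, ← mul_one (1 / (k : ℝ))]
  exact mul_le_mul (norm_natCast_cpow_vertical_le hc (Finset.mem_Ioc.mp hk).1) (h.le_one k)
    (norm_nonneg _) (by positivity)

/-- Growth of the Dirichlet series to the right of the line `Re s = 1`. -/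
lemma norm_LSeries_vertical_le (h : HasMean a α) {c t : ℝ} (hc : 0 < c) (hc1 : c ≤ 1)
    (ht : 1 ≤ |t|) : ‖LSeries a (1 + c + I * t)‖ ≤ 32 * |t| ^ (1 / 8 : ℝ) := by
  -- Truncating at M ≈ |t| keeps the remainder (2 + ‖s‖)/M bounded, so only the harmonic sum 1 + log
  -- M grows.
  obtain ⟨hM, hM1, hM2⟩ := ceil_bounds ht
  set M := ⌈|t|⌉₊
  set s : ℂ := 1 + c + I * t with hs
  have hs1 : 1 < s.re := by rw [hs, vertical_re]; linarith
  have hM0 : (0 : ℝ) < M := by exact_mod_cast hM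
  have h1 := norm_LSeries_sub_le h.zero h.le_one h.sum_le hs1 hM
  have h2 := norm_sum_vertical_le (t := t) h hc M
  have h3 : ‖α * (M : ℂ) ^ (1 - s) / (s - 1)‖ ≤ 1 := by
    rw [norm_div, norm_mul]
    have h4 : 1 ≤ ‖s - 1‖ := ht.trans (abs_le_norm_vertical c t)
    rw [div_le_one (by linarith)]
    refine le_trans ?_ h4
    exact mul_le_one₀ h.mean_le (norm_nonneg _) (norm_natCast_cpow_one_sub_le hc hM)
  have h4 : (2 + ‖s‖) / M ≤ 5 := by
    rw [div_le_iff₀ hM0]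
    have := norm_vertical_le (t := t) hc hc1
    linarith
  have h5 : 1 + Real.log M ≤ 8 * (2 * |t|) ^ (1 / 8 : ℝ) := by
    refine (one_add_log_le hM0 (by norm_num : (1 : ℝ) ≤ 8)).trans ?_
    gcongr
  have h6 : (2 * |t|) ^ (1 / 8 : ℝ) ≤ 2 * |t| ^ (1 / 8 : ℝ) := by
    rw [Real.mul_rpow (by norm_num) (by positivity)]
    gcongr
    calc (2 : ℝ) ^ (1 / 8 : ℝ) ≤ 2 ^ (1 : ℝ) :=
          Real.rpow_le_rpow_of_exponent_le (by norm_num) (by norm_num)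
      _ = 2 := by norm_num
  have h7 : 1 ≤ |t| ^ (1 / 8 : ℝ) := Real.one_le_rpow ht (by norm_num)
  have e : LSeries a s = (LSeries a s - ∑ k ∈ Ioc 0 M, (k : ℂ) ^ (-s) * a k
      - α * (M : ℂ) ^ (1 - s) / (s - 1)) + ∑ k ∈ Ioc 0 M, (k : ℂ) ^ (-s) * a k
      + α * (M : ℂ) ^ (1 - s) / (s - 1) := by ring
  rw [e]
  refine (norm_add₃_le).trans ?_
  linarith

lemma norm_LSeries_real_le (h : HasMean a α) {c : ℝ} (hc : 0 < c) (hc1 : c ≤ 1) :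
    ‖LSeries a (1 + c)‖ ≤ 6 / c := by
  have h1 := norm_LSeries_sub_le h.zero h.le_one h.sum_le (s := 1 + c) (by simp [hc])
    (M := 1) one_pos
  have h2 := norm_vertical_le (t := 0) hc hc1
  simp only [Nat.cast_one, Complex.one_cpow, mul_one, div_one, add_sub_cancel_left,
    Nat.Ioc_succ_singleton, Finset.sum_singleton, zero_add, one_mul] at h1
  simp only [Complex.ofReal_zero, mul_zero, add_zero, abs_zero] at h2
  have h3 : ‖α / (c : ℂ)‖ ≤ 1 / c := by
    rw [norm_div, Complex.norm_real, Real.norm_eq_abs, abs_of_pos hc]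
    gcongr
    exact h.mean_le
  have e : LSeries a (1 + c) = (LSeries a (1 + c) - a 1 - α / c) + a 1 + α / c := by ring
  rw [e]
  refine (norm_add₃_le).trans ?_
  have h4 : 1 ≤ 1 / c := (one_le_div hc).mpr hc1
  have := h.le_one 1
  rw [show 6 / c = 6 * (1 / c) by ring]
  linarith

/-- The two powers share their phase n^{-it}; only the moduli n^{-c} and n^{-c'} differ, and 1 −
e^{-y} ≤ y. -/
lemma norm_cpow_sub_cpow_le {c c' t : ℝ} (hc : 0 < c) (hcc : c ≤ c') {n : ℕ} (hn : 0 < n) :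
    ‖(n : ℂ) ^ (1 - (1 + c + I * t : ℂ)) - (n : ℂ) ^ (1 - (1 + c' + I * t : ℂ))‖
      ≤ (c' - c) * Real.log n := by
  have hn0 : (n : ℂ) ≠ 0 := by exact_mod_cast hn.ne'
  have hn1 : (0 : ℝ) < n := by exact_mod_cast hn
  have hl : 0 ≤ Real.log n := Real.log_natCast_nonneg n
  have e : ∀ b : ℝ, (n : ℂ) ^ (1 - (1 + b + I * t : ℂ))
      = ((n : ℝ) ^ (-b) : ℝ) * (n : ℂ) ^ (-(I * t)) := fun b => by
    rw [Complex.ofReal_cpow hn1.le, Complex.ofReal_natCast, ← Complex.cpow_add _ _ hn0]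
    congr 1
    push_cast
    ring
  rw [e, e, ← sub_mul, ← Complex.ofReal_sub, norm_mul, Complex.norm_real,
    Complex.norm_natCast_cpow_of_pos hn]
  have h1 : (n : ℝ) ^ (-c') ≤ (n : ℝ) ^ (-c) :=
    Real.rpow_le_rpow_of_exponent_le (by exact_mod_cast hn) (by linarith)
  have h2 : (n : ℝ) ^ (-c') = (n : ℝ) ^ (-c) * Real.exp (-((c' - c) * Real.log n)) := by
    rw [Real.rpow_def_of_pos hn1, Real.rpow_def_of_pos hn1, ← Real.exp_add]
    congr 1
    ring
  have h3 := Real.add_one_le_exp (-((c' - c) * Real.log n))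
  have h4 : (n : ℝ) ^ (-c) ≤ 1 :=
    Real.rpow_le_one_of_one_le_of_nonpos (by exact_mod_cast hn) (by linarith)
  have h5 : 0 ≤ (n : ℝ) ^ (-c) := by positivity
  rw [Real.norm_eq_abs, abs_of_nonneg (by linarith)]
  have h6 : (-(I * (t : ℂ))).re = 0 := by simp
  rw [h6, Real.rpow_zero, mul_one, h2]
  have h7 : 0 ≤ (c' - c) * Real.log n := mul_nonneg (by linarith) hl
  nlinarith

/-- Variation of the Dirichlet series near the line `Re s = 1`. -/
lemma norm_LSeries_sub_LSeries_le (h : HasMean a α) {c c' t : ℝ} (hc : 0 < c) (hcc : c ≤ c')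
    (hc1 : c' ≤ 1) (ht : 1 ≤ |t|) :
    ‖LSeries a (1 + c' + I * t) - LSeries a (1 + c + I * t)‖
      ≤ 90112 * c' ^ (31 / 32 : ℝ) * |t| ^ (1 / 32 : ℝ) := by
  have hc'0 := hc.trans_le hcc
  -- Truncating at |t|/c' instead of |t| makes both remainders O(c'), so that they do not swamp the
  -- variation being estimated.
  have hy : 1 ≤ |t| / c' := by rw [one_le_div hc'0]; linarith
  obtain ⟨hM, hM1, hM2⟩ := ceil_bounds hy
  set M := ⌈|t| / c'⌉₊
  have hM0 : (0 : ℝ) < M := by exact_mod_cast hM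
  set s : ℂ := 1 + c + I * t with hs
  set s' : ℂ := 1 + c' + I * t with hs'
  have hs1 : 1 < s.re := by rw [hs, vertical_re]; linarith
  have hs1' : 1 < s'.re := by rw [hs', vertical_re]; linarith
  have h1 := norm_LSeries_sub_le h.zero h.le_one h.sum_le hs1 hM
  have h1' := norm_LSeries_sub_le h.zero h.le_one h.sum_le hs1' hM
  have hlog : 0 ≤ Real.log M := Real.log_natCast_nonneg M
  have hsm : ∀ z : ℂ, ‖z‖ ≤ 2 + |t| → (2 + ‖z‖) / M ≤ 5 * c' := fun z hz => by
    rw [div_le_iff₀ hM0]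
    have h2 : |t| ≤ M * c' := (div_le_iff₀ hc'0).mp hM1
    nlinarith
  have h2 := hsm s (norm_vertical_le hc (by linarith))
  have h2' := hsm s' (norm_vertical_le hc'0 hc1)
  have h3 : ‖∑ k ∈ Ioc 0 M, (k : ℂ) ^ (-s') * a k - ∑ k ∈ Ioc 0 M, (k : ℂ) ^ (-s) * a k‖
      ≤ c' * Real.log M * (1 + Real.log M) := by
    rw [← Finset.sum_sub_distrib]
    calc _ ≤ ∑ k ∈ Ioc 0 M, c' * Real.log M * (1 / k) := by
          refine (norm_sum_le _ _).trans (Finset.sum_le_sum fun k hk => ?_)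
          obtain ⟨hk0, hkM⟩ := Finset.mem_Ioc.mp hk
          have hk0' : (k : ℂ) ≠ 0 := by exact_mod_cast hk0.ne'
          have hk0'' : (0 : ℝ) < k := by exact_mod_cast hk0
          have e : ∀ z : ℂ, (k : ℂ) ^ (-z) = (k : ℂ) ^ (1 - z) * (1 / k) := fun z => by
            rw [show -z = 1 - z - 1 by ring, Complex.cpow_sub _ _ hk0', Complex.cpow_one]
            ring
          have hlogk : Real.log k ≤ Real.log M := Real.log_le_log hk0'' (by exact_mod_cast hkM)
          have hlk0 : 0 ≤ Real.log k := Real.log_natCast_nonneg k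
          rw [← sub_mul, e, e, ← sub_mul, norm_mul, norm_mul, norm_sub_rev]
          have h5 := norm_cpow_sub_cpow_le (t := t) hc hcc hk0
          have h6 : ‖(1 / k : ℂ)‖ = 1 / k := by simp
          rw [h6]
          calc _ ≤ ((c' - c) * Real.log k) * (1 / k) * 1 :=
                mul_le_mul (mul_le_mul_of_nonneg_right h5 (by positivity)) (h.le_one k)
                  (norm_nonneg _) (mul_nonneg (mul_nonneg (by linarith) hlk0) (by positivity))
            _ ≤ _ := by
                rw [mul_one]
                gcongr
                linarith
      _ ≤ _ := by
          rw [← Finset.mul_sum]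
          exact mul_le_mul_of_nonneg_left (sum_Ioc_inv_le M) (by positivity)
  have hn1 : 1 ≤ ‖s - 1‖ := ht.trans (abs_le_norm_vertical c t)
  have hn1' : 1 ≤ ‖s' - 1‖ := ht.trans (abs_le_norm_vertical c' t)
  have hz1 : s - 1 ≠ 0 := norm_pos_iff.mp (by linarith)
  have hz1' : s' - 1 ≠ 0 := norm_pos_iff.mp (by linarith)
  have h4 : ‖α * (M : ℂ) ^ (1 - s') / (s' - 1) - α * (M : ℂ) ^ (1 - s) / (s - 1)‖
      ≤ c' * Real.log M + c' := by
    have e : α * (M : ℂ) ^ (1 - s') / (s' - 1) - α * (M : ℂ) ^ (1 - s) / (s - 1)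
        = α * (-((M : ℂ) ^ (1 - s) - (M : ℂ) ^ (1 - s')) / (s - 1)
          + (M : ℂ) ^ (1 - s') * ((s - s') / ((s - 1) * (s' - 1)))) := by
      field_simp
      ring
    rw [e, norm_mul]
    refine (mul_le_of_le_one_left (norm_nonneg _) h.mean_le).trans
      ((norm_add_le _ _).trans (add_le_add ?_ ?_))
    · rw [norm_div, norm_neg]
      refine (div_le_self (norm_nonneg _) hn1).trans
        ((norm_cpow_sub_cpow_le (t := t) hc hcc hM).trans ?_)
      gcongr
      linarith
    · rw [norm_mul, norm_div, norm_mul]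
      have h5 : ‖s - s'‖ ≤ c' := by
        have : s - s' = ((c - c' : ℝ) : ℂ) := by rw [hs, hs']; push_cast; ring
        rw [this, Complex.norm_real, Real.norm_eq_abs, abs_le]
        constructor <;> linarith
      calc _ ≤ 1 * (c' / (1 * 1)) := by
            gcongr
            exact norm_natCast_cpow_one_sub_le hc'0 hM
        _ = c' := by ring
  have e : LSeries a s' - LSeries a s
      = (LSeries a s' - ∑ k ∈ Ioc 0 M, (k : ℂ) ^ (-s') * a k - α * (M : ℂ) ^ (1 - s') / (s' - 1))
        - (LSeries a s - ∑ k ∈ Ioc 0 M, (k : ℂ) ^ (-s) * a k - α * (M : ℂ) ^ (1 - s) / (s - 1))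
        + ((∑ k ∈ Ioc 0 M, (k : ℂ) ^ (-s') * a k - ∑ k ∈ Ioc 0 M, (k : ℂ) ^ (-s) * a k))
        + (α * (M : ℂ) ^ (1 - s') / (s' - 1) - α * (M : ℂ) ^ (1 - s) / (s - 1)) := by ring
  have h5 : ‖LSeries a s' - LSeries a s‖ ≤ 11 * c' * (1 + Real.log M) ^ 2 := by
    rw [e]
    refine (norm_add₃_le).trans ?_
    have := norm_sub_le (LSeries a s' - ∑ k ∈ Ioc 0 M, (k : ℂ) ^ (-s') * a k
      - α * (M : ℂ) ^ (1 - s') / (s' - 1)) (LSeries a s - ∑ k ∈ Ioc 0 M, (k : ℂ) ^ (-s) * a k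
      - α * (M : ℂ) ^ (1 - s) / (s - 1))
    nlinarith [mul_nonneg hc'0.le hlog, mul_nonneg (mul_nonneg hc'0.le hlog) hlog]
  -- Here 4096 = 64² comes from the exponent 1/64 and a factor 2 from rounding M up; then 90112 = 11
  -- · 8192.
  have h6 : (1 + Real.log M) ^ 2 ≤ 8192 * (|t| / c') ^ (1 / 32 : ℝ) := by
    have h7 := one_add_log_le hM0 (by norm_num : (1 : ℝ) ≤ 64)
    calc _ ≤ (64 * (M : ℝ) ^ (1 / 64 : ℝ)) ^ 2 := by gcongr
      _ = 4096 * (M : ℝ) ^ (1 / 32 : ℝ) := by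
          rw [mul_pow, ← Real.rpow_natCast, ← Real.rpow_natCast, ← Real.rpow_mul hM0.le]
          norm_num
      _ ≤ 4096 * (2 * (|t| / c')) ^ (1 / 32 : ℝ) := by gcongr
      _ ≤ 4096 * (2 * (|t| / c') ^ (1 / 32 : ℝ)) := by
          rw [Real.mul_rpow (by norm_num) (by positivity)]
          gcongr
          calc (2 : ℝ) ^ (1 / 32 : ℝ) ≤ 2 ^ (1 : ℝ) :=
                Real.rpow_le_rpow_of_exponent_le (by norm_num) (by norm_num)
            _ = 2 := by norm_num
      _ = _ := by ring
  calc _ ≤ 11 * c' * (8192 * (|t| / c') ^ (1 / 32 : ℝ)) := h5.trans (by gcongr)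
    _ = 90112 * (c' * (|t| / c') ^ (1 / 32 : ℝ)) := by ring
    _ = 90112 * (c' ^ (31 / 32 : ℝ) * |t| ^ (1 / 32 : ℝ)) := by
        rw [Real.div_rpow (abs_nonneg _) hc'0.le]
        congr 1
        have : c' ^ (31 / 32 : ℝ) = c' / c' ^ (1 / 32 : ℝ) := by
          rw [show (31 / 32 : ℝ) = 1 - 1 / 32 by norm_num, Real.rpow_sub hc'0, Real.rpow_one]
        rw [this]
        ring
    _ = _ := by ring

end Bounds
end SumTwoSquaresSieve
end

/-! ### Lower bounds for the L-functions modulo 4 by the 3-4-1 inequality -/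

section
namespace SumTwoSquaresSieve
open Finset MeasureTheory
open Complex (I)

/-- The non-trivial character modulo `4` with complex values. -/
noncomputable def chiD : DirichletCharacter ℂ 4 := ZMod.χ₄.ringHomComp (Int.castRingHom ℂ)

lemma chiD_natCast (n : ℕ) : chiD n = (chi n : ℂ) := by
  rw [chiD, MulChar.ringHomComp_apply, chi_apply]
  simp

lemma chiD_sq : chiD ^ 2 = 1 := (ZMod.isQuadratic_χ₄.comp _).sq_eq_one

lemma chiD_ne_one : chiD ≠ 1 := fun h => by
  have h3 : chiD ((3 : ℕ) : ZMod 4) = 1 := by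
    rw [h]; exact MulChar.one_apply (by decide)
  rw [chiD_natCast, chi_eq] at h3
  norm_num at h3

lemma trivChar_natCast (n : ℕ) :
    (1 : DirichletCharacter ℂ 4) n = if n % 2 = 1 then 1 else 0 := by
  have h : IsUnit (n : ZMod 4) ↔ n % 2 = 1 := by
    rw [ZMod.isUnit_iff_coprime, show 4 = 2 ^ 2 by norm_num, Nat.coprime_pow_right_iff (by norm_num),
      Nat.coprime_two_right, Nat.odd_iff]
  split_ifs with h1
  · exact MulChar.one_apply (h.mpr h1)
  · exact MulChar.map_nonunit _ (fun h2 => h1 (h.mp h2))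

lemma hasMean_trivChar : HasMean (fun n => (1 : DirichletCharacter ℂ 4) n) (1 / 2) where
  zero := by simpa using trivChar_natCast 0
  le_one n := DirichletCharacter.norm_le_one _ _
  mean_le := by norm_num
  sum_le t ht := by
    have h1 : ∀ k : ℕ, ∑ n ∈ Icc 0 k, (1 : DirichletCharacter ℂ 4) n = (((k + 1) / 2 : ℕ) : ℂ) := by
      intro k
      induction k with
      | zero => simpa using trivChar_natCast 0
      | succ k ih =>
        rw [Finset.sum_Icc_succ_top (by omega), ih, trivChar_natCast]
        split_ifs with h
        · rw [show (k + 1 + 1) / 2 = (k + 1) / 2 + 1 by omega]; push_cast; ring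
        · rw [show (k + 1 + 1) / 2 = (k + 1) / 2 by omega]; ring
    rw [h1]
    have h2 := Nat.floor_le ht
    have h3 := Nat.lt_floor_add_one t
    set k := ⌊t⌋₊
    have h4 : (k : ℝ) ≤ 2 * ((k + 1) / 2 : ℕ) := by exact_mod_cast (by omega)
    have h5 : 2 * (((k + 1) / 2 : ℕ) : ℝ) ≤ k + 1 := by exact_mod_cast (by omega)
    have e : ((((k + 1) / 2 : ℕ) : ℂ) - 1 / 2 * t) = (((((k + 1) / 2 : ℕ) : ℝ) - t / 2 : ℝ) : ℂ) := by
      push_cast; ring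
    rw [e, Complex.norm_real, Real.norm_eq_abs, abs_le]
    constructor <;> linarith

lemma hasMean_chiD : HasMean (fun n => chiD n) 0 where
  zero := by rw [chiD_natCast]; simp
  le_one n := DirichletCharacter.norm_le_one _ _
  mean_le := by norm_num
  sum_le t _ := by
    rw [zero_mul, sub_zero]
    simp_rw [chiD_natCast]
    rw [← Complex.ofReal_sum, Complex.norm_real, Real.norm_eq_abs,
      ← Finset.add_sum_Ioc_eq_sum_Icc (Nat.zero_le _)]
    simpa using abs_sum_chi_le 0 ⌊t⌋₊

/-- As χ² = 1, the first and third factors of the 3-4-1 product belong to the principal character,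
and they are at most 6/x and 64|t|^{1/8}. Solving for the fourth power works because 6³ · 64 = 13824
≤ 11⁴ = 14641. -/
lemma norm_LSeries_ge_of_three_four_one {χ : DirichletCharacter ℂ 4} (hχ : χ ^ 2 = 1) {x t : ℝ}
    (hx : 0 < x) (hx1 : x ≤ 1) (ht : 1 ≤ |t|) :
    x ^ (3 / 4 : ℝ) * |t| ^ (-(1 / 32) : ℝ) / 11 ≤ ‖LSeries (fun n => χ n) (1 + x + I * t)‖ := by
  have ht0 : 0 < |t| := by linarith
  have h := DirichletCharacter.norm_LSeries_product_ge_one χ hx t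
  rw [hχ] at h
  have h1 := norm_LSeries_real_le hasMean_trivChar hx hx1
  have h2 : ‖LSeries (fun n => (1 : DirichletCharacter ℂ 4) n) (1 + x + 2 * I * t)‖
      ≤ 64 * |t| ^ (1 / 8 : ℝ) := by
    have := norm_LSeries_vertical_le (t := 2 * t) hasMean_trivChar hx hx1
      (by rw [abs_mul, abs_two]; linarith)
    rw [show (1 + x + 2 * I * t : ℂ) = 1 + x + I * ((2 * t : ℝ) : ℂ) by push_cast; ring]
    refine this.trans ?_
    rw [abs_mul, abs_two, Real.mul_rpow (by norm_num) (by positivity)]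
    have : (2 : ℝ) ^ (1 / 8 : ℝ) ≤ 2 := by
      calc (2 : ℝ) ^ (1 / 8 : ℝ) ≤ 2 ^ (1 : ℝ) :=
            Real.rpow_le_rpow_of_exponent_le (by norm_num) (by norm_num)
        _ = 2 := by norm_num
    nlinarith [show 0 ≤ |t| ^ (1 / 8 : ℝ) by positivity]
  set F := ‖LSeries (fun n => χ n) (1 + x + I * t)‖ with hF
  have hF0 : 0 ≤ F := norm_nonneg _
  rw [norm_mul, norm_mul, norm_pow, norm_pow] at h
  have h3 : 1 ≤ (6 / x) ^ 3 * F ^ 4 * (64 * |t| ^ (1 / 8 : ℝ)) := by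
    refine le_trans h ?_
    gcongr
  set u := x ^ (3 / 4 : ℝ) * |t| ^ (-(1 / 32) : ℝ) / 11 with hu
  have hu0 : 0 ≤ u := by positivity
  have hu4 : u ^ 4 = x ^ 3 * |t| ^ (-(1 / 8) : ℝ) / 14641 := by
    rw [hu, div_pow, mul_pow, ← Real.rpow_natCast, ← Real.rpow_natCast, ← Real.rpow_natCast,
      ← Real.rpow_mul hx.le, ← Real.rpow_mul ht0.le]
    norm_num
  have h4 : u ^ 4 ≤ F ^ 4 := by
    rw [hu4, Real.rpow_neg ht0.le]
    have h5 : 0 < |t| ^ (1 / 8 : ℝ) := by positivity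
    rw [← div_eq_mul_inv, div_div, div_le_iff₀ (by positivity)]
    have h6 : (6 / x) ^ 3 * F ^ 4 * (64 * |t| ^ (1 / 8 : ℝ)) * x ^ 3
        = 13824 * (F ^ 4 * |t| ^ (1 / 8 : ℝ)) := by
      field_simp
      ring
    have h7 : x ^ 3 ≤ 13824 * (F ^ 4 * |t| ^ (1 / 8 : ℝ)) := by
      rw [← h6]
      exact le_mul_of_one_le_left (by positivity) h3
    nlinarith [show 0 ≤ F ^ 4 * |t| ^ (1 / 8 : ℝ) by positivity]
  exact le_of_pow_le_pow_left₀ (by norm_num) hF0 h4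

/-- A lower bound for `L`-functions modulo `4` up to the line `Re s = 1`. -/
lemma exists_norm_LSeries_ge : ∃ b : ℝ, 0 < b ∧ ∀ (χ : DirichletCharacter ℂ 4) (α : ℂ),
    χ ^ 2 = 1 → HasMean (fun n => χ n) α → ∀ c t : ℝ, 0 < c → c ≤ 1 → 1 ≤ |t| →
    b * |t| ^ (-(7 / 16) : ℝ) ≤ ‖LSeries (fun n => χ n) (1 + c + I * t)‖ := by
  -- With x = κ|t|^{-1/2} the 3-4-1 bound is κ^{3/4}|t|^{-13/32}/11, while the variation between c
  -- and x is at most 90112·κ^{31/32}|t|^{-29/64}. Taking κ^{7/32} ≤ q makes the variation at most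
  -- half of the lower bound; κ = q⁵ achieves this since 35/32 ≥ 1.
  set q : ℝ := 1 / (22 * 90112) with hq
  have hq0 : 0 < q := by norm_num [hq]
  have hq1 : q ≤ 1 := by norm_num [hq]
  set κ : ℝ := q ^ 5 with hκ
  have hκ0 : 0 < κ := by positivity
  have hκ1 : κ ≤ 1 := pow_le_one₀ hq0.le hq1
  have hκq : κ ^ (7 / 32 : ℝ) ≤ q := by
    rw [hκ, ← Real.rpow_natCast, ← Real.rpow_mul hq0.le]
    calc _ ≤ q ^ (1 : ℝ) := Real.rpow_le_rpow_of_exponent_ge hq0 hq1 (by norm_num)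
      _ = q := Real.rpow_one q
  refine ⟨κ ^ (3 / 4 : ℝ) / 22, by positivity, fun χ α hχ hα c t hc hc1 ht => ?_⟩
  have ht0 : 0 < |t| := by linarith
  set x : ℝ := κ * |t| ^ (-(1 / 2) : ℝ) with hx
  have hx0 : 0 < x := by positivity
  have htl : |t| ^ (-(1 / 2) : ℝ) ≤ 1 := Real.rpow_le_one_of_one_le_of_nonpos ht (by norm_num)
  have hx1 : x ≤ 1 := mul_le_one₀ hκ1 (by positivity) htl
  have hxp : ∀ r : ℝ, x ^ r = κ ^ r * |t| ^ (-(r / 2)) := fun r => by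
    rw [hx, Real.mul_rpow hκ0.le (by positivity), ← Real.rpow_mul ht0.le]
    congr 2
    ring
  have hlow : x ^ (3 / 4 : ℝ) * |t| ^ (-(1 / 32) : ℝ) = κ ^ (3 / 4 : ℝ) * |t| ^ (-(13 / 32) : ℝ) := by
    rw [hxp, mul_assoc, ← Real.rpow_add ht0]
    norm_num
  have hexp : |t| ^ (-(7 / 16) : ℝ) ≤ |t| ^ (-(13 / 32) : ℝ) :=
    Real.rpow_le_rpow_of_exponent_le ht (by norm_num)
  have hK : 0 < κ ^ (3 / 4 : ℝ) := by positivity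
  have hT : 0 < |t| ^ (-(7 / 16) : ℝ) := by positivity
  -- If c is at least x, the 3-4-1 bound applies at c itself. Otherwise it is applied at x and
  -- carried to c by the variation bound.
  rcases le_total x c with h | h
  · have h1 := norm_LSeries_ge_of_three_four_one hχ hc hc1 ht
    have h2 : x ^ (3 / 4 : ℝ) * |t| ^ (-(1 / 32) : ℝ) ≤ c ^ (3 / 4 : ℝ) * |t| ^ (-(1 / 32) : ℝ) := by
      gcongr
    rw [hlow] at h2
    have h3 : κ ^ (3 / 4 : ℝ) * |t| ^ (-(7 / 16) : ℝ) ≤ κ ^ (3 / 4 : ℝ) * |t| ^ (-(13 / 32) : ℝ) := by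
      gcongr
    have h4 : 0 ≤ κ ^ (3 / 4 : ℝ) * |t| ^ (-(7 / 16) : ℝ) := by positivity
    linarith
  · have h1 := norm_LSeries_ge_of_three_four_one hχ hx0 hx1 ht
    have h2 := norm_LSeries_sub_LSeries_le hα hc h hx1 ht
    rw [hlow] at h1
    have h3 : 90112 * x ^ (31 / 32 : ℝ) * |t| ^ (1 / 32 : ℝ)
        ≤ κ ^ (3 / 4 : ℝ) * |t| ^ (-(13 / 32) : ℝ) / 22 := by
      have e1 : κ ^ (31 / 32 : ℝ) = κ ^ (3 / 4 : ℝ) * κ ^ (7 / 32 : ℝ) := by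
        rw [← Real.rpow_add hκ0]; norm_num
      have e2 : x ^ (31 / 32 : ℝ) * |t| ^ (1 / 32 : ℝ) = κ ^ (31 / 32 : ℝ) * |t| ^ (-(29 / 64) : ℝ) := by
        rw [hxp, mul_assoc, ← Real.rpow_add ht0]
        norm_num
      have e3 : |t| ^ (-(29 / 64) : ℝ) ≤ |t| ^ (-(13 / 32) : ℝ) :=
        Real.rpow_le_rpow_of_exponent_le ht (by norm_num)
      calc _ = 90112 * (κ ^ (3 / 4 : ℝ) * κ ^ (7 / 32 : ℝ) * |t| ^ (-(29 / 64) : ℝ)) := by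
            rw [mul_assoc, e2, e1]
        _ ≤ 90112 * (κ ^ (3 / 4 : ℝ) * q * |t| ^ (-(13 / 32) : ℝ)) := by gcongr
        _ = _ := by rw [hq]; ring
    have h4 := norm_sub_norm_le (LSeries (fun n => χ n) (1 + x + I * t))
      (LSeries (fun n => χ n) (1 + c + I * t))
    have h5 : κ ^ (3 / 4 : ℝ) * |t| ^ (-(7 / 16) : ℝ) ≤ κ ^ (3 / 4 : ℝ) * |t| ^ (-(13 / 32) : ℝ) := by
      gcongr
    linarith

end SumTwoSquaresSieve
end

/-! ### The function 1/(w²ζ(1+w)L(1+w,χ₄)) with its pole at 0 removed -/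

section
namespace SumTwoSquaresSieve
open Finset MeasureTheory ArithmeticFunction Filter Topology
open Complex (I)
open scoped ArithmeticFunction.zeta ArithmeticFunction.Moebius

/-- A real arithmetic function viewed as a complex one. -/
noncomputable def toC (f : ArithmeticFunction ℝ) : ArithmeticFunction ℂ :=
  ⟨fun n => (f n : ℂ), by simp⟩

@[simp] lemma toC_apply (f : ArithmeticFunction ℝ) (n : ℕ) : toC f n = (f n : ℂ) := rfl

lemma toC_mul (f g : ArithmeticFunction ℝ) : toC (f * g) = toC f * toC g := by
  ext n
  rw [toC_apply, mul_apply, mul_apply, Complex.ofReal_sum]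
  simp

lemma LSeriesSummable_cm_chi {s : ℂ} (hs : 1 < s.re) :
    LSeriesSummable (fun n => toC (cm chi) n) s := by
  have := DirichletCharacter.LSeriesSummable_of_one_lt_re chiD hs
  simpa [chiD_natCast] using this

lemma LSeriesSummable_zetaR {s : ℂ} (hs : 1 < s.re) :
    LSeriesSummable (fun n => toC (ζ : ArithmeticFunction ℝ) n) s := by
  have h := LSeriesSummable_zeta_iff.mpr hs
  exact (LSeriesSummable_congr s fun {n} hn => by simp [natCoe_apply, hn]).mp h

lemma LSeriesSummable_rr {s : ℂ} (hs : 1 < s.re) : LSeriesSummable (fun n => (rr n : ℂ)) s := by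
  have := LSeriesSummable_mul (LSeriesSummable_zetaR hs) (LSeriesSummable_cm_chi hs)
  rwa [← toC_mul] at this

lemma LSeries_rr {s : ℂ} (hs : 1 < s.re) :
    LSeries (fun n => (rr n : ℂ)) s = riemannZeta s * DirichletCharacter.LFunction chiD s := by
  have h := LSeries_mul' (LSeriesSummable_zetaR hs) (LSeriesSummable_cm_chi hs)
  rw [← toC_mul] at h
  have h1 : LSeries (fun n => toC (ζ : ArithmeticFunction ℝ) n) s = riemannZeta s := by
    rw [← LSeries_zeta_eq_riemannZeta hs]
    exact LSeries_congr (fun {n} hn => by simp [natCoe_apply, hn]) s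
  have h2 : LSeries (fun n => toC (cm chi) n) s = DirichletCharacter.LFunction chiD s := by
    rw [DirichletCharacter.LFunction_eq_LSeries _ hs]
    exact LSeries_congr (fun {n} hn => by simp [chiD_natCast]) s
  rw [h1, h2] at h
  exact h

lemma LSeriesSummable_nu {s : ℂ} (hs : 1 < s.re) : LSeriesSummable (fun n => (nu n : ℂ)) s := by
  refine Summable.of_norm_bounded (LSeriesSummable_rr hs).norm fun n => LSeries.norm_term_le s ?_
  rw [Complex.norm_real, Complex.norm_real, Real.norm_eq_abs, Real.norm_eq_abs,
    abs_of_nonneg (rr_nonneg n)]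
  exact abs_nu_le n

lemma LSeries_rr_mul_LSeries_nu {s : ℂ} (hs : 1 < s.re) :
    LSeries (fun n => (rr n : ℂ)) s * LSeries (fun n => (nu n : ℂ)) s = 1 := by
  have h := LSeries_mul' (f := toC rr) (g := toC nu) (LSeriesSummable_rr hs) (LSeriesSummable_nu hs)
  rw [← toC_mul, rr_mul_nu] at h
  refine h.symm.trans ?_
  have : (fun n => toC 1 n) = LSeries.delta := by
    ext n
    by_cases hn : n = 1 <;> simp [LSeries.delta, one_apply, hn]
  rw [this, LSeries_delta]
  rfl

lemma LSeries_nu {s : ℂ} (hs : 1 < s.re) :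
    LSeries (fun n => (nu n : ℂ)) s = (riemannZeta s * DirichletCharacter.LFunction chiD s)⁻¹ := by
  rw [← LSeries_rr hs]
  exact eq_inv_of_mul_eq_one_right (LSeries_rr_mul_LSeries_nu hs)

/-- The entire function `w ζ(1 + w) L(1 + w, χ₄)`. -/
noncomputable def qq (w : ℂ) : ℂ := riemannZeta₁ (1 + w) * DirichletCharacter.LFunction chiD (1 + w)

lemma differentiable_qq : Differentiable ℂ qq := by
  have h1 := DirichletCharacter.differentiable_LFunction chiD_ne_one
  have h2 := differentiable_riemannZeta₁
  unfold qq
  fun_prop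

lemma qq_eq {w : ℂ} (hw : w ≠ 0) :
    qq w = w * (riemannZeta (1 + w) * DirichletCharacter.LFunction chiD (1 + w)) := by
  have : (1 + w : ℂ) ≠ 1 := by simpa using hw
  rw [qq, riemannZeta_eq_inv_sub_mul this, add_sub_cancel_left]
  field_simp

/-- Neither ζ nor L(·, χ₄) vanishes on Re s ≥ 1, and at w = 0 the factor w cancels the pole of ζ. -/
lemma qq_ne_zero {w : ℂ} (hw : 0 ≤ w.re) : qq w ≠ 0 := by
  have hL : DirichletCharacter.LFunction chiD (1 + w) ≠ 0 :=
    DirichletCharacter.LFunction_ne_zero_of_one_le_re _ (Or.inl chiD_ne_one) (by simpa using hw)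
  rcases eq_or_ne w 0 with rfl | h0
  · rw [qq]
    refine mul_ne_zero ?_ hL
    simp
  · rw [qq_eq h0]
    exact mul_ne_zero h0 (mul_ne_zero (riemannZeta_ne_zero_of_one_le_re (by simpa using hw)) hL)

lemma tendsto_sum_rr_div : Tendsto (fun N : ℕ => (∑ n ∈ Icc 1 N, rr n) / (N : ℝ)) atTop
    (𝓝 (Real.pi / 4)) := by
  have h1 : Tendsto (fun N : ℕ => 3 * (√(N : ℝ))⁻¹) atTop (𝓝 (3 * 0)) :=
    ((Real.tendsto_sqrt_atTop.comp tendsto_natCast_atTop_atTop).inv_tendsto_atTop).const_mul 3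
  rw [mul_zero] at h1
  rw [tendsto_iff_dist_tendsto_zero]
  refine squeeze_zero' (Eventually.of_forall fun _ => dist_nonneg)
    (eventually_atTop.mpr ⟨1, fun N hN => ?_⟩) h1
  have hN0 : (0 : ℝ) < N := by exact_mod_cast hN
  have h := abs_sum_rr_sub_le N
  rw [Real.dist_eq, show Icc 1 N = Ioc 0 N from Finset.Icc_add_one_left_eq_Ioc 0 N]
  have e : (∑ n ∈ Ioc 0 N, rr n) / (N : ℝ) - Real.pi / 4
      = (∑ n ∈ Ioc 0 N, rr n - Real.pi / 4 * N) / N := by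
    field_simp
  rw [e, abs_div, abs_of_pos hN0, div_le_iff₀ hN0]
  refine h.trans (le_of_eq ?_)
  rw [mul_assoc]
  congr 1
  rw [inv_mul_eq_div, eq_div_iff (by positivity), Real.mul_self_sqrt hN0.le]

/-- The residue at 1 of a Dirichlet series with nonnegative coefficients is the mean value of the
coefficients, here π/4. No separate evaluation of L(1, χ₄) as an analytic function is needed. -/
lemma qq_zero : qq 0 = (Real.pi / 4 : ℝ) := by
  have h1 := LSeries_tendsto_sub_mul_nhds_one_of_tendsto_sum_div_and_nonneg (fun n => rr n)
    tendsto_sum_rr_div rr_nonneg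
  have h2 : Tendsto (fun s : ℝ => qq ((s : ℂ) - 1)) (𝓝[>] 1) (𝓝 (qq 0)) := by
    have hc : Continuous fun s : ℝ => qq ((s : ℂ) - 1) :=
      differentiable_qq.continuous.comp (by fun_prop)
    have := (hc.tendsto 1).mono_left (nhdsWithin_le_nhds (s := Set.Ioi 1))
    simpa using this
  refine tendsto_nhds_unique (h2.congr' ?_) h1
  filter_upwards [self_mem_nhdsWithin] with s hs
  have hs' : (1 : ℝ) < s := hs
  rw [LSeries_rr (by simpa using hs'), qq_eq]
  · simp
  · rw [sub_ne_zero]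
    exact_mod_cast hs'.ne'

/-- The Laplace transform of `kk (exp u) - (4 / π) (1 - exp (-u))`. -/
noncomputable def hh (w : ℂ) : ℂ :=
  (w * qq w)⁻¹ - (4 / Real.pi : ℝ) / (w * (1 + w))

/-- The numerator P(w) = 1/qq(w) − (4/π)/(1+w) vanishes at 0, so `hh` is its divided difference
there. That extends continuously through 0 and is bounded on the compact rectangle. -/
lemma exists_norm_hh_le_of_abs_le_one :
    ∃ B : ℝ, ∀ c t : ℝ, 0 < c → c ≤ 1 → |t| ≤ 1 → ‖hh (c + I * t)‖ ≤ B := by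
  set P : ℂ → ℂ := fun w => (qq w)⁻¹ - (4 / Real.pi : ℝ) / (1 + w) with hP
  set U : Set ℂ := {w | qq w ≠ 0 ∧ 1 + w ≠ 0} with hU
  have hUo : IsOpen U := by
    have h1 : IsOpen {w | qq w ≠ 0} := isOpen_ne_fun differentiable_qq.continuous continuous_const
    have h2 : IsOpen {w : ℂ | 1 + w ≠ 0} := isOpen_ne_fun (by fun_prop) continuous_const
    exact h1.inter h2
  have hmem : ∀ w : ℂ, 0 ≤ w.re → w ∈ U := fun w hw => ⟨qq_ne_zero hw, fun h => by
    have := congrArg Complex.re h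
    simp at this; linarith⟩
  have hPd : DifferentiableOn ℂ P U := fun w hw =>
    (((differentiable_qq w).inv hw.1).sub (DifferentiableAt.div (by fun_prop) (by fun_prop)
      hw.2)).differentiableWithinAt
  have h0 : (0 : ℂ) ∈ U := hmem 0 (by simp)
  have hds : ContinuousOn (dslope P 0) U :=
    (continuousOn_dslope (hUo.mem_nhds h0)).mpr
      ⟨hPd.continuousOn, (hPd 0 h0).differentiableAt (hUo.mem_nhds h0)⟩
  have hP0 : P 0 = 0 := by
    have : (Real.pi : ℂ) ≠ 0 := by exact_mod_cast Real.pi_ne_zero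
    simp only [hP, qq_zero]
    push_cast
    field_simp
    ring
  have hK : IsCompact (Set.Icc (0 : ℝ) 1 ×ℂ Set.Icc (-1 : ℝ) 1) := isCompact_Icc.reProdIm isCompact_Icc
  obtain ⟨B, hB⟩ := hK.exists_bound_of_continuousOn
    (hds.mono fun w hw => hmem w (Complex.mem_reProdIm.mp hw).1.1)
  refine ⟨B, fun c t hc hc1 ht => ?_⟩
  have hw0 : (c + I * t : ℂ) ≠ 0 := fun h => by
    have := congrArg Complex.re h
    simp at this; linarith
  have := hB (c + I * t) (Complex.mem_reProdIm.mpr ⟨by simp [hc.le, hc1], by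
    simpa using abs_le.mp ht⟩)
  rw [dslope_of_ne _ hw0, slope_def_field, hP0] at this
  refine le_of_eq_of_le (congrArg _ ?_) this
  have h1 : (1 + (c + I * t) : ℂ) ≠ 0 := (hmem _ (by simp [hc.le])).2
  have h2 := (hmem (c + I * t) (by simp [hc.le])).1
  generalize (c + I * t : ℂ) = w at *
  have h3 : qq w ≠ 0 := h2
  simp only [hP, hh, sub_zero]
  field_simp

/-- Each L-function modulo 4 is at least b|t|^{-7/16}; ζ differs from the principal one by 1 −
2^{-s}, of norm at most 2. Hence 1/(w²ζL) = O(|t|^{-2+7/8}), and the exponent −9/8 is integrable. -/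
lemma exists_norm_hh_le_of_one_le_abs :
    ∃ B : ℝ, 0 ≤ B ∧ ∀ c t : ℝ, 0 < c → c ≤ 1 → 1 ≤ |t| →
      ‖hh (c + I * t)‖ ≤ B * |t| ^ (-(9 / 8) : ℝ) := by
  obtain ⟨b, hb, h⟩ := exists_norm_LSeries_ge
  refine ⟨2 / b ^ 2 + 2, by positivity, fun c t hc hc1 ht => ?_⟩
  have ht0 : 0 < |t| := by linarith
  set w : ℂ := c + I * t with hw
  have hwre : w.re = c := by simp [hw]
  have hw0 : w ≠ 0 := fun h => by rw [h] at hwre; simp at hwre; linarith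
  have e1 : (1 + c + I * t : ℂ) = 1 + w := by rw [hw]; ring
  have hs : 1 < (1 + w).re := by rw [Complex.add_re, hwre]; simpa using hc
  have h1 := h chiD 0 chiD_sq hasMean_chiD c t hc hc1 ht
  have h2 := h 1 (1 / 2) (one_pow 2) hasMean_trivChar c t hc hc1 ht
  rw [e1, ← DirichletCharacter.LFunction_eq_LSeries _ hs] at h1 h2
  have h3 : DirichletCharacter.LFunction (1 : DirichletCharacter ℂ 4) (1 + w)
      = (1 - 2 ^ (-(1 + w))) * riemannZeta (1 + w) := by
    have := DirichletCharacter.LFunctionTrivChar_eq_mul_riemannZeta (N := 4) (s := 1 + w)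
      (by simpa using hw0)
    rw [DirichletCharacter.LFunctionTrivChar] at this
    rw [this, show (4 : ℕ) = 2 ^ 2 by norm_num, Nat.primeFactors_prime_pow (by norm_num)
      Nat.prime_two]
    simp
  have h4 : ‖(1 - 2 ^ (-(1 + w)) : ℂ)‖ ≤ 2 := by
    refine (norm_sub_le _ _).trans ?_
    have : ‖(2 : ℂ) ^ (-(1 + w))‖ ≤ 1 := by
      have h5 := Complex.norm_natCast_cpow_of_pos (n := 2) (by norm_num) (-(1 + w))
      simp only [Nat.cast_ofNat] at h5
      rw [h5]
      refine Real.rpow_le_one_of_one_le_of_nonpos (by norm_num) ?_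
      rw [Complex.neg_re]; linarith
    rw [norm_one]; linarith
  rw [h3, norm_mul] at h2
  set Z := ‖riemannZeta (1 + w)‖
  set Lf := ‖DirichletCharacter.LFunction chiD (1 + w)‖
  have hZ0 : 0 ≤ Z := norm_nonneg _
  have h5 : b * |t| ^ (-(7 / 16) : ℝ) ≤ 2 * Z := h2.trans (by gcongr)
  have hT : 0 < |t| ^ (-(7 / 16) : ℝ) := by positivity
  have h6 : b ^ 2 * |t| ^ (-(7 / 8) : ℝ) ≤ 2 * (Z * Lf) := by
    have e : |t| ^ (-(7 / 8) : ℝ) = |t| ^ (-(7 / 16) : ℝ) * |t| ^ (-(7 / 16) : ℝ) := by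
      rw [← Real.rpow_add ht0]; norm_num
    rw [e]
    calc _ = (b * |t| ^ (-(7 / 16) : ℝ)) * (b * |t| ^ (-(7 / 16) : ℝ)) := by ring
      _ ≤ (2 * Z) * Lf := mul_le_mul h5 h1 (by positivity) (by positivity)
      _ = _ := by ring
  have hwt : |t| ≤ ‖w‖ := by
    have := Complex.abs_im_le_norm w
    simpa [hw] using this
  have hwt' : |t| ≤ ‖1 + w‖ := by
    have := Complex.abs_im_le_norm (1 + w)
    simpa [hw] using this
  rw [hh, qq_eq hw0]
  refine (norm_sub_le _ _).trans ?_
  refine (add_le_add (?_ : _ ≤ 2 / b ^ 2 * |t| ^ (-(9 / 8) : ℝ))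
    (?_ : _ ≤ 2 * |t| ^ (-(9 / 8) : ℝ))).trans (le_of_eq (by ring))
  · rw [norm_inv, norm_mul, norm_mul, norm_mul]
    have h7 : b ^ 2 / 2 * |t| ^ (9 / 8 : ℝ) ≤ ‖w‖ * (‖w‖ * (Z * Lf)) := by
      have e : |t| ^ (9 / 8 : ℝ) = |t| * (|t| * |t| ^ (-(7 / 8) : ℝ)) := by
        nth_rw 2 [← Real.rpow_one |t|]
        nth_rw 3 [← Real.rpow_one |t|]
        rw [← Real.rpow_add ht0, ← Real.rpow_add ht0]; norm_num
      rw [e]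
      calc _ = |t| * (|t| * (b ^ 2 * |t| ^ (-(7 / 8) : ℝ) / 2)) := by ring
        _ ≤ ‖w‖ * (‖w‖ * (Z * Lf)) := by
            gcongr
            linarith
    calc _ ≤ (b ^ 2 / 2 * |t| ^ (9 / 8 : ℝ))⁻¹ := inv_anti₀ (by positivity) h7
      _ = _ := by rw [Real.rpow_neg ht0.le, mul_inv]; congr 1; field_simp
  · rw [norm_div, norm_mul, Complex.norm_real, Real.norm_eq_abs, abs_of_pos (by positivity)]
    have h8 : 4 / Real.pi ≤ 2 := by
      rw [div_le_iff₀ Real.pi_pos]; linarith [Real.pi_gt_three]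
    calc _ ≤ 2 / (|t| * |t|) := by gcongr
      _ = 2 * |t| ^ (-2 : ℝ) := by
          rw [Real.rpow_neg ht0.le, Real.rpow_two, sq]; rfl
      _ ≤ _ := by
          gcongr
          norm_num

lemma exists_norm_hh_le : ∃ B : ℝ, 0 ≤ B ∧ ∀ c t : ℝ, 0 < c → c ≤ 1 →
    ‖hh (c + I * t)‖ ≤ B * (1 + ‖t‖) ^ (-(9 / 8) : ℝ) := by
  obtain ⟨B1, h1⟩ := exists_norm_hh_le_of_abs_le_one
  obtain ⟨B2, hB2, h2⟩ := exists_norm_hh_le_of_one_le_abs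
  have h8 : (2 : ℝ) ^ (9 / 8 : ℝ) ≤ 4 := by
    calc (2 : ℝ) ^ (9 / 8 : ℝ) ≤ 2 ^ (2 : ℝ) :=
          Real.rpow_le_rpow_of_exponent_le (by norm_num) (by norm_num)
      _ = 4 := by norm_num
  refine ⟨4 * max B1 B2, mul_nonneg (by norm_num) (le_max_of_le_right hB2),
    fun c t hc hc1 => ?_⟩
  rw [Real.norm_eq_abs]
  have hB : 0 ≤ max B1 B2 := le_max_of_le_right hB2
  have hp : 0 < (1 + |t|) ^ (9 / 8 : ℝ) := by positivity
  rcases le_total |t| 1 with ht | ht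
  · refine (h1 c t hc hc1 ht).trans ?_
    rw [Real.rpow_neg (by positivity), ← div_eq_mul_inv, le_div_iff₀ hp]
    have : (1 + |t|) ^ (9 / 8 : ℝ) ≤ 4 := le_trans (by gcongr; linarith) h8
    calc _ ≤ max B1 B2 * 4 := mul_le_mul (le_max_left _ _) this hp.le hB
      _ = _ := by ring
  · have ht0 : 0 < |t| := by linarith
    refine (h2 c t hc hc1 ht).trans ?_
    rw [Real.rpow_neg (by positivity), Real.rpow_neg (by positivity), ← div_eq_mul_inv,
      ← div_eq_mul_inv, div_le_div_iff₀ (by positivity) hp]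
    have : (1 + |t|) ^ (9 / 8 : ℝ) ≤ 4 * |t| ^ (9 / 8 : ℝ) := by
      calc _ ≤ (2 * |t|) ^ (9 / 8 : ℝ) := by gcongr; linarith
        _ = 2 ^ (9 / 8 : ℝ) * |t| ^ (9 / 8 : ℝ) := Real.mul_rpow (by norm_num) ht0.le
        _ ≤ _ := by gcongr
    calc _ ≤ max B1 B2 * (4 * |t| ^ (9 / 8 : ℝ)) := mul_le_mul (le_max_right _ _) this hp.le hB
      _ = _ := by ring

end SumTwoSquaresSieve
end

/-! ### Laplace transform of `kk` on the logarithmic scale -/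

section
namespace SumTwoSquaresSieve
open Finset MeasureTheory ArithmeticFunction Filter Topology
open Complex (I)
open scoped ArithmeticFunction.zeta ArithmeticFunction.Moebius

/-- The ramp function `max 0 u` damped by `exp (-w u)`. -/
noncomputable def phi (w : ℂ) (u : ℝ) : ℂ := (max 0 u : ℝ) * Complex.exp (-w * u)

lemma norm_exp_neg_mul (w : ℂ) (u : ℝ) : ‖Complex.exp (-w * u)‖ = Real.exp (-w.re * u) := by
  rw [Complex.norm_exp]
  simp

lemma norm_phi (w : ℂ) (u : ℝ) : ‖phi w u‖ = max 0 u * Real.exp (-w.re * u) := by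
  rw [phi, norm_mul, norm_exp_neg_mul, Complex.norm_real, Real.norm_eq_abs,
    abs_of_nonneg (le_max_left _ _)]

lemma continuous_phi (w : ℂ) : Continuous (phi w) := by
  unfold phi
  fun_prop

lemma phi_eq_indicator (w : ℂ) :
    phi w = (Set.Ioi 0).indicator fun u : ℝ => (u : ℂ) * Complex.exp (-w * u) := by
  ext u
  by_cases hu : 0 < u
  · rw [Set.indicator_of_mem (Set.mem_Ioi.mpr hu), phi, max_eq_right hu.le]
  · rw [Set.indicator_of_notMem (by simpa using hu), phi, max_eq_left (not_lt.mp hu)]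
    simp

lemma integrable_phi {w : ℂ} (hw : 0 < w.re) : Integrable (phi w) := by
  have h : IntegrableOn (fun x : ℝ => x ^ (1 : ℝ) * Real.exp (-w.re * x ^ (1 : ℝ))) (Set.Ioi 0) :=
    integrableOn_rpow_mul_exp_neg_mul_rpow (by norm_num) one_pos hw
  have h' := (integrable_indicator_iff measurableSet_Ioi).mpr h
  refine h'.mono (continuous_phi w).aestronglyMeasurable (Eventually.of_forall fun u => ?_)
  rw [norm_phi]
  by_cases hu : 0 < u
  · rw [Set.indicator_of_mem (Set.mem_Ioi.mpr hu), max_eq_right hu.le, Real.rpow_one]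
    exact le_abs_self _
  · rw [max_eq_left (not_lt.mp hu), zero_mul]
    exact norm_nonneg _

lemma integral_phi {w : ℂ} (hw : 0 < w.re) : ∫ u, phi w u = 1 / w ^ 2 := by
  have hw0 : w ≠ 0 := fun h => by rw [h] at hw; simp at hw
  have hint := integrable_phi hw
  rw [phi_eq_indicator, integrable_indicator_iff measurableSet_Ioi] at hint
  have hder : ∀ u ∈ Set.Ici (0 : ℝ), HasDerivAt
      (fun u : ℝ => -((u : ℂ) / w + 1 / w ^ 2) * Complex.exp (-w * u))
      ((u : ℂ) * Complex.exp (-w * u)) u := fun u _ => by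
    have h1 : HasDerivAt (fun u : ℝ => (u : ℂ)) 1 u := Complex.ofRealCLM.hasDerivAt
    have h2 := ((h1.div_const w).add_const (1 / w ^ 2)).neg
    have h3 := (h1.const_mul (-w)).cexp
    refine (h2.mul h3).congr_deriv ?_
    simp only [Pi.neg_apply]
    field_simp
    ring
  rw [phi_eq_indicator, integral_indicator measurableSet_Ioi,
    integral_Ioi_of_hasDerivAt_of_tendsto' (m := 0) hder hint ?_]
  · simp
  · have h1 : Tendsto (fun u : ℝ => ‖w‖⁻¹ * (u ^ (1 : ℝ) * Real.exp (-w.re * u))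
        + ‖w ^ 2‖⁻¹ * (u ^ (0 : ℝ) * Real.exp (-w.re * u))) atTop
        (𝓝 (‖w‖⁻¹ * 0 + ‖w ^ 2‖⁻¹ * 0)) :=
      ((tendsto_rpow_mul_exp_neg_mul_atTop_nhds_zero 1 w.re hw).const_mul _).add
        ((tendsto_rpow_mul_exp_neg_mul_atTop_nhds_zero 0 w.re hw).const_mul _)
    rw [mul_zero, mul_zero, add_zero] at h1
    refine squeeze_zero_norm' ?_ h1
    filter_upwards [eventually_ge_atTop 0] with u hu
    rw [norm_mul, norm_exp_neg_mul, norm_neg, Real.rpow_one, Real.rpow_zero, one_mul,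
      ← mul_assoc, ← add_mul]
    gcongr
    refine (norm_add_le _ _).trans (le_of_eq ?_)
    rw [norm_div, norm_div, Complex.norm_real, Real.norm_eq_abs, abs_of_nonneg hu, norm_one]
    ring

lemma phi_sub (w : ℂ) {n : ℕ} (hn : n ≠ 0) (u : ℝ) :
    (n : ℂ) ^ (-w) * phi w (u - Real.log n)
      = (max 0 (u - Real.log n) : ℝ) * Complex.exp (-w * u) := by
  have hn' : (n : ℂ) ≠ 0 := by exact_mod_cast hn
  rw [phi, Complex.cpow_def_of_ne_zero hn', mul_left_comm, ← Complex.exp_add, Complex.ofReal_sub,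
    Complex.natCast_log]
  congr 2
  ring

lemma hasSum_kk_exp (u : ℝ) :
    HasSum (fun n : ℕ => til nu n * max 0 (u - Real.log n)) (kk (Real.exp u)) := by
  have e : kk (Real.exp u)
      = ∑ n ∈ Ioc 0 ⌊Real.exp u⌋₊, til nu n * max 0 (u - Real.log n) := by
    rw [kk, ev]
    refine sum_congr rfl fun n hn => ?_
    have hn := mem_Ioc.mp hn
    have hn0 : (0 : ℝ) < n := by exact_mod_cast hn.1
    have hne : (n : ℝ) ≤ Real.exp u := (Nat.le_floor_iff (Real.exp_pos u).le).mp hn.2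
    rw [Real.log_div (Real.exp_ne_zero u) hn0.ne', Real.log_exp, max_eq_right]
    rw [sub_nonneg, Real.log_le_iff_le_exp hn0]
    exact hne
  rw [e]
  refine hasSum_sum_of_ne_finset_zero fun n hn => ?_
  rcases Nat.eq_zero_or_pos n with rfl | hn0
  · simp
  · have : ⌊Real.exp u⌋₊ < n := by simpa [hn0] using hn
    have h1 : Real.exp u < n := (Nat.floor_lt (Real.exp_pos u).le).mp this
    have h2 : u ≤ Real.log n := ((Real.lt_log_iff_exp_lt (by exact_mod_cast hn0)).mpr h1).le
    rw [max_eq_left (by linarith), mul_zero]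

/-- Transform term by term: the ramp starting at log n has transform n^{-w}/w², so the total is w⁻²
Σ ν(n) n^{-1-w}. -/
lemma hasSum_laplace_kk {w : ℂ} (hw : 0 < w.re) :
    ∫ u : ℝ, (kk (Real.exp u) : ℂ) * Complex.exp (-w * u) = (w * qq w)⁻¹ := by
  set F : ℕ → ℝ → ℂ := fun n u => LSeries.term (fun n => (nu n : ℂ)) (1 + w) n *
    phi w (u - Real.log n) with hF
  have hs : 1 < (1 + w).re := by simpa using hw
  have hw0 : w ≠ 0 := fun h => by rw [h] at hw; simp at hw
  have hsum := LSeriesSummable_nu hs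
  have hint : ∀ n, Integrable (F n) := fun n =>
    ((integrable_phi hw).comp_sub_right (Real.log n)).const_mul _
  have hnorm : ∀ n, ∫ u, ‖F n u‖
      = ‖LSeries.term (fun n => (nu n : ℂ)) (1 + w) n‖ * ∫ u, ‖phi w u‖ := fun n => by
    simp only [hF, norm_mul]
    rw [integral_const_mul, integral_sub_right_eq_self (fun u => ‖phi w u‖)]
  have key := hasSum_integral_of_summable_integral_norm hint (by
    simp only [hnorm]; exact hsum.norm.mul_right _)
  have h1 : ∀ n, ∫ u, F n u = LSeries.term (fun n => (nu n : ℂ)) (1 + w) n * (1 / w ^ 2) :=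
    fun n => by
      simp only [hF]
      rw [integral_const_mul, integral_sub_right_eq_self (fun u => phi w u), integral_phi hw]
  simp only [h1] at key
  have h2 : ∀ u : ℝ, ∑' n, F n u = (kk (Real.exp u) : ℂ) * Complex.exp (-w * u) := fun u => by
    have h3 : HasSum (fun n : ℕ => ((til nu n * max 0 (u - Real.log n) : ℝ) : ℂ)
        * Complex.exp (-w * u)) ((kk (Real.exp u) : ℂ) * Complex.exp (-w * u)) :=
      (Complex.hasSum_ofReal.mpr (hasSum_kk_exp u)).mul_right _
    rw [← h3.tsum_eq]
    refine tsum_congr fun n => ?_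
    rcases eq_or_ne n 0 with rfl | hn
    · simp [hF]
    · have hn' : (n : ℂ) ≠ 0 := by exact_mod_cast hn
      have h4 := phi_sub w hn u
      simp only [hF]
      rw [LSeries.term_of_ne_zero hn, Complex.cpow_add _ _ hn', Complex.cpow_one, til_apply,
        Complex.ofReal_mul, mul_assoc, ← h4, Complex.cpow_neg]
      push_cast
      field_simp
  simp only [h2] at key
  have h5 := key.unique ((show HasSum _ _ from hsum.hasSum).mul_right (1 / w ^ 2))
  rw [h5]
  change LSeries (fun n => (nu n : ℂ)) (1 + w) * _ = _
  rw [LSeries_nu hs, qq_eq hw0]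
  rw [← one_div, ← one_div, div_mul_div_comm, one_mul]
  congr 1
  ring

/-- The centred function `kk (exp u) - (4 / π) (1 - exp (-u))`, continuous and zero for `u ≤ 0`. -/
noncomputable def kc (u : ℝ) : ℝ := kk (Real.exp u) - 4 / Real.pi * (1 - Real.exp (-max 0 u))

lemma abs_kk_exp_sub_le (u v : ℝ) : |kk (Real.exp u) - kk (Real.exp v)| ≤ 44 * |u - v| := by
  wlog h : v ≤ u generalizing u v
  · rw [abs_sub_comm, abs_sub_comm u]
    exact this v u (le_of_not_ge h)
  · have := abs_kk_sub_le (Real.exp_pos v) (Real.exp_le_exp.mpr h)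
    rwa [← Real.exp_sub, Real.log_exp, ← abs_of_nonneg (sub_nonneg.mpr h)] at this

lemma continuous_kk_exp : Continuous fun u => kk (Real.exp u) := by
  refine (LipschitzWith.of_dist_le_mul (K := 44) fun u v => ?_).continuous
  rw [Real.dist_eq, Real.dist_eq]
  exact abs_kk_exp_sub_le u v

lemma continuous_kc : Continuous kc := by
  have := continuous_kk_exp
  unfold kc
  fun_prop

lemma abs_kk_exp_le (u : ℝ) : |kk (Real.exp u)| ≤ 44 * max 0 u := by
  rcases le_total u 0 with hu | hu
  · rcases hu.eq_or_lt with rfl | hu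
    · simp [kk_one]
    · rw [kk_of_lt (by simpa using hu)]
      simp
  · have := abs_kk_exp_sub_le u 0
    rw [Real.exp_zero, kk_one, sub_zero, sub_zero, abs_of_nonneg hu] at this
    rwa [max_eq_right hu]

lemma integrable_kk_mul_exp {w : ℂ} (hw : 0 < w.re) :
    Integrable fun u : ℝ => (kk (Real.exp u) : ℂ) * Complex.exp (-w * u) := by
  refine ((integrable_phi hw).norm.const_mul 44).mono'
    (Continuous.aestronglyMeasurable ?_) (Eventually.of_forall fun u => ?_)
  · have := continuous_kk_exp
    fun_prop
  · rw [norm_mul, norm_exp_neg_mul, norm_phi, Complex.norm_real, Real.norm_eq_abs, ← mul_assoc]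
    gcongr
    exact abs_kk_exp_le u

lemma main_eq_indicator (w : ℂ) :
    (fun u : ℝ => ((1 - Real.exp (-max 0 u) : ℝ) : ℂ) * Complex.exp (-w * u))
      = (Set.Ioi 0).indicator fun u : ℝ => Complex.exp (-w * u) - Complex.exp (-(1 + w) * u) := by
  ext u
  by_cases hu : 0 < u
  · rw [Set.indicator_of_mem (Set.mem_Ioi.mpr hu), max_eq_right hu.le]
    push_cast
    rw [sub_mul, one_mul, ← Complex.exp_add]
    congr 2
    ring
  · rw [Set.indicator_of_notMem (by simpa using hu), max_eq_left (not_lt.mp hu)]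
    simp

lemma integrable_main {w : ℂ} (hw : 0 < w.re) :
    Integrable fun u : ℝ => ((1 - Real.exp (-max 0 u) : ℝ) : ℂ) * Complex.exp (-w * u) := by
  rw [main_eq_indicator, integrable_indicator_iff measurableSet_Ioi]
  exact (integrableOn_exp_mul_complex_Ioi (by simpa using hw) 0).sub
    (integrableOn_exp_mul_complex_Ioi (by simp; linarith) 0)

lemma integral_main {w : ℂ} (hw : 0 < w.re) :
    ∫ u : ℝ, ((1 - Real.exp (-max 0 u) : ℝ) : ℂ) * Complex.exp (-w * u) = 1 / (w * (1 + w)) := by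
  rw [main_eq_indicator, integral_indicator measurableSet_Ioi, integral_sub
    (integrableOn_exp_mul_complex_Ioi (by simpa using hw) 0)
    (integrableOn_exp_mul_complex_Ioi (by simp; linarith) 0),
    integral_exp_mul_complex_Ioi (by simpa using hw), integral_exp_mul_complex_Ioi
    (by simp; linarith)]
  have hw0 : w ≠ 0 := fun h => by rw [h] at hw; simp at hw
  have hw1 : 1 + w ≠ 0 := fun h => by
    have := congrArg Complex.re h
    simp at this; linarith
  have hw2 : -(1 + w) ≠ 0 := neg_ne_zero.mpr hw1
  simp only [Complex.ofReal_zero, mul_zero, Complex.exp_zero]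
  field_simp
  ring

lemma integrable_kc {w : ℂ} (hw : 0 < w.re) :
    Integrable fun u : ℝ => (kc u : ℂ) * Complex.exp (-w * u) := by
  refine ((integrable_kk_mul_exp hw).sub ((integrable_main hw).const_mul (4 / Real.pi : ℝ))).congr
    (Eventually.of_forall fun u => ?_)
  simp only [kc, Pi.sub_apply]
  push_cast
  ring

lemma integral_kc {w : ℂ} (hw : 0 < w.re) :
    ∫ u : ℝ, (kc u : ℂ) * Complex.exp (-w * u) = hh w := by
  have e : ∀ u : ℝ, (kc u : ℂ) * Complex.exp (-w * u)
      = (kk (Real.exp u) : ℂ) * Complex.exp (-w * u) - ((4 / Real.pi : ℝ) : ℂ) *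
        (((1 - Real.exp (-max 0 u) : ℝ) : ℂ) * Complex.exp (-w * u)) := fun u => by
    simp only [kc]
    push_cast
    ring
  simp only [e]
  rw [integral_sub (integrable_kk_mul_exp hw) ((integrable_main hw).const_mul _),
    integral_const_mul, hasSum_laplace_kk hw, integral_main hw, hh, mul_one_div]

end SumTwoSquaresSieve
end

/-! ### Mean square of `kk` − 4/π by Plancherel -/

section
namespace SumTwoSquaresSieve
open Finset MeasureTheory Filter Topology
open Complex (I)
open scoped FourierTransform

/-- The sesquilinear Parseval formula pairs G with its own transform, and Fourier inversion
identifies the other side. -/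
lemma integral_norm_sq_fourier {G : ℝ → ℂ} (hc : Continuous G) (hG : Integrable G)
    (hF : Integrable (𝓕 G)) : ∫ ξ, ‖𝓕 G ξ‖ ^ 2 = ∫ u, ‖G u‖ ^ 2 := by
  have h := VectorFourier.integral_sesq_fourierIntegral_eq_neg_flip (μ := volume) (ν := volume)
    (L := innerₗ ℝ) (f := G) (g := 𝓕 G) (innerSL ℂ) Real.continuous_fourierChar
    (by fun_prop) hG hF
  have h2 : ∀ x, VectorFourier.fourierIntegral Real.fourierChar volume (-(innerₗ ℝ).flip) (𝓕 G) x
      = G x := fun x => by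
    rw [flip_innerₗ]
    exact congrFun (hc.fourierInv_fourier_eq hG hF) x
  simp only [h2] at h
  have h3 : ∀ x : ℂ, (innerSL ℂ x) x = ((‖x‖ ^ 2 : ℝ) : ℂ) := fun x => by
    rw [innerSL_apply_apply, inner_self_eq_norm_sq_to_K]
    push_cast
    rfl
  change ∫ ξ, (innerSL ℂ (𝓕 G ξ)) (𝓕 G ξ) = _ at h
  simp only [h3] at h
  rw [integral_complex_ofReal, integral_complex_ofReal] at h
  exact_mod_cast h

/-- The Fourier transform of kc(u)e^{-cu} is ξ ↦ hh(c + 2πiξ), dominated by an integrable function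
that does not depend on c. The bound is therefore uniform as c → 0, although the transform is used
only for c > 0. -/
lemma exists_integral_kc_sq_le : ∃ B : ℝ, ∀ c : ℝ, 0 < c → c ≤ 1 →
    Integrable (fun u => kc u ^ 2 * Real.exp (-(2 * c) * u)) ∧
    ∫ u, kc u ^ 2 * Real.exp (-(2 * c) * u) ≤ B := by
  obtain ⟨B, hB, h⟩ := exists_norm_hh_le
  set J : ℝ → ℝ := fun ξ => (B * (1 + ‖ξ‖) ^ (-(9 / 8) : ℝ)) with hJ
  have hJint : Integrable J := (integrable_one_add_norm (by simp; norm_num)).const_mul B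
  have hle1 : ∀ ξ : ℝ, (1 + ‖ξ‖) ^ (-(9 / 8) : ℝ) ≤ 1 := fun ξ =>
    Real.rpow_le_one_of_one_le_of_nonpos (by linarith [norm_nonneg ξ]) (by norm_num)
  refine ⟨∫ ξ, B * J ξ, fun c hc hc1 => ?_⟩
  set G : ℝ → ℂ := fun u => (kc u : ℂ) * Complex.exp (-(c : ℂ) * u) with hGdef
  have hcc : Continuous G := by
    have := continuous_kc
    fun_prop
  have hG : Integrable G := integrable_kc (w := c) (by simpa using hc)
  have hFeq : ∀ ξ, 𝓕 G ξ = hh (c + I * (2 * Real.pi * ξ : ℝ)) := fun ξ => by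
    rw [Real.fourier_real_eq_integral_exp_smul, ← integral_kc (by simpa using hc)]
    refine integral_congr_ae (Eventually.of_forall fun u => ?_)
    simp only [hGdef, smul_eq_mul]
    rw [mul_left_comm, ← Complex.exp_add]
    congr 2
    push_cast
    ring
  have hnorm : ∀ ξ, ‖𝓕 G ξ‖ ≤ J ξ := fun ξ => by
    rw [hFeq]
    refine (h c _ hc hc1).trans ?_
    simp only [hJ]
    refine mul_le_mul_of_nonneg_left ?_ hB
    refine Real.rpow_le_rpow_of_nonpos (by positivity) ?_ (by norm_num)
    rw [norm_mul, Real.norm_of_nonneg (show (0 : ℝ) ≤ 2 * Real.pi by positivity)]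
    have : (1 : ℝ) ≤ 2 * Real.pi := by linarith [Real.pi_gt_three]
    nlinarith [norm_nonneg ξ]
  have hFc : Continuous (𝓕 G) :=
    VectorFourier.fourierIntegral_continuous Real.continuous_fourierChar (by fun_prop) hG
  have hF : Integrable (𝓕 G) :=
    hJint.mono' hFc.aestronglyMeasurable (Eventually.of_forall hnorm)
  have hsq : ∀ ξ, ‖𝓕 G ξ‖ ^ 2 ≤ B * J ξ := fun ξ => by
    rw [sq]
    refine mul_le_mul ((hnorm ξ).trans ?_) (hnorm ξ) (norm_nonneg _) hB
    simp only [hJ]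
    exact mul_le_of_le_one_right hB (hle1 ξ)
  have hGsq : ∀ u, ‖G u‖ ^ 2 = kc u ^ 2 * Real.exp (-(2 * c) * u) := fun u => by
    simp only [hGdef]
    rw [norm_mul, norm_exp_neg_mul, Complex.norm_real, mul_pow, Real.norm_eq_abs, sq_abs,
      ← Real.exp_nat_mul]
    congr 2
    simp
    ring
  have hle := integral_mono_of_nonneg (Eventually.of_forall fun ξ => sq_nonneg ‖𝓕 G ξ‖)
    (hJint.const_mul B) (Eventually.of_forall hsq)
  rw [integral_norm_sq_fourier hcc hG hF] at hle
  simp only [hGsq] at hle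
  refine ⟨?_, hle⟩
  have hbd : ∀ u, ‖G u‖ ≤ ∫ ξ, J ξ := fun u => by
    have := congrFun (hcc.fourierInv_fourier_eq hG hF) u
    rw [← this]
    refine (VectorFourier.norm_fourierIntegral_le_integral_norm _ _ _ _ _).trans ?_
    exact integral_mono_of_nonneg (Eventually.of_forall fun _ => norm_nonneg _) hJint
      (Eventually.of_forall hnorm)
  have : Integrable fun u => ‖G u‖ ^ 2 := by
    refine (hG.norm.const_mul (∫ ξ, J ξ)).mono' (by fun_prop) (Eventually.of_forall fun u => ?_)
    rw [Real.norm_of_nonneg (sq_nonneg _), sq]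
    exact mul_le_mul_of_nonneg_right (hbd u) (norm_nonneg _)
  simpa only [hGsq] using this

lemma exists_integral_kk_sub_sq_le : ∃ B : ℝ, 0 ≤ B ∧ ∀ U : ℝ, 0 ≤ U →
    ∫ u in (0 : ℝ)..U, (kk (Real.exp u) - 4 / Real.pi) ^ 2 ≤ B := by
  obtain ⟨B, hB⟩ := exists_integral_kc_sq_le
  have hkc := continuous_kc
  have hB0 : 0 ≤ B := (integral_nonneg fun u => by positivity).trans (hB 1 one_pos le_rfl).2
  refine ⟨2 * (Real.exp 2 * B) + 8, by positivity, fun U hU => ?_⟩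
  -- With this damping e^{-2cu} is at least e^{-2} on [0, U], so removing it costs only the factor
  -- e². The discarded (4/π)e^{-u} contributes a bounded amount.
  set c : ℝ := 1 / (U + 1) with hc
  have hU1 : 0 < U + 1 := by linarith
  have hc0 : 0 < c := by positivity
  have hc1 : c ≤ 1 := by rw [hc, div_le_one hU1]; linarith
  obtain ⟨hi, hle⟩ := hB c hc0 hc1
  have hp : 4 / Real.pi ≤ 4 / 3 := by gcongr; exact Real.pi_gt_three.le
  have hp0 : 0 < 4 / Real.pi := by positivity
  have h1 : ∀ u ∈ Set.Icc 0 U, (kk (Real.exp u) - 4 / Real.pi) ^ 2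
      ≤ 2 * (Real.exp 2 * (kc u ^ 2 * Real.exp (-(2 * c) * u))) + 4 * Real.exp (-u) := by
    intro u hu
    have e : kk (Real.exp u) - 4 / Real.pi = kc u - 4 / Real.pi * Real.exp (-u) := by
      rw [kc, max_eq_right hu.1]; ring
    have h2 : 1 ≤ Real.exp 2 * Real.exp (-(2 * c) * u) := by
      rw [← Real.exp_add]
      apply Real.one_le_exp
      have : c * u ≤ 1 := by
        rw [hc, one_div, inv_mul_le_iff₀ hU1]; linarith [hu.2]
      linarith
    have h3 : Real.exp (-u) ≤ 1 := Real.exp_le_one_iff.mpr (by linarith [hu.1])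
    have h4 : 0 < Real.exp (-u) := Real.exp_pos _
    have h5 : kc u ^ 2 ≤ Real.exp 2 * (kc u ^ 2 * Real.exp (-(2 * c) * u)) := by
      nlinarith [sq_nonneg (kc u)]
    have h6 : (4 / Real.pi * Real.exp (-u)) ^ 2 ≤ 2 * Real.exp (-u) := by
      have : (4 / Real.pi) ^ 2 ≤ 2 := by nlinarith
      rw [mul_pow]
      have h7 : Real.exp (-u) ^ 2 ≤ Real.exp (-u) := by nlinarith
      exact mul_le_mul this h7 (sq_nonneg _) (by norm_num)
    rw [e]
    nlinarith [sq_nonneg (kc u + 4 / Real.pi * Real.exp (-u))]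
  have hcont := continuous_kk_exp
  refine (intervalIntegral.integral_mono_on hU
    (Continuous.intervalIntegrable (by fun_prop) _ _)
    (Continuous.intervalIntegrable (by fun_prop) _ _) h1).trans ?_
  rw [intervalIntegral.integral_add (Continuous.intervalIntegrable (by fun_prop) _ _)
    (Continuous.intervalIntegrable (by fun_prop) _ _), intervalIntegral.integral_const_mul,
    intervalIntegral.integral_const_mul, intervalIntegral.integral_const_mul]
  refine add_le_add ?_ ?_
  · have : ∫ u in (0 : ℝ)..U, kc u ^ 2 * Real.exp (-(2 * c) * u) ≤ B := by
      rw [intervalIntegral.integral_of_le hU]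
      exact (setIntegral_le_integral hi (Eventually.of_forall fun u => by positivity)).trans hle
    gcongr
  · have : ∫ u in (0 : ℝ)..U, Real.exp (-u) = 1 - Real.exp (-U) := by
      rw [intervalIntegral.integral_comp_neg (fun u => Real.exp u)]
      simp
    rw [this]
    linarith [Real.exp_pos (-U)]

end SumTwoSquaresSieve
end

/-! ### Mertens' theorem for primes congruent to 1 modulo 4 -/

section
namespace SumTwoSquaresSieve
open Finset ArithmeticFunction
open scoped ArithmeticFunction.zeta ArithmeticFunction.Moebius

lemma pmul_cm_mul (g : ℕ →*₀ ℝ) (a b : ArithmeticFunction ℝ) :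
    (cm g).pmul (a * b) = (cm g).pmul a * (cm g).pmul b := by
  ext n
  simp only [pmul_apply, mul_apply, cm_apply, Finset.mul_sum]
  refine sum_congr rfl fun x hx => ?_
  rw [← (Nat.mem_divisorsAntidiagonal.mp hx).1, map_mul]
  ring

lemma pmul_log_mul (a b : ArithmeticFunction ℝ) :
    (a * b).pmul log = a.pmul log * b + a * b.pmul log := by
  ext n
  simp only [pmul_apply, mul_apply, ArithmeticFunction.add_apply, Finset.sum_mul]
  rw [← sum_add_distrib]
  refine sum_congr rfl fun x hx => ?_
  have hx' := Nat.mem_divisorsAntidiagonal.mp hx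
  have h1 : x.1 ≠ 0 := fun h => hx'.2 (by rw [← hx'.1, h, zero_mul])
  have h2 : x.2 ≠ 0 := fun h => hx'.2 (by rw [← hx'.1, h, mul_zero])
  rw [← hx'.1, log_apply, log_apply, log_apply, Nat.cast_mul,
    Real.log_mul (by exact_mod_cast h1) (by exact_mod_cast h2)]
  ring

lemma pmul_cm_log (g : ℕ →*₀ ℝ) : (cm g).pmul log = (cm g).pmul Λ * cm g := by
  rw [← vonMangoldt_mul_zeta, pmul_cm_mul]
  congr 1
  ext n
  simp

/-- This is the logarithmic derivative of ζ(s)L(s, χ₄) read on coefficients. -/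
lemma rr_pmul_log : rr.pmul log = (Λ + (cm chi).pmul Λ) * rr := by
  have h1 : (ζ : ArithmeticFunction ℝ).pmul log = Λ * ζ := by
    rw [vonMangoldt_mul_zeta]
    ext n
    simp
  rw [rr, pmul_log_mul, pmul_cm_log, h1]
  ring

lemma log_le_two_sqrt {x : ℝ} (hx : 0 < x) : Real.log x ≤ 2 * √x := by
  have h1 := Real.log_le_sub_one_of_pos (Real.sqrt_pos.mpr hx)
  rw [Real.log_sqrt hx.le] at h1
  linarith [Real.sqrt_nonneg x]

lemma sum_vonMangoldt_le (N : ℕ) : ∑ n ∈ Ioc 0 N, Λ n ≤ 6 * N := by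
  have h := Chebyshev.psi_le_const_mul_self (x := N) (by positivity)
  rw [Chebyshev.psi, Nat.floor_natCast] at h
  have h4 : Real.log 4 ≤ 2 := by
    have : Real.log 4 = 2 * Real.log 2 := by
      rw [show (4 : ℝ) = 2 ^ 2 by norm_num, Real.log_pow]; norm_num
    linarith [Real.log_two_lt_d9]
  nlinarith [(Nat.cast_nonneg N : (0 : ℝ) ≤ N)]

lemma abs_vK_le (n : ℕ) : |(Λ + (cm chi).pmul Λ) n| ≤ 2 * Λ n := by
  have h1 := abs_chi_le n
  have h2 : 0 ≤ Λ n := vonMangoldt_nonneg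
  rw [ArithmeticFunction.add_apply, pmul_apply, cm_apply]
  calc _ ≤ |Λ n| + |chi n * Λ n| := abs_add_le _ _
    _ ≤ Λ n + 1 * Λ n := by
        rw [abs_mul, abs_of_nonneg h2]
        gcongr
    _ = _ := by ring

/-- Mertens' first theorem for the Gaussian field, in terms of rational integers. -/
lemma exists_abs_sum_vK_div_sub_log_le : ∃ B : ℝ, ∀ N : ℕ, 0 < N →
    |∑ n ∈ Ioc 0 N, (Λ + (cm chi).pmul Λ) n / n - Real.log N| ≤ B := by
  -- The sum of r(n) log n is evaluated twice: by partial summation, with error 26N, and through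
  -- r·log = ((1 + χ₄)Λ) ∗ r with r replaced by its mean, with error 96N. Comparing and dividing by
  -- πN/4 gives the constant, as 26 + 96 = 122.
  refine ⟨122 / (Real.pi / 4), fun N hN => ?_⟩
  have hN0 : (0 : ℝ) < N := by exact_mod_cast hN
  have hpi : 0 < Real.pi / 4 := by positivity
  set vK := Λ + (cm chi).pmul Λ with hvK
  have hsq : √(N : ℝ) * √N = N := Real.mul_self_sqrt hN0.le
  -- the logarithmic sum, evaluated by partial summation
  have hL : |∑ n ∈ Ioc 0 N, rr n * Real.log n - Real.pi / 4 * N * Real.log N| ≤ 26 * N := by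
    have h1 : ∑ n ∈ Ioc 0 N, rr n * Real.log n = (∑ n ∈ Ioc 0 N, rr n) * Real.log N
        - ∑ n ∈ Ioc 0 N, rr n * Real.log (N / n) := by
      rw [Finset.sum_mul, ← sum_sub_distrib]
      refine sum_congr rfl fun n hn => ?_
      have : (0 : ℝ) < n := by exact_mod_cast (mem_Ioc.mp hn).1
      rw [Real.log_div hN0.ne' this.ne']
      ring
    have h2 : ∑ n ∈ Ioc 0 N, rr n * Real.log (N / n) ≤ 16 * N := by
      calc _ ≤ ∑ n ∈ Ioc 0 N, 2 * √N * (rr n / √n) := by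
            refine sum_le_sum fun n hn => ?_
            have : (0 : ℝ) < n := by exact_mod_cast (mem_Ioc.mp hn).1
            have h3 := log_le_two_sqrt (div_pos hN0 this)
            rw [Real.sqrt_div hN0.le] at h3
            calc _ ≤ rr n * (2 * (√N / √n)) := mul_le_mul_of_nonneg_left h3 (rr_nonneg n)
              _ = _ := by ring
        _ ≤ 2 * √N * (2 * 4 * √N) := by
            rw [← Finset.mul_sum]
            exact mul_le_mul_of_nonneg_left (sum_div_sqrt_le (by norm_num) sum_rr_le N)
              (by positivity)
        _ = 16 * N := by linear_combination 16 * hsq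
    have h3 : 0 ≤ ∑ n ∈ Ioc 0 N, rr n * Real.log (N / n) := by
      refine sum_nonneg fun n hn => mul_nonneg (rr_nonneg n) (Real.log_nonneg ?_)
      have hn' := mem_Ioc.mp hn
      rw [one_le_div (by exact_mod_cast hn'.1)]
      exact_mod_cast hn'.2
    have h4 := abs_sum_rr_sub_le N
    have h5 := log_le_two_sqrt hN0
    have h6 : 0 ≤ Real.log N := Real.log_natCast_nonneg N
    have h7 : |(∑ n ∈ Ioc 0 N, rr n - Real.pi / 4 * N) * Real.log N| ≤ 6 * N := by
      rw [abs_mul, abs_of_nonneg h6]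
      calc _ ≤ (3 * √N) * (2 * √N) := mul_le_mul h4 h5 h6 (by positivity)
        _ = 6 * N := by linear_combination 6 * hsq
    rw [h1]
    have h8 := abs_le.mp h7
    rw [abs_le]
    constructor <;> nlinarith
  have hR : |∑ n ∈ Ioc 0 N, rr n * Real.log n - Real.pi / 4 * N * ∑ n ∈ Ioc 0 N, vK n / n|
      ≤ 96 * N := by
    have h1 : ∑ n ∈ Ioc 0 N, rr n * Real.log n
        = ∑ d ∈ Ioc 0 N, vK d * ∑ m ∈ Ioc 0 (N / d), rr m := by
      rw [← sum_Ioc_mul_eq_sum_sum, hvK, ← rr_pmul_log]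
      rfl
    rw [h1, Finset.mul_sum, ← sum_sub_distrib]
    calc _ ≤ ∑ d ∈ Ioc 0 N, 8 * √N * (Λ d / √d) := by
          refine (abs_sum_le_sum_abs _ _).trans (sum_le_sum fun d hd => ?_)
          have hd' := mem_Ioc.mp hd
          have e : vK d * ∑ m ∈ Ioc 0 (N / d), rr m - Real.pi / 4 * N * (vK d / d)
              = vK d * (∑ m ∈ Ioc 0 (N / d), rr m - Real.pi / 4 * (N / d)) := by ring
          rw [e, abs_mul]
          calc _ ≤ (2 * Λ d) * (4 * (√N / √d)) :=
                mul_le_mul (abs_vK_le d) (abs_sum_rr_div_sub_le hd'.1 hd'.2) (abs_nonneg _)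
                  (mul_nonneg two_pos.le vonMangoldt_nonneg)
            _ = _ := by ring
      _ ≤ 8 * √N * (2 * 6 * √N) := by
          rw [← Finset.mul_sum]
          exact mul_le_mul_of_nonneg_left (sum_div_sqrt_le (by norm_num) sum_vonMangoldt_le N)
            (by positivity)
      _ = 96 * N := by linear_combination 96 * hsq
  have h := (abs_sub_le _ _ _).trans (add_le_add ((abs_sub_comm _ _).trans_le hR) hL)
  rw [← mul_sub, abs_mul, abs_of_pos (by positivity)] at h
  rw [le_div_iff₀ hpi]
  nlinarith

/-- Higher prime powers contribute a convergent sum. The statement for residue classes is applied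
with modulus 1, whose only class contains every integer. -/
lemma exists_sum_not_prime_le : ∃ B : ℝ, ∀ N : ℕ,
    ∑ n ∈ Ioc 0 N, (if n.Prime then 0 else Λ n) / n ≤ B := by
  have h := vonMangoldt.summable_residueClass_non_primes_div (q := 1) 0
  refine ⟨_, fun N => le_trans (le_of_eq ?_) (h.sum_le_tsum (Ioc 0 N) fun n _ => ?_)⟩
  · refine sum_congr rfl fun n _ => ?_
    congr 2
    rw [vonMangoldt.residueClass, Set.indicator_of_mem]
    exact Subsingleton.elim (n : ZMod 1) 0
  · positivity [vonMangoldt.residueClass_nonneg (q := 1) 0 n]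

/-- The partial sums of `Λ(p) / p` over powers of primes congruent to `1` modulo `4`. -/
lemma exists_abs_sum_log_div_sub_le : ∃ B : ℝ, ∀ x : ℝ, 1 ≤ x →
    |∑ p ∈ Ioc 0 ⌊x⌋₊ with p.Prime ∧ p % 4 = 1, Real.log p / p - Real.log x / 2| ≤ B := by
  obtain ⟨B1, h1⟩ := exists_abs_sum_vK_div_sub_log_le
  obtain ⟨B2, h2⟩ := exists_sum_not_prime_le
  refine ⟨(B1 + 2 * B2 + 2) / 2, fun x hx => ?_⟩
  have hN : 0 < ⌊x⌋₊ := Nat.floor_pos.mpr hx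
  set N := ⌊x⌋₊ with hNdef
  have hN0 : (1 : ℝ) ≤ N := by exact_mod_cast hN
  have h1' := h1 N hN
  have h2' := h2 N
  have h3 : |Real.log x - Real.log N| ≤ 1 := by
    have hle : (N : ℝ) ≤ x := Nat.floor_le (by linarith)
    have hlt : x < N + 1 := Nat.lt_floor_add_one x
    have := Real.log_le_log (by linarith) hle
    rw [abs_of_nonneg (by linarith), ← Real.log_div (by linarith) (by linarith)]
    have h4 : x / N ≤ 2 := by rw [div_le_iff₀ (by linarith)]; linarith
    have h5 := Real.log_le_sub_one_of_pos (show 0 < x / N by positivity)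
    linarith
  -- The weight 1 + χ₄ is 2 at p ≡ 1, 0 at p ≡ 3 and 1 at p = 2. So doubling the sum over p ≡ 1
  -- misses only proper prime powers and the single term log 2/2.
  have h4 : |∑ n ∈ Ioc 0 N, (Λ + (cm chi).pmul Λ) n / n
      - 2 * ∑ p ∈ Ioc 0 N with p.Prime ∧ p % 4 = 1, Real.log p / p| ≤ 2 * B2 + 1 := by
    rw [sum_filter, Finset.mul_sum, ← sum_sub_distrib]
    have hlog2 : ∑ n ∈ Ioc 0 N, (if n = 2 then (1 : ℝ) else 0) ≤ 1 := by
      rw [sum_ite_eq']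
      split_ifs <;> norm_num
    refine (abs_sum_le_sum_abs _ _).trans ?_
    calc _ ≤ ∑ n ∈ Ioc 0 N, (2 * ((if n.Prime then 0 else Λ n) / n)
          + (if n = 2 then (1 : ℝ) else 0)) := by
          refine sum_le_sum fun n hn => ?_
          have hn0 : (0 : ℝ) < n := by exact_mod_cast (mem_Ioc.mp hn).1
          by_cases hp : n.Prime
          · have hΛ : Λ n = Real.log n := vonMangoldt_apply_prime hp
            simp only [ArithmeticFunction.add_apply, pmul_apply, cm_apply, hp, true_and, if_true, zero_div, mul_zero,
              zero_add, hΛ, chi_eq]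
            rcases hp.eq_two_or_odd with rfl | hodd
            · have := Real.log_two_lt_d9
              have := Real.log_pos one_lt_two
              norm_num
              rw [abs_of_pos (by positivity)]
              linarith
            · have h2 : n ≠ 2 := by omega
              have : n % 4 = 1 ∨ n % 4 = 3 := by omega
              rcases this with h | h <;> simp [h, h2] <;> ring_nf
          · have h5 := abs_vK_le n
            have h6 : 0 ≤ if n = 2 then (1 : ℝ) else 0 := by split_ifs <;> norm_num
            simp only [hp, false_and, if_false, mul_zero, sub_zero]
            rw [abs_div, abs_of_pos hn0, ← mul_div_assoc]
            have := div_le_div_of_nonneg_right h5 hn0.le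
            linarith
      _ ≤ _ := by
          rw [sum_add_distrib, ← Finset.mul_sum]
          linarith
  have e : ∑ p ∈ Ioc 0 N with p.Prime ∧ p % 4 = 1, Real.log p / p - Real.log x / 2
      = ((∑ n ∈ Ioc 0 N, (Λ + (cm chi).pmul Λ) n / n - Real.log N)
        - (∑ n ∈ Ioc 0 N, (Λ + (cm chi).pmul Λ) n / n
          - 2 * ∑ p ∈ Ioc 0 N with p.Prime ∧ p % 4 = 1, Real.log p / p)
        - (Real.log x - Real.log N)) / 2 := by ring
  rw [e, abs_div, abs_two]
  gcongr
  have := abs_sub (∑ n ∈ Ioc 0 N, (Λ + (cm chi).pmul Λ) n / n - Real.log N)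
    (∑ n ∈ Ioc 0 N, (Λ + (cm chi).pmul Λ) n / n
          - 2 * ∑ p ∈ Ioc 0 N with p.Prime ∧ p % 4 = 1, Real.log p / p)
  have := abs_sub (∑ n ∈ Ioc 0 N, (Λ + (cm chi).pmul Λ) n / n - Real.log N
    - (∑ n ∈ Ioc 0 N, (Λ + (cm chi).pmul Λ) n / n
          - 2 * ∑ p ∈ Ioc 0 N with p.Prime ∧ p % 4 = 1, Real.log p / p))
    (Real.log x - Real.log N)
  linarith

end SumTwoSquaresSieve
end

/-! ### A Tauberian lemma with bounded error -/

section
namespace SumTwoSquaresSieve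
open Finset Filter Topology

lemma ev_log_exp (c : ArithmeticFunction ℝ) (t : ℝ) {M : ℕ} (hM : ⌊Real.exp t⌋₊ ≤ M) :
    ev c Real.log (Real.exp t) = ∑ n ∈ Ioc 0 M, c n * max 0 (t - Real.log n) := by
  rw [ev]
  have hsub : Ioc 0 ⌊Real.exp t⌋₊ ⊆ Ioc 0 M := Ioc_subset_Ioc_right hM
  rw [← sum_subset hsub]
  · refine sum_congr rfl fun n hn => ?_
    have hn := mem_Ioc.mp hn
    have hn0 : (0 : ℝ) < n := by exact_mod_cast hn.1
    have hne : (n : ℝ) ≤ Real.exp t := (Nat.le_floor_iff (Real.exp_pos t).le).mp hn.2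
    rw [Real.log_div (Real.exp_ne_zero t) hn0.ne', Real.log_exp, max_eq_right]
    rw [sub_nonneg, Real.log_le_iff_le_exp hn0]
    exact hne
  · intro n hn hn'
    have hn0 := (mem_Ioc.mp hn).1
    have : ⌊Real.exp t⌋₊ < n := by simpa [hn0] using hn'
    have h1 : Real.exp t < n := (Nat.floor_lt (Real.exp_pos t).le).mp this
    have h2 : t ≤ Real.log n := ((Real.lt_log_iff_exp_lt (by exact_mod_cast hn0)).mpr h1).le
    rw [max_eq_left (by linarith), mul_zero]

lemma continuous_ev_log_exp (c : ArithmeticFunction ℝ) :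
    Continuous fun t => ev c Real.log (Real.exp t) := by
  rw [continuous_iff_continuousAt]
  intro u
  have h : (fun t => ∑ n ∈ Ioc 0 ⌊Real.exp (u + 1)⌋₊, c n * max 0 (t - Real.log n)) =ᶠ[𝓝 u]
      fun t => ev c Real.log (Real.exp t) := by
    filter_upwards [eventually_lt_nhds (show u < u + 1 by linarith)] with t ht
    exact (ev_log_exp c t (Nat.floor_mono (Real.exp_le_exp.mpr ht.le))).symm
  exact ContinuousAt.congr (Continuous.continuousAt (by fun_prop)) h

/-- Until e^t reaches the next integer, the sum is affine in t. Only the right derivative exists in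
general, since new terms start at t = log n. -/
lemma hasDerivWithinAt_ev_log_exp (c : ArithmeticFunction ℝ) (u : ℝ) :
    HasDerivWithinAt (fun t => ev c Real.log (Real.exp t)) (∑ n ∈ Ioc 0 ⌊Real.exp u⌋₊, c n)
      (Set.Ici u) u := by
  have hlin : HasDerivWithinAt
      (fun t => ∑ n ∈ Ioc 0 ⌊Real.exp u⌋₊, c n * (t - Real.log n))
      (∑ n ∈ Ioc 0 ⌊Real.exp u⌋₊, c n * 1) (Set.Ici u) u :=
    HasDerivWithinAt.fun_sum fun n _ =>
      (((hasDerivWithinAt_id u _).sub_const (Real.log n)).const_mul (c n))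
  simp only [mul_one] at hlin
  have key : ∀ t, u ≤ t → Real.exp t < ⌊Real.exp u⌋₊ + 1 → ev c Real.log (Real.exp t)
      = ∑ n ∈ Ioc 0 ⌊Real.exp u⌋₊, c n * (t - Real.log n) := by
    intro t ht1 ht2
    have hfl : ⌊Real.exp t⌋₊ = ⌊Real.exp u⌋₊ := by
      rw [Nat.floor_eq_iff (Real.exp_pos t).le]
      exact ⟨(Nat.floor_le (Real.exp_pos u).le).trans (Real.exp_le_exp.mpr ht1), ht2⟩
    rw [ev, hfl]
    refine sum_congr rfl fun n hn => ?_
    have : (0 : ℝ) < n := by exact_mod_cast (mem_Ioc.mp hn).1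
    rw [Real.log_div (Real.exp_ne_zero t) this.ne', Real.log_exp]
  refine hlin.congr_of_eventuallyEq ?_ (key u le_rfl (Nat.lt_floor_add_one _))
  have h1 : ∀ᶠ t in 𝓝[≥] u, Real.exp t < ⌊Real.exp u⌋₊ + 1 :=
    (Real.continuous_exp.continuousAt.eventually_lt continuousAt_const
      (Nat.lt_floor_add_one _)).filter_mono nhdsWithin_le_nhds
  filter_upwards [h1, self_mem_nhdsWithin] with t ht1 ht2
  exact key t ht2 ht1

/-- A Tauberian lemma: if `u D(u) = (3/2) ∫₀ᵘ D + O(D(u))` with `D` increasing, then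
`D(u) = c √u + O(1)`. -/
lemma exists_abs_sub_sqrt_le {J D : ℝ → ℝ} {B : ℝ} (hJ : Continuous J)
    (hder : ∀ u, HasDerivWithinAt J (D u) (Set.Ici u) u) (hD : Monotone D) (hD0 : ∀ u, 0 ≤ D u)
    (hJ0 : ∀ u, 0 ≤ J u) (hB : 1 ≤ B) (h : ∀ u, 0 ≤ u → |u * D u - 3 / 2 * J u| ≤ B * D u) :
    ∃ c B' : ℝ, ∀ u, 0 ≤ u → |D u - c * √u| ≤ B' := by
  set u₀ := 2 * B with hu₀
  -- an upper bound of the right order of magnitude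
  set E := J u₀ * (u₀ - B) ^ (-(3 / 2) : ℝ) with hE
  have hE0 : 0 ≤ E := mul_nonneg (hJ0 _) (Real.rpow_nonneg (by linarith) _)
  -- The right derivative of J(u)(u−B)^{-3/2} is (u−B)^{-5/2}((u−B)D − (3/2)J), nonpositive by
  -- hypothesis; so the quotient never exceeds its value at 2B.
  have hJle : ∀ u, u₀ ≤ u → J u * (u - B) ^ (-(3 / 2) : ℝ) ≤ E := by
    intro u hu
    have hd : ∀ x ∈ Set.Ico u₀ u, HasDerivWithinAt (fun x => J x * (x - B) ^ (-(3 / 2) : ℝ))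
        (D x * (x - B) ^ (-(3 / 2) : ℝ) + J x * (1 * (-(3 / 2)) * (x - B) ^ (-(3 / 2) - 1 : ℝ)))
        (Set.Ici x) x := by
      intro x hx
      have hx0 : x - B ≠ 0 := by have := hx.1; intro h0; linarith
      exact (hder x).mul
        (((hasDerivAt_id x).sub_const B).rpow_const (Or.inl hx0)).hasDerivWithinAt
    refine image_le_of_deriv_right_le_deriv_boundary (B := fun _ => E) (B' := fun _ => 0)
      (ContinuousOn.mul hJ.continuousOn ?_) hd le_rfl continuousOn_const
      (fun x _ => hasDerivWithinAt_const x _ _) ?_ (Set.right_mem_Icc.mpr hu)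
    · refine ContinuousOn.rpow_const (by fun_prop) fun x hx => Or.inl ?_
      have := hx.1; intro h0; linarith
    · intro x hx
      have hx1 : 0 < x - B := by have := hx.1; linarith
      have e : (x - B) ^ (-(3 / 2) : ℝ) = (x - B) ^ (-(3 / 2) - 1 : ℝ) * (x - B) := by
        rw [← Real.rpow_add_one hx1.ne']; congr 1; ring
      have h1 := (abs_le.mp (h x (by have := hx.1; linarith))).2
      rw [e]
      have h2 : 0 < (x - B) ^ (-(3 / 2) - 1 : ℝ) := by positivity
      have e2 : D x * ((x - B) ^ (-(3 / 2) - 1 : ℝ) * (x - B))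
          + J x * (1 * (-(3 / 2)) * (x - B) ^ (-(3 / 2) - 1 : ℝ))
          = (x - B) ^ (-(3 / 2) - 1 : ℝ) * ((x * D x - 3 / 2 * J x) - B * D x) := by ring
      rw [e2]
      exact mul_nonpos_of_nonneg_of_nonpos h2.le (by linarith)
  have hDle : ∀ u, u₀ ≤ u → D u ≤ 3 / 2 * E * √u := by
    intro u hu
    have hx1 : 0 < u - B := by linarith
    have h1 := (abs_le.mp (h u (by linarith))).2
    have h2 := hJle u hu
    rw [Real.rpow_neg hx1.le, ← div_eq_mul_inv, div_le_iff₀ (by positivity)] at h2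
    have e : (u - B) ^ (3 / 2 : ℝ) = (u - B) * √(u - B) := by
      rw [Real.sqrt_eq_rpow, ← Real.rpow_one_add' hx1.le (by norm_num)]; norm_num
    rw [e] at h2
    have h3 : √(u - B) ≤ √u := Real.sqrt_le_sqrt (by linarith)
    have h4 : (u - B) * D u ≤ (u - B) * (3 / 2 * E * √(u - B)) := by linarith
    have h5 := le_of_mul_le_mul_left h4 hx1
    refine h5.trans ?_
    gcongr
  set K := 3 / 2 * B * E with hK
  have hK0 : 0 ≤ K := by positivity
  -- The derivative of J·u^{-3/2} is u^{-5/2}(uD − (3/2)J), of size u^{-5/2}·B·D = O(u⁻²) once D =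
  -- O(√u) is known.
  have hvar : ∀ a b, u₀ ≤ a → a ≤ b →
      |J b * b ^ (-(3 / 2) : ℝ) - J a * a ^ (-(3 / 2) : ℝ)| ≤ K * (a⁻¹ - b⁻¹) := by
    intro a b ha hab
    have ha0 : 0 < a := by linarith
    have hd : ∀ x ∈ Set.Ico a b, HasDerivWithinAt
        (fun x => J x * x ^ (-(3 / 2) : ℝ) - J a * a ^ (-(3 / 2) : ℝ))
        (D x * x ^ (-(3 / 2) : ℝ) + J x * (-(3 / 2) * x ^ (-(3 / 2) - 1 : ℝ)))
        (Set.Ici x) x := by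
      intro x hx
      have hx0 : x ≠ 0 := by have := hx.1; intro h0; linarith
      exact ((hder x).mul (Real.hasDerivAt_rpow_const (Or.inl hx0)).hasDerivWithinAt).sub_const _
    refine image_norm_le_of_norm_deriv_right_le_deriv_boundary'
      (B := fun x => K * (a⁻¹ - x⁻¹)) (B' := fun x => K * (x ^ 2)⁻¹)
      (f' := fun x => D x * x ^ (-(3 / 2) : ℝ) + J x * (-(3 / 2) * x ^ (-(3 / 2) - 1 : ℝ)))
      (ContinuousOn.sub (ContinuousOn.mul hJ.continuousOn ?_) continuousOn_const) hd (by simp)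
      ?_ (fun x hx => ?_) ?_ (Set.right_mem_Icc.mpr hab)
    · refine ContinuousOn.rpow_const (by fun_prop) fun x hx => Or.inl ?_
      have := hx.1; intro h0; linarith
    · refine ContinuousOn.mul continuousOn_const (continuousOn_const.sub
        (continuousOn_inv₀.mono fun x hx h0 => ?_))
      have := hx.1
      rw [Set.mem_singleton_iff] at h0
      linarith
    · have hx0 : x ≠ 0 := by have := hx.1; intro h0; linarith
      have := (((hasDerivAt_inv hx0).const_sub a⁻¹).const_mul K).hasDerivWithinAt (s := Set.Ici x)
      simpa using this
    · intro x hx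
      have hx1 : 0 < x := by have := hx.1; linarith
      have hxu : u₀ ≤ x := ha.trans hx.1
      have e : x ^ (-(3 / 2) : ℝ) = x ^ (-(3 / 2) - 1 : ℝ) * x := by
        rw [← Real.rpow_add_one hx1.ne']; congr 1; ring
      have h2 : 0 < x ^ (-(3 / 2) - 1 : ℝ) := by positivity
      have e2 : D x * x ^ (-(3 / 2) : ℝ) + J x * (-(3 / 2) * x ^ (-(3 / 2) - 1 : ℝ))
          = x ^ (-(3 / 2) - 1 : ℝ) * (x * D x - 3 / 2 * J x) := by rw [e]; ring
      rw [e2, Real.norm_eq_abs, abs_mul, abs_of_pos h2]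
      calc _ ≤ x ^ (-(3 / 2) - 1 : ℝ) * (B * (3 / 2 * E * √x)) := by
            gcongr
            exact (h x hx1.le).trans (by gcongr; exact hDle x hxu)
        _ = K * (x ^ (-(3 / 2) - 1 : ℝ) * √x) := by ring
        _ = K * (x ^ 2)⁻¹ := by
            rw [Real.sqrt_eq_rpow, ← Real.rpow_add hx1, ← Real.rpow_natCast, ← Real.rpow_neg hx1.le]
            norm_num
  have hinv : Tendsto (fun n : ℕ => K * (u₀ + n)⁻¹) atTop (𝓝 0) := by
    have : Tendsto (fun n : ℕ => u₀ + n) atTop atTop :=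
      tendsto_atTop_add_const_left _ _ tendsto_natCast_atTop_atTop
    simpa using this.inv_tendsto_atTop.const_mul K
  -- The quotient J·u^{-3/2} is thus Cauchy with rate 1/u. Feeding its limit j back into the
  -- hypothesis gives D(u) = (3/2)j√u + O(1).
  obtain ⟨j, hj⟩ : ∃ j, Tendsto (fun n : ℕ => J (u₀ + n) * (u₀ + n) ^ (-(3 / 2) : ℝ))
      atTop (𝓝 j) := by
    apply cauchySeq_tendsto_of_complete
    refine cauchySeq_of_le_tendsto_0' (fun n : ℕ => K * (u₀ + n)⁻¹) (fun n m hnm => ?_) hinv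
    have hnm' : (n : ℝ) ≤ m := by exact_mod_cast hnm
    have hn0 : (0 : ℝ) ≤ n := Nat.cast_nonneg n
    rw [dist_comm, Real.dist_eq]
    refine (hvar _ _ (by linarith) (by linarith)).trans ?_
    have : 0 ≤ (u₀ + m : ℝ)⁻¹ := by positivity
    gcongr
    linarith
  have hlim : ∀ u, u₀ ≤ u → |j - J u * u ^ (-(3 / 2) : ℝ)| ≤ K * u⁻¹ := by
    intro u hu
    have hu0 : 0 < u := by linarith
    refine le_of_tendsto (hj.sub_const _).abs ?_
    obtain ⟨n₀, hn₀⟩ := exists_nat_ge (u - u₀)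
    filter_upwards [eventually_ge_atTop n₀] with n hn
    have hn' : (n₀ : ℝ) ≤ n := by exact_mod_cast hn
    refine (hvar u _ hu (by linarith)).trans ?_
    have : 0 ≤ (u₀ + n : ℝ)⁻¹ := by positivity
    gcongr
    linarith
  refine ⟨3 / 2 * j, max (3 * K) (D u₀ + |3 / 2 * j| * √u₀), fun u hu => ?_⟩
  rcases le_total u₀ u with h1 | h1
  · refine le_max_of_le_left ?_
    have hu1 : 1 ≤ u := by linarith
    have hu0 : 0 < u := by linarith
    have hs : √u * √u = u := Real.mul_self_sqrt hu0.le
    have hs1 : 1 ≤ √u := Real.one_le_sqrt.mpr hu1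
    have h2 := hlim u h1
    have e : u ^ (-(3 / 2) : ℝ) = (u * √u)⁻¹ := by
      rw [Real.sqrt_eq_rpow, ← Real.rpow_one_add' hu0.le (by norm_num), ← Real.rpow_neg hu0.le]
      norm_num
    have h3 : |j * (u * √u) - J u| ≤ K * √u := by
      have e2 : j * (u * √u) - J u = (j - J u * u ^ (-(3 / 2) : ℝ)) * (u * √u) := by
        rw [e]; field_simp
      rw [e2, abs_mul, abs_of_pos (show 0 < u * √u by positivity)]
      calc _ ≤ K * u⁻¹ * (u * √u) := by gcongr
        _ = _ := by field_simp
    have h4 : |u * D u - 3 / 2 * J u| ≤ K * √u :=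
      (h u hu).trans (by rw [hK]; nlinarith [hDle u h1])
    have h5 : |u * (D u - 3 / 2 * j * √u)| ≤ 3 * K * √u := by
      have e3 : u * (D u - 3 / 2 * j * √u)
          = (u * D u - 3 / 2 * J u) - 3 / 2 * (j * (u * √u) - J u) := by ring
      rw [e3, abs_le]
      have := abs_le.mp h3
      have := abs_le.mp h4
      have : 0 ≤ K * √u := by positivity
      constructor <;> linarith
    rw [abs_mul, abs_of_pos hu0] at h5
    have h6 : u * |D u - 3 / 2 * j * √u| ≤ u * (3 * K) := by
      refine h5.trans ?_
      have : √u ≤ u := by nlinarith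
      nlinarith
    exact le_of_mul_le_mul_left h6 hu0
  · refine le_max_of_le_right ((abs_sub _ _).trans (add_le_add ?_ ?_))
    · rw [abs_of_nonneg (hD0 u)]
      exact hD h1
    · rw [abs_mul, abs_of_nonneg (Real.sqrt_nonneg u)]
      gcongr

end SumTwoSquaresSieve
end

/-! ### Integers composed of primes congruent to 1 modulo 4 -/

section
namespace SumTwoSquaresSieve
open Finset ArithmeticFunction Filter Topology
open scoped ArithmeticFunction.zeta ArithmeticFunction.Moebius

/-- The indicator function of the positive integers all of whose prime factors satisfy `P`. -/
noncomputable def ind (P : ℕ → Prop) [DecidablePred P] : ℕ →*₀ ℝ where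
  toFun n := if n ≠ 0 ∧ ∀ p ∈ n.primeFactors, P p then 1 else 0
  map_zero' := by simp
  map_one' := by simp
  map_mul' a b := by
    rcases eq_or_ne a 0 with rfl | ha
    · simp
    rcases eq_or_ne b 0 with rfl | hb
    · simp
    have hab : a * b ≠ 0 := mul_ne_zero ha hb
    have key : (a * b ≠ 0 ∧ ∀ p ∈ (a * b).primeFactors, P p) ↔
        (b ≠ 0 ∧ ∀ p ∈ b.primeFactors, P p) ∧ (a ≠ 0 ∧ ∀ p ∈ a.primeFactors, P p) := by
      rw [Nat.primeFactors_mul ha hb, forall_mem_union]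
      tauto
    rw [if_congr key rfl rfl, ite_and, mul_ite, mul_one, mul_zero]

lemma ind_apply (P : ℕ → Prop) [DecidablePred P] (n : ℕ) :
    ind P n = if n ≠ 0 ∧ ∀ p ∈ n.primeFactors, P p then 1 else 0 := rfl

lemma ind_nonneg (P : ℕ → Prop) [DecidablePred P] (n : ℕ) : 0 ≤ ind P n := by
  rw [ind_apply]; split_ifs <;> norm_num

lemma ind_le_one (P : ℕ → Prop) [DecidablePred P] (n : ℕ) : ind P n ≤ 1 := by
  rw [ind_apply]; split_ifs <;> norm_num

lemma ind_prime (P : ℕ → Prop) [DecidablePred P] {p : ℕ} (hp : p.Prime) :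
    ind P p = if P p then 1 else 0 := by
  rw [ind_apply, hp.primeFactors]
  simp [hp.ne_zero]

/-- The condition `p ≡ 1 (mod 4)`, `p > z`. -/
abbrev Pz (z : ℕ) : ℕ → Prop := fun p => p % 4 = 1 ∧ z < p

/-- `1 / n` on the integers `n` composed of primes `p ≡ 1 (mod 4)`, `p > z`. -/
noncomputable def ss (z : ℕ) : ArithmeticFunction ℝ := til (cm (ind (Pz z)))

/-- The Dirichlet inverse of `ss z`. -/
noncomputable def ff (z : ℕ) : ArithmeticFunction ℝ := til (cmInv (ind (Pz z)))

lemma ss_mul_ff (z : ℕ) : ss z * ff z = 1 := by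
  rw [ss, ff, ← til_mul, cm_mul_cmInv, til_one]

lemma ss_apply (z n : ℕ) : ss z n = ind (Pz z) n / n := rfl

lemma ff_apply (z n : ℕ) : ff z n = mu n * ind (Pz z) n / n := rfl

lemma ss_nonneg (z n : ℕ) : 0 ≤ ss z n := div_nonneg (ind_nonneg _ _) (Nat.cast_nonneg _)

/-- The summatory function of `ss z`. -/
noncomputable def dd (z : ℕ) (x : ℝ) : ℝ := ∑ n ∈ Ioc 0 ⌊x⌋₊, ss z n

lemma dd_nonneg (z : ℕ) (x : ℝ) : 0 ≤ dd z x := sum_nonneg fun n _ => ss_nonneg z n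

lemma monotone_dd (z : ℕ) : Monotone (dd z) := fun _ _ h =>
  sum_le_sum_of_subset_of_nonneg (Ioc_subset_Ioc_right (Nat.floor_mono h))
    fun n _ _ => ss_nonneg z n

lemma exists_abs_sum_ind_vonMangoldt_le : ∃ B : ℝ, 1 ≤ B ∧ ∀ x : ℝ, 1 ≤ x →
    |∑ n ∈ Ioc 0 ⌊x⌋₊, til ((cm (ind (Pz 0))).pmul Λ) n - Real.log x / 2| ≤ B := by
  obtain ⟨B1, h1⟩ := exists_abs_sum_log_div_sub_le
  obtain ⟨B2, h2⟩ := exists_sum_not_prime_le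
  refine ⟨max 1 (B1 + B2), le_max_left _ _, fun x hx => le_max_of_le_right ?_⟩
  have h3 := h1 x hx
  have h4 : |∑ n ∈ Ioc 0 ⌊x⌋₊, til ((cm (ind (Pz 0))).pmul Λ) n
      - ∑ p ∈ Ioc 0 ⌊x⌋₊ with p.Prime ∧ p % 4 = 1, Real.log p / p| ≤ B2 := by
    rw [sum_filter, ← sum_sub_distrib]
    refine (abs_sum_le_sum_abs _ _).trans ((sum_le_sum fun n hn => ?_).trans (h2 ⌊x⌋₊))
    have hn0 : (0 : ℝ) < n := by exact_mod_cast (mem_Ioc.mp hn).1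
    rw [til_apply, pmul_apply, cm_apply]
    by_cases hp : n.Prime
    · rw [ind_prime _ hp, vonMangoldt_apply_prime hp]
      by_cases h : n % 4 = 1 <;> simp [Pz, hp, h, hp.pos]
    · have h0 : 0 ≤ Λ n := vonMangoldt_nonneg
      simp only [hp, false_and, if_false, sub_zero]
      rw [abs_div, abs_of_pos hn0, abs_mul, abs_of_nonneg (ind_nonneg _ _), abs_of_nonneg h0]
      gcongr
      exact mul_le_of_le_one_left h0 (ind_le_one _ _)
  have := abs_sub_le _ _ _ |>.trans (add_le_add h4 h3)
  linarith

lemma ss_pmul_log (z : ℕ) : (ss z).pmul log = ss z * til ((cm (ind (Pz z))).pmul Λ) := by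
  rw [ss, ← til_mul, mul_comm, ← pmul_cm_log]
  ext n
  simp only [pmul_apply, til_apply]
  ring

/-- The sum of `1 / n` over the `n ≤ x` composed of primes `≡ 1 (mod 4)` is `c √(log x) + O(1)`. -/
lemma exists_abs_dd_sub_sqrt_le : ∃ c B : ℝ, ∀ u : ℝ, 0 ≤ u →
    |dd 0 (Real.exp u) - c * √u| ≤ B := by
  obtain ⟨B, hB1, hB⟩ := exists_abs_sum_ind_vonMangoldt_le
  refine exists_abs_sub_sqrt_le (J := fun u => ev (ss 0) Real.log (Real.exp u)) (B := B)
    (continuous_ev_log_exp _) (hasDerivWithinAt_ev_log_exp _)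
    (fun u v h => monotone_dd 0 (Real.exp_le_exp.mpr h)) (fun u => dd_nonneg 0 _) (fun u => ?_)
    hB1 fun u hu => ?_
  · rw [ev_log_exp _ u le_rfl]
    exact sum_nonneg fun n _ => mul_nonneg (ss_nonneg 0 n) (le_max_left _ _)
  · set x := Real.exp u with hx
    have hx0 : 0 < x := Real.exp_pos u
    -- The Tauberian hypothesis: uD − J is the sum of ss(n) log n, which equals Σ ss(m) times a
    -- Mertens sum up to x/m. The latter is ½ log(x/m) + O(1), so uD − J = ½J + O(D).
    have h1 : u * dd 0 x - ev (ss 0) Real.log x = ∑ n ∈ Ioc 0 ⌊x⌋₊, ss 0 n * Real.log n := by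
      rw [dd, Finset.mul_sum, ev, ← sum_sub_distrib]
      refine sum_congr rfl fun n hn => ?_
      have : (0 : ℝ) < n := by exact_mod_cast (mem_Ioc.mp hn).1
      rw [Real.log_div hx0.ne' this.ne', hx, Real.log_exp]
      ring
    have h2 : ∑ n ∈ Ioc 0 ⌊x⌋₊, ss 0 n * Real.log n
        = ∑ m ∈ Ioc 0 ⌊x⌋₊, ss 0 m * ∑ n ∈ Ioc 0 ⌊x / m⌋₊, til ((cm (ind (Pz 0))).pmul Λ) n := by
      have := ev_mul (ss 0) (til ((cm (ind (Pz 0))).pmul Λ)) (fun _ => 1) x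
      rw [← ss_pmul_log] at this
      simpa only [ev, mul_one, pmul_apply, log_apply] using this
    have e : u * dd 0 x - 3 / 2 * ev (ss 0) Real.log x
        = ∑ m ∈ Ioc 0 ⌊x⌋₊, ss 0 m * (∑ n ∈ Ioc 0 ⌊x / m⌋₊, til ((cm (ind (Pz 0))).pmul Λ) n
          - Real.log (x / m) / 2) := by
      have h3 : ev (ss 0) Real.log x / 2
          = ∑ m ∈ Ioc 0 ⌊x⌋₊, ss 0 m * (Real.log (x / m) / 2) := by
        rw [ev, Finset.sum_div]
        exact sum_congr rfl fun n _ => by ring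
      simp only [mul_sub]
      rw [sum_sub_distrib, ← h2, ← h1, ← h3]
      ring
    rw [e, dd, Finset.mul_sum]
    refine (abs_sum_le_sum_abs _ _).trans (sum_le_sum fun m hm => ?_)
    have hm' := mem_Ioc.mp hm
    have hm0 : (0 : ℝ) < m := by exact_mod_cast hm'.1
    rw [abs_mul, abs_of_nonneg (ss_nonneg 0 m), mul_comm B]
    refine mul_le_mul_of_nonneg_left (hB _ ?_) (ss_nonneg 0 m)
    rw [one_le_div hm0]
    exact (Nat.le_floor_iff hx0.le).mp hm'.2

end SumTwoSquaresSieve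
end

/-! ### Euler products and the Landau constant -/

section
namespace SumTwoSquaresSieve
open Finset ArithmeticFunction Filter Topology

/-- The completely multiplicative function `n ↦ n ^ (-s)`, vanishing at `0`. -/
noncomputable def pw (s : ℝ) : ℕ →*₀ ℝ where
  toFun n := if n = 0 then 0 else (n : ℝ) ^ (-s)
  map_zero' := by simp
  map_one' := by simp
  map_mul' a b := by
    rcases eq_or_ne a 0 with rfl | ha
    · simp
    rcases eq_or_ne b 0 with rfl | hb
    · simp
    rw [if_neg (mul_ne_zero ha hb), if_neg ha, if_neg hb, Nat.cast_mul,
      Real.mul_rpow (Nat.cast_nonneg a) (Nat.cast_nonneg b)]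

lemma pw_apply (s : ℝ) {n : ℕ} (hn : n ≠ 0) : pw s n = (n : ℝ) ^ (-s) := if_neg hn

lemma pw_nonneg (s : ℝ) (n : ℕ) : 0 ≤ pw s n := by
  rcases eq_or_ne n 0 with rfl | hn
  · simp
  · rw [pw_apply s hn]; positivity

lemma pw_two_mul (s : ℝ) (n : ℕ) : pw (2 * s) n = pw s n ^ 2 := by
  rcases eq_or_ne n 0 with rfl | hn
  · simp
  · rw [pw_apply _ hn, pw_apply _ hn, ← Real.rpow_natCast, ← Real.rpow_mul (Nat.cast_nonneg n)]
    congr 1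
    push_cast
    ring

lemma pw_lt_one {s : ℝ} (hs : 0 < s) {n : ℕ} (hn : 2 ≤ n) : pw s n < 1 := by
  rw [pw_apply _ (by omega)]
  exact Real.rpow_lt_one_of_one_lt_of_neg (by exact_mod_cast (show 1 < n by omega)) (by linarith)

lemma summable_pw {s : ℝ} (hs : 1 < s) : Summable (pw s) := by
  refine (Real.summable_nat_rpow_inv.mpr hs).congr fun n => ?_
  rcases eq_or_ne n 0 with rfl | hn
  · rw [Nat.cast_zero, Real.zero_rpow (by linarith), inv_zero, _root_.map_zero]
  · rw [pw_apply _ hn, Real.rpow_neg (Nat.cast_nonneg n)]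

/-- The Dirichlet series of `ind P`. -/
noncomputable def gs (P : ℕ → Prop) [DecidablePred P] (s : ℝ) : ℝ := ∑' n, ind P n * pw s n

lemma summable_ind_mul_pw (P : ℕ → Prop) [DecidablePred P] {s : ℝ} (hs : 1 < s) :
    Summable fun n => ind P n * pw s n :=
  (summable_pw hs).of_nonneg_of_le (fun _ => mul_nonneg (ind_nonneg _ _) (pw_nonneg _ _))
    fun _ => mul_le_of_le_one_left (pw_nonneg _ _) (ind_le_one _ _)

lemma hasProd_congr_fun {β : Type*} {f g : β → ℝ} {a : ℝ} (h : ∀ b, f b = g b) :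
    HasProd f a ↔ HasProd g a := by
  rw [funext h]

lemma mul_pw_apply (g : ℕ →*₀ ℝ) (s : ℝ) (n : ℕ) : (g * pw s) n = g n * pw s n := rfl

lemma hasProd_gs (P : ℕ → Prop) [DecidablePred P] {s : ℝ} (hs : 1 < s) :
    HasProd (fun p : Nat.Primes => (1 - (if P p then pw s p else 0))⁻¹) (gs P s) := by
  have h := EulerProduct.eulerProduct_completely_multiplicative_hasProd (f := ind P * pw s)
    (summable_ind_mul_pw P hs).norm
  refine (hasProd_congr_fun fun p => ?_).mp h
  rw [mul_pw_apply, ind_prime P p.2]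
  split_ifs <;> simp

lemma hasProd_chi {s : ℝ} (hs : 1 < s) :
    HasProd (fun p : Nat.Primes => (1 - chi p * pw s p)⁻¹) (∑' n, chi n * pw s n) := by
  refine EulerProduct.eulerProduct_completely_multiplicative_hasProd (f := chi * pw s) ?_
  refine (summable_pw hs).of_nonneg_of_le (fun _ => norm_nonneg _) fun n => ?_
  rw [mul_pw_apply, norm_mul, Real.norm_of_nonneg (pw_nonneg s n)]
  exact mul_le_of_le_one_left (pw_nonneg s n) (abs_chi_le n)

lemma gs_eq_two {s : ℝ} (hs : 1 < s) : gs (· = 2) s = (1 - pw s 2)⁻¹ := by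
  refine (hasProd_gs (· = 2) hs).unique ?_
  have := hasProd_single (f := fun p : Nat.Primes =>
    (1 - (if (p : ℕ) = 2 then pw s p else 0))⁻¹) ⟨2, Nat.prime_two⟩ (fun p hp => by
      rw [if_neg fun h => hp (Subtype.ext h)]; simp)
  simpa using this

/-- The factorization of the Dedekind zeta function of the Gaussian field. -/
lemma gs_factorization {s : ℝ} (hs : 1 < s) :
    gs (fun _ => True) s * ∑' n, chi n * pw s n
      = (1 - pw s 2)⁻¹ * (gs (Pz 0) s ^ 2 * gs (fun p => p % 4 = 3) (2 * s)) := by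
  refine ((hasProd_gs (fun _ => True) hs).mul (hasProd_chi hs)).unique ?_
  rw [← gs_eq_two hs, sq]
  refine (hasProd_congr_fun fun p => ?_).mp ((hasProd_gs (· = 2) hs).mul
    (((hasProd_gs (Pz 0) hs).mul (hasProd_gs (Pz 0) hs)).mul
    (hasProd_gs (fun p => p % 4 = 3) (show 1 < 2 * s by linarith))))
  have hlt := pw_lt_one (show 0 < s by linarith) p.2.two_le
  have h0 := pw_nonneg s p
  rw [pw_two_mul, chi_eq]
  rcases p.2.eq_two_or_odd with h | h
  · simp [Pz, h]
  · have h2 : (p : ℕ) ≠ 2 := by omega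
    have hpos := p.2.pos
    have : (p : ℕ) % 4 = 1 ∨ (p : ℕ) % 4 = 3 := by omega
    rcases this with h3 | h3
    · simp [Pz, h2, h3, hpos]
    · have e1 : (1 - pw s p ^ 2)⁻¹ = (1 - pw s p)⁻¹ * (1 - -pw s p)⁻¹ := by
        rw [← mul_inv]
        congr 1
        ring
      simp [Pz, h2, h3, e1]

lemma tendsto_mul_gs_true :
    Tendsto (fun σ : ℝ => σ * (gs (fun _ => True) (1 + σ) * ∑' n, chi n * pw (1 + σ) n))
      (𝓝[>] 0) (𝓝 (Real.pi / 4)) := by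
  have hc : Continuous fun σ : ℝ => (qq σ).re :=
    Complex.continuous_re.comp (differentiable_qq.continuous.comp Complex.continuous_ofReal)
  have h0 : Tendsto (fun σ : ℝ => (qq σ).re) (𝓝[>] 0) (𝓝 (Real.pi / 4)) := by
    have := (hc.tendsto 0).mono_left (nhdsWithin_le_nhds (s := Set.Ioi 0))
    simpa [qq_zero] using this
  refine h0.congr' ?_
  filter_upwards [self_mem_nhdsWithin] with σ hσ
  have hσ' : (0 : ℝ) < σ := hσ
  have hs : 1 < (1 + (σ : ℂ)).re := by simpa using hσ'
  have hpw : ∀ n : ℕ, ((pw (1 + σ) n : ℝ) : ℂ) = (n : ℂ) ^ (-(1 + (σ : ℂ))) := fun n => by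
    rcases eq_or_ne n 0 with rfl | hn
    · rw [_root_.map_zero, Nat.cast_zero, Complex.zero_cpow]
      · simp
      · intro h
        have := congrArg Complex.re h
        simp at this
        linarith
    · rw [pw_apply _ hn, Complex.ofReal_cpow (Nat.cast_nonneg n)]
      push_cast
      rfl
  have h1 : ((gs (fun _ => True) (1 + σ) : ℝ) : ℂ) = riemannZeta (1 + σ) := by
    rw [← tsum_riemannZetaSummand hs, gs, Complex.ofReal_tsum]
    refine tsum_congr fun n => ?_
    rcases eq_or_ne n 0 with rfl | hn
    · simp
    · rw [ind_apply, if_pos ⟨hn, by simp⟩, one_mul]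
      exact hpw n
  have h2 : ((∑' n, chi n * pw (1 + σ) n : ℝ) : ℂ)
      = DirichletCharacter.LFunction chiD (1 + σ) := by
    rw [DirichletCharacter.LFunction_eq_LSeries _ hs, ← tsum_dirichletSummand chiD hs,
      Complex.ofReal_tsum]
    refine tsum_congr fun n => ?_
    rw [Complex.ofReal_mul, hpw, ← chiD_natCast]
    rfl
  rw [qq_eq (by exact_mod_cast hσ'.ne'), ← h1, ← h2, ← Complex.ofReal_mul, ← Complex.ofReal_mul,
    Complex.ofReal_re]

/-- The infinite product defining `landauA` is meaningful only once its convergence is known. That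
follows by passing the continuous square root through the Euler product over p ≡ 3. -/
lemma landauA_pos_and_sq : 0 < landauA ∧ landauA ^ 2 = gs (fun p => p % 4 = 3) 2 / 2 := by
  have h := hasProd_gs (fun p => p % 4 = 3) (s := 2) (by norm_num)
  have hg1 : 1 ≤ gs (fun p => p % 4 = 3) 2 := by
    have := (summable_ind_mul_pw (fun p => p % 4 = 3) (s := 2) (by norm_num)).le_tsum 1
      fun n _ => mul_nonneg (ind_nonneg _ _) (pw_nonneg _ _)
    rwa [map_one, map_one, one_mul] at this
  set g := gs (fun p => p % 4 = 3) 2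
  have hg0 : 0 ≤ g := zero_le_one.trans hg1
  let i : {p : ℕ // p.Prime ∧ p % 4 = 3} → Nat.Primes := fun p => ⟨p, p.2.1⟩
  have hi : Function.Injective i := fun p q hpq => Subtype.ext
    (congrArg (fun x : Nat.Primes => (x : ℕ)) hpq)
  have h1 := (hi.hasProd_iff (fun x hx => by
    have : ¬ (x : ℕ) % 4 = 3 := fun h3 => hx ⟨⟨x, x.2, h3⟩, rfl⟩
    rw [if_neg this]; simp)).mpr h
  have hpos : ∀ p : {p : ℕ // p.Prime ∧ p % 4 = 3}, 0 < 1 - 1 / ((p : ℕ) : ℝ) ^ 2 := fun p => by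
    have h2 : (2 : ℝ) ≤ (p : ℕ) := by exact_mod_cast p.2.1.two_le
    rw [sub_pos, div_lt_one (by positivity)]
    nlinarith
  have h2 : HasProd (fun p : {p : ℕ // p.Prime ∧ p % 4 = 3} => (1 - 1 / ((p : ℕ) : ℝ) ^ 2)⁻¹) g := by
    refine (hasProd_congr_fun fun p => ?_).mp h1
    have hp : (i p : ℕ) = p := rfl
    simp only [Function.comp_apply, hp, p.2.2, if_true]
    rw [pw_apply _ p.2.1.ne_zero, Real.rpow_neg (Nat.cast_nonneg _), Real.rpow_two, one_div]
  have h3 : HasProd (fun p : {p : ℕ // p.Prime ∧ p % 4 = 3} =>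
      (1 - 1 / ((p : ℕ) : ℝ) ^ 2) ^ (-(1 / 2) : ℝ)) (g ^ (1 / 2 : ℝ)) := by
    have hc := (Real.continuousAt_rpow_const g (1 / 2 : ℝ) (Or.inl (by positivity))).tendsto
    refine (hc.comp h2).congr fun s => ?_
    rw [Function.comp_apply, ← Real.finsetProd_rpow _ _ fun p _ => inv_nonneg.mpr (hpos p).le]
    refine prod_congr rfl fun p _ => ?_
    rw [Real.inv_rpow (hpos p).le]
    exact (Real.rpow_neg (hpos p).le _).symm
  have h4 : landauA = 1 / √2 * √g := by
    rw [landauA, h3.tprod_eq, Real.sqrt_eq_rpow g]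
  constructor
  · rw [h4]
    positivity
  · rw [h4, mul_pow, div_pow, Real.sq_sqrt hg0, Real.sq_sqrt (by norm_num)]
    ring

lemma tendsto_gs_three : Tendsto (fun σ : ℝ => gs (fun p => p % 4 = 3) (2 * (1 + σ))) (𝓝[>] 0)
    (𝓝 (gs (fun p => p % 4 = 3) 2)) := by
  refine tendsto_tsum_of_dominated_convergence (summable_pw (s := 2) (by norm_num)) (fun n => ?_) ?_
  · refine Tendsto.mono_left ?_ nhdsWithin_le_nhds
    rcases eq_or_ne n 0 with rfl | hn
    · simp
    · simp only [pw_apply _ hn]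
      have hn' : (n : ℝ) ≠ 0 := by exact_mod_cast hn
      have : Continuous fun σ : ℝ => ind (fun p => p % 4 = 3) n * (n : ℝ) ^ (-(2 * (1 + σ))) :=
        continuous_const.mul (continuous_const.rpow (by fun_prop) fun _ => Or.inl hn')
      simpa using this.tendsto 0
  · filter_upwards [self_mem_nhdsWithin] with σ hσ n
    have hσ' : (0 : ℝ) < σ := hσ
    rw [Real.norm_of_nonneg (mul_nonneg (ind_nonneg _ _) (pw_nonneg _ _))]
    refine (mul_le_of_le_one_left (pw_nonneg _ _) (ind_le_one _ _)).trans ?_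
    rcases eq_or_ne n 0 with rfl | hn
    · simp
    · rw [pw_apply _ hn, pw_apply _ hn]
      exact Real.rpow_le_rpow_of_exponent_le (by exact_mod_cast Nat.one_le_iff_ne_zero.mpr hn)
        (by linarith)

/-- Solve the factorisation for the square and let σ → 0: the limit is (π/4)·(1/2)/(2A²). -/
lemma tendsto_mul_gs_sq : Tendsto (fun σ : ℝ => σ * gs (Pz 0) (1 + σ) ^ 2) (𝓝[>] 0)
    (𝓝 (Real.pi / (16 * landauA ^ 2))) := by
  obtain ⟨hA, hA2⟩ := landauA_pos_and_sq
  have h2 : Tendsto (fun σ : ℝ => 1 - pw (1 + σ) 2) (𝓝[>] 0) (𝓝 (1 / 2)) := by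
    refine Tendsto.mono_left ?_ nhdsWithin_le_nhds
    have : Continuous fun σ : ℝ => 1 - ((2 : ℕ) : ℝ) ^ (-(1 + σ)) :=
      continuous_const.sub (continuous_const.rpow (by fun_prop) fun _ => Or.inl (by norm_num))
    have h3 := this.tendsto 0
    simp only [pw_apply _ two_ne_zero]
    convert h3 using 2
    norm_num [Real.rpow_neg_one]
  have h := (tendsto_mul_gs_true.mul h2).div tendsto_gs_three (by
    intro h0; rw [h0] at hA2; nlinarith)
  have e : Real.pi / 4 * (1 / 2) / gs (fun p => p % 4 = 3) 2 = Real.pi / (16 * landauA ^ 2) := by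
    rw [hA2]
    have : gs (fun p => p % 4 = 3) 2 ≠ 0 := by intro h0; rw [h0] at hA2; nlinarith
    field_simp
    norm_num
  rw [e] at h
  refine h.congr' ?_
  filter_upwards [self_mem_nhdsWithin] with σ hσ
  have hσ' : (0 : ℝ) < σ := hσ
  have hs : 1 < 1 + σ := by linarith
  have h5 : 0 < 1 - pw (1 + σ) 2 := by
    linarith [pw_lt_one (show 0 < 1 + σ by linarith) (le_refl 2)]
  have h6 : gs (fun p => p % 4 = 3) (2 * (1 + σ)) ≠ 0 := by
    have := (summable_ind_mul_pw (fun p => p % 4 = 3) (s := 2 * (1 + σ)) (by linarith)).le_tsum 1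
      fun n _ => mul_nonneg (ind_nonneg _ _) (pw_nonneg _ _)
    rw [map_one, map_one, mul_one] at this
    rw [gs]
    linarith
  simp only [Pi.div_apply]
  rw [gs_factorization hs, div_eq_iff h6]
  field_simp

end SumTwoSquaresSieve
end

/-! ### Determination of the constant by a Laplace transform -/

section
namespace SumTwoSquaresSieve
open Finset MeasureTheory Filter Topology

/-- The term n is present for u > log n, and the integral of e^{-σu} from there is n^{-σ}/σ. -/
lemma gs_eq_integral {σ : ℝ} (hσ : 0 < σ) :
    ∫ u in Set.Ioi 0, dd 0 (Real.exp u) * Real.exp (-σ * u) = gs (Pz 0) (1 + σ) / σ := by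
  set F : ℕ → ℝ → ℝ := fun n u =>
    (Set.Ioi (Real.log n)).indicator (fun u => ss 0 n * Real.exp (-σ * u)) u with hF
  have hσ' : -σ < 0 := by linarith
  have hint : ∀ n, Integrable (F n) (volume.restrict (Set.Ioi 0)) := fun n =>
    Integrable.restrict ((integrable_indicator_iff measurableSet_Ioi).mpr
      ((integrableOn_exp_mul_Ioi hσ' _).const_mul _))
  have hval : ∀ n, ∫ u in Set.Ioi 0, F n u = ind (Pz 0) n * pw (1 + σ) n / σ := fun n => by
    rcases eq_or_ne n 0 with rfl | hn
    · simp [hF]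
    have hn0 : (0 : ℝ) < n := by exact_mod_cast Nat.pos_of_ne_zero hn
    have hl : 0 ≤ Real.log n := Real.log_natCast_nonneg n
    simp only [hF]
    rw [setIntegral_indicator measurableSet_Ioi, Set.Ioi_inter_Ioi, max_eq_right hl,
      integral_const_mul, integral_exp_mul_Ioi hσ', pw_apply _ hn, ss_apply,
      show -(1 + σ) = -σ - 1 by ring, Real.rpow_sub_one hn0.ne', Real.rpow_def_of_pos hn0,
      mul_comm (Real.log n)]
    field_simp
  have hnn : ∀ n u, 0 ≤ F n u := fun n u =>
    Set.indicator_nonneg (fun _ _ => mul_nonneg (ss_nonneg 0 n) (Real.exp_pos _).le) _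
  have hs : 1 < 1 + σ := by linarith
  have key := hasSum_integral_of_summable_integral_norm hint (by
    simp only [Real.norm_of_nonneg (hnn _ _), hval]
    exact (summable_ind_mul_pw (Pz 0) hs).div_const σ)
  simp only [hval] at key
  have h2 := key.unique (((summable_ind_mul_pw (Pz 0) hs).hasSum).div_const σ)
  rw [gs, ← h2]
  refine setIntegral_congr_ae measurableSet_Ioi ?_
  -- The indicators use u > log n while `dd` counts n ≤ e^u. They differ only at the countably many
  -- points log n.
  have hae : ∀ᵐ u : ℝ, u ∉ Set.range fun n : ℕ => Real.log n :=
    (Set.countable_range _).ae_notMem volume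
  filter_upwards [hae] with u hu _
  rw [tsum_eq_sum (s := Ioc 0 ⌊Real.exp u⌋₊), dd, Finset.sum_mul]
  · refine sum_congr rfl fun n hn => ?_
    have hn := mem_Ioc.mp hn
    have hn0 : (0 : ℝ) < n := by exact_mod_cast hn.1
    have hle : Real.log n ≤ u := by
      rw [Real.log_le_iff_le_exp hn0]
      exact (Nat.le_floor_iff (Real.exp_pos u).le).mp hn.2
    have hne : Real.log n ≠ u := fun h => hu ⟨n, h⟩
    simp only [hF]
    rw [Set.indicator_of_mem (Set.mem_Ioi.mpr (lt_of_le_of_ne hle hne))]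
  · intro n hn
    rcases Nat.eq_zero_or_pos n with rfl | hn0
    · simp [hF]
    · have : ⌊Real.exp u⌋₊ < n := by simpa [hn0] using hn
      have h1 : Real.exp u < n := (Nat.floor_lt (Real.exp_pos u).le).mp this
      have h2 : u ≤ Real.log n := ((Real.lt_log_iff_exp_lt (by exact_mod_cast hn0)).mpr h1).le
      simp only [hF]
      rw [Set.indicator_of_notMem (by simpa using h2)]

lemma integral_sqrt_mul_exp {σ : ℝ} (hσ : 0 < σ) :
    IntegrableOn (fun u : ℝ => √u * Real.exp (-σ * u)) (Set.Ioi 0) ∧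
    ∫ u in Set.Ioi 0, √u * Real.exp (-σ * u) = √Real.pi / 2 / (σ * √σ) := by
  constructor
  · have := integrableOn_rpow_mul_exp_neg_mul_rpow (s := 1 / 2) (p := 1) (b := σ) (by norm_num)
      one_pos hσ
    simpa only [Real.rpow_one, ← Real.sqrt_eq_rpow] using this
  · have h := Real.integral_rpow_mul_exp_neg_mul_Ioi (a := 3 / 2) (r := σ) (by norm_num) hσ
    have e : (3 / 2 - 1 : ℝ) = 1 / 2 := by norm_num
    have eG : Real.Gamma (3 / 2) = √Real.pi / 2 := by
      rw [show (3 / 2 : ℝ) = 1 / 2 + 1 by norm_num, Real.Gamma_add_one (by norm_num),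
        Real.Gamma_one_half_eq]
      ring
    have e2 : (1 / σ) ^ (3 / 2 : ℝ) = (σ * √σ)⁻¹ := by
      rw [one_div, Real.inv_rpow hσ.le, Real.sqrt_eq_rpow, ← Real.rpow_one_add' hσ.le (by norm_num)]
      norm_num
    rw [e, eG, e2] at h
    simp only [← Real.sqrt_eq_rpow] at h
    simp only [neg_mul]
    rw [h]
    ring

/-- The sum of `1 / n` over the `n ≤ x` composed of primes `≡ 1 (mod 4)`, with its constant. -/
lemma exists_abs_dd_sub_le : ∃ B : ℝ, 0 ≤ B ∧ ∀ u : ℝ, 0 ≤ u →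
    |dd 0 (Real.exp u) - √u / (2 * landauA)| ≤ B := by
  obtain ⟨c, B, h⟩ := exists_abs_dd_sub_sqrt_le
  have hB : 0 ≤ B := (abs_nonneg _).trans (h 0 le_rfl)
  obtain ⟨hA, -⟩ := landauA_pos_and_sq
  -- The O(1) error in D transforms to at most B/σ, against a main term of order σ^{-3/2}. So the
  -- behaviour of the Euler product as σ → 0 determines c.
  have key : ∀ σ : ℝ, 0 < σ →
      |√σ * gs (Pz 0) (1 + σ) - c * (√Real.pi / 2)| ≤ B * √σ := by
    intro σ hσ
    have hσ' : -σ < 0 := by linarith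
    obtain ⟨hi, hv⟩ := integral_sqrt_mul_exp hσ
    have hie := integrableOn_exp_mul_Ioi hσ' 0
    have hdiff : ∀ᵐ u ∂(volume.restrict (Set.Ioi (0 : ℝ))),
        ‖dd 0 (Real.exp u) * Real.exp (-σ * u) - c * (√u * Real.exp (-σ * u))‖
          ≤ B * Real.exp (-σ * u) := by
      filter_upwards [ae_restrict_mem measurableSet_Ioi] with u hu
      have hu' : (0 : ℝ) < u := hu
      rw [← mul_assoc, ← sub_mul, norm_mul, Real.norm_eq_abs, Real.norm_of_nonneg (Real.exp_pos _).le]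
      exact mul_le_mul_of_nonneg_right (h u hu'.le) (Real.exp_pos _).le
    have hm : Monotone fun u => dd 0 (Real.exp u) := fun u v huv =>
      monotone_dd 0 (Real.exp_le_exp.mpr huv)
    have hid : IntegrableOn (fun u => dd 0 (Real.exp u) * Real.exp (-σ * u)
        - c * (√u * Real.exp (-σ * u))) (Set.Ioi 0) := by
      refine Integrable.mono' (hie.const_mul B) ?_ hdiff
      have := hm.measurable
      exact Measurable.aestronglyMeasurable (by fun_prop)
    have hi2 : IntegrableOn (fun u => dd 0 (Real.exp u) * Real.exp (-σ * u)) (Set.Ioi 0) := by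
      refine (hid.add (hi.const_mul c)).congr (Eventually.of_forall fun u => ?_)
      simp only [Pi.add_apply, sub_add_cancel]
    have hle := norm_integral_le_of_norm_le (hie.const_mul B) hdiff
    rw [integral_sub hi2 (hi.const_mul c), integral_const_mul, integral_const_mul, hv,
      gs_eq_integral hσ, integral_exp_mul_Ioi hσ', mul_zero, Real.exp_zero, Real.norm_eq_abs] at hle
    have hs0 : 0 < √σ := Real.sqrt_pos.mpr hσ
    have e : √σ * gs (Pz 0) (1 + σ) - c * (√Real.pi / 2)
        = (gs (Pz 0) (1 + σ) / σ - c * (√Real.pi / 2 / (σ * √σ))) * (σ * √σ) := by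
      field_simp
    rw [e, abs_mul, abs_of_pos (by positivity : 0 < σ * √σ)]
    calc _ ≤ B * (-1 / -σ) * (σ * √σ) := by gcongr
      _ = _ := by field_simp
  have hlim : Tendsto (fun σ : ℝ => √σ * gs (Pz 0) (1 + σ)) (𝓝[>] 0) (𝓝 (c * (√Real.pi / 2))) := by
    rw [tendsto_iff_dist_tendsto_zero]
    have h0 : Tendsto (fun σ : ℝ => B * √σ) (𝓝[>] 0) (𝓝 0) := by
      have : Continuous fun σ : ℝ => B * √σ := by fun_prop
      have := (this.tendsto 0).mono_left (nhdsWithin_le_nhds (s := Set.Ioi 0))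
      simpa using this
    refine squeeze_zero' (Eventually.of_forall fun _ => dist_nonneg) ?_ h0
    filter_upwards [self_mem_nhdsWithin] with σ hσ
    exact key σ hσ
  have hsq := hlim.pow 2
  have hsq' : Tendsto (fun σ : ℝ => (√σ * gs (Pz 0) (1 + σ)) ^ 2) (𝓝[>] 0)
      (𝓝 (Real.pi / (16 * landauA ^ 2))) := by
    refine tendsto_mul_gs_sq.congr' ?_
    filter_upwards [self_mem_nhdsWithin] with σ hσ
    have hσ' : (0 : ℝ) < σ := hσ
    rw [mul_pow, Real.sq_sqrt hσ'.le]
  have heq := tendsto_nhds_unique hsq hsq'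
  have hc0 : 0 ≤ c * (√Real.pi / 2) := ge_of_tendsto' hlim fun σ =>
    mul_nonneg (Real.sqrt_nonneg _)
      (tsum_nonneg fun n => mul_nonneg (ind_nonneg _ _) (pw_nonneg _ _))
  have hpi : 0 < √Real.pi := Real.sqrt_pos.mpr Real.pi_pos
  have hcv : c = 1 / (2 * landauA) := by
    have h1 : (c * (√Real.pi / 2)) ^ 2 = (√Real.pi / (4 * landauA)) ^ 2 := by
      rw [heq, div_pow, Real.sq_sqrt Real.pi_pos.le]
      ring
    have h2 := (sq_eq_sq₀ hc0 (by positivity)).mp h1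
    field_simp at h2
    field_simp
    linarith
  refine ⟨B, hB, fun u hu => ?_⟩
  have := h u hu
  rwa [hcv, one_div_mul_eq_div] at this

end SumTwoSquaresSieve
end

/-! ### Factorisations at sieving level z and the weights `ee` and `aa` -/

section
namespace SumTwoSquaresSieve
open Finset ArithmeticFunction Filter Topology
open scoped ArithmeticFunction.zeta ArithmeticFunction.Moebius

lemma ind_prime_pow (P : ℕ → Prop) [DecidablePred P] {p : ℕ} (hp : p.Prime) (k : ℕ) :
    ind P (p ^ k) = if P p ∨ k = 0 then 1 else 0 := by
  rw [map_pow, ind_prime P hp]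
  by_cases h : P p <;> by_cases hk : k = 0 <;> simp [h, hk]

/-- Every positive integer splits uniquely into a part with all prime factors in P and a part with
none. -/
lemma cm_ind_mul_cm_ind_not (P : ℕ → Prop) [DecidablePred P] :
    cm (ind fun p => ¬ P p) * cm (ind P) = (ζ : ArithmeticFunction ℝ) := by
  rw [((isMultiplicative_cm _).mul (isMultiplicative_cm _)).eq_iff_eq_on_prime_powers _ _
    isMultiplicative_zeta.natCast]
  intro p k hp
  have hz : (ζ : ArithmeticFunction ℝ) (p ^ k) = 1 := by
    simp [natCoe_apply, hp.ne_zero]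
  rw [hz, mul_apply, Nat.sum_divisorsAntidiagonal (f := fun a b => cm (ind fun p => ¬ P p) a *
    cm (ind P) b), Nat.sum_divisors_prime_pow hp]
  have hdiv : ∀ j ∈ range (k + 1), p ^ k / p ^ j = p ^ (k - j) := fun j hj =>
    Nat.pow_div (by have := Finset.mem_range.mp hj; omega) hp.pos
  rw [Finset.sum_congr rfl fun j hj => by rw [hdiv j hj, cm_apply, cm_apply, ind_prime_pow _ hp,
    ind_prime_pow _ hp]]
  by_cases h : P p
  · rw [sum_eq_single_of_mem 0 (by simp)]
    · simp [h]
    · intro j _ hj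
      simp [h, hj]
  · rw [sum_eq_single_of_mem k (by simp)]
    · simp [h]
    · intro j hj hj'
      have := mem_range.mp hj
      have : k - j ≠ 0 := by omega
      simp [h, this]

lemma pmul_ind_chi (P : ℕ → Prop) [DecidablePred P] (hP : ∀ p, P p → p % 4 = 1) :
    (cm chi).pmul (cm (ind P)) = cm (ind P) := by
  have h : (cm chi).pmul (cm (ind P)) = cm (chi * ind P) := rfl
  rw [h, (isMultiplicative_cm _).eq_iff_eq_on_prime_powers _ _ (isMultiplicative_cm _)]
  intro p k hp
  change chi (p ^ k) * ind P (p ^ k) = ind P (p ^ k)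
  rw [map_pow chi, ind_prime_pow _ hp, chi_eq]
  by_cases h : P p
  · simp [hP p h]
  · by_cases hk : k = 0 <;> simp [h, hk]

/-- The nonnegative weight `rr n / n` on integers without prime factors `p ≡ 1 (mod 4)`, `p > z`. -/
noncomputable def ee (z : ℕ) : ArithmeticFunction ℝ :=
  til ((cm (ind fun p => ¬ Pz z p)).pmul rr)

/-- At the primes of `Pz z` the character is 1, so both 1 and χ₄ contribute a full copy of `ss z`;
`ee z` collects all other primes. -/
lemma til_rr_eq (z : ℕ) : til rr = ee z * ss z * ss z := by
  rw [ee, ss, ← til_mul, ← til_mul]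
  congr 1
  have h1 := cm_ind_mul_cm_ind_not (Pz z)
  have h2 : cm chi = (cm chi).pmul (cm (ind fun p => ¬ Pz z p)) * cm (ind (Pz z)) := by
    have h4 : cm chi = (cm chi).pmul (ζ : ArithmeticFunction ℝ) := by
      ext n
      rcases eq_or_ne n 0 with rfl | hn
      · simp
      · simp [natCoe_apply, zeta_apply, hn]
    have h5 := pmul_ind_chi (Pz z) fun p h => h.1
    calc cm chi = _ := h4
      _ = _ := by rw [← h1, pmul_cm_mul, h5]
  have h3 : (cm (ind fun p => ¬ Pz z p)).pmul rr
      = cm (ind fun p => ¬ Pz z p) * (cm chi).pmul (cm (ind fun p => ¬ Pz z p)) := by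
    rw [rr, pmul_cm_mul]
    congr 1
    · ext n
      simp
    · ext n
      simp [mul_comm]
  rw [h3]
  nth_rw 1 [rr, ← h1, h2]
  ring

lemma ee_eq (z : ℕ) : ee z = til rr * (ff z * ff z) := by
  rw [til_rr_eq z]
  calc ee z = ee z * ((ss z * ff z) * (ss z * ff z)) := by rw [ss_mul_ff]; simp
    _ = _ := by ring

/-- The key identity: after squaring, the sieved Möbius function differs from the inverse of 1 ∗ χ₄
only by a nonnegative factor with convergent sum. The half-integral powers of ζ have disappeared. -/
lemma ff_mul_ff_eq (z : ℕ) : ff z * ff z = ee z * til nu := by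
  have : til rr * til nu = 1 := by rw [← til_mul, rr_mul_nu, til_one]
  calc ff z * ff z = (til rr * til nu) * (ff z * ff z) := by rw [this, one_mul]
    _ = _ := by rw [ee_eq]; ring

lemma ee_apply (z n : ℕ) : ee z n = ind (fun p => ¬ Pz z p) n * rr n / n := rfl

lemma ee_nonneg (z n : ℕ) : 0 ≤ ee z n :=
  div_nonneg (mul_nonneg (ind_nonneg _ _) (rr_nonneg n)) (Nat.cast_nonneg n)

/-- Every n < N has all its prime factors below N, so it occurs in the expansion of the finite Euler
product. -/
lemma sum_le_of_euler {f : ArithmeticFunction ℝ} (hm : f.IsMultiplicative) (h0 : ∀ n, 0 ≤ f n)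
    (hs : ∀ p : ℕ, p.Prime → Summable fun k : ℕ => f (p ^ k)) {B : ℝ}
    (hB : ∀ N, ∏ p ∈ range N with p.Prime, ∑' k : ℕ, f (p ^ k) ≤ B) (N : ℕ) :
    ∑ n ∈ range N, f n ≤ B := by
  have h := (EulerProduct.summable_and_hasSum_factoredNumbers_prod_filter_prime_tsum (f := f)
    hm.1 hm.2 (fun {p} hp => (hs p hp).norm) (range N)).2
  change HasSum (f ∘ ((↑) : Nat.factoredNumbers (range N) → ℕ)) _ at h
  rw [hasSum_subtype_iff_indicator] at h
  refine le_trans ?_ (hB N)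
  refine le_trans (sum_le_sum fun n hn => ?_) (sum_le_hasSum (range N)
    (fun n _ => Set.indicator_nonneg (fun n _ => h0 n) n) h)
  rcases Nat.eq_zero_or_pos n with rfl | hn0
  · rw [f.map_zero]
    exact Set.indicator_nonneg (fun n _ => h0 n) _
  · rw [Set.indicator_of_mem]
    refine Nat.mem_factoredNumbers.mpr ⟨hn0.ne', fun p hp => ?_⟩
    have := Nat.le_of_mem_primeFactorsList hp
    simp only [Finset.mem_range] at hn ⊢
    omega

/-- The function `ee z`, twisted by a power. -/
noncomputable def wz (z : ℕ) (s : ℝ) : ArithmeticFunction ℝ :=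
  ((cm (ind fun p => ¬ Pz z p)).pmul rr).pmul (cm (pw s))

lemma wz_apply (z : ℕ) (s : ℝ) (n : ℕ) :
    wz z s n = ind (fun p => ¬ Pz z p) n * rr n * pw s n := rfl

lemma wz_nonneg (z : ℕ) (s : ℝ) (n : ℕ) : 0 ≤ wz z s n :=
  mul_nonneg (mul_nonneg (ind_nonneg _ _) (rr_nonneg n)) (pw_nonneg s n)

lemma isMultiplicative_wz (z : ℕ) (s : ℝ) : (wz z s).IsMultiplicative :=
  ((isMultiplicative_cm _).pmul isMultiplicative_rr).pmul (isMultiplicative_cm _)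

lemma hasSum_rr_prime_pow {p : ℕ} (hp : p.Prime) {x : ℝ} (hx0 : 0 ≤ x) (hx : x < 1) :
    HasSum (fun k : ℕ => rr (p ^ k) * x ^ k) ((1 - x)⁻¹ * (1 - chi p * x)⁻¹) := by
  have h1 : ‖x‖ < 1 := by rwa [Real.norm_of_nonneg hx0]
  have h2 : ‖chi p * x‖ < 1 := by
    rw [norm_mul, Real.norm_of_nonneg hx0]
    exact (mul_le_of_le_one_left hx0 (abs_chi_le p)).trans_lt hx
  have s1 := summable_norm_geometric_of_norm_lt_one h1
  have s2 := summable_norm_geometric_of_norm_lt_one h2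
  have h3 := tsum_mul_tsum_eq_tsum_sum_range_of_summable_norm s2 s1
  have h4 := (summable_norm_sum_mul_range_of_summable_norm s2 s1).of_norm
  rw [tsum_geometric_of_norm_lt_one h1, tsum_geometric_of_norm_lt_one h2] at h3
  have h5 := h4.hasSum
  rw [← h3, mul_comm (1 - chi p * x)⁻¹] at h5
  have e : (fun k : ℕ => rr (p ^ k) * x ^ k)
      = fun n => ∑ k ∈ range (n + 1), (chi p * x) ^ k * x ^ (n - k) := funext fun n => by
    rw [rr_prime_pow hp, Finset.sum_mul]
    refine sum_congr rfl fun j hj => ?_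
    have : j + (n - j) = n := by have := Finset.mem_range.mp hj; omega
    rw [mul_pow, mul_assoc, ← pow_add, this]
  rwa [e]

lemma hasSum_wz_prime_pow (z : ℕ) {s : ℝ} (hs : 0 < s) {p : ℕ} (hp : p.Prime) :
    HasSum (fun k : ℕ => wz z s (p ^ k))
      (if Pz z p then 1 else (1 - pw s p)⁻¹ * (1 - chi p * pw s p)⁻¹) := by
  split_ifs with h
  · have := hasSum_single (f := fun k : ℕ => wz z s (p ^ k)) 0 (fun k hk => by
      rw [wz_apply, ind_prime_pow _ hp]
      simp [h, hk])
    simpa [wz_apply, isMultiplicative_rr.1] using this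
  · have h1 := hasSum_rr_prime_pow hp (pw_nonneg s p) (pw_lt_one hs hp.two_le)
    have e : (fun k : ℕ => wz z s (p ^ k)) = fun k : ℕ => rr (p ^ k) * pw s p ^ k := funext fun k => by
      rw [wz_apply, ind_prime_pow _ hp, map_pow (pw s), if_pos (Or.inl h), one_mul]
    rwa [e]

lemma inv_one_sub_le_exp {x : ℝ} (h0 : 0 ≤ x) (h1 : x ≤ 2 / 3) : (1 - x)⁻¹ ≤ Real.exp (3 * x) := by
  rw [inv_le_comm₀ (by linarith) (Real.exp_pos _), ← Real.exp_neg, Real.exp_neg]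
  have h2 := Real.add_one_le_exp (3 * x)
  calc (Real.exp (3 * x))⁻¹ ≤ (3 * x + 1)⁻¹ := inv_anti₀ (by linarith) h2
    _ ≤ 1 - x := by
        rw [inv_le_iff_one_le_mul₀ (by linarith)]
        nlinarith

lemma sum_rpow_le (z : ℕ) : ∑ n ∈ Ioc 0 z, (n : ℝ) ^ (-(3 / 4) : ℝ) ≤ 4 * (z : ℝ) ^ (1 / 4 : ℝ) := by
  induction z with
  | zero => simp
  | succ n ih =>
    rw [sum_Ioc_succ_top (by omega)]
    set a := (n : ℝ) ^ (1 / 4 : ℝ) with ha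
    set b := ((n + 1 : ℕ) : ℝ) ^ (1 / 4 : ℝ) with hb
    have hn : (0 : ℝ) ≤ n := Nat.cast_nonneg n
    have ha0 : 0 ≤ a := by positivity
    have hb0 : 0 < b := by positivity
    have hab : a ≤ b := by
      rw [ha, hb]; gcongr; simp
    have ha4 : a ^ 4 = n := by
      rw [ha, ← Real.rpow_natCast, ← Real.rpow_mul hn]; norm_num
    have hb4 : b ^ 4 = n + 1 := by
      rw [hb, ← Real.rpow_natCast, ← Real.rpow_mul (by positivity)]; norm_num
    have hb3 : ((n + 1 : ℕ) : ℝ) ^ (-(3 / 4) : ℝ) = (b ^ 3)⁻¹ := by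
      rw [hb, ← Real.rpow_natCast, ← Real.rpow_mul (by positivity), Real.rpow_neg (by positivity)]
      norm_num
    rw [hb3]
    have : (b ^ 3)⁻¹ ≤ 4 * (b - a) := by
      rw [inv_le_iff_one_le_mul₀ (by positivity)]
      have e : 1 = (b - a) * (b ^ 3 + b ^ 2 * a + b * a ^ 2 + a ^ 3) := by
        linear_combination ha4 - hb4
      have h2 : b ^ 3 + b ^ 2 * a + b * a ^ 2 + a ^ 3 ≤ 4 * b ^ 3 := by
        have : b ^ 2 * a ≤ b ^ 2 * b := by gcongr
        have : b * a ^ 2 ≤ b * b ^ 2 := by gcongr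
        have : a ^ 3 ≤ b ^ 3 := by gcongr
        nlinarith
      calc 1 = (b - a) * (b ^ 3 + b ^ 2 * a + b * a ^ 2 + a ^ 3) := e
        _ ≤ (b - a) * (4 * b ^ 3) := mul_le_mul_of_nonneg_left h2 (by linarith)
        _ = _ := by ring
    linarith

/-- The primes `p ≤ z`, `p ≡ 1 (mod 4)`. -/
def onePrimes (z : ℕ) : Finset ℕ := (Ioc 0 z).filter fun p => p.Prime ∧ p % 4 = 1

/-- The product `∏ (1 - 1/p)` over `p ≤ z`, `p ≡ 1 (mod 4)`. -/
noncomputable def gz (z : ℕ) : ℝ := ∏ p ∈ onePrimes z, (1 - 1 / (p : ℝ))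

/-- With x = p^{-3/4}: the factor at 2 is bounded; at p ≡ 3 it is (1 − x²)⁻¹, and Σ p^{-3/2}
converges; at p ≡ 1 beyond z it is 1. The growth comes from p ≡ 1, p ≤ z, where (1 − x)⁻² ≤ exp(6x)
and the sum of 6n^{-3/4} over n ≤ z is at most 24 z^{1/4}. -/
lemma exists_prod_wz_le : ∃ B : ℝ, 0 < B ∧ ∀ z N : ℕ,
    ∏ p ∈ range N with p.Prime, ∑' k : ℕ, wz z (3 / 4) (p ^ k)
      ≤ B * Real.exp (24 * (z : ℝ) ^ (1 / 4 : ℝ)) := by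
  have hS := summable_pw (s := 2 * (3 / 4)) (by norm_num)
  set S := ∑' n, pw (2 * (3 / 4)) n with hSdef
  refine ⟨Real.exp (3 + 3 * S), Real.exp_pos _, fun z N => ?_⟩
  rw [← Real.exp_add]
  have hloc : ∀ p : ℕ, p.Prime → ∑' k : ℕ, wz z (3 / 4) (p ^ k) ≤ Real.exp
      ((if p = 2 then 3 else 0) + 3 * pw (2 * (3 / 4)) p
        + (if p ∈ Ioc 0 z then 6 * (p : ℝ) ^ (-(3 / 4) : ℝ) else 0)) := by
    intro p hp
    rw [(hasSum_wz_prime_pow z (by norm_num) hp).tsum_eq]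
    have hx0 := pw_nonneg (3 / 4) p
    have hx : pw (3 / 4) p ≤ 2 / 3 := by
      rw [pw_apply _ hp.ne_zero]
      calc (p : ℝ) ^ (-(3 / 4) : ℝ) ≤ (2 : ℝ) ^ (-(3 / 4) : ℝ) :=
            Real.rpow_le_rpow_of_nonpos (by norm_num) (by exact_mod_cast hp.two_le) (by norm_num)
        _ ≤ 2 / 3 := by
            refine le_of_pow_le_pow_left₀ (n := 4) (by norm_num) (by norm_num) ?_
            rw [← Real.rpow_natCast, ← Real.rpow_mul (by norm_num)]
            norm_num
    have hxx : pw (2 * (3 / 4)) p = pw (3 / 4) p ^ 2 := pw_two_mul _ _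
    have h6 : 0 ≤ 6 * (p : ℝ) ^ (-(3 / 4) : ℝ) := by positivity
    have hxx : pw (2 * (3 / 4)) p = pw (3 / 4) p ^ 2 := pw_two_mul _ _
    rw [hxx]
    set x := pw (3 / 4) p with hxdef
    have hc1 : (0 : ℝ) ≤ if p = 2 then 3 else 0 := by split_ifs <;> norm_num
    have hc2 : 0 ≤ if p ∈ Ioc 0 z then 6 * (p : ℝ) ^ (-(3 / 4) : ℝ) else 0 := by
      split_ifs <;> linarith
    by_cases h : Pz z p
    · rw [if_pos h]
      exact Real.one_le_exp (by positivity)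
    rw [if_neg h]
    have hodd := hp.eq_two_or_odd
    rcases eq_or_ne p 2 with h2 | h2
    · have hchi : chi p = 0 := by rw [chi_eq, h2]; norm_num
      rw [hchi, zero_mul, sub_zero, inv_one, mul_one, if_pos h2]
      refine (inv_one_sub_le_exp hx0 hx).trans (Real.exp_le_exp.mpr ?_)
      nlinarith
    · have h4 : p % 4 = 1 ∨ p % 4 = 3 := by omega
      rcases h4 with h4 | h4
      · have hchi : chi p = 1 := by rw [chi_eq, if_pos h4]
        have hz : p ∈ Ioc 0 z := by
          have := hp.pos
          have : ¬ z < p := fun h' => h ⟨h4, h'⟩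
          rw [mem_Ioc]; omega
        rw [hchi, one_mul, if_pos hz, ← pw_apply _ hp.ne_zero, ← hxdef]
        have h5 := inv_one_sub_le_exp hx0 hx
        have h0 : 0 ≤ (1 - x)⁻¹ := inv_nonneg.mpr (by linarith)
        calc (1 - x)⁻¹ * (1 - x)⁻¹ ≤ Real.exp (3 * x) * Real.exp (3 * x) := by gcongr
          _ = Real.exp (6 * x) := by rw [← Real.exp_add]; ring_nf
          _ ≤ _ := Real.exp_le_exp.mpr (by nlinarith)
      · have hchi : chi p = -1 := by rw [chi_eq, if_neg (by omega), if_pos h4]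
        rw [hchi, ← mul_inv]
        have e : (1 - x) * (1 - -1 * x) = 1 - x ^ 2 := by ring
        rw [e]
        exact (inv_one_sub_le_exp (sq_nonneg x) (by nlinarith)).trans
          (Real.exp_le_exp.mpr (by linarith))
  refine (prod_le_prod (fun p hp => tsum_nonneg fun k => wz_nonneg _ _ _)
    fun p hp => hloc p (mem_filter.mp hp).2).trans ?_
  rw [← Real.exp_sum, Real.exp_le_exp, sum_add_distrib, sum_add_distrib, ← Finset.mul_sum]
  have s1 : ∑ p ∈ range N with p.Prime, (if p = 2 then (3 : ℝ) else 0) ≤ 3 := by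
    rw [sum_ite_eq']
    split_ifs <;> norm_num
  have s2 : ∑ p ∈ range N with p.Prime, pw (2 * (3 / 4)) p ≤ S :=
    hS.sum_le_tsum _ fun n _ => pw_nonneg _ n
  have s3 : ∑ p ∈ range N with p.Prime, (if p ∈ Ioc 0 z then 6 * (p : ℝ) ^ (-(3 / 4) : ℝ) else 0)
      ≤ 24 * (z : ℝ) ^ (1 / 4 : ℝ) := by
    rw [← sum_filter]
    refine (sum_le_sum_of_subset_of_nonneg (t := Ioc 0 z) (fun p hp => (mem_filter.mp hp).2)
      fun _ _ _ => by positivity).trans ?_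
    rw [← Finset.mul_sum]
    linarith [sum_rpow_le z]
  linarith

lemma summable_wz (z : ℕ) : Summable (wz z (3 / 4)) := by
  obtain ⟨B, -, hB⟩ := exists_prod_wz_le
  exact summable_of_sum_range_le (wz_nonneg z _) fun n => sum_le_of_euler
    (isMultiplicative_wz z _) (wz_nonneg z _)
    (fun p hp => (hasSum_wz_prime_pow z (by norm_num) hp).summable) (hB z) n

/-- The sum `∑ ee z n * n ^ (1/4)`. -/
noncomputable def hz (z : ℕ) : ℝ := ∑' n, wz z (3 / 4) n

lemma exists_hz_le : ∃ B : ℝ, 0 < B ∧ ∀ z : ℕ, hz z ≤ B * Real.exp (24 * (z : ℝ) ^ (1 / 4 : ℝ)) := by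
  obtain ⟨B, hB0, hB⟩ := exists_prod_wz_le
  exact ⟨B, hB0, fun z => Real.tsum_le_of_sum_range_le (wz_nonneg z _) fun n => sum_le_of_euler
    (isMultiplicative_wz z _) (wz_nonneg z _)
    (fun p hp => (hasSum_wz_prime_pow z (by norm_num) hp).summable) (hB z) n⟩

lemma one_le_hz (z : ℕ) : 1 ≤ hz z := by
  have := (summable_wz z).le_tsum 1 fun n _ => wz_nonneg z _ n
  rwa [(isMultiplicative_wz z _).1] at this

lemma wz_eq_ee_mul (z n : ℕ) : wz z (3 / 4) n = ee z n * (n : ℝ) ^ (1 / 4 : ℝ) := by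
  rcases eq_or_ne n 0 with rfl | hn
  · simp
  · have hn' : (0 : ℝ) < n := by positivity
    rw [wz_apply, ee_apply, pw_apply _ hn, div_mul_eq_mul_div, mul_div_assoc]
    congr 1
    rw [← Real.rpow_sub_one hn'.ne']
    norm_num

lemma wz_one_eq_ee (z n : ℕ) : wz z 1 n = ee z n := by
  rcases eq_or_ne n 0 with rfl | hn
  · simp
  · rw [wz_apply, ee_apply, pw_apply _ hn, Real.rpow_neg_one, div_eq_mul_inv]

lemma ee_le_wz (z n : ℕ) : ee z n ≤ wz z (3 / 4) n := by
  rcases eq_or_ne n 0 with rfl | hn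
  · simp
  · rw [wz_eq_ee_mul]
    exact le_mul_of_one_le_right (ee_nonneg z n)
      (Real.one_le_rpow (by exact_mod_cast Nat.one_le_iff_ne_zero.mpr hn) (by norm_num))

lemma summable_ee (z : ℕ) : Summable (ee z) :=
  (summable_wz z).of_nonneg_of_le (ee_nonneg z) (ee_le_wz z)

lemma tsum_ee_le (z : ℕ) : ∑' n, ee z n ≤ hz z :=
  (summable_ee z).tsum_le_tsum (ee_le_wz z) (summable_wz z)

lemma gz_pos (z : ℕ) : 0 < gz z := by
  refine prod_pos fun p hp => ?_
  have h2 := (mem_filter.mp hp).2.1.one_lt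
  have : 1 / (p : ℝ) < 1 := by
    rw [div_lt_one (by positivity)]; exact_mod_cast h2
  linarith

lemma gz_le_one (z : ℕ) : gz z ≤ 1 := by
  refine prod_le_one (fun p hp => ?_) fun p hp => ?_
  · have h2 := (mem_filter.mp hp).2.1.one_lt
    have : 1 / (p : ℝ) < 1 := by
      rw [div_lt_one (by positivity)]; exact_mod_cast h2
    linarith
  · have : 0 ≤ 1 / (p : ℝ) := by positivity
    linarith

lemma hasProd_primes_finset {s : Finset ℕ} (hs : ∀ p ∈ s, p.Prime) (f : ℕ → ℝ) :
    HasProd (fun p : Nat.Primes => if (p : ℕ) ∈ s then f p else 1) (∏ p ∈ s, f p) := by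
  have h0 : ∏ p ∈ s, (if p ∈ s then f p else 1) = ∏ p ∈ s, f p :=
    prod_congr rfl fun p hp => if_pos hp
  have h1 : HasProd (fun p : ℕ => if p ∈ s then f p else 1) (∏ p ∈ s, if p ∈ s then f p else 1) :=
    hasProd_prod_of_ne_finset_one fun p hp => if_neg hp
  rw [h0] at h1
  have hi : Function.Injective fun p : Nat.Primes => (p : ℕ) := Subtype.val_injective
  have h2 := hi.hasProd_iff (f := fun p : ℕ => if p ∈ s then f p else 1) (a := ∏ p ∈ s, f p)
    fun p hp => if_neg fun h => hp ⟨⟨p, hs p h⟩, rfl⟩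
  exact h2.mpr h1

/-- The Euler factors are 2 at p = 2, (1 − p⁻²)⁻¹ at p ≡ 3, and (1 − 1/p)⁻² at p ≡ 1, p ≤ z. The
first two kinds multiply to 2 · 2A². -/
lemma tsum_ee (z : ℕ) : ∑' n, ee z n = 4 * landauA ^ 2 / gz z ^ 2 := by
  have h1 := (isMultiplicative_wz z 1).eulerProduct_hasProd (by
    refine (summable_ee z).congr fun n => ?_
    rw [wz_one_eq_ee, Real.norm_of_nonneg (ee_nonneg z n)])
  simp only [wz_one_eq_ee] at h1
  have p1 := hasProd_primes_finset (s := {2}) (by simpa using Nat.prime_two) fun _ => (2 : ℝ)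
  have p2 := hasProd_gs (fun p => p % 4 = 3) (s := 2) (by norm_num)
  have p3 := hasProd_primes_finset (s := onePrimes z) (fun p hp => (mem_filter.mp hp).2.1)
    fun p => ((1 - 1 / (p : ℝ)) ^ 2)⁻¹
  have h2 := (p1.mul p2).mul p3
  refine h1.unique ?_
  have hv : (∏ _p ∈ ({2} : Finset ℕ), (2 : ℝ)) * gs (fun p => p % 4 = 3) 2
      * ∏ p ∈ onePrimes z, ((1 - 1 / (p : ℝ)) ^ 2)⁻¹ = 4 * landauA ^ 2 / gz z ^ 2 := by
    rw [prod_inv_distrib, prod_pow, landauA_pos_and_sq.2, gz, prod_singleton]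
    ring
  rw [← hv]
  refine (hasProd_congr_fun fun p => ?_).mp h2
  have e : ∑' k : ℕ, ee z ((p : ℕ) ^ k)
      = if Pz z p then 1 else (1 - pw 1 p)⁻¹ * (1 - chi p * pw 1 p)⁻¹ := by
    simpa only [wz_one_eq_ee] using (hasSum_wz_prime_pow z one_pos p.2).tsum_eq
  rw [e]
  have hp0 : (p : ℕ) ≠ 0 := p.2.ne_zero
  have hpw : pw 1 p = 1 / ((p : ℕ) : ℝ) := by
    rw [pw_apply _ hp0, Real.rpow_neg_one, one_div]
  have hpw2 : pw 2 p = (1 / ((p : ℕ) : ℝ)) ^ 2 := by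
    rw [← hpw, ← pw_two_mul, mul_one]
  have hodd := p.2.eq_two_or_odd
  rw [hpw, hpw2, chi_eq]
  rcases eq_or_ne (p : ℕ) 2 with h2 | h2
  · simp [h2, onePrimes, Pz]
    norm_num
  · have h4 : (p : ℕ) % 4 = 1 ∨ (p : ℕ) % 4 = 3 := by omega
    rcases h4 with h4 | h4
    · by_cases hz : z < p
      · simp [h2, h4, onePrimes, Pz, hz]
      · have : (p : ℕ) ≤ z := by omega
        simp [h2, h4, onePrimes, Pz, this, p.2, p.2.pos, sq]
    · have e2 : (1 - 1 / ((p : ℕ) : ℝ)) * (1 - -1 * (1 / ((p : ℕ) : ℝ)))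
          = 1 - (1 / ((p : ℕ) : ℝ)) ^ 2 := by ring
      have a1 : (p : ℕ) ∉ ({2} : Finset ℕ) := by simpa using h2
      have a2 : ¬ Pz z p := by simp [Pz, h4]
      have a3 : (p : ℕ) ∉ onePrimes z := by simp [onePrimes, h4]
      have a4 : ¬ (p : ℕ) % 4 = 1 := by omega
      simp only [if_neg a1, if_neg a2, if_neg a3, if_neg a4, if_pos h4, ← mul_inv, e2, one_mul,
        mul_one]

/-- The condition `p ≡ 1 (mod 4)`, `p ≤ z`. -/
abbrev Az (z : ℕ) : ℕ → Prop := fun p => p % 4 = 1 ∧ p ≤ z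

/-- The function `μ(n) / n` on the integers composed of primes `p ≡ 1 (mod 4)`, `p ≤ z`. -/
noncomputable def aa (z : ℕ) : ArithmeticFunction ℝ := til (cmInv (ind (Az z)))

/-- The small primes are removed from `ss 0` by their own Möbius function, which carries the
asymptotics at z = 0 to every z. -/
lemma ss_eq_ss_zero_mul (z : ℕ) : ss z = aa z * ss 0 := by
  have h : ss 0 = ss z * til (cm (ind (Az z))) := by
    rw [ss, ss, ← til_mul]
    congr 1
    rw [(isMultiplicative_cm _).eq_iff_eq_on_prime_powers _ _
      ((isMultiplicative_cm _).mul (isMultiplicative_cm _))]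
    intro p k hp
    rw [mul_apply, Nat.sum_divisorsAntidiagonal (f := fun a b => cm (ind (Pz z)) a *
      cm (ind (Az z)) b), Nat.sum_divisors_prime_pow hp]
    have hdiv : ∀ j ∈ range (k + 1), p ^ k / p ^ j = p ^ (k - j) := fun j hj =>
      Nat.pow_div (by have := Finset.mem_range.mp hj; omega) hp.pos
    rw [Finset.sum_congr rfl fun j hj => by rw [hdiv j hj, cm_apply, cm_apply, ind_prime_pow _ hp,
      ind_prime_pow _ hp], cm_apply, ind_prime_pow _ hp]
    have hp0 := hp.pos
    by_cases hz : z < p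
    · rw [sum_eq_single_of_mem k (by simp)]
      · simp [Pz, hp0, hz]
      · intro j hj hj'
        have := mem_range.mp hj
        have : k - j ≠ 0 := by omega
        have : ¬ p ≤ z := by omega
        simp [*]
    · rw [sum_eq_single_of_mem 0 (by simp)]
      · have : p ≤ z := by omega
        simp [Pz, Az, hp0, this]
      · intro j _ hj
        simp [Pz, hz, hj]
  have h2 : til (cm (ind (Az z))) * aa z = 1 := by
    rw [aa, ← til_mul, cm_mul_cmInv, til_one]
  calc ss z = ss z * (til (cm (ind (Az z))) * aa z) := by rw [h2, mul_one]
    _ = _ := by rw [h]; ring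

lemma abs_mu_le (n : ℕ) : |mu n| ≤ 1 := by
  have := abs_moebius_le_one (n := n)
  rw [mu]
  exact_mod_cast this

/-- On integers composed of primes ≡ 1 (mod 4), 1 ∗ χ₄ counts divisors and is at least 1. -/
lemma ind_Az_le (z n : ℕ) : ind (Az z) n ≤ ind (fun p => ¬ Pz z p) n * rr n := by
  rcases eq_or_ne n 0 with rfl | hn
  · simp
  have h1 : ind (Az z) n ≤ ind (Az z) n * rr n := by
    have hchi : ∀ b, chi b * ind (Az z) b = ind (Az z) b := fun b =>
      DFunLike.congr_fun (pmul_ind_chi (Az z) fun p h => h.1) b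
    rw [rr, mul_apply, Finset.mul_sum]
    have h2 : ∀ x ∈ n.divisorsAntidiagonal, ind (Az z) n *
        ((ζ : ArithmeticFunction ℝ) x.1 * cm chi x.2) = ind (Az z) x.1 * ind (Az z) x.2 := by
      intro x hx
      have hx' := Nat.mem_divisorsAntidiagonal.mp hx
      have h1 : x.1 ≠ 0 := fun h => hx'.2 (by rw [← hx'.1, h, zero_mul])
      rw [← hx'.1, map_mul, natCoe_apply, zeta_apply, if_neg h1, cm_apply]
      push_cast
      have := hchi x.2
      linear_combination ind (Az z) x.1 * this
    rw [sum_congr rfl h2]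
    have h3 := single_le_sum (f := fun x : ℕ × ℕ => ind (Az z) x.1 * ind (Az z) x.2)
      (s := n.divisorsAntidiagonal) (fun x _ => mul_nonneg (ind_nonneg _ _) (ind_nonneg _ _))
      (a := (n, 1)) (by simp [hn])
    simpa using h3
  refine h1.trans (mul_le_mul_of_nonneg_right ?_ (rr_nonneg n))
  rw [ind_apply, ind_apply]
  split_ifs with h2 h3 h3
  · exact le_rfl
  · exact absurd ⟨h2.1, fun p hp h => by have := h2.2 p hp; have := h.2; omega⟩ h3
  · norm_num
  · exact le_rfl

lemma abs_aa_le (z n : ℕ) : |aa z n| ≤ ee z n := by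
  rw [aa, til_apply, cmInv_apply, ee_apply, abs_div, abs_mul, abs_of_nonneg (ind_nonneg _ n),
    Nat.abs_cast]
  exact div_le_div_of_nonneg_right ((mul_le_of_le_one_left (ind_nonneg _ _) (abs_mu_le n)).trans
    (ind_Az_le z n)) (Nat.cast_nonneg n)

lemma summable_aa (z : ℕ) : Summable (aa z) :=
  (summable_ee z).of_norm_bounded (abs_aa_le z)

lemma tsum_aa (z : ℕ) : ∑' n, aa z n = gz z := by
  have hm : (aa z).IsMultiplicative := by
    refine ⟨by simp [aa, mu], fun {m n} h => ?_⟩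
    rw [aa, til_apply, til_apply, til_apply, (isMultiplicative_cmInv _).2 h]
    push_cast
    rw [mul_div_mul_comm]
  have h1 := hm.eulerProduct_hasProd (summable_aa z).norm
  refine h1.unique ?_
  refine (hasProd_congr_fun fun p => ?_).mp (hasProd_primes_finset (s := onePrimes z)
    (fun p hp => (mem_filter.mp hp).2.1) fun p => (1 - 1 / (p : ℝ)))
  have h2 : HasSum (fun k : ℕ => aa z ((p : ℕ) ^ k)) (∑ k ∈ {0, 1}, aa z ((p : ℕ) ^ k)) :=
    hasSum_sum_of_ne_finset_zero fun k hk => by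
      have hk' : k ≠ 0 ∧ k ≠ 1 := by simpa using hk
      have : ¬ Squarefree ((p : ℕ) ^ k) := fun h => by
        rcases Nat.squarefree_pow_iff p.2.ne_one hk'.1 |>.mp h with ⟨_, h⟩
        exact hk'.2 h
      simp [aa, mu, moebius_eq_zero_of_not_squarefree this]
  rw [h2.tsum_eq, sum_pair (by norm_num), pow_zero, pow_one, hm.1, aa, til_apply, cmInv_apply,
    ind_prime _ p.2, mu, moebius_apply_prime p.2]
  by_cases hz : (p : ℕ) % 4 = 1 ∧ (p : ℕ) ≤ z
  · simp [onePrimes, Az, hz, p.2, p.2.pos]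
    ring
  · have : (p : ℕ) ∉ onePrimes z := fun h => hz ⟨(mem_filter.mp h).2.2,
      (mem_Ioc.mp (mem_filter.mp h).1).2⟩
    rw [if_neg this, if_neg hz]
    simp

end SumTwoSquaresSieve
end

/-! ### Mean square bounds for `kk` and for the sieved sum `vv` -/

section
namespace SumTwoSquaresSieve
open Finset ArithmeticFunction Filter Topology
open scoped ArithmeticFunction.zeta ArithmeticFunction.Moebius

/-- On the logarithmic scale `kk` is Lipschitz with constant 44. A deviation above 45 + B would
therefore stay above 1 + B on a unit interval, contradicting the mean square bound B. -/
lemma exists_abs_kk_sub_le : ∃ Q : ℝ, 1 ≤ Q ∧ ∀ y : ℝ, |kk y - 4 / Real.pi| ≤ Q := by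
  obtain ⟨B, hB0, hB⟩ := exists_integral_kk_sub_sq_le
  refine ⟨45 + B, by linarith, fun y => ?_⟩
  have hpi := Real.pi_gt_three
  rcases lt_or_ge y 1 with hy | hy
  · rw [kk_of_lt hy, zero_sub, abs_neg, abs_of_pos (by positivity), div_le_iff₀ Real.pi_pos]
    nlinarith
  · set u := Real.log y with hu
    have hu0 : 0 ≤ u := Real.log_nonneg hy
    have hyu : y = Real.exp u := (Real.exp_log (by linarith)).symm
    by_contra! h
    have hc : Continuous fun v => (kk (Real.exp v) - 4 / Real.pi) ^ 2 :=
      (continuous_kk_exp.sub continuous_const).pow 2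
    have h1 : ∫ _v in u..(u + 1), (1 + B) ^ 2
        ≤ ∫ v in u..(u + 1), (kk (Real.exp v) - 4 / Real.pi) ^ 2 := by
      refine intervalIntegral.integral_mono_on (by linarith) (by simp) (hc.intervalIntegrable _ _)
        fun v hv => ?_
      have h2 := abs_kk_exp_sub_le u v
      have h3 : |u - v| ≤ 1 := by rw [abs_le]; constructor <;> linarith [hv.1, hv.2]
      have h4 := abs_sub_abs_le_abs_sub (kk y - 4 / Real.pi) (kk (Real.exp v) - 4 / Real.pi)
      rw [sub_sub_sub_cancel_right, hyu] at h4
      rw [hyu] at h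
      rw [← sq_abs (kk (Real.exp v) - 4 / Real.pi)]
      gcongr
      linarith
    have h2 : ∫ v in u..(u + 1), (kk (Real.exp v) - 4 / Real.pi) ^ 2
        ≤ ∫ v in (0 : ℝ)..(u + 1), (kk (Real.exp v) - 4 / Real.pi) ^ 2 :=
      intervalIntegral.integral_mono_interval hu0 (by linarith) le_rfl
        (Eventually.of_forall fun v => sq_nonneg _) (hc.intervalIntegrable _ _)
    have h3 := hB (u + 1) (by linarith)
    simp at h1
    nlinarith

/-- Riemann sum comparison on [log n, log(n+1)], whose length lies between 1/(n+1) and 1/n. The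
Lipschitz constant 44 controls the oscillation, and the errors telescope through 1/n − 1/(n+1). -/
lemma sum_kk_sub_sq_le_integral (U : ℝ) {N : ℕ} (hN : 1 ≤ N) :
    ∑ d ∈ Ioc 1 N, 1 / (d : ℝ) * (kk (Real.exp (U - Real.log d)) - 4 / Real.pi) ^ 2
      ≤ 2 * (∫ w in (0 : ℝ)..Real.log N, (kk (Real.exp (U - w)) - 4 / Real.pi) ^ 2)
        + 4 * 44 ^ 2 * (1 - 1 / (N : ℝ)) := by
  set F : ℝ → ℝ := fun w => (kk (Real.exp (U - w)) - 4 / Real.pi) ^ 2 with hF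
  have hc : Continuous F :=
    ((continuous_kk_exp.comp (continuous_const.sub continuous_id)).sub continuous_const).pow 2
  induction N, hN using Nat.le_induction with
  | base => simp
  | succ n hn ih =>
    have hn0 : (0 : ℝ) < n := by positivity
    have hn1 : (1 : ℝ) ≤ n := by exact_mod_cast hn
    rw [sum_Ioc_succ_top (by omega), ← intervalIntegral.integral_add_adjacent_intervals
      (hc.intervalIntegrable 0 (Real.log n)) (hc.intervalIntegrable (Real.log n) _)]
    set a := Real.log n with ha
    set b := Real.log ((n + 1 : ℕ) : ℝ) with hb
    set ℓ := b - a with hℓ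
    have hl : ℓ = Real.log ((n + 1 : ℕ) / n) := by
      rw [hℓ, ha, hb, Real.log_div (by positivity) (by positivity)]
    have hl1 : ℓ ≤ 1 / n := by
      rw [hl]
      refine (Real.log_le_sub_one_of_pos (by positivity)).trans (le_of_eq ?_)
      push_cast
      field_simp
      ring
    have hl2 : 1 / ((n + 1 : ℕ) : ℝ) ≤ ℓ := by
      rw [hl]
      refine le_trans (le_of_eq ?_) (Real.one_sub_inv_le_log_of_pos (by positivity))
      push_cast
      field_simp
      ring
    have hl0 : 0 ≤ ℓ := le_trans (by positivity) hl2
    set q := kk (Real.exp (U - b)) - 4 / Real.pi with hq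
    have h1 : ℓ * q ^ 2 ≤ 2 * (∫ w in a..b, F w) + ℓ * (2 * (44 * ℓ) ^ 2) := by
      have h2 : ∫ _w in a..b, q ^ 2 ≤ ∫ w in a..b, (2 * F w + 2 * (44 * ℓ) ^ 2) := by
        refine intervalIntegral.integral_mono_on (by linarith) (by simp)
          (((hc.const_mul 2).add continuous_const).intervalIntegrable _ _) fun w hw => ?_
        have h3 := abs_kk_exp_sub_le (U - b) (U - w)
        have h4 : |U - b - (U - w)| ≤ ℓ := by rw [abs_le]; constructor <;> linarith [hw.1, hw.2]
        have h5 : |q - (kk (Real.exp (U - w)) - 4 / Real.pi)| ≤ 44 * ℓ := by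
          rw [hq, sub_sub_sub_cancel_right]; linarith
        have h6 := sq_le_sq' (abs_le.mp h5).1 (abs_le.mp h5).2
        simp only [hF]
        nlinarith [sq_nonneg (q - 2 * (kk (Real.exp (U - w)) - 4 / Real.pi))]
      rw [intervalIntegral.integral_add ((hc.const_mul 2).intervalIntegrable _ _) (by simp),
        intervalIntegral.integral_const_mul, intervalIntegral.integral_const,
        intervalIntegral.integral_const] at h2
      simpa only [smul_eq_mul] using h2
    have h2 : 1 / ((n + 1 : ℕ) : ℝ) * q ^ 2 ≤ ℓ * q ^ 2 :=
      mul_le_mul_of_nonneg_right hl2 (sq_nonneg q)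
    have h3 : ℓ * (2 * (44 * ℓ) ^ 2) ≤ 4 * 44 ^ 2 * (1 / n - 1 / ((n + 1 : ℕ) : ℝ)) := by
      have e : (1 : ℝ) / n - 1 / ((n + 1 : ℕ) : ℝ) = 1 / (n * (n + 1)) := by
        push_cast; field_simp; ring
      have h4 : ℓ ^ 2 ≤ (1 / n) ^ 2 := by gcongr
      have h5 : (1 / (n : ℝ)) ^ 2 ≤ 2 * (1 / (n * (n + 1))) := by
        rw [div_pow, one_pow, ← sub_nonneg]
        have : 2 * (1 / ((n : ℝ) * (n + 1))) - 1 / (n : ℝ) ^ 2 = (n - 1) / (n ^ 2 * (n + 1)) := by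
          field_simp; ring
        rw [this]
        exact div_nonneg (by linarith) (by positivity)
      have h6 : ℓ ≤ 1 := hl1.trans (by rw [div_le_one hn0]; exact hn1)
      rw [e]
      nlinarith [mul_le_mul_of_nonneg_right h6 (sq_nonneg ℓ)]
    nlinarith

lemma exists_ev_kk_sub_sq_le : ∃ B : ℝ, 0 ≤ B ∧ ∀ y : ℝ,
    ev (til (ζ : ArithmeticFunction ℝ)) (fun t => (kk t - 4 / Real.pi) ^ 2) y ≤ B := by
  obtain ⟨B, hB0, hB⟩ := exists_integral_kk_sub_sq_le
  obtain ⟨Q, hQ1, hQ⟩ := exists_abs_kk_sub_le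
  refine ⟨Q ^ 2 + 2 * B + 4 * 44 ^ 2, by positivity, fun y => ?_⟩
  rcases lt_or_ge y 1 with hy | hy
  · rw [ev, Nat.floor_eq_zero.mpr hy]
    simp only [Ioc_self, sum_empty]
    positivity
  have hN : 1 ≤ ⌊y⌋₊ := (Nat.one_le_floor_iff y).mpr hy
  set N := ⌊y⌋₊ with hNdef
  have hy0 : 0 < y := by linarith
  have hyU : Real.exp (Real.log y) = y := Real.exp_log hy0
  set U := Real.log y with hU
  have hU0 : 0 ≤ U := Real.log_nonneg hy
  have hterm : ∀ d ∈ Ioc 0 N, til (ζ : ArithmeticFunction ℝ) d * (kk (y / d) - 4 / Real.pi) ^ 2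
      = 1 / (d : ℝ) * (kk (Real.exp (U - Real.log d)) - 4 / Real.pi) ^ 2 := fun d hd => by
    have hd0 : d ≠ 0 := by have := (mem_Ioc.mp hd).1; omega
    rw [til_apply, natCoe_apply, zeta_apply, if_neg hd0, Real.exp_sub, hyU,
      Real.exp_log (by positivity)]
    push_cast
    rfl
  rw [ev, sum_congr rfl hterm, ← sum_Ioc_consecutive _ (Nat.zero_le 1) hN]
  have h1 := sum_kk_sub_sq_le_integral U hN
  have hc : Continuous fun v => (kk (Real.exp v) - 4 / Real.pi) ^ 2 :=
    (continuous_kk_exp.sub continuous_const).pow 2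
  have hc2 : Continuous fun w => (kk (Real.exp (U - w)) - 4 / Real.pi) ^ 2 :=
    hc.comp (continuous_const.sub continuous_id)
  have h2 : ∫ w in (0 : ℝ)..Real.log N, (kk (Real.exp (U - w)) - 4 / Real.pi) ^ 2
      ≤ ∫ w in (0 : ℝ)..U, (kk (Real.exp (U - w)) - 4 / Real.pi) ^ 2 :=
    intervalIntegral.integral_mono_interval le_rfl (Real.log_natCast_nonneg N)
      (Real.log_le_log (by positivity) (Nat.floor_le hy0.le))
      (Eventually.of_forall fun v => sq_nonneg _) (hc2.intervalIntegrable _ _)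
  have e2 : ∫ w in (0 : ℝ)..U, (kk (Real.exp (U - w)) - 4 / Real.pi) ^ 2
      = ∫ w in (0 : ℝ)..U, (kk (Real.exp w) - 4 / Real.pi) ^ 2 := by
    rw [intervalIntegral.integral_comp_sub_left (fun v => (kk (Real.exp v) - 4 / Real.pi) ^ 2) U,
      sub_self, sub_zero]
  rw [e2] at h2
  have h3 := hB U hU0
  have h4 : ∑ d ∈ Ioc (0 : ℕ) 1, 1 / (d : ℝ) * (kk (Real.exp (U - Real.log d)) - 4 / Real.pi) ^ 2
      ≤ Q ^ 2 := by
    have e : Ioc (0 : ℕ) 1 = {1} := rfl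
    rw [e, sum_singleton, ← sq_abs]
    have := hQ (Real.exp (U - Real.log (1 : ℕ)))
    simp only [Nat.cast_one, div_one, one_mul] at this ⊢
    gcongr
  have h5 : (0 : ℝ) ≤ 1 / (N : ℝ) := by positivity
  linarith

/-- The convolution `∑ (ff * ff) n log (x / n)`. -/
noncomputable def vv (z : ℕ) (x : ℝ) : ℝ := ev (ff z * ff z) Real.log x

lemma vv_eq (z : ℕ) (x : ℝ) : vv z x = ev (ee z) kk x := by
  rw [vv, ff_mul_ff_eq, ev_mul]
  rfl

lemma ev_of_lt (c : ArithmeticFunction ℝ) (h : ℝ → ℝ) {x : ℝ} (hx : x < 1) : ev c h x = 0 := by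
  rw [ev, Nat.floor_eq_zero.mpr hx]
  simp

lemma vv_of_lt (z : ℕ) {x : ℝ} (hx : x < 1) : vv z x = 0 := ev_of_lt _ _ hx

/-- The average value of `vv z`. -/
noncomputable def cc (z : ℕ) : ℝ := 4 / Real.pi * ∑' n, ee z n

lemma cc_eq (z : ℕ) : cc z = 16 * landauA ^ 2 / (Real.pi * gz z ^ 2) := by
  rw [cc, tsum_ee]
  have := gz_pos z
  have := Real.pi_pos
  field_simp
  ring

lemma cc_nonneg (z : ℕ) : 0 ≤ cc z :=
  mul_nonneg (by positivity) (tsum_nonneg (ee_nonneg z))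

lemma cc_le (z : ℕ) : cc z ≤ 2 * hz z := by
  have h1 : 4 / Real.pi ≤ 2 := by
    rw [div_le_iff₀ Real.pi_pos]; linarith [Real.pi_gt_three]
  exact mul_le_mul h1 (tsum_ee_le z) (tsum_nonneg (ee_nonneg z)) (by norm_num)

lemma sum_ee_le (z : ℕ) (s : Finset ℕ) : ∑ n ∈ s, ee z n ≤ hz z :=
  ((summable_ee z).sum_le_tsum s fun n _ => ee_nonneg z n).trans (tsum_ee_le z)

/-- Rankin's trick: 1 ≤ (n/y)^{1/4} for n > y. -/
lemma tsum_ee_sub_le (z : ℕ) {y : ℝ} (hy : 1 ≤ y) :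
    ∑' n, ee z n - ∑ n ∈ Ioc 0 ⌊y⌋₊, ee z n ≤ y ^ (-(1 / 4) : ℝ) * hz z := by
  have hy0 : 0 < y := by linarith
  rw [← (summable_ee z).sum_add_tsum_compl (s := Ioc 0 ⌊y⌋₊), add_sub_cancel_left]
  have h1 : ∀ n : {n // n ∉ Ioc 0 ⌊y⌋₊}, ee z n ≤ y ^ (-(1 / 4) : ℝ) * wz z (3 / 4) n := by
    rintro ⟨n, hn⟩
    rcases Nat.eq_zero_or_pos n with rfl | hn0
    · simp
    have hyn : y < n := by
      refine (Nat.floor_lt hy0.le).mp ?_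
      simp only [mem_Ioc, not_and, not_le] at hn
      exact hn hn0
    simp only
    rw [wz_eq_ee_mul, mul_left_comm]
    refine le_mul_of_one_le_right (ee_nonneg z n) ?_
    rw [Real.rpow_neg hy0.le, inv_mul_eq_div, one_le_div (by positivity)]
    gcongr
  have h2 := (summable_wz z).subtype (fun n => n ∉ Ioc 0 ⌊y⌋₊)
  have h3 := (summable_ee z).subtype (fun n => n ∉ Ioc 0 ⌊y⌋₊)
  refine (h3.tsum_le_tsum h1 (h2.mul_left _)).trans ?_
  rw [tsum_mul_left]
  gcongr
  exact (summable_wz z).tsum_subtype_le _ _ (wz_nonneg z _)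

lemma abs_vv_sub_le {Q : ℝ} (hQ : ∀ y : ℝ, |kk y - 4 / Real.pi| ≤ Q) (z : ℕ) (x : ℝ) :
    |vv z x - cc z| ≤ Q * hz z := by
  have h1 : vv z x = ∑' n, ee z n * kk (x / n) := by
    rw [vv_eq, ev, tsum_eq_sum fun n hn => ?_]
    rcases Nat.eq_zero_or_pos n with rfl | hn0
    · simp
    rw [kk_of_lt, mul_zero]
    rw [div_lt_one (by positivity)]
    simp only [mem_Ioc, not_and, not_le] at hn
    exact Nat.lt_of_floor_lt (hn hn0)
  have hs : Summable fun n => ee z n * (kk (x / n) - 4 / Real.pi) := by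
    refine ((summable_ee z).mul_right Q).of_norm_bounded fun n => ?_
    rw [norm_mul, Real.norm_of_nonneg (ee_nonneg z n)]
    exact mul_le_mul_of_nonneg_left (hQ _) (ee_nonneg z n)
  have hs2 : Summable fun n => ee z n * (4 / Real.pi) := (summable_ee z).mul_right _
  have h2 : vv z x - cc z = ∑' n, ee z n * (kk (x / n) - 4 / Real.pi) := by
    rw [h1, cc, mul_comm, ← tsum_mul_right, ← Summable.tsum_sub _ hs2]
    · simp only [mul_sub]
    · exact (hs.add hs2).congr fun n => by ring
  rw [h2, ← Real.norm_eq_abs]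
  refine (tsum_of_norm_bounded ((summable_ee z).mul_right Q).hasSum fun n => ?_).trans ?_
  · rw [norm_mul, Real.norm_of_nonneg (ee_nonneg z n)]
    exact mul_le_mul_of_nonneg_left (hQ _) (ee_nonneg z n)
  · rw [tsum_mul_right, mul_comm]
    have := tsum_ee_le z
    have hQ0 := (abs_nonneg _).trans (hQ 0)
    gcongr

lemma exists_abs_vv_le : ∃ B : ℝ, 1 ≤ B ∧ ∀ (z : ℕ) (x : ℝ), |vv z x - cc z| ≤ B * hz z ∧
    |vv z x| ≤ B * hz z := by
  obtain ⟨Q, hQ1, hQ⟩ := exists_abs_kk_sub_le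
  refine ⟨Q + 2, by linarith, fun z x => ?_⟩
  have h1 := abs_vv_sub_le hQ z x
  have h2 := cc_le z
  have h3 := cc_nonneg z
  have h4 := one_le_hz z
  have h5 := abs_add_le (vv z x - cc z) (cc z)
  rw [sub_add_cancel, abs_of_nonneg h3] at h5
  constructor <;> nlinarith

/-- The deviation is Σ_{n ≤ y} ee(n)(kk(y/n) − 4/π) minus 4/π times the missing tail of `ee`.
Cauchy–Schwarz with weight `ee` treats the first part, Rankin's bound the second. -/
lemma vv_sub_sq_le (z : ℕ) {y : ℝ} (hy : 1 ≤ y) : (vv z y - cc z) ^ 2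
    ≤ 2 * (hz z * ev (ee z) (fun t => (kk t - 4 / Real.pi) ^ 2) y) + 8 * hz z ^ 2 * y ^ (-(1 / 2) : ℝ) := by
  have hy0 : 0 < y := by linarith
  set a := ∑ n ∈ Ioc 0 ⌊y⌋₊, ee z n * (kk (y / n) - 4 / Real.pi) with ha
  set t := ∑' n, ee z n - ∑ n ∈ Ioc 0 ⌊y⌋₊, ee z n with ht
  have e : vv z y - cc z = a - 4 / Real.pi * t := by
    rw [vv_eq, ev, cc, ha, ht]
    simp only [mul_sub, sum_sub_distrib, ← Finset.sum_mul]
    ring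
  have ht0 : 0 ≤ t := sub_nonneg.mpr ((summable_ee z).sum_le_tsum _ fun n _ => ee_nonneg z n)
  have ht1 := tsum_ee_sub_le z hy
  rw [← ht] at ht1
  have ha2 : a ^ 2 ≤ hz z * ev (ee z) (fun t => (kk t - 4 / Real.pi) ^ 2) y := by
    have h1 := sum_mul_sq_le_sq_mul_sq (Ioc 0 ⌊y⌋₊) (fun n => √(ee z n))
      fun n => √(ee z n) * (kk (y / n) - 4 / Real.pi)
    have h2 : ∀ n, √(ee z n) * (√(ee z n) * (kk (y / n) - 4 / Real.pi))
        = ee z n * (kk (y / n) - 4 / Real.pi) := fun n => by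
      rw [← mul_assoc, Real.mul_self_sqrt (ee_nonneg z n)]
    simp only [h2, mul_pow, Real.sq_sqrt (ee_nonneg z _)] at h1
    exact h1.trans (mul_le_mul_of_nonneg_right (sum_ee_le z _)
      (sum_nonneg fun n _ => mul_nonneg (ee_nonneg z n) (sq_nonneg _)))
  have h4 : 4 / Real.pi ≤ 4 / 3 := div_le_div_of_nonneg_left (by norm_num) (by norm_num)
    Real.pi_gt_three.le
  have h5 : (4 / Real.pi * t) ^ 2 ≤ 4 * hz z ^ 2 * y ^ (-(1 / 2) : ℝ) := by
    have e1 : y ^ (-(1 / 2) : ℝ) = (y ^ (-(1 / 4) : ℝ)) ^ 2 := by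
      rw [← Real.rpow_natCast, ← Real.rpow_mul hy0.le]; norm_num
    have h6 : 4 / Real.pi * t ≤ 2 * (y ^ (-(1 / 4) : ℝ) * hz z) :=
      mul_le_mul (by linarith) ht1 ht0 (by norm_num)
    rw [e1]
    calc (4 / Real.pi * t) ^ 2 ≤ (2 * (y ^ (-(1 / 4) : ℝ) * hz z)) ^ 2 := by gcongr
      _ = _ := by ring
  rw [e]
  nlinarith [sq_nonneg (a + 4 / Real.pi * t)]

end SumTwoSquaresSieve
end

/-! ### Asymptotics of the model sums `tt` and `th` -/

section
namespace SumTwoSquaresSieve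
open Finset ArithmeticFunction Filter Topology
open scoped ArithmeticFunction.zeta ArithmeticFunction.Moebius

/-- Exchanging the sums over d and over the argument of `ee` leaves, inside, the averages of (kk −
4/π)² with weight 1/d, bounded uniformly. The Rankin terms sum to O(1) since Σ d^{-1/2} = O(√x). -/
lemma exists_sum_vv_sub_sq_le : ∃ B : ℝ, 0 ≤ B ∧ ∀ (z : ℕ) (x : ℝ), 1 ≤ x →
    ∑ d ∈ Ioc 0 ⌊x⌋₊, 1 / (d : ℝ) * (vv z (x / d) - cc z) ^ 2 ≤ B * hz z ^ 2 := by
  obtain ⟨B, hB0, hB⟩ := exists_ev_kk_sub_sq_le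
  refine ⟨2 * B + 16, by positivity, fun z x hx => ?_⟩
  have hx0 : 0 < x := by linarith
  set F : ℝ → ℝ := fun t => (kk t - 4 / Real.pi) ^ 2 with hF
  have hH := one_le_hz z
  have h1 : ∑ d ∈ Ioc 0 ⌊x⌋₊, 1 / (d : ℝ) * ev (ee z) F (x / d) ≤ B * hz z := by
    have e : ∑ d ∈ Ioc 0 ⌊x⌋₊, 1 / (d : ℝ) * ev (ee z) F (x / d)
        = ev (til (ζ : ArithmeticFunction ℝ)) (ev (ee z) F) x := by
      rw [ev]
      refine sum_congr rfl fun d hd => ?_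
      have hd0 : d ≠ 0 := by have := (mem_Ioc.mp hd).1; omega
      rw [til_apply, natCoe_apply, zeta_apply, if_neg hd0]
      push_cast
      rfl
    rw [e, ← ev_mul, mul_comm, ev_mul, ev]
    calc _ ≤ ∑ n ∈ Ioc 0 ⌊x⌋₊, ee z n * B :=
          sum_le_sum fun n _ => mul_le_mul_of_nonneg_left (hB _) (ee_nonneg z n)
      _ ≤ B * hz z := by
          rw [← Finset.sum_mul, mul_comm]
          exact mul_le_mul_of_nonneg_left (sum_ee_le z _) hB0
  have h2 : ∑ d ∈ Ioc 0 ⌊x⌋₊, 1 / (d : ℝ) * (x / d) ^ (-(1 / 2) : ℝ) ≤ 2 := by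
    have h3 := sum_div_sqrt_le (a := fun _ => 1) (B := 1) zero_le_one (by simp) ⌊x⌋₊
    have hs : 0 < √x := Real.sqrt_pos.mpr hx0
    have h4 : ∀ d : ℕ, 1 / (d : ℝ) * (x / d) ^ (-(1 / 2) : ℝ) = 1 / √d * (1 / √x) := fun d => by
      rcases eq_or_ne d 0 with rfl | hd
      · simp
      have hd0 : (0 : ℝ) < d := by positivity
      have hd1 := Real.sqrt_pos.mpr hd0
      have hd2 := Real.sq_sqrt hd0.le
      rw [Real.rpow_neg (by positivity), ← Real.sqrt_eq_rpow, Real.sqrt_div hx0.le]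
      nth_rw 1 [← hd2]
      field_simp
    rw [sum_congr rfl fun d _ => h4 d, ← Finset.sum_mul, mul_one_div, div_le_iff₀ hs]
    have h5 : √(⌊x⌋₊ : ℝ) ≤ √x := Real.sqrt_le_sqrt (Nat.floor_le hx0.le)
    linarith
  calc ∑ d ∈ Ioc 0 ⌊x⌋₊, 1 / (d : ℝ) * (vv z (x / d) - cc z) ^ 2
      ≤ ∑ d ∈ Ioc 0 ⌊x⌋₊, 1 / (d : ℝ) * (2 * (hz z * ev (ee z) F (x / d))
        + 8 * hz z ^ 2 * (x / d) ^ (-(1 / 2) : ℝ)) := by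
        refine sum_le_sum fun d hd => ?_
        have hd' := mem_Ioc.mp hd
        have hd0 : (0 : ℝ) < d := by exact_mod_cast hd'.1
        gcongr
        refine vv_sub_sq_le z ?_
        rw [one_le_div hd0]
        exact (Nat.le_floor_iff hx0.le).mp hd'.2
    _ = 2 * hz z * (∑ d ∈ Ioc 0 ⌊x⌋₊, 1 / (d : ℝ) * ev (ee z) F (x / d))
        + 8 * hz z ^ 2 * ∑ d ∈ Ioc 0 ⌊x⌋₊, 1 / (d : ℝ) * (x / d) ^ (-(1 / 2) : ℝ) := by
        rw [Finset.mul_sum, Finset.mul_sum, ← sum_add_distrib]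
        exact sum_congr rfl fun d _ => by ring
    _ ≤ 2 * hz z * (B * hz z) + 8 * hz z ^ 2 * 2 := by gcongr
    _ = _ := by ring

lemma sqrt_log_le {n : ℕ} (hn : n ≠ 0) : √(Real.log n) ≤ 2 * (n : ℝ) ^ (1 / 4 : ℝ) := by
  have hn0 : (0 : ℝ) < n := by positivity
  rw [Real.sqrt_le_left (by positivity), mul_pow, ← Real.rpow_natCast ((n : ℝ) ^ (1 / 4 : ℝ)),
    ← Real.rpow_mul hn0.le]
  have h1 := Real.log_le_sub_one_of_pos (Real.sqrt_pos.mpr hn0)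
  rw [Real.log_sqrt hn0.le] at h1
  have h2 : (n : ℝ) ^ ((1 / 4 : ℝ) * (2 : ℕ)) = √n := by rw [Real.sqrt_eq_rpow]; norm_num
  rw [h2]
  linarith [Real.sqrt_nonneg (n : ℝ)]

lemma abs_sqrt_sub_sqrt_sub_le (u : ℝ) {w : ℝ} (hw : 0 ≤ w) : |√(u - w) - √u| ≤ √w := by
  have h1 : √(u - w) ≤ √u := Real.sqrt_le_sqrt (by linarith)
  have h2 : √u ≤ √(u - w) + √w := by
    rcases le_or_gt u w with h | h
    · exact (Real.sqrt_le_sqrt h).trans (le_add_of_nonneg_left (Real.sqrt_nonneg _))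
    · rw [Real.sqrt_le_left (by positivity)]
      have h3 := Real.sq_sqrt hw
      have h4 := Real.sq_sqrt (sub_pos.mpr h).le
      nlinarith [mul_nonneg (Real.sqrt_nonneg (u - w)) (Real.sqrt_nonneg w)]
  rw [abs_sub_comm, abs_of_nonneg (by linarith)]
  linarith

/-- Uniform asymptotics for the summatory function of `ss z`. -/
lemma exists_abs_dd_sub_le_hz : ∃ B : ℝ, 1 ≤ B ∧ ∀ (z : ℕ) (u : ℝ), 0 ≤ u →
    |dd z (Real.exp u) - gz z * (√u / (2 * landauA))| ≤ B * hz z := by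
  obtain ⟨B, hB0, hB⟩ := exists_abs_dd_sub_le
  have hA := landauA_pos_and_sq.1
  refine ⟨B + 1 / landauA + 1, by have : 0 ≤ 1 / landauA := by positivity
                                  linarith, fun z u hu => ?_⟩
  set x := Real.exp u with hx
  have hx0 : 0 < x := Real.exp_pos u
  have h1 : dd z x = ∑' n, aa z n * dd 0 (x / n) := by
    have e : dd z x = ev (aa z) (dd 0) x := by
      have := ev_mul (aa z) (ss 0) (fun _ => 1) x
      rw [← ss_eq_ss_zero_mul] at this
      simpa only [dd, ev, mul_one] using this
    rw [e, ev, tsum_eq_sum fun n hn => ?_]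
    rcases Nat.eq_zero_or_pos n with rfl | hn0
    · simp
    have : x / n < 1 := by
      rw [div_lt_one (by positivity)]
      simp only [mem_Ioc, not_and, not_le] at hn
      exact Nat.lt_of_floor_lt (hn hn0)
    rw [dd, Nat.floor_eq_zero.mpr this]
    simp
  -- Passing from x/n to x changes the main term by at most √(log n)/(2A), which is O(n^{1/4}). The
  -- weight `wz` is exactly `ee` times n^{1/4} and absorbs this.
  have hbd : ∀ n : ℕ, ‖aa z n * (dd 0 (x / n) - √u / (2 * landauA))‖
      ≤ (B + 1 / landauA) * wz z (3 / 4) n := by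
    intro n
    rcases eq_or_ne n 0 with rfl | hn
    · simp
    have hn0 : (0 : ℝ) < n := by positivity
    have hn1 : 1 ≤ (n : ℝ) ^ (1 / 4 : ℝ) :=
      Real.one_le_rpow (by exact_mod_cast Nat.one_le_iff_ne_zero.mpr hn) (by norm_num)
    rw [norm_mul, wz_eq_ee_mul, Real.norm_eq_abs, Real.norm_eq_abs, mul_left_comm]
    refine mul_le_mul (abs_aa_le z n) ?_ (abs_nonneg _) (ee_nonneg z n)
    have hlog : 0 ≤ Real.log n := Real.log_natCast_nonneg n
    have h3 : |dd 0 (x / n) - √(u - Real.log n) / (2 * landauA)| ≤ B := by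
      have e : x / n = Real.exp (u - Real.log n) := by
        rw [Real.exp_sub, Real.exp_log hn0]
      rcases le_or_gt (Real.log n) u with h | h
      · rw [e]
        exact hB _ (by linarith)
      · rw [Real.sqrt_eq_zero_of_nonpos (by linarith), dd, Nat.floor_eq_zero.mpr]
        · simpa using hB0
        · rw [e, Real.exp_lt_one_iff]
          linarith
    have h4 : |√(u - Real.log n) / (2 * landauA) - √u / (2 * landauA)|
        ≤ 1 / landauA * (n : ℝ) ^ (1 / 4 : ℝ) := by
      rw [← sub_div, abs_div, abs_of_pos (by positivity : 0 < 2 * landauA),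
        div_le_iff₀ (by positivity)]
      calc _ ≤ _ := abs_sqrt_sub_sqrt_sub_le u hlog
        _ ≤ _ := sqrt_log_le hn
        _ = _ := by field_simp
    have h5 := abs_sub_le (dd 0 (x / n)) (√(u - Real.log n) / (2 * landauA)) (√u / (2 * landauA))
    nlinarith
  have hs1 : Summable fun n => aa z n * (dd 0 (x / n) - √u / (2 * landauA)) :=
    ((summable_wz z).mul_left _).of_norm_bounded hbd
  have hs2 : Summable fun n => aa z n * (√u / (2 * landauA)) := (summable_aa z).mul_right _
  have h2 : dd z x - gz z * (√u / (2 * landauA))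
      = ∑' n, aa z n * (dd 0 (x / n) - √u / (2 * landauA)) := by
    rw [h1, ← tsum_aa, ← tsum_mul_right, ← Summable.tsum_sub _ hs2]
    · simp only [mul_sub]
    · exact (hs1.add hs2).congr fun n => by ring
  rw [h2, ← Real.norm_eq_abs]
  refine (tsum_of_norm_bounded ((summable_wz z).mul_left _).hasSum hbd).trans ?_
  rw [tsum_mul_left]
  have := one_le_hz z
  change (B + 1 / landauA) * hz z ≤ _
  nlinarith

lemma sq_rpow_quarter {u : ℝ} (hu : 0 ≤ u) : ((1 + u) ^ (1 / 4 : ℝ)) ^ 2 = √(1 + u) := by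
  rw [← Real.rpow_natCast, ← Real.rpow_mul (by positivity), Real.sqrt_eq_rpow]
  norm_num

lemma one_le_rpow_quarter {u : ℝ} (hu : 0 ≤ u) : 1 ≤ (1 + u) ^ (1 / 4 : ℝ) :=
  Real.one_le_rpow (by linarith) (by norm_num)

/-- Cauchy–Schwarz with ss(d) ≤ 1/d: the total mass is O(hz·√(1+u)) and the mean square is O(hz²).
The outcome has half the exponent of the main term. -/
lemma exists_sum_ss_mul_abs_le : ∃ B : ℝ, 1 ≤ B ∧ ∀ (z : ℕ) (u : ℝ), 0 ≤ u →
    ∑ d ∈ Ioc 0 ⌊Real.exp u⌋₊, ss z d * |vv z (Real.exp u / d) - cc z|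
      ≤ B * hz z ^ 2 * (1 + u) ^ (1 / 4 : ℝ) := by
  obtain ⟨B1, hB1, h1⟩ := exists_abs_dd_sub_le_hz
  obtain ⟨B2, hB2, h2⟩ := exists_sum_vv_sub_sq_le
  have hA := landauA_pos_and_sq.1
  set b := 1 / (2 * landauA) + B1 + B2 with hb
  have hb0 : 0 < 1 / (2 * landauA) := by positivity
  refine ⟨b, by linarith, fun z u hu => ?_⟩
  set x := Real.exp u with hx
  set S := ∑ d ∈ Ioc 0 ⌊x⌋₊, ss z d * |vv z (x / d) - cc z| with hS
  have hx1 : 1 ≤ x := Real.one_le_exp hu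
  have hH := one_le_hz z
  have hsq := sq_rpow_quarter hu
  have hq := one_le_rpow_quarter hu
  set r := (1 + u) ^ (1 / 4 : ℝ) with hr
  have hdd : dd z x ≤ b * hz z * r ^ 2 := by
    have h3 := (abs_le.mp (h1 z u hu)).2
    have h4 : √u ≤ √(1 + u) := Real.sqrt_le_sqrt (by linarith)
    have h5 : gz z * (√u / (2 * landauA)) ≤ 1 / (2 * landauA) * r ^ 2 := by
      rw [hsq]
      calc gz z * (√u / (2 * landauA)) ≤ 1 * (√(1 + u) / (2 * landauA)) := by
            gcongr
            exact gz_le_one z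
        _ = _ := by ring
    have hr1 : 1 ≤ r ^ 2 := one_le_pow₀ hq
    have h6 : B1 * hz z ≤ B1 * hz z * r ^ 2 := le_mul_of_one_le_right (by positivity) hr1
    have h7 : 1 / (2 * landauA) * r ^ 2 ≤ 1 / (2 * landauA) * hz z * r ^ 2 := by
      gcongr
      exact le_mul_of_one_le_right hb0.le hH
    have h8 : 0 ≤ B2 * hz z * r ^ 2 := by positivity
    rw [hb]
    linarith
  have hCS : S ^ 2 ≤ dd z x * (B2 * hz z ^ 2) := by
    have h3 := sum_mul_sq_le_sq_mul_sq (Ioc 0 ⌊x⌋₊) (fun n => √(ss z n))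
      fun n => √(ss z n) * |vv z (x / n) - cc z|
    have h4 : ∀ n, √(ss z n) * (√(ss z n) * |vv z (x / n) - cc z|)
        = ss z n * |vv z (x / n) - cc z| := fun n => by
      rw [← mul_assoc, Real.mul_self_sqrt (ss_nonneg z n)]
    simp only [h4, mul_pow, Real.sq_sqrt (ss_nonneg z _), sq_abs] at h3
    refine h3.trans (mul_le_mul_of_nonneg_left ((sum_le_sum fun n _ => ?_).trans (h2 z x hx1))
      (dd_nonneg z x))
    rw [ss_apply]
    gcongr
    exact ind_le_one _ _
  have hle : S ^ 2 ≤ (b * hz z ^ 2 * r) ^ 2 := by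
    have hb1 : B2 ≤ b := by linarith
    have hbp : 0 ≤ b := by linarith
    calc S ^ 2 ≤ _ := hCS
      _ ≤ (b * hz z * r ^ 2) * (b * hz z ^ 2) := by gcongr
      _ = b ^ 2 * r ^ 2 * hz z ^ 3 * 1 := by ring
      _ ≤ b ^ 2 * r ^ 2 * hz z ^ 3 * hz z := by gcongr
      _ = _ := by ring
  exact le_of_sq_le_sq hle (by positivity)

/-- The one-dimensional sum `∑ ff z n * log (x / n)`. -/
noncomputable def tt (z : ℕ) (x : ℝ) : ℝ := ev (ff z) Real.log x

/-- Convolving with the inverse `ss z` undoes the squaring: ff = ss ∗ (ff ∗ ff). -/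
lemma tt_eq (z : ℕ) (x : ℝ) : tt z x = ev (ss z) (vv z) x := by
  have : ff z = ss z * (ff z * ff z) := by rw [← mul_assoc, ss_mul_ff, one_mul]
  rw [tt, this, ev_mul]
  rfl

/-- The main term of `tt z`. -/
noncomputable def mm (z : ℕ) : ℝ := 8 * landauA / (Real.pi * gz z)

lemma cc_mul_gz (z : ℕ) : cc z * (gz z / (2 * landauA)) = mm z := by
  rw [cc_eq, mm]
  have := (gz_pos z).ne'
  have := Real.pi_ne_zero
  have := landauA_pos_and_sq.1.ne'
  field_simp
  norm_num

lemma exists_abs_tt_sub_le : ∃ B : ℝ, 1 ≤ B ∧ ∀ (z : ℕ) (u : ℝ), 0 ≤ u →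
    |tt z (Real.exp u) - mm z * √u| ≤ B * hz z ^ 3 * (1 + u) ^ (1 / 4 : ℝ) := by
  obtain ⟨B1, hB1, h1⟩ := exists_abs_dd_sub_le_hz
  obtain ⟨B2, hB2, h2⟩ := exists_sum_ss_mul_abs_le
  refine ⟨B2 + 2 * B1, by linarith, fun z u hu => ?_⟩
  set x := Real.exp u with hx
  have e : tt z x - mm z * √u = ∑ d ∈ Ioc 0 ⌊x⌋₊, ss z d * (vv z (x / d) - cc z)
      + cc z * (dd z x - gz z * (√u / (2 * landauA))) := by
    rw [tt_eq, ← cc_mul_gz, ev, dd]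
    simp only [mul_sub, sum_sub_distrib, ← Finset.sum_mul]
    ring
  have h3 : |∑ d ∈ Ioc 0 ⌊x⌋₊, ss z d * (vv z (x / d) - cc z)|
      ≤ B2 * hz z ^ 2 * (1 + u) ^ (1 / 4 : ℝ) := by
    refine (abs_sum_le_sum_abs _ _).trans (le_trans (sum_le_sum fun d _ => ?_) (h2 z u hu))
    rw [abs_mul, abs_of_nonneg (ss_nonneg z d)]
  have h4 : |cc z * (dd z x - gz z * (√u / (2 * landauA)))| ≤ 2 * B1 * hz z ^ 2 := by
    rw [abs_mul, abs_of_nonneg (cc_nonneg z)]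
    calc _ ≤ (2 * hz z) * (B1 * hz z) :=
          mul_le_mul (cc_le z) (h1 z u hu) (abs_nonneg _) (by linarith [one_le_hz z])
      _ = _ := by ring
  have hH := one_le_hz z
  have hq := one_le_rpow_quarter hu
  set r := (1 + u) ^ (1 / 4 : ℝ) with hr
  have h23 : hz z ^ 2 ≤ hz z ^ 3 := pow_le_pow_right₀ hH (by norm_num)
  rw [e]
  calc _ ≤ _ := abs_add_le _ _
    _ ≤ B2 * hz z ^ 2 * r + 2 * B1 * hz z ^ 2 * 1 := by linarith
    _ ≤ B2 * hz z ^ 3 * r + 2 * B1 * hz z ^ 3 * r := by gcongr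
    _ = _ := by ring

/-- The two-dimensional sum `∑ ss z d * vv z (x / d) * vv z (y / d)`. -/
noncomputable def th (z : ℕ) (x y : ℝ) : ℝ :=
  ∑ d ∈ Ioc 0 ⌊x⌋₊, ss z d * vv z (x / d) * vv z (y / d)

/-- The main term of `th z`. -/
noncomputable def ka (z : ℕ) : ℝ := 128 * landauA ^ 3 / (Real.pi ^ 2 * gz z ^ 3)

lemma cc_sq_mul_gz (z : ℕ) : cc z ^ 2 * (gz z / (2 * landauA)) = ka z := by
  rw [cc_eq, ka]
  have := (gz_pos z).ne'
  have := Real.pi_ne_zero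
  have := landauA_pos_and_sq.1.ne'
  field_simp
  norm_num

/-- Replace the two factors `vv` by `cc` one after the other, then insert the asymptotics of `dd`.
The range of d is governed by the smaller variable, so only its logarithm enters the main term. -/
lemma exists_abs_th_sub_le : ∃ B : ℝ, 1 ≤ B ∧ ∀ (z : ℕ) (u v : ℝ), 0 ≤ u → u ≤ v →
    |th z (Real.exp u) (Real.exp v) - ka z * √u| ≤ B * hz z ^ 3 * (1 + v) ^ (1 / 4 : ℝ) := by
  obtain ⟨B1, hB1, h1⟩ := exists_abs_dd_sub_le_hz
  obtain ⟨B2, hB2, h2⟩ := exists_sum_ss_mul_abs_le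
  obtain ⟨B3, hB3, h3⟩ := exists_abs_vv_le
  refine ⟨B3 * B2 + 2 * B2 + 4 * B1, by nlinarith, fun z u v hu huv => ?_⟩
  set x := Real.exp u with hx
  set y := Real.exp v with hy
  have hv : 0 ≤ v := hu.trans huv
  have e : th z x y - ka z * √u
      = ∑ d ∈ Ioc 0 ⌊x⌋₊, ss z d * (vv z (x / d) - cc z) * vv z (y / d)
      + cc z * ∑ d ∈ Ioc 0 ⌊x⌋₊, ss z d * (vv z (y / d) - cc z)
      + cc z ^ 2 * (dd z x - gz z * (√u / (2 * landauA))) := by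
    have e1 : ka z * √u = cc z ^ 2 * (gz z * (√u / (2 * landauA))) := by
      rw [← cc_sq_mul_gz]; ring
    rw [th, e1, dd, mul_sub, Finset.mul_sum, Finset.mul_sum, ← add_sub_assoc, ← sum_add_distrib,
      ← sum_add_distrib]
    congr 1
    exact sum_congr rfl fun d _ => by ring
  have hH := one_le_hz z
  have hqu := one_le_rpow_quarter hu
  have hquv : (1 + u) ^ (1 / 4 : ℝ) ≤ (1 + v) ^ (1 / 4 : ℝ) := by gcongr
  set r := (1 + v) ^ (1 / 4 : ℝ) with hr
  have h4 : |∑ d ∈ Ioc 0 ⌊x⌋₊, ss z d * (vv z (x / d) - cc z) * vv z (y / d)|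
      ≤ B3 * B2 * hz z ^ 3 * r := by
    calc _ ≤ ∑ d ∈ Ioc 0 ⌊x⌋₊, ss z d * |vv z (x / d) - cc z| * (B3 * hz z) := by
          refine (abs_sum_le_sum_abs _ _).trans (sum_le_sum fun d _ => ?_)
          rw [abs_mul, abs_mul, abs_of_nonneg (ss_nonneg z d)]
          exact mul_le_mul_of_nonneg_left (h3 z _).2 (mul_nonneg (ss_nonneg z d) (abs_nonneg _))
      _ ≤ (B2 * hz z ^ 2 * r) * (B3 * hz z) := by
          rw [← Finset.sum_mul]
          refine mul_le_mul_of_nonneg_right ((h2 z u hu).trans ?_) (by positivity)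
          gcongr
      _ = _ := by ring
  have h5 : |cc z * ∑ d ∈ Ioc 0 ⌊x⌋₊, ss z d * (vv z (y / d) - cc z)|
      ≤ 2 * B2 * hz z ^ 3 * r := by
    rw [abs_mul, abs_of_nonneg (cc_nonneg z)]
    calc _ ≤ (2 * hz z) * (B2 * hz z ^ 2 * r) := by
          refine mul_le_mul (cc_le z) ?_ (abs_nonneg _) (by linarith)
          refine (abs_sum_le_sum_abs _ _).trans (le_trans ?_ (h2 z v hv))
          simp only [abs_mul, abs_of_nonneg (ss_nonneg z _)]
          exact sum_le_sum_of_subset_of_nonneg (Ioc_subset_Ioc_right (Nat.floor_mono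
            (Real.exp_le_exp.mpr huv))) fun d _ _ => mul_nonneg (ss_nonneg z d) (abs_nonneg _)
      _ = _ := by ring
  have h6 : |cc z ^ 2 * (dd z x - gz z * (√u / (2 * landauA)))| ≤ 4 * B1 * hz z ^ 3 * r := by
    rw [abs_mul, abs_of_nonneg (sq_nonneg (cc z))]
    calc _ ≤ (2 * hz z) ^ 2 * (B1 * hz z) :=
          mul_le_mul (pow_le_pow_left₀ (cc_nonneg z) (cc_le z) 2) (h1 z u hu) (abs_nonneg _)
            (by positivity)
      _ = 4 * B1 * hz z ^ 3 * 1 := by ring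
      _ ≤ _ := by gcongr; linarith
  rw [e]
  calc _ ≤ _ := (abs_add_le _ _).trans (add_le_add_left (abs_add_le _ _) _)
    _ ≤ B3 * B2 * hz z ^ 3 * r + 2 * B2 * hz z ^ 3 * r + 4 * B1 * hz z ^ 3 * r := by linarith
    _ = _ := by ring

end SumTwoSquaresSieve
end

/-! ### The algebra of dilations in two variables -/

section
namespace SumTwoSquaresSieve
open Finset

/-- The algebra of dilation operators on functions of two positive integers. -/
abbrev Dil := MonoidAlgebra ℝ (ℕ × ℕ)

/-- The dilation `F ↦ F (· * m)`. -/
def dilate : ℕ × ℕ →* Module.End ℝ (ℕ × ℕ → ℝ) where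
  toFun m :=
    { toFun := fun F t => F (t * m)
      map_add' := fun _ _ => rfl
      map_smul' := fun _ _ => rfl }
  map_one' := by
    ext F t
    simp
  map_mul' m n := by
    refine LinearMap.ext fun F => funext fun t => ?_
    change F (t * (m * n)) = F (t * m * n)
    rw [mul_assoc]

/-- The action of the dilation algebra. -/
noncomputable def act : Dil →ₐ[ℝ] Module.End ℝ (ℕ × ℕ → ℝ) := MonoidAlgebra.lift ℝ _ _ dilate

lemma act_single (m : ℕ × ℕ) (r : ℝ) (F : ℕ × ℕ → ℝ) (t : ℕ × ℕ) :
    act (MonoidAlgebra.single m r) F t = r * F (t * m) := by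
  rw [act, MonoidAlgebra.lift_single]
  rfl

lemma act_mul (ξ η : Dil) (F : ℕ × ℕ → ℝ) : act (ξ * η) F = act ξ (act η F) := by
  rw [map_mul]; rfl

lemma act_add (ξ η : Dil) (F : ℕ × ℕ → ℝ) (t : ℕ × ℕ) :
    act (ξ + η) F t = act ξ F t + act η F t := by
  rw [map_add]; rfl

lemma act_sub (ξ η : Dil) (F : ℕ × ℕ → ℝ) (t : ℕ × ℕ) :
    act (ξ - η) F t = act ξ F t - act η F t := by
  rw [map_sub]; rfl

lemma act_one (F : ℕ × ℕ → ℝ) : act 1 F = F := by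
  rw [map_one]; rfl

/-- The functions supported on `[1, N]²`. -/
def finSupp (N : ℕ) : Submodule ℝ (ℕ × ℕ → ℝ) where
  carrier := {F | ∀ t, ¬ ((1 ≤ t.1 ∧ t.1 ≤ N) ∧ 1 ≤ t.2 ∧ t.2 ≤ N) → F t = 0}
  add_mem' hF hG t ht := by
    rw [Pi.add_apply, hF t ht, hG t ht, add_zero]
  zero_mem' _ _ := rfl
  smul_mem' c F hF t ht := by
    change c * F t = 0
    rw [hF t ht, mul_zero]

lemma act_mem_finSupp {N : ℕ} (ξ : Dil) {F : ℕ × ℕ → ℝ} (hF : F ∈ finSupp N) :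
    act ξ F ∈ finSupp N := by
  induction ξ using MonoidAlgebra.induction_linear with
  | zero => rw [_root_.map_zero]; exact zero_mem _
  | add x y hx hy => rw [map_add]; exact add_mem hx hy
  | single m r =>
    intro t ht
    rw [act_single, hF, mul_zero]
    intro h
    refine ht ⟨⟨?_, ?_⟩, ?_, ?_⟩
    · exact Nat.pos_of_mul_pos_right h.1.1
    · exact (Nat.le_mul_of_pos_right _ (Nat.pos_of_mul_pos_left h.1.1)).trans h.1.2
    · exact Nat.pos_of_mul_pos_right h.2.1
    · exact (Nat.le_mul_of_pos_right _ (Nat.pos_of_mul_pos_left h.2.1)).trans h.2.2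

lemma act_prod_congr {N : ℕ} {P : Finset ℕ} {ξ η : ℕ → Dil}
    (h : ∀ p ∈ P, ∀ F ∈ finSupp N, act (ξ p) F = act (η p) F) {F : ℕ × ℕ → ℝ}
    (hF : F ∈ finSupp N) : act (∏ p ∈ P, ξ p) F = act (∏ p ∈ P, η p) F := by
  induction P using Finset.induction_on with
  | empty => simp
  | insert q P hq ih =>
    rw [prod_insert hq, prod_insert hq, act_mul, act_mul,
      ih fun p hp => h p (mem_insert_of_mem hp)]
    exact h q (mem_insert_self q P) _ (act_mem_finSupp _ hF)

/-- The operator of `ξ` has norm at most `ε` for the supremum norm. -/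
def NormLE (ξ : Dil) (ε : ℝ) : Prop :=
  0 ≤ ε ∧ ∀ (F : ℕ × ℕ → ℝ) (K : ℝ), (∀ t, |F t| ≤ K) → ∀ t, |act ξ F t| ≤ ε * K

namespace NormLE

lemma mono {ξ : Dil} {ε δ : ℝ} (h : NormLE ξ ε) (hε : ε ≤ δ) : NormLE ξ δ :=
  ⟨h.1.trans hε, fun F K hF t => (h.2 F K hF t).trans
    (mul_le_mul_of_nonneg_right hε ((abs_nonneg _).trans (hF t)))⟩

lemma single (m : ℕ × ℕ) (r : ℝ) : NormLE (MonoidAlgebra.single m r) |r| :=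
  ⟨abs_nonneg r, fun F K hF t => by
    rw [act_single, abs_mul]
    exact mul_le_mul_of_nonneg_left (hF _) (abs_nonneg r)⟩

lemma one : NormLE 1 1 := ⟨zero_le_one, fun F K hF t => by rw [act_one, one_mul]; exact hF t⟩

lemma const (r : ℝ) : NormLE (algebraMap ℝ Dil r) |r| := by
  refine ⟨abs_nonneg r, fun F K hF t => ?_⟩
  have : act (algebraMap ℝ Dil r) F t = r * F t := by
    rw [AlgHom.commutes]; rfl
  rw [this, abs_mul]
  exact mul_le_mul_of_nonneg_left (hF _) (abs_nonneg r)

lemma add {ξ η : Dil} {ε δ : ℝ} (h : NormLE ξ ε) (h' : NormLE η δ) : NormLE (ξ + η) (ε + δ) :=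
  ⟨add_nonneg h.1 h'.1, fun F K hF t => by
    rw [act_add, add_mul]
    exact (abs_add_le _ _).trans (add_le_add (h.2 F K hF t) (h'.2 F K hF t))⟩

lemma mul {ξ η : Dil} {ε δ : ℝ} (h : NormLE ξ ε) (h' : NormLE η δ) : NormLE (ξ * η) (ε * δ) :=
  ⟨mul_nonneg h.1 h'.1, fun F K hF t => by
    rw [act_mul, mul_assoc]
    exact h.2 _ _ (h'.2 F K hF) t⟩

lemma pow {ξ : Dil} {ε : ℝ} (h : NormLE ξ ε) (n : ℕ) : NormLE (ξ ^ n) (ε ^ n) := by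
  induction n with
  | zero => simpa using one
  | succ n ih => rw [pow_succ, pow_succ]; exact ih.mul h

lemma sum {ι : Type*} {s : Finset ι} {ξ : ι → Dil} {ε : ι → ℝ} (h : ∀ i ∈ s, NormLE (ξ i) (ε i)) :
    NormLE (∑ i ∈ s, ξ i) (∑ i ∈ s, ε i) := by
  classical
  induction s using Finset.induction_on with
  | empty => exact ⟨le_rfl, fun F K hF t => by simp⟩
  | insert q P hq ih =>
    rw [sum_insert hq, sum_insert hq]
    exact (h q (mem_insert_self q P)).add (ih fun p hp => h p (mem_insert_of_mem hp))

lemma prod_one_add_sub_one {P : Finset ℕ} {ξ : ℕ → Dil} {ε : ℕ → ℝ}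
    (h : ∀ p ∈ P, NormLE (ξ p) (ε p)) :
    NormLE (∏ p ∈ P, (1 + ξ p) - 1) (∏ p ∈ P, (1 + ε p) - 1) := by
  induction P using Finset.induction_on with
  | empty => simpa using ⟨le_rfl, fun F K hF t => by simp⟩
  | insert q P hq ih =>
    have h1 := h q (mem_insert_self q P)
    have h2 := ih fun p hp => h p (mem_insert_of_mem hp)
    rw [prod_insert hq, prod_insert hq]
    have e1 : (1 + ξ q) * ∏ p ∈ P, (1 + ξ p) - 1
        = (1 + ξ q) * (∏ p ∈ P, (1 + ξ p) - 1) + ξ q := by ring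
    have e2 : (1 + ε q) * ∏ p ∈ P, (1 + ε p) - 1
        = (1 + ε q) * (∏ p ∈ P, (1 + ε p) - 1) + ε q := by ring
    rw [e1, e2]
    exact ((one.add h1).mul h2).add h1

end NormLE

/-- Comparison of two products of dilation operators that are close factor by factor. -/
lemma abs_act_prod_sub_le {N : ℕ} {P : Finset ℕ} {A Δ Δ' Γ Γ' : ℕ → Dil} {ε : ℕ → ℝ}
    (hΓ : ∀ p ∈ P, ∀ F ∈ finSupp N, act (Γ p * Γ' p) F = F)
    (hΔ : ∀ p ∈ P, ∀ F ∈ finSupp N, act (Δ p * Δ' p) F = F)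
    (hε : ∀ p ∈ P, NormLE ((A p * Δ p - Γ p) * Γ' p) (ε p)) {Θ Ψ : ℕ × ℕ → ℝ}
    (hΘ : Θ ∈ finSupp N) (hΨ : Ψ ∈ finSupp N)
    (h : act (∏ p ∈ P, Δ p) Θ = act (∏ p ∈ P, Γ p) Ψ) {K : ℝ} (hK : ∀ t, |Θ t| ≤ K)
    (t : ℕ × ℕ) : |act (∏ p ∈ P, A p) Ψ t - Θ t| ≤ (∏ p ∈ P, (1 + ε p) - 1) * K := by
  -- Formally Θ = (∏ Γ/Δ)Ψ and the target is ∏ A Ψ. On finitely supported functions Γ' inverts Γ, so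
  -- UΓ = AΔ and ∏ U takes Θ to ∏ A Ψ. Each U is within ε of the identity.
  set U : ℕ → Dil := fun p => 1 + (A p * Δ p - Γ p) * Γ' p with hU
  have h1 : act (∏ p ∈ P, Δ p) (act (∏ p ∈ P, U p) Θ)
      = act (∏ p ∈ P, Δ p) (act (∏ p ∈ P, A p) Ψ) := by
    rw [← act_mul, mul_comm, act_mul, h, ← act_mul, ← act_mul, ← prod_mul_distrib,
      ← prod_mul_distrib]
    refine act_prod_congr (fun p hp F hF => ?_) hΨ
    have e : U p * Γ p = Γ p + (A p * Δ p - Γ p) * (Γ p * Γ' p) := by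
      rw [hU]; ring
    funext s
    rw [e, act_add, act_mul (A p * Δ p - Γ p), hΓ p hp F hF, act_sub, mul_comm (Δ p)]
    ring
  have h2 : ∀ F ∈ finSupp N, act (∏ p ∈ P, Δ' p) (act (∏ p ∈ P, Δ p) F) = F := fun F hF => by
    rw [← act_mul, ← prod_mul_distrib, act_prod_congr (η := fun _ => 1) (fun p hp G hG => ?_) hF]
    · rw [prod_const_one, act_one]
    · rw [mul_comm, hΔ p hp G hG, act_one]
  have h3 : act (∏ p ∈ P, U p) Θ = act (∏ p ∈ P, A p) Ψ := by
    rw [← h2 _ (act_mem_finSupp _ hΘ), h1, h2 _ (act_mem_finSupp _ hΨ)]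
  have h4 := (NormLE.prod_one_add_sub_one hε).2 Θ K hK t
  rw [act_sub, act_one] at h4
  rwa [← h3]

/-- The truncated inverse of `1 - ξ`. -/
noncomputable def geom (N : ℕ) (ξ : Dil) : Dil := ∑ k ∈ range (N + 1), ξ ^ k

/-- The power N + 1 of a nontrivial dilation multiplies some coordinate by at least 2^{N+1} > N and
so leaves the support. The truncated geometric series is thus an exact inverse there. -/
lemma act_one_sub_mul_geom {N : ℕ} {m : ℕ × ℕ} (hm : 2 ≤ m.1 ∨ 2 ≤ m.2) (r : ℝ)
    {F : ℕ × ℕ → ℝ} (hF : F ∈ finSupp N) :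
    act ((1 - MonoidAlgebra.single m r) * geom N (MonoidAlgebra.single m r)) F = F := by
  have h : (1 - MonoidAlgebra.single m r) * geom N (MonoidAlgebra.single m r)
      = 1 - MonoidAlgebra.single m r ^ (N + 1) := by
    rw [geom, mul_comm, geom_sum_mul_neg]
  funext t
  rw [h, act_sub, act_one, MonoidAlgebra.single_pow, act_single, hF (t * m ^ (N + 1)), mul_zero, sub_zero]
  intro h
  have key : ∀ a b : ℕ, 2 ≤ b → 1 ≤ a * b ^ (N + 1) → a * b ^ (N + 1) ≤ N → False := by
    intro a b hb h1 h2
    have ha : 0 < a := Nat.pos_of_mul_pos_right h1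
    have h3 : N + 1 < b ^ (N + 1) := Nat.lt_pow_self (by omega)
    have := Nat.le_mul_of_pos_left (b ^ (N + 1)) ha
    omega
  rcases hm with hm | hm
  · exact key t.1 m.1 hm h.1.1 h.1.2
  · exact key t.2 m.2 hm h.2.1 h.2.2

lemma normLE_geom (N : ℕ) (m : ℕ × ℕ) {r : ℝ} (h0 : 0 ≤ r) (h1 : r ≤ 1 / 2) :
    NormLE (geom N (MonoidAlgebra.single m r)) 2 := by
  have h2 : NormLE (MonoidAlgebra.single m r) (1 / 2) :=
    (NormLE.single m r).mono (by rwa [abs_of_nonneg h0])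
  refine (NormLE.sum fun k _ => h2.pow k).mono ?_
  have := (summable_geometric_two).sum_le_tsum (range (N + 1)) fun _ _ => by positivity
  rwa [tsum_geometric_two] at this

end SumTwoSquaresSieve
end

/-! ### Comparison of the local factors -/

section
namespace SumTwoSquaresSieve
open Finset

lemma single_eq_algebraMap_mul (m : ℕ × ℕ) (r : ℝ) :
    (MonoidAlgebra.single m r : Dil) = algebraMap ℝ Dil r * MonoidAlgebra.single m 1 := by
  rw [← Algebra.smul_def, MonoidAlgebra.smul_single, smul_eq_mul, mul_one]

lemma single_diag (p : ℕ) (r : ℝ) : (MonoidAlgebra.single (p, p) r : Dil)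
    = algebraMap ℝ Dil r * (MonoidAlgebra.single (p, 1) 1 * MonoidAlgebra.single (1, p) 1) := by
  rw [MonoidAlgebra.single_mul_single, ← Algebra.smul_def, MonoidAlgebra.smul_single]
  simp

/-- The local factor `1 - h x - k y + j x y`. -/
noncomputable def loc (p : ℕ) (h j : ℝ) : Dil :=
  1 - MonoidAlgebra.single (p, 1) h - MonoidAlgebra.single (1, p) h + MonoidAlgebra.single (p, p) j

/-- The local factor `1 - x / p`. -/
noncomputable def lx (p : ℕ) : Dil := 1 - MonoidAlgebra.single (p, 1) (1 / (p : ℝ))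

/-- The local factor `1 - y / p`. -/
noncomputable def ly (p : ℕ) : Dil := 1 - MonoidAlgebra.single (1, p) (1 / (p : ℝ))

/-- The local factor `1 - x y / p`. -/
noncomputable def lxy (p : ℕ) : Dil := 1 - MonoidAlgebra.single (p, p) (1 / (p : ℝ))

/-- The truncated inverse of `lx p`. -/
noncomputable def lx' (N p : ℕ) : Dil := geom N (MonoidAlgebra.single (p, 1) (1 / (p : ℝ)))

/-- The truncated inverse of `ly p`. -/
noncomputable def ly' (N p : ℕ) : Dil := geom N (MonoidAlgebra.single (1, p) (1 / (p : ℝ)))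

/-- The truncated inverse of `lxy p`. -/
noncomputable def lxy' (N p : ℕ) : Dil := geom N (MonoidAlgebra.single (p, p) (1 / (p : ℝ)))

section

variable {N p : ℕ} (hp : 2 ≤ p) {F : ℕ × ℕ → ℝ} (hF : F ∈ finSupp N)
include hp

lemma one_div_le_half : (1 : ℝ) / p ≤ 1 / 2 :=
  div_le_div_of_nonneg_left (by norm_num) (by norm_num) (by exact_mod_cast hp)

lemma normLE_lx' : NormLE (lx' N p) 2 := normLE_geom N _ (by positivity) (one_div_le_half hp)

lemma normLE_ly' : NormLE (ly' N p) 2 := normLE_geom N _ (by positivity) (one_div_le_half hp)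

include hF

lemma act_lx_mul : act (lx p * lx' N p) F = F := act_one_sub_mul_geom (Or.inl hp) _ hF

lemma act_ly_mul : act (ly p * ly' N p) F = F := act_one_sub_mul_geom (Or.inr hp) _ hF

lemma act_lxy_mul : act (lxy p * lxy' N p) F = F := act_one_sub_mul_geom (Or.inl hp) _ hF

lemma act_lx_mul_ly_mul : act (lx p * ly p * (lx' N p * ly' N p)) F = F := by
  rw [mul_mul_mul_comm, act_mul, act_ly_mul hp hF, act_lx_mul hp hF]

lemma act_sq_mul : act ((lx p * ly p) ^ 2 * (lx' N p * ly' N p) ^ 2) F = F := by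
  rw [← mul_pow, sq, act_mul, act_lx_mul_ly_mul hp hF, act_lx_mul_ly_mul hp hF]

end

/-- The coefficient `g₄(p) / (p g₂(p))` for `p ≡ 1 (mod 4)`. -/
noncomputable def hcoef (p : ℝ) : ℝ := (4 * p ^ 2 - 3 * p + 1) / (p * (p + 1) * (2 * p - 1))

/-- The coefficient `g₄(p) / (p g₂(p)²)` for `p ≡ 1 (mod 4)`. -/
noncomputable def jcoef (p : ℝ) : ℝ := (4 * p ^ 2 - 3 * p + 1) / ((p + 1) * (2 * p - 1) ^ 2)

lemma abs_hcoef_sub_le {p : ℝ} (hp : 2 ≤ p) : |hcoef p - 2 / p| ≤ 5 / p ^ 2 := by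
  have h1 : 0 < 2 * p - 1 := by linarith
  have e : hcoef p - 2 / p = -((5 * p - 3) / (p * (p + 1) * (2 * p - 1))) := by
    rw [hcoef, div_sub_div _ _ (by positivity) (by positivity), ← neg_div,
      div_eq_div_iff (by positivity) (by positivity)]
    ring
  rw [e, abs_neg, abs_of_nonneg (div_nonneg (by linarith) (by positivity)),
    div_le_div_iff₀ (by positivity) (by positivity)]
  have : p ^ 2 ≤ (p + 1) * (2 * p - 1) := by nlinarith
  nlinarith [mul_le_mul_of_nonneg_left this (by linarith : 0 ≤ p)]

lemma abs_jcoef_sub_le {p : ℝ} (hp : 2 ≤ p) : |jcoef p - 1 / p| ≤ 3 / p ^ 2 := by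
  have h1 : 0 < 2 * p - 1 := by linarith
  have e : jcoef p - 1 / p = -((3 * p ^ 2 - 4 * p + 1) / (p * (p + 1) * (2 * p - 1) ^ 2)) := by
    rw [jcoef, div_sub_div _ _ (by positivity) (by positivity), ← neg_div,
      div_eq_div_iff (by positivity) (by positivity)]
    ring
  rw [e, abs_neg, abs_of_nonneg (div_nonneg (by nlinarith) (by positivity)),
    div_le_div_iff₀ (by positivity) (by positivity)]
  have h2 : p ^ 2 ≤ (2 * p - 1) ^ 2 := by gcongr; linarith
  have h3 : p * p ^ 2 * p ≤ p * (2 * p - 1) ^ 2 * (p + 1) := by gcongr; linarith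
  nlinarith [mul_nonneg (by linarith : 0 ≤ p) (sq_nonneg p)]

/-- Since h = 2/p + O(p⁻²) and j = 1/p + O(p⁻²), the terms of order 1/p in (1 − hx − hy + jxy)(1 −
xy/p) and in (1 − x/p)²(1 − y/p)² coincide. The difference has norm at most 50/p², and the inverses
contribute (2 · 2)² = 16. -/
lemma normLE_loc_mul_sub {p : ℕ} (hp : 2 ≤ p) (N : ℕ) :
    NormLE ((loc p (hcoef p) (jcoef p) * lxy p - (lx p * ly p) ^ 2) * (lx' N p * ly' N p) ^ 2)
      (800 / (p : ℝ) ^ 2) := by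
  have hp2 : (2 : ℝ) ≤ p := by exact_mod_cast hp
  have hp0 : (0 : ℝ) < p := by linarith
  set c : ℝ := 1 / (p : ℝ) with hc
  set h := hcoef p with hh
  set j := jcoef p with hj
  set x : Dil := MonoidAlgebra.single (p, 1) 1 with hx
  set y : Dil := MonoidAlgebra.single (1, p) 1 with hy
  have nx : NormLE x 1 := (NormLE.single _ _).mono (by simp)
  have ny : NormLE y 1 := (NormLE.single _ _).mono (by simp)
  have hc0 : 0 < c := by positivity
  have hc1 : c ≤ 1 / 2 := one_div_le_half hp
  have hh1 : |h - 2 * c| ≤ 5 * c ^ 2 := by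
    have := abs_hcoef_sub_le hp2
    rw [hc, one_div, inv_pow, ← div_eq_mul_inv, ← div_eq_mul_inv]
    exact this
  have hj1 : |j - c| ≤ 3 * c ^ 2 := by
    have := abs_jcoef_sub_le hp2
    rw [hc, one_div, inv_pow, ← div_eq_mul_inv, ← one_div]
    exact this
  have e : loc p h j * lxy p - (lx p * ly p) ^ 2
      = algebraMap ℝ Dil (2 * c - h) * x + algebraMap ℝ Dil (2 * c - h) * y
        + algebraMap ℝ Dil (j - c - 4 * c ^ 2) * (x * y)
        + algebraMap ℝ Dil (-c ^ 2) * x ^ 2 + algebraMap ℝ Dil (-c ^ 2) * y ^ 2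
        + algebraMap ℝ Dil (h * c + 2 * c ^ 3) * (x ^ 2 * y)
        + algebraMap ℝ Dil (h * c + 2 * c ^ 3) * (x * y ^ 2)
        + algebraMap ℝ Dil (-(j * c + c ^ 4)) * (x ^ 2 * y ^ 2) := by
    rw [loc, lxy, lx, ly, ← hc, single_diag, single_diag, single_eq_algebraMap_mul (p, 1) c,
      single_eq_algebraMap_mul (1, p) c, single_eq_algebraMap_mul (p, 1) h,
      single_eq_algebraMap_mul (1, p) h, ← hx, ← hy]
    simp only [map_sub, map_add, map_mul, map_neg, map_pow, map_ofNat]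
    ring
  have hh2 := abs_le.mp hh1
  have hj2 := abs_le.mp hj1
  have b1 : |2 * c - h| ≤ 5 * c ^ 2 := by rwa [abs_sub_comm]
  have b2 : |j - c - 4 * c ^ 2| ≤ 7 * c ^ 2 := by
    rw [abs_le]; constructor <;> nlinarith
  have b3 : |-c ^ 2| ≤ c ^ 2 := by rw [abs_neg, abs_of_nonneg (sq_nonneg c)]
  have b4 : |h * c + 2 * c ^ 3| ≤ 8 * c ^ 2 := by
    rw [abs_le]; constructor <;> nlinarith [mul_pos hc0 hc0, pow_pos hc0 3]
  have b5 : |-(j * c + c ^ 4)| ≤ 4 * c ^ 2 := by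
    rw [abs_neg, abs_le]
    constructor <;> nlinarith [mul_pos hc0 hc0, pow_pos hc0 3, pow_pos hc0 4]
  have n1 : NormLE (loc p h j * lxy p - (lx p * ly p) ^ 2) (50 * c ^ 2) := by
    rw [e]
    refine ((((((((((NormLE.const _).mono b1).mul nx).add (((NormLE.const _).mono b1).mul ny)).add
      (((NormLE.const _).mono b2).mul (nx.mul ny))).add
      (((NormLE.const _).mono b3).mul (nx.pow 2))).add
      (((NormLE.const _).mono b3).mul (ny.pow 2))).add
      (((NormLE.const _).mono b4).mul ((nx.pow 2).mul ny))).add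
      (((NormLE.const _).mono b4).mul (nx.mul (ny.pow 2)))).add
      (((NormLE.const _).mono b5).mul ((nx.pow 2).mul (ny.pow 2)))).mono ?_
    nlinarith [sq_nonneg c]
  refine (n1.mul (((normLE_lx' hp).mul (normLE_ly' hp)).pow 2)).mono (le_of_eq ?_)
  rw [hc]
  ring

/-- Here 1/p − 1/(p+1) and the product term are both O(p⁻²). The argument gives 12; the constant 800
is kept so that one product bound serves both comparisons. -/
lemma normLE_loc_sub {p : ℕ} (hp : 2 ≤ p) (N : ℕ) :
    NormLE ((loc p (1 / (p + 1)) 0 * 1 - lx p * ly p) * (lx' N p * ly' N p))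
      (800 / (p : ℝ) ^ 2) := by
  have hp2 : (2 : ℝ) ≤ p := by exact_mod_cast hp
  have hp0 : (0 : ℝ) < p := by linarith
  set c : ℝ := 1 / (p : ℝ) with hc
  set k : ℝ := 1 / ((p : ℝ) + 1) with hk
  set x : Dil := MonoidAlgebra.single (p, 1) 1 with hx
  set y : Dil := MonoidAlgebra.single (1, p) 1 with hy
  have nx : NormLE x 1 := (NormLE.single _ _).mono (by simp)
  have ny : NormLE y 1 := (NormLE.single _ _).mono (by simp)
  have hc0 : 0 < c := by positivity
  have b1 : |c - k| ≤ c ^ 2 := by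
    have e : c - k = 1 / (p * (p + 1)) := by rw [hc, hk]; field_simp; ring
    rw [e, abs_of_nonneg (by positivity), hc, div_pow, one_pow]
    refine div_le_div_of_nonneg_left (by norm_num) (by positivity) (by nlinarith)
  have e : loc p k 0 * 1 - lx p * ly p
      = algebraMap ℝ Dil (c - k) * x + algebraMap ℝ Dil (c - k) * y
        + algebraMap ℝ Dil (-c ^ 2) * (x * y) := by
    rw [loc, lx, ly, ← hc, single_diag, single_eq_algebraMap_mul (p, 1) c,
      single_eq_algebraMap_mul (1, p) c, single_eq_algebraMap_mul (p, 1) k,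
      single_eq_algebraMap_mul (1, p) k, ← hx, ← hy]
    simp only [map_sub, map_neg, map_pow, _root_.map_zero]
    ring
  have b3 : |-c ^ 2| ≤ c ^ 2 := by rw [abs_neg, abs_of_nonneg (sq_nonneg c)]
  have n1 : NormLE (loc p k 0 * 1 - lx p * ly p) (3 * c ^ 2) := by
    rw [e]
    refine (((((NormLE.const _).mono b1).mul nx).add (((NormLE.const _).mono b1).mul ny)).add
      (((NormLE.const _).mono b3).mul (nx.mul ny))).mono ?_
    nlinarith [sq_nonneg c]
  refine (n1.mul ((normLE_lx' hp).mul (normLE_ly' hp))).mono ?_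
  have e2 : 800 / (p : ℝ) ^ 2 = 800 * c ^ 2 := by rw [hc]; ring
  rw [e2]
  nlinarith [sq_nonneg c]

/-- The primes `z < p ≤ N`, `p ≡ 1 (mod 4)`. -/
def bigPrimes (z N : ℕ) : Finset ℕ := (Ioc z N).filter fun p => p.Prime ∧ p % 4 = 1

lemma mem_bigPrimes {z N p : ℕ} :
    p ∈ bigPrimes z N ↔ (z < p ∧ p ≤ N) ∧ p.Prime ∧ p % 4 = 1 := by
  rw [bigPrimes, mem_filter, mem_Ioc]

/-- The sum of 800/p² beyond z is at most 800/z, which is at most 1 by the size of z; there e^x − 1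
≤ 2x. -/
lemma prod_one_add_sub_one_le {z : ℕ} (hz : 800 ≤ z) (N : ℕ) :
    ∏ p ∈ bigPrimes z N, (1 + 800 / (p : ℝ) ^ 2) - 1 ≤ 1600 / (z : ℝ) := by
  have hz0 : (800 : ℝ) ≤ z := by exact_mod_cast hz
  have h1 : ∏ p ∈ bigPrimes z N, (1 + 800 / (p : ℝ) ^ 2)
      ≤ Real.exp (∑ p ∈ bigPrimes z N, 800 / (p : ℝ) ^ 2) := by
    rw [Real.exp_sum]
    refine prod_le_prod (fun p _ => by positivity) fun p _ => ?_
    rw [add_comm]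
    exact Real.add_one_le_exp _
  have h2 : ∑ p ∈ bigPrimes z N, 800 / (p : ℝ) ^ 2 ≤ 800 / (z : ℝ) := by
    have h3 : ∑ p ∈ bigPrimes z N, 800 / (p : ℝ) ^ 2 ≤ ∑ p ∈ Ioc z (max z N), 800 / (p : ℝ) ^ 2 :=
      sum_le_sum_of_subset_of_nonneg ((filter_subset _ _).trans
        (Ioc_subset_Ioc_right (le_max_right _ _))) fun _ _ _ => by positivity
    have h4 := sum_Ioc_inv_sq_le_sub (α := ℝ) (k := z) (n := max z N) (by omega) (le_max_left _ _)
    have h5 : (0 : ℝ) ≤ ((max z N : ℕ) : ℝ)⁻¹ := by positivity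
    simp only [div_eq_mul_inv, ← Finset.mul_sum] at h3 ⊢
    linarith
  have h6 : (0 : ℝ) ≤ 800 / z := by positivity
  have h7 : (800 : ℝ) / z ≤ 1 := by rw [div_le_one (by linarith)]; exact hz0
  have h8 := Real.abs_exp_sub_one_le (x := 800 / (z : ℝ)) (by rwa [abs_of_nonneg h6])
  rw [abs_of_nonneg h6] at h8
  have h9 := le_of_abs_le h8
  have h10 := Real.exp_le_exp.mpr h2
  have e : 1600 / (z : ℝ) = 2 * (800 / z) := by ring
  linarith

end SumTwoSquaresSieve
end

/-! ### Expansion of products of local factors over squarefree integers -/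

section
namespace SumTwoSquaresSieve
open Finset ArithmeticFunction
open scoped ArithmeticFunction.zeta ArithmeticFunction.Moebius

/-- The squarefree integers up to `N` with all prime factors in `P`. -/
def sqf (P : Finset ℕ) (N : ℕ) : Finset ℕ :=
  (Ioc 0 N).filter fun n => Squarefree n ∧ n.primeFactors ⊆ P

lemma sum_powerset_eq {P : Finset ℕ} (hP : ∀ p ∈ P, p.Prime) {N : ℕ} {Φ : Finset ℕ → ℝ}
    (hΦ : ∀ s ⊆ P, N < ∏ p ∈ s, p → Φ s = 0) :
    ∑ s ∈ P.powerset, Φ s = ∑ n ∈ sqf P N, Φ n.primeFactors := by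
  rw [← sum_filter_of_ne (p := fun s => ∏ p ∈ s, p ≤ N) fun s hs h => by
    by_contra hn
    exact h (hΦ s (mem_powerset.mp hs) (by omega))]
  refine sum_bij' (fun s _ => ∏ p ∈ s, p) (fun n _ => n.primeFactors) ?_ ?_ ?_ ?_ ?_
  · intro s hs
    obtain ⟨h1, h2⟩ := mem_filter.mp hs
    have hsP := mem_powerset.mp h1
    have hs' : ∀ p ∈ s, p.Prime := fun p hp => hP p (hsP hp)
    refine mem_filter.mpr ⟨mem_Ioc.mpr ⟨prod_pos fun p hp => (hs' p hp).pos, h2⟩, ?_, ?_⟩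
    · refine Finset.squarefree_prod_of_pairwise_isCoprime (fun p hp q hq hpq => ?_)
        fun p hp => (hs' p hp).squarefree
      exact Nat.coprime_iff_isRelPrime.mp ((Nat.coprime_primes (hs' p hp) (hs' q hq)).mpr hpq)
    · rwa [Nat.primeFactors_prod hs']
  · intro n hn
    obtain ⟨h1, h2, h3⟩ := mem_filter.mp hn
    refine mem_filter.mpr ⟨mem_powerset.mpr h3, ?_⟩
    rw [Nat.prod_primeFactors_of_squarefree h2]
    exact (mem_Ioc.mp h1).2
  · intro s hs
    exact Nat.primeFactors_prod fun p hp => hP p (mem_powerset.mp (mem_filter.mp hs).1 hp)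
  · intro n hn
    exact Nat.prod_primeFactors_of_squarefree (mem_filter.mp hn).2.1
  · intro s hs
    rw [Nat.primeFactors_prod fun p hp => hP p (mem_powerset.mp (mem_filter.mp hs).1 hp)]

lemma prod_single (s : Finset ℕ) (e : ℕ →* ℕ × ℕ) (r : ℕ → ℝ) :
    ∏ p ∈ s, (MonoidAlgebra.single (e p) (r p) : Dil)
      = MonoidAlgebra.single (e (∏ p ∈ s, p)) (∏ p ∈ s, r p) := by
  induction s using Finset.induction_on with
  | empty => simp [MonoidAlgebra.one_def]
  | insert q s hq ih =>
    rw [prod_insert hq, prod_insert hq, prod_insert hq, ih, MonoidAlgebra.single_mul_single,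
      map_mul]

lemma act_sum {ι : Type*} (s : Finset ι) (ξ : ι → Dil) (F : ℕ × ℕ → ℝ) (t : ℕ × ℕ) :
    act (∑ i ∈ s, ξ i) F t = ∑ i ∈ s, act (ξ i) F t := by
  rw [map_sum, LinearMap.sum_apply, Finset.sum_apply]

lemma ff_of_mem {z N n : ℕ} (hn : n ∈ sqf (bigPrimes z N) N) :
    ff z n = ∏ p ∈ n.primeFactors, -(1 / (p : ℝ)) := by
  obtain ⟨h1, h2, h3⟩ := mem_filter.mp hn
  have hi : ind (Pz z) n = 1 := by
    rw [ind_apply, if_pos]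
    exact ⟨h2.ne_zero, fun p hp => ⟨(mem_bigPrimes.mp (h3 hp)).2.2, (mem_bigPrimes.mp (h3 hp)).1.1⟩⟩
  have h4 : cardFactors n = n.primeFactors.card := by
    rw [← (cardDistinctFactors_eq_cardFactors_iff_squarefree h2.ne_zero).mpr h2]
    rfl
  rw [ff_apply, hi, mul_one, prod_neg, mu, moebius_apply_of_squarefree h2, h4,
    prod_div_distrib, prod_const_one, ← Nat.cast_prod, Nat.prod_primeFactors_of_squarefree h2]
  push_cast
  ring

lemma ff_of_not_mem {z N n : ℕ} (hn : n ∈ Ioc 0 N) (h : n ∉ sqf (bigPrimes z N) N) :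
    ff z n = 0 := by
  rw [ff_apply]
  by_cases h2 : Squarefree n
  · rw [ind_apply, if_neg, mul_zero, zero_div]
    rintro ⟨h0, h3⟩
    refine h (mem_filter.mpr ⟨hn, h2, fun p hp => mem_bigPrimes.mpr ⟨⟨(h3 p hp).2, ?_⟩,
      Nat.prime_of_mem_primeFactors hp, (h3 p hp).1⟩⟩)
    exact (Nat.le_of_mem_primeFactors hp).trans (mem_Ioc.mp hn).2
  · rw [mu, moebius_eq_zero_of_not_squarefree h2]
    simp

/-- Expanding the product over squarefree n gives convolution with `ff z`. The homomorphism e places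
n in the first coordinate, in the second, or in both at once. -/
lemma act_prod_one_sub (z N : ℕ) (e : ℕ →* ℕ × ℕ) {F : ℕ × ℕ → ℝ} (t : ℕ × ℕ)
    (hF : ∀ n, N < n → F (t * e n) = 0) :
    act (∏ p ∈ bigPrimes z N, (1 - MonoidAlgebra.single (e p) (1 / (p : ℝ)))) F t
      = ∑ n ∈ Ioc 0 N, ff z n * F (t * e n) := by
  have hP : ∀ p ∈ bigPrimes z N, p.Prime := fun p hp => (mem_bigPrimes.mp hp).2.1
  have e1 : ∏ p ∈ bigPrimes z N, (1 - (MonoidAlgebra.single (e p) (1 / (p : ℝ)) : Dil))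
      = ∏ p ∈ bigPrimes z N, (1 + MonoidAlgebra.single (e p) (-(1 / (p : ℝ)))) :=
    prod_congr rfl fun p _ => by rw [sub_eq_add_neg, MonoidAlgebra.single_neg]
  rw [e1, prod_one_add, act_sum]
  simp only [prod_single, act_single]
  rw [sum_powerset_eq hP fun s _ h => by rw [hF _ h, mul_zero]]
  rw [← sum_subset (filter_subset _ _ : sqf (bigPrimes z N) N ⊆ Ioc 0 N) fun n hn h => by
    rw [ff_of_not_mem hn h, zero_mul]]
  refine sum_congr rfl fun n hn => ?_
  rw [ff_of_mem hn, Nat.prod_primeFactors_of_squarefree (mem_filter.mp hn).2.1]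

/-- The weight of `p` in the expansion of a product of local factors. -/
def wt (δ α β γ : ℝ) (P Q : Prop) [Decidable P] [Decidable Q] : ℝ :=
  if P then (if Q then γ else α) else if Q then β else δ

lemma prod_add_sum {P s : Finset ℕ} (hs : s ⊆ P) (f g : ℕ → Dil) :
    (∏ p ∈ s, f p) * ∏ p ∈ P \ s, g p = ∏ p ∈ P, if p ∈ s then f p else g p := by
  rw [prod_ite, filter_mem_eq_inter, inter_eq_right.mpr hs, filter_notMem_eq_sdiff]

/-- One of four monomials is chosen at each p; s and t record the primes placed in the first and
second coordinate. The constant term δ is left free because in Z⁽²⁾ it is 0 at one prime. -/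
lemma prod_eq_sum_single {P : Finset ℕ} (δ α β γ : ℕ → ℝ) :
    ∏ p ∈ P, (MonoidAlgebra.single 1 (δ p) + MonoidAlgebra.single (p, 1) (α p)
      + MonoidAlgebra.single (1, p) (β p) + MonoidAlgebra.single (p, p) (γ p) : Dil)
    = ∑ s ∈ P.powerset, ∑ t ∈ P.powerset, MonoidAlgebra.single (∏ p ∈ s, p, ∏ p ∈ t, p)
      (∏ p ∈ P, wt (δ p) (α p) (β p) (γ p) (p ∈ s) (p ∈ t)) := by
  classical
  have key : ∀ s ∈ P.powerset, ∀ t ∈ P.powerset,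
      (MonoidAlgebra.single (∏ p ∈ s, p, ∏ p ∈ t, p)
      (∏ p ∈ P, wt (δ p) (α p) (β p) (γ p) (p ∈ s) (p ∈ t)) : Dil)
      = (∏ p ∈ t, if p ∈ s then MonoidAlgebra.single (p, p) (γ p)
          else MonoidAlgebra.single (1, p) (β p))
        * ∏ p ∈ P \ t, if p ∈ s then MonoidAlgebra.single (p, 1) (α p)
          else MonoidAlgebra.single 1 (δ p) := by
    intro s hs t ht
    have hs' := mem_powerset.mp hs
    have ht' := mem_powerset.mp ht
    rw [prod_add_sum ht']
    have e1 : (∏ p ∈ s, p, ∏ p ∈ t, p)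
        = ∏ p ∈ P, ((if p ∈ s then p else 1, if p ∈ t then p else 1) : ℕ × ℕ) := by
      rw [Prod.ext_iff]
      simp only [Prod.fst_prod, Prod.snd_prod, prod_ite_mem, inter_eq_right.mpr hs',
        inter_eq_right.mpr ht', and_self]
    rw [e1]
    clear hs ht hs' ht' e1
    induction P using Finset.induction_on with
    | empty => simp [MonoidAlgebra.one_def]
    | insert q P hq ih =>
      rw [prod_insert hq, prod_insert hq, prod_insert hq, ← MonoidAlgebra.single_mul_single, ih]
      congr 1
      rw [wt]
      split_ifs <;> rfl
  rw [sum_congr rfl fun s hs => sum_congr rfl (key s hs), sum_comm]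
  have e2 : ∀ p, (MonoidAlgebra.single 1 (δ p) + MonoidAlgebra.single (p, 1) (α p)
      + MonoidAlgebra.single (1, p) (β p) + MonoidAlgebra.single (p, p) (γ p) : Dil)
      = (MonoidAlgebra.single (p, p) (γ p) + MonoidAlgebra.single (1, p) (β p))
        + (MonoidAlgebra.single (p, 1) (α p) + MonoidAlgebra.single 1 (δ p)) := fun p => by abel
  simp only [e2]
  rw [prod_add]
  refine sum_congr rfl fun t ht => ?_
  have ht' := mem_powerset.mp ht
  rw [prod_add_sum ht']
  have e3 : ∀ p, (if p ∈ t then (MonoidAlgebra.single (p, p) (γ p)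
      + MonoidAlgebra.single (1, p) (β p) : Dil)
      else (MonoidAlgebra.single (p, 1) (α p) + MonoidAlgebra.single 1 (δ p)))
      = (if p ∈ t then MonoidAlgebra.single (p, p) (γ p) else MonoidAlgebra.single (p, 1) (α p))
      + (if p ∈ t then MonoidAlgebra.single (1, p) (β p) else MonoidAlgebra.single 1 (δ p)) :=
    fun p => by split_ifs <;> rfl
  simp only [e3]
  rw [prod_add]
  refine sum_congr rfl fun s hs => ?_
  rw [prod_add_sum (mem_powerset.mp hs), prod_add_sum ht']
  refine prod_congr rfl fun p _ => ?_
  split_ifs <;> rfl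

lemma act_prod_eq_sum {P : Finset ℕ} (hP : ∀ p ∈ P, p.Prime) (N : ℕ) (δ α β γ : ℕ → ℝ)
    {F : ℕ × ℕ → ℝ} (hF : F ∈ finSupp N) :
    act (∏ p ∈ P, (MonoidAlgebra.single 1 (δ p) + MonoidAlgebra.single (p, 1) (α p)
      + MonoidAlgebra.single (1, p) (β p) + MonoidAlgebra.single (p, p) (γ p))) F (1, 1)
    = ∑ a ∈ sqf P N, ∑ b ∈ sqf P N, (∏ p ∈ P, wt (δ p) (α p) (β p) (γ p) (p ∈ a.primeFactors)
      (p ∈ b.primeFactors)) * F (a, b) := by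
  rw [prod_eq_sum_single, act_sum]
  simp only [act_sum, act_single, Prod.mk_mul_mk, one_mul]
  rw [sum_powerset_eq (N := N) hP fun s _ h => sum_eq_zero fun t _ => by
    rw [hF _ fun h' => by have := h'.1.2; simp only at this; omega, mul_zero]]
  refine sum_congr rfl fun a ha => ?_
  rw [sum_powerset_eq (N := N) hP fun s _ h => by
    rw [hF _ fun h' => by have := h'.2.2; simp only at this; omega, mul_zero]]
  refine sum_congr rfl fun b hb => ?_
  rw [Nat.prod_primeFactors_of_squarefree (mem_filter.mp ha).2.1,
    Nat.prod_primeFactors_of_squarefree (mem_filter.mp hb).2.1]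

end SumTwoSquaresSieve
end

/-! ### Model products acting on the pair of logarithms -/

section
namespace SumTwoSquaresSieve
open Finset ArithmeticFunction
open scoped ArithmeticFunction.zeta ArithmeticFunction.Moebius

/-- The positive part of the logarithm, cut off below `1`. -/
noncomputable def lg (t : ℝ) : ℝ := if 1 ≤ t then Real.log t else 0

/-- The function `(a, b) ↦ f (v / a) k (v / b)`. -/
noncomputable def tens (v : ℝ) (f k : ℝ → ℝ) (t : ℕ × ℕ) : ℝ := f (v / t.1) * k (v / t.2)

lemma lg_of_lt {t : ℝ} (h : t < 1) : lg t = 0 := if_neg (not_le.mpr h)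

lemma one_le_div_cast_iff {v : ℝ} (hv : 0 ≤ v) {n : ℕ} : 1 ≤ v / n ↔ 1 ≤ n ∧ n ≤ ⌊v⌋₊ := by
  rcases Nat.eq_zero_or_pos n with rfl | hn
  · simp
  · rw [one_le_div (by exact_mod_cast hn), Nat.le_floor_iff hv]
    exact ⟨fun h => ⟨hn, h⟩, fun h => h.2⟩

lemma tens_mem_finSupp {v : ℝ} (hv : 0 ≤ v) {f k : ℝ → ℝ} (hf : ∀ t < 1, f t = 0)
    (hk : ∀ t < 1, k t = 0) : tens v f k ∈ finSupp ⌊v⌋₊ := by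
  intro t ht
  rw [← one_le_div_cast_iff hv, ← one_le_div_cast_iff hv, not_and_or, not_le, not_le] at ht
  rcases ht with ht | ht
  · rw [tens, hf _ ht, zero_mul]
  · rw [tens, hk _ ht, mul_zero]

lemma ev_eq_sum {c : ArithmeticFunction ℝ} {h : ℝ → ℝ} (hh : ∀ t < 1, h t = 0) {x : ℝ} {N : ℕ}
    (hx : 0 ≤ x) (hN : ⌊x⌋₊ ≤ N) : ∑ n ∈ Ioc 0 N, c n * h (x / n) = ev c h x := by
  rw [ev]
  refine (sum_subset (Ioc_subset_Ioc_right hN) fun n hn hn' => ?_).symm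
  rw [hh, mul_zero]
  by_contra! h1
  exact hn' (mem_Ioc.mpr ((one_le_div_cast_iff hx).mp h1))

lemma ev_congr {c : ArithmeticFunction ℝ} {h k : ℝ → ℝ} (hh : ∀ t, 1 ≤ t → h t = k t) {x : ℝ}
    (hx : 0 ≤ x) : ev c h x = ev c k x :=
  sum_congr rfl fun n hn => by rw [hh _ ((one_le_div_cast_iff hx).mpr (mem_Ioc.mp hn))]

lemma ev_lg (c : ArithmeticFunction ℝ) {x : ℝ} (hx : 0 ≤ x) : ev c lg x = ev c Real.log x :=
  ev_congr (fun _ h => if_pos h) hx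

lemma tt_of_lt (z : ℕ) {x : ℝ} (hx : x < 1) : tt z x = 0 := ev_of_lt _ _ hx

section

variable {v : ℝ} (hv : 0 ≤ v) {f k : ℝ → ℝ} (z : ℕ)
include hv

lemma floor_div_cast_le (n : ℕ) : ⌊v / n⌋₊ ≤ ⌊v⌋₊ := by
  rw [Nat.floor_div_natCast]
  exact Nat.div_le_self _ _

lemma act_prod_lx (hf : ∀ t < 1, f t = 0) :
    act (∏ p ∈ bigPrimes z ⌊v⌋₊, lx p) (tens v f k) = tens v (ev (ff z) f) k := by
  funext t
  have h := act_prod_one_sub z ⌊v⌋₊ (MonoidHom.inl ℕ ℕ) (F := tens v f k) t fun n hn => by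
    have : f (v / (t.1 * n : ℕ)) = 0 := hf _ <| by
      by_contra! h1
      have h2 := (one_le_div_cast_iff hv).mp h1
      have := Nat.le_mul_of_pos_left n (Nat.pos_of_mul_pos_right h2.1)
      omega
    change f (v / (t.1 * n : ℕ)) * _ = 0
    rw [this, zero_mul]
  refine h.trans ?_
  rw [tens, ← ev_eq_sum hf (by positivity) (floor_div_cast_le hv t.1), Finset.sum_mul]
  refine sum_congr rfl fun n _ => ?_
  change _ * (f (v / (t.1 * n : ℕ)) * k (v / (t.2 * 1 : ℕ))) = _
  rw [mul_one, Nat.cast_mul, div_div, mul_assoc]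

lemma act_prod_ly (hk : ∀ t < 1, k t = 0) :
    act (∏ p ∈ bigPrimes z ⌊v⌋₊, ly p) (tens v f k) = tens v f (ev (ff z) k) := by
  funext t
  have h := act_prod_one_sub z ⌊v⌋₊ (MonoidHom.inr ℕ ℕ) (F := tens v f k) t fun n hn => by
    have : k (v / (t.2 * n : ℕ)) = 0 := hk _ <| by
      by_contra! h1
      have h2 := (one_le_div_cast_iff hv).mp h1
      have := Nat.le_mul_of_pos_left n (Nat.pos_of_mul_pos_right h2.1)
      omega
    change _ * k (v / (t.2 * n : ℕ)) = 0
    rw [this, mul_zero]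
  refine h.trans ?_
  rw [tens, ← ev_eq_sum hk (by positivity) (floor_div_cast_le hv t.2), Finset.mul_sum]
  refine sum_congr rfl fun n _ => ?_
  change _ * (f (v / (t.1 * 1 : ℕ)) * k (v / (t.2 * n : ℕ))) = _
  rw [mul_one, Nat.cast_mul, div_div, mul_left_comm]

lemma act_prod_lx_mul_ly (hf : ∀ t < 1, f t = 0) (hk : ∀ t < 1, k t = 0) :
    act (∏ p ∈ bigPrimes z ⌊v⌋₊, lx p * ly p) (tens v f k) = tens v (ev (ff z) f) (ev (ff z) k) := by
  rw [prod_mul_distrib, act_mul, act_prod_ly hv z hk, act_prod_lx hv z hf]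

omit hv in
lemma tens_congr (hv : 0 ≤ v) {f' k' : ℝ → ℝ} (hf : ∀ t, 0 ≤ t → f t = f' t)
    (hk : ∀ t, 0 ≤ t → k t = k' t) : tens v f k = tens v f' k' := by
  funext t
  rw [tens, tens, hf _ (by positivity), hk _ (by positivity)]

lemma act_prod_lx_mul_ly_lg :
    act (∏ p ∈ bigPrimes z ⌊v⌋₊, lx p * ly p) (tens v lg lg) = tens v (tt z) (tt z) := by
  rw [act_prod_lx_mul_ly hv z (fun _ => lg_of_lt) fun _ => lg_of_lt]
  exact tens_congr hv (fun t ht => ev_lg _ ht) fun t ht => ev_lg _ ht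

lemma act_prod_sq_lg :
    act (∏ p ∈ bigPrimes z ⌊v⌋₊, (lx p * ly p) ^ 2) (tens v lg lg) = tens v (vv z) (vv z) := by
  have h : ∀ t, ev (ff z) (tt z) t = vv z t := fun t => (ev_mul _ _ _ _).symm
  simp only [sq]
  rw [prod_mul_distrib, act_mul, act_prod_lx_mul_ly_lg hv z, act_prod_lx_mul_ly hv z
    (fun _ => tt_of_lt z) fun _ => tt_of_lt z]
  exact tens_congr hv (fun t _ => h t) fun t _ => h t

end

/-- The function `(a, b) ↦ th z (v / a) (v / b)`. -/
noncomputable def thf (z : ℕ) (v : ℝ) (t : ℕ × ℕ) : ℝ := th z (v / t.1) (v / t.2)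

lemma th_of_lt_left (z : ℕ) {x : ℝ} (y : ℝ) (hx : x < 1) : th z x y = 0 := by
  rw [th, Nat.floor_eq_zero.mpr hx]
  simp

lemma th_of_lt_right (z : ℕ) (x : ℝ) {y : ℝ} (hy : y < 1) (hy0 : 0 ≤ y) : th z x y = 0 := by
  refine sum_eq_zero fun d hd => ?_
  have hd0 : (1 : ℝ) ≤ d := by exact_mod_cast (mem_Ioc.mp hd).1
  rw [vv_of_lt z ((div_le_self hy0 hd0).trans_lt hy), mul_zero]

/-- The sum defining `th` stops at ⌊x⌋ only; it is symmetric because `vv` vanishes below 1. -/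
lemma th_comm (z : ℕ) {x y : ℝ} (hx : 0 ≤ x) (hy : 0 ≤ y) : th z x y = th z y x := by
  have key : ∀ {x y : ℝ}, 0 ≤ x → 0 ≤ y → x ≤ y → th z x y = th z y x := by
    intro x y hx hy h
    rw [th, sum_subset (Ioc_subset_Ioc_right (Nat.floor_mono h)) fun d hd hd' => by
      rw [vv_of_lt, mul_zero, zero_mul]
      by_contra! h1
      exact hd' (mem_Ioc.mpr ((one_le_div_cast_iff hx).mp h1))]
    exact sum_congr rfl fun d _ => by ring
  rcases le_total x y with h | h
  · exact key hx hy h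
  · exact (key hy hx h).symm

lemma thf_mem_finSupp (z : ℕ) {v : ℝ} (hv : 0 ≤ v) : thf z v ∈ finSupp ⌊v⌋₊ := by
  intro t ht
  rw [← one_le_div_cast_iff hv, ← one_le_div_cast_iff hv, not_and_or, not_le, not_le] at ht
  rcases ht with ht | ht
  · exact th_of_lt_left z _ ht
  · exact th_of_lt_right z _ ht (by positivity)

lemma act_prod_lxy (z : ℕ) {v : ℝ} (hv : 0 ≤ v) :
    act (∏ p ∈ bigPrimes z ⌊v⌋₊, lxy p) (thf z v) = tens v (vv z) (vv z) := by
  funext t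
  have h := act_prod_one_sub z ⌊v⌋₊ ((MonoidHom.id ℕ).prod (MonoidHom.id ℕ)) (F := thf z v) t
    fun n hn => by
      refine thf_mem_finSupp z hv _ fun h => ?_
      have h2 : 1 ≤ t.1 * n ∧ t.1 * n ≤ ⌊v⌋₊ := h.1
      have := Nat.le_mul_of_pos_left n (Nat.pos_of_mul_pos_right h2.1)
      omega
  refine h.trans ?_
  change ∑ n ∈ Ioc 0 ⌊v⌋₊, ff z n * th z (v / (t.1 * n : ℕ)) (v / (t.2 * n : ℕ)) = _
  rw [tens]
  set x := v / t.1 with hx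
  set y := v / t.2 with hy
  have hx0 : 0 ≤ x := by positivity
  have hxy : ∀ n : ℕ, v / (t.1 * n : ℕ) = x / n ∧ v / (t.2 * n : ℕ) = y / n := fun n => by
    rw [Nat.cast_mul, Nat.cast_mul, hx, hy, div_div, div_div]
    exact ⟨rfl, rfl⟩
  simp only [hxy]
  rcases lt_or_ge x 1 with h1 | h1
  · rw [vv_of_lt z h1, zero_mul]
    refine sum_eq_zero fun n hn => ?_
    have hn0 : (1 : ℝ) ≤ n := by exact_mod_cast (mem_Ioc.mp hn).1
    rw [th_of_lt_left z _ ((div_le_self hx0 hn0).trans_lt h1), mul_zero]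
  have hx1 : 0 < x := by linarith
  -- Freezing the ratio y/x turns `th` along the diagonal into a one-variable sum with coefficients
  -- `ss z`, and convolving with `ff z` leaves only the term d = 1.
  set k : ℝ → ℝ := fun s => vv z s * vv z (s * (y / x)) with hk
  have h2 : ∀ n : ℕ, th z (x / n) (y / n) = ev (ss z) k (x / n) := fun n => by
    rw [th, ev]
    refine sum_congr rfl fun d _ => ?_
    rw [hk, mul_assoc]
    have : x / n / d * (y / x) = y / n / d := by field_simp
    simp only [this]
  simp only [h2]
  have e : ff z * ss z = 1 := by rw [mul_comm, ss_mul_ff]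
  rw [ev_eq_sum (fun s hs => ev_of_lt _ _ hs) hx0 (floor_div_cast_le hv t.1), ← ev_mul, e,
    ev_one _ h1, hk]
  simp only
  rw [mul_div_cancel₀ _ hx1.ne']

lemma two_le_of_mem_bigPrimes {z N p : ℕ} (hp : p ∈ bigPrimes z N) : 2 ≤ p :=
  (mem_bigPrimes.mp hp).2.1.two_le

/-- The two-dimensional sum for `Z1` is close to `thf z v`. -/
lemma abs_act_prod_loc_sub_thf_le {z : ℕ} (hz : 800 ≤ z) {v : ℝ} (hv : 0 ≤ v) {K : ℝ}
    (hK : ∀ t, |thf z v t| ≤ K) (t : ℕ × ℕ) :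
    |act (∏ p ∈ bigPrimes z ⌊v⌋₊, loc p (hcoef p) (jcoef p)) (tens v lg lg) t - thf z v t|
      ≤ 1600 / z * K := by
  refine (abs_act_prod_sub_le (N := ⌊v⌋₊) (P := bigPrimes z ⌊v⌋₊) (Δ := lxy) (Δ' := lxy' ⌊v⌋₊)
    (Γ := fun p => (lx p * ly p) ^ 2) (Γ' := fun p => (lx' ⌊v⌋₊ p * ly' ⌊v⌋₊ p) ^ 2)
    (fun p hp F hF => act_sq_mul (two_le_of_mem_bigPrimes hp) hF)
    (fun p hp F hF => act_lxy_mul (two_le_of_mem_bigPrimes hp) hF)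
    (fun p hp => normLE_loc_mul_sub (two_le_of_mem_bigPrimes hp) ⌊v⌋₊) (thf_mem_finSupp z hv)
    (tens_mem_finSupp hv (fun _ => lg_of_lt) fun _ => lg_of_lt) ?_ hK t).trans ?_
  · rw [act_prod_lxy z hv, act_prod_sq_lg hv z]
  · exact mul_le_mul_of_nonneg_right (prod_one_add_sub_one_le hz _) ((abs_nonneg _).trans (hK t))

/-- The two-dimensional sum for `Y` is close to a product of one-dimensional ones. -/
lemma abs_act_prod_loc_sub_tens_le {z : ℕ} (hz : 800 ≤ z) {v : ℝ} (hv : 0 ≤ v) {K : ℝ}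
    (hK : ∀ t, |tens v (tt z) (tt z) t| ≤ K) (t : ℕ × ℕ) :
    |act (∏ p ∈ bigPrimes z ⌊v⌋₊, loc p (1 / (p + 1)) 0) (tens v lg lg) t
      - tens v (tt z) (tt z) t| ≤ 1600 / z * K := by
  refine (abs_act_prod_sub_le (N := ⌊v⌋₊) (P := bigPrimes z ⌊v⌋₊) (Δ := fun _ => 1) (Δ' := fun _ => 1)
    (Γ := fun p => lx p * ly p) (Γ' := fun p => lx' ⌊v⌋₊ p * ly' ⌊v⌋₊ p)
    (fun p hp F hF => act_lx_mul_ly_mul (two_le_of_mem_bigPrimes hp) hF)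
    (fun p hp F hF => by rw [mul_one]; exact act_one F)
    (fun p hp => normLE_loc_sub (two_le_of_mem_bigPrimes hp) ⌊v⌋₊)
    (tens_mem_finSupp hv (fun _ => tt_of_lt z) fun _ => tt_of_lt z)
    (tens_mem_finSupp hv (fun _ => lg_of_lt) fun _ => lg_of_lt) ?_ hK t).trans ?_
  · rw [act_prod_lx_mul_ly_lg hv z]
    rw [prod_const_one, act_one]
  · exact mul_le_mul_of_nonneg_right (prod_one_add_sub_one_le hz _) ((abs_nonneg _).trans (hK t))

end SumTwoSquaresSieve
end

/-! ### The sums X, Y, Z⁽¹⁾, Z⁽²⁾ as actions of local products -/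

section
namespace SumTwoSquaresSieve
open Finset ArithmeticFunction
open scoped ArithmeticFunction.zeta ArithmeticFunction.Moebius

/-- Coprimality to W excludes the odd primes up to z; the prime 2, absent from W, is excluded by the
congruence modulo 4. -/
lemma mem_idx_iff {N z : ℕ} (hz : z = ⌊D₀ N⌋₊) {v : ℝ} {a : ℕ} (ha : a ∈ Ioc 0 ⌊v⌋₊) :
    a ∈ idx v (W N) ↔ a.primeFactors ⊆ bigPrimes z ⌊v⌋₊ := by
  have ha' := mem_Ioc.mp ha
  have h1 : a ∈ Icc 1 ⌊v⌋₊ := mem_Icc.mpr ha'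
  rw [idx, mem_filter, W, Nat.coprime_prod_right_iff]
  constructor
  · rintro ⟨-, h2, h3⟩ p hp
    have hpp := Nat.prime_of_mem_primeFactors hp
    have h4 := h3 p hp
    refine mem_bigPrimes.mpr ⟨⟨?_, (Nat.le_of_mem_primeFactors hp).trans ha'.2⟩, hpp, h4⟩
    by_contra! h5
    have h6 := h2 p (mem_filter.mpr ⟨mem_filter.mpr ⟨mem_range.mpr (by omega), hpp⟩,
      by have := hpp.two_le; omega⟩)
    exact hpp.coprime_iff_not_dvd.mp h6.symm (Nat.dvd_of_mem_primeFactors hp)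
  · intro h
    refine ⟨h1, fun p hp => ?_, fun p hp => (mem_bigPrimes.mp (h hp)).2.2⟩
    obtain ⟨h2, h3⟩ := mem_filter.mp hp
    obtain ⟨h4, hpp⟩ := mem_filter.mp h2
    rw [Nat.coprime_comm, hpp.coprime_iff_not_dvd]
    intro hpa
    have h5 := (mem_bigPrimes.mp (h (Nat.mem_primeFactors.mpr ⟨hpp, hpa, by omega⟩))).1.1
    have := mem_range.mp h4
    omega

lemma sum_idx_eq {N z : ℕ} (hz : z = ⌊D₀ N⌋₊) (v : ℝ) {f : ℕ → ℝ}
    (hf : ∀ n, mu n = 0 → f n = 0) :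
    ∑ a ∈ idx v (W N), f a = ∑ a ∈ sqf (bigPrimes z ⌊v⌋₊) ⌊v⌋₊, f a := by
  have hmem : ∀ a ∈ idx v (W N), a ∈ Ioc 0 ⌊v⌋₊ := fun a ha =>
    mem_Ioc.mpr (mem_Icc.mp (mem_filter.mp ha).1)
  refine (sum_subset (fun a ha => ?_) fun a ha ha' => hf a ?_).symm
  · obtain ⟨h1, -, h2⟩ := mem_filter.mp ha
    exact (mem_idx_iff hz h1).mpr h2
  · rw [mu, moebius_eq_zero_of_not_squarefree, Int.cast_zero]
    intro h
    have h1 := hmem a ha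
    exact ha' (mem_filter.mpr ⟨h1, h, (mem_idx_iff hz h1).mp ha⟩)

lemma lg_div_eq {v : ℝ} (hv : 0 ≤ v) {P : Finset ℕ} {a : ℕ} (ha : a ∈ sqf P ⌊v⌋₊) :
    Real.log (v / a) = lg (v / a) := by
  rw [lg, if_pos]
  exact (one_le_div_cast_iff hv).mpr (mem_Ioc.mp (mem_filter.mp ha).1)

lemma X_eq {N z : ℕ} (hz : z = ⌊D₀ N⌋₊) (v : ℝ) : X v (W N) = tt z v := by
  rw [X, sum_idx_eq hz v fun n hn => by rw [hn, zero_div, zero_mul], tt, ev]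
  rw [← sum_subset (filter_subset _ _ : sqf (bigPrimes z ⌊v⌋₊) ⌊v⌋₊ ⊆ Ioc 0 ⌊v⌋₊) fun n hn h => by
    rw [ff_of_not_mem hn h, zero_mul]]
  refine sum_congr rfl fun n hn => ?_
  obtain ⟨h1, h2, h3⟩ := mem_filter.mp hn
  rw [ff_apply, ind_apply, if_pos, mul_one]
  exact ⟨h2.ne_zero, fun p hp => ⟨(mem_bigPrimes.mp (h3 hp)).2.2, (mem_bigPrimes.mp (h3 hp)).1.1⟩⟩

section

variable {P : Finset ℕ} {n : ℕ} (hs : Squarefree n) (hP : n.primeFactors ⊆ P)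
include hP

lemma prod_primeFactors_eq (f : ℕ → ℝ) :
    ∏ p ∈ n.primeFactors, f p = ∏ p ∈ P, if p ∈ n.primeFactors then f p else 1 := by
  rw [prod_ite_mem, inter_eq_right.mpr hP]

include hs

lemma cast_eq_prod : (n : ℝ) = ∏ p ∈ P, if p ∈ n.primeFactors then (p : ℝ) else 1 := by
  rw [← prod_primeFactors_eq hP, ← Nat.cast_prod, Nat.prod_primeFactors_of_squarefree hs]

lemma mu_eq_prod : mu n = ∏ p ∈ P, if p ∈ n.primeFactors then (-1 : ℝ) else 1 := by
  have h4 : cardFactors n = n.primeFactors.card := by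
    rw [← (cardDistinctFactors_eq_cardFactors_iff_squarefree hs.ne_zero).mpr hs]
    rfl
  rw [← prod_primeFactors_eq hP, mu, moebius_apply_of_squarefree hs, h4, prod_const]
  push_cast
  rfl

end

lemma primeFactors_lcm {a b : ℕ} (ha : a ≠ 0) (hb : b ≠ 0) :
    (a.lcm b).primeFactors = a.primeFactors ∪ b.primeFactors := by
  ext p
  rw [mem_union, Nat.mem_primeFactors, Nat.mem_primeFactors, Nat.mem_primeFactors]
  constructor
  · rintro ⟨hp, h, -⟩
    rcases (hp.dvd_mul).mp (h.trans (Nat.lcm_dvd_mul a b)) with h | h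
    · exact Or.inl ⟨hp, h, ha⟩
    · exact Or.inr ⟨hp, h, hb⟩
  · rintro (⟨hp, h, -⟩ | ⟨hp, h, -⟩)
    · exact ⟨hp, h.trans (Nat.dvd_lcm_left a b), Nat.lcm_ne_zero ha hb⟩
    · exact ⟨hp, h.trans (Nat.dvd_lcm_right a b), Nat.lcm_ne_zero ha hb⟩

lemma squarefree_lcm {a b : ℕ} (ha : Squarefree a) (hb : Squarefree b) :
    Squarefree (a.lcm b) := by
  rw [Nat.squarefree_iff_factorization_le_one (Nat.lcm_ne_zero ha.ne_zero hb.ne_zero)]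
  intro p
  rw [Nat.factorization_lcm ha.ne_zero hb.ne_zero, Finsupp.sup_apply]
  exact sup_le ((Nat.squarefree_iff_factorization_le_one ha.ne_zero).mp ha p)
    ((Nat.squarefree_iff_factorization_le_one hb.ne_zero).mp hb p)

lemma loc_eq (p : ℕ) (h j : ℝ) : loc p h j = MonoidAlgebra.single 1 1
    + MonoidAlgebra.single (p, 1) (-h) + MonoidAlgebra.single (1, p) (-h)
    + MonoidAlgebra.single (p, p) j := by
  rw [loc, MonoidAlgebra.single_neg, MonoidAlgebra.single_neg, ← MonoidAlgebra.one_def]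
  abel

/-- Prime by prime: if p divides exactly one of a, b the weight is −g₄(p)/(p g₂(p)); if it divides
both, it is g₄(p)/(p g₂(p)²), the two signs of μ cancelling and [a,b] containing p once. -/
lemma zTerm_eq {P : Finset ℕ} (hP1 : ∀ p ∈ P, p.Prime ∧ p % 4 = 1) {v : ℝ} (hv : 0 ≤ v) {a b : ℕ}
    (ha : a ∈ sqf P ⌊v⌋₊) (hb : b ∈ sqf P ⌊v⌋₊) :
    zTerm v a b = (∏ p ∈ P, wt 1 (-hcoef p) (-hcoef p) (jcoef p) (p ∈ a.primeFactors)
      (p ∈ b.primeFactors)) * tens v lg lg (a, b) := by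
  have ha' := (mem_filter.mp ha).2
  have hb' := (mem_filter.mp hb).2
  have hL := squarefree_lcm ha'.1 hb'.1
  have hU : (a.lcm b).primeFactors = a.primeFactors ∪ b.primeFactors :=
    primeFactors_lcm ha'.1.ne_zero hb'.1.ne_zero
  have hLP : (a.lcm b).primeFactors ⊆ P := hU ▸ union_subset ha'.2 hb'.2
  rw [zTerm, tens, lg_div_eq hv ha, lg_div_eq hv hb, mul_assoc _ (lg _)]
  congr 1
  rw [mu_eq_prod ha'.1 ha'.2, mu_eq_prod hb'.1 hb'.2, g₄, g₂, multExt, multExt, multExt,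
    prod_primeFactors_eq hLP, prod_primeFactors_eq ha'.2, prod_primeFactors_eq hb'.2,
    cast_eq_prod hL hLP, ← prod_mul_distrib, ← prod_mul_distrib, ← prod_mul_distrib,
    ← prod_mul_distrib, ← prod_div_distrib]
  refine prod_congr rfl fun p hp => ?_
  obtain ⟨hpp, hp4⟩ := hP1 p hp
  have hp2 : (2 : ℝ) ≤ p := by exact_mod_cast hpp.two_le
  have h1 : (0 : ℝ) < 2 * p - 1 := by linarith
  have e2 : (2 : ℝ) - 1 / p = (2 * p - 1) / p := by field_simp
  simp only [hU, mem_union, wt, g₂Prime, if_pos hp4, e2, hcoef, jcoef]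
  have hp0 : (p : ℝ) ≠ 0 := by positivity
  have hp1 : (p : ℝ) + 1 ≠ 0 := by positivity
  generalize hd : 2 * (p : ℝ) - 1 = d at h1 ⊢
  have hd0 := h1.ne'
  by_cases h3 : p ∈ a.primeFactors <;> by_cases h4 : p ∈ b.primeFactors
  · simp only [h3, h4, or_self, if_true]
    field_simp
  · simp only [h3, h4, or_false, if_true, if_false]
    field_simp
  · simp only [h3, h4, or_true, if_true, if_false]
    field_simp
  · simp only [h3, h4, or_self, if_false]
    norm_num

lemma zTerm_eq_zero_left {v : ℝ} {a b : ℕ} (h : mu a = 0) : zTerm v a b = 0 := by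
  rw [zTerm, h]; simp

lemma zTerm_eq_zero_right {v : ℝ} {a b : ℕ} (h : mu b = 0) : zTerm v a b = 0 := by
  rw [zTerm, h]; simp

lemma bigPrimes_spec (z N : ℕ) : ∀ p ∈ bigPrimes z N, p.Prime ∧ p % 4 = 1 :=
  fun _ hp => (mem_bigPrimes.mp hp).2

/-- The local factor for `Z1`. -/
noncomputable def locz (p : ℕ) : Dil := loc p (hcoef p) (jcoef p)

lemma Z1_eq {N z : ℕ} (hz : z = ⌊D₀ N⌋₊) {v : ℝ} (hv : 0 ≤ v) :
    Z1 v (W N) = act (∏ p ∈ bigPrimes z ⌊v⌋₊, locz p) (tens v lg lg) (1, 1) := by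
  simp only [locz, loc_eq]
  rw [act_prod_eq_sum (fun p hp => (bigPrimes_spec z _ p hp).1) ⌊v⌋₊ _ _ _ _
    (tens_mem_finSupp hv (fun _ => lg_of_lt) fun _ => lg_of_lt), Z1,
    sum_idx_eq hz v fun n hn => sum_eq_zero fun b _ => zTerm_eq_zero_left hn]
  refine sum_congr rfl fun a ha => ?_
  rw [sum_idx_eq hz v fun n hn => zTerm_eq_zero_right hn]
  exact sum_congr rfl fun b hb => zTerm_eq (bigPrimes_spec z _) hv ha hb

/-- After interchanging sums, q must divide [a,b]. In the expanded product this means dropping the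
choice 1 at q, so its factor becomes `locz q - 1`. -/
lemma Z2_eq {N z : ℕ} (hz : z = ⌊D₀ N⌋₊) {v : ℝ} (hv : 0 ≤ v) :
    Z2 v (W N) = ∑ q ∈ bigPrimes z ⌊v⌋₊, g₆ q *
      act ((locz q - 1) * ∏ p ∈ (bigPrimes z ⌊v⌋₊).erase q, locz p) (tens v lg lg) (1, 1) := by
  classical
  set P := bigPrimes z ⌊v⌋₊ with hP
  have h1 : ∀ q ∈ P, (locz q - 1) * ∏ p ∈ P.erase q, locz p
      = ∏ p ∈ P, (MonoidAlgebra.single 1 (if p = q then 0 else 1)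
      + MonoidAlgebra.single (p, 1) (-hcoef p)
      + MonoidAlgebra.single (1, p) (-hcoef p) + MonoidAlgebra.single (p, p) (jcoef p)) := by
    intro q hq
    rw [← mul_prod_erase P _ hq, if_pos rfl]
    congr 1
    · rw [locz, loc_eq, ← MonoidAlgebra.one_def, MonoidAlgebra.single_zero]
      abel
    · refine prod_congr rfl fun p hp => ?_
      rw [if_neg (mem_erase.mp hp).1, locz, loc_eq]
  have h2 : ∀ q ∈ P, act ((locz q - 1) * ∏ p ∈ P.erase q, locz p) (tens v lg lg) (1, 1)
      = ∑ a ∈ sqf P ⌊v⌋₊, ∑ b ∈ sqf P ⌊v⌋₊,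
        if q ∈ (a.lcm b).primeFactors then zTerm v a b else 0 := by
    intro q hq
    rw [h1 q hq, act_prod_eq_sum (fun p hp => (bigPrimes_spec z _ p hp).1) ⌊v⌋₊ _ _ _ _
      (tens_mem_finSupp hv (fun _ => lg_of_lt) fun _ => lg_of_lt)]
    refine sum_congr rfl fun a ha => sum_congr rfl fun b hb => ?_
    rw [zTerm_eq (bigPrimes_spec z _) hv ha hb, primeFactors_lcm (mem_filter.mp ha).2.1.ne_zero
      (mem_filter.mp hb).2.1.ne_zero]
    split_ifs with h
    · congr 1
      refine prod_congr rfl fun p hp => ?_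
      rcases eq_or_ne p q with rfl | hpq
      · rcases mem_union.mp h with h | h <;> simp [wt, h]
      · rw [if_neg hpq]
    · rw [prod_eq_zero hq, zero_mul]
      rw [mem_union, not_or] at h
      simp [wt, h]
  rw [Z2, sum_idx_eq hz v fun n hn => sum_eq_zero fun b _ => by
    rw [zTerm_eq_zero_left hn, zero_mul]]
  have h3 : ∀ a ∈ sqf P ⌊v⌋₊, ∑ b ∈ idx v (W N), zTerm v a b * ∑ p ∈ (a.lcm b).primeFactors, g₆ p
      = ∑ b ∈ sqf P ⌊v⌋₊, ∑ q ∈ P, g₆ q *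
        if q ∈ (a.lcm b).primeFactors then zTerm v a b else 0 := by
    intro a ha
    rw [sum_idx_eq hz v fun n hn => by rw [zTerm_eq_zero_right hn, zero_mul]]
    refine sum_congr rfl fun b hb => ?_
    have hLP : (a.lcm b).primeFactors ⊆ P := by
      rw [primeFactors_lcm (mem_filter.mp ha).2.1.ne_zero (mem_filter.mp hb).2.1.ne_zero]
      exact union_subset (mem_filter.mp ha).2.2 (mem_filter.mp hb).2.2
    rw [← inter_eq_right.mpr hLP, ← sum_ite_mem, Finset.mul_sum]
    refine sum_congr rfl fun q hq => ?_
    rw [inter_eq_right.mpr hLP]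
    split_ifs <;> ring
  have h4 : ∑ q ∈ P, g₆ q * act ((locz q - 1) * ∏ p ∈ P.erase q, locz p) (tens v lg lg) (1, 1)
      = ∑ q ∈ P, ∑ a ∈ sqf P ⌊v⌋₊, ∑ b ∈ sqf P ⌊v⌋₊,
        g₆ q * if q ∈ (a.lcm b).primeFactors then zTerm v a b else 0 :=
    sum_congr rfl fun q hq => by
      rw [h2 q hq, Finset.mul_sum]
      exact sum_congr rfl fun a _ => by rw [Finset.mul_sum]
  rw [sum_congr rfl h3, h4, sum_comm (s := P)]
  exact sum_congr rfl fun a _ => sum_comm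

/-- Coprimality of a and b is expressed by a vanishing xy-coefficient in every local factor. -/
lemma Y_eq {N z : ℕ} (hz : z = ⌊D₀ N⌋₊) {v : ℝ} (hv : 0 ≤ v) :
    Y v (W N) = act (∏ p ∈ bigPrimes z ⌊v⌋₊, loc p (1 / (p + 1)) 0) (tens v lg lg) (1, 1) := by
  simp only [loc_eq]
  rw [act_prod_eq_sum (fun p hp => (bigPrimes_spec z _ p hp).1) ⌊v⌋₊ _ _ _ _
    (tens_mem_finSupp hv (fun _ => lg_of_lt) fun _ => lg_of_lt), Y,
    sum_idx_eq hz v fun n hn => sum_eq_zero fun b _ => by rw [hn]; simp]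
  refine sum_congr rfl fun a ha => ?_
  rw [sum_filter, sum_idx_eq hz v fun n hn => by rw [hn]; simp]
  refine sum_congr rfl fun b hb => ?_
  have ha' := (mem_filter.mp ha).2
  have hb' := (mem_filter.mp hb).2
  have hco : a.Coprime b ↔ Disjoint a.primeFactors b.primeFactors :=
    (Nat.disjoint_primeFactors ha'.1.ne_zero hb'.1.ne_zero).symm
  split_ifs with h
  · rw [hco, disjoint_left] at h
    rw [tens, lg_div_eq hv ha, lg_div_eq hv hb, mul_assoc _ (lg _)]
    congr 1
    rw [mu_eq_prod ha'.1 ha'.2, mu_eq_prod hb'.1 hb'.2, g₇, multExt, multExt,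
      prod_primeFactors_eq ha'.2, prod_primeFactors_eq hb'.2,
      ← prod_mul_distrib, ← prod_mul_distrib, ← prod_div_distrib]
    refine prod_congr rfl fun p hp => ?_
    by_cases h3 : p ∈ a.primeFactors <;> by_cases h4 : p ∈ b.primeFactors
    · exact absurd h4 (h h3)
    · simp only [h3, h4, wt, if_true, if_false]
      ring
    · simp only [h3, h4, wt, if_true, if_false]
      ring
    · simp only [h3, h4, wt, if_false]
      norm_num
  · rw [hco, not_disjoint_iff] at h
    obtain ⟨p, h3, h4⟩ := h
    rw [prod_eq_zero (ha'.2 h3), zero_mul]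
    simp only [wt, h3, h4, if_true]

end SumTwoSquaresSieve
end

/-! ### A Mertens sum weighted by √(L − log p) -/

section
namespace SumTwoSquaresSieve
open Finset Filter Topology

/-- A Riemann sum for the integral of √(L − t). With s, t consecutive square roots the step of the
logarithm is s² − t², so both bounds become polynomial inequalities. The lower error telescopes
because s² − t² ≤ 1. -/
lemma sum_log_sub_mul_sqrt (L : ℝ) {k : ℕ} (hk : 1 ≤ k) (hkL : Real.log k ≤ L) :
    ∑ n ∈ Ioc 1 k, (Real.log n - Real.log (n - 1 : ℕ)) * √(L - Real.log n)
      ≤ 2 / 3 * (√L ^ 3 - √(L - Real.log k) ^ 3) ∧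
    2 / 3 * (√L ^ 3 - √(L - Real.log k) ^ 3) - (√L - √(L - Real.log k))
      ≤ ∑ n ∈ Ioc 1 k, (Real.log n - Real.log (n - 1 : ℕ)) * √(L - Real.log n) := by
  induction k, hk using Nat.le_induction with
  | base => simp
  | succ k hk ih =>
    have hk0 : (0 : ℝ) < k := by positivity
    have hk1 : (1 : ℝ) ≤ k := by exact_mod_cast hk
    have hmono : Real.log k ≤ Real.log (k + 1 : ℕ) :=
      Real.log_le_log hk0 (by push_cast; linarith)
    obtain ⟨h1, h2⟩ := ih (hmono.trans hkL)
    rw [sum_Ioc_succ_top (by omega), Nat.add_sub_cancel]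
    set s := √(L - Real.log k) with hs
    set t := √(L - Real.log (k + 1 : ℕ)) with ht
    have hs2 : s ^ 2 = L - Real.log k := Real.sq_sqrt (by linarith)
    have ht2 : t ^ 2 = L - Real.log (k + 1 : ℕ) := Real.sq_sqrt (by linarith)
    have ht0 : 0 ≤ t := Real.sqrt_nonneg _
    have hts : t ≤ s := Real.sqrt_le_sqrt (by linarith)
    have hd : Real.log (k + 1 : ℕ) - Real.log k = s ^ 2 - t ^ 2 := by rw [hs2, ht2]; ring
    have hd1 : s ^ 2 - t ^ 2 ≤ 1 := by
      rw [← hd, ← Real.log_div (by positivity) (by positivity)]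
      refine (Real.log_le_sub_one_of_pos (by positivity)).trans ?_
      rw [sub_le_iff_le_add, div_le_iff₀ hk0]
      push_cast
      linarith
    rw [hd]
    have a1 : (s ^ 2 - t ^ 2) * t ≤ 2 / 3 * (s ^ 3 - t ^ 3) := by
      have e : 2 / 3 * (s ^ 3 - t ^ 3) - (s ^ 2 - t ^ 2) * t
          = 1 / 3 * (s - t) ^ 2 * (2 * s + t) := by ring
      have : 0 ≤ 1 / 3 * (s - t) ^ 2 * (2 * s + t) := by
        have : 0 ≤ s := ht0.trans hts
        positivity
      linarith
    have a2 : 2 / 3 * (s ^ 3 - t ^ 3) - (s - t) ≤ (s ^ 2 - t ^ 2) * t := by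
      have e : (s ^ 2 - t ^ 2) * s - 2 / 3 * (s ^ 3 - t ^ 3)
          = 1 / 3 * (s - t) ^ 2 * (s + 2 * t) := by ring
      have h3 : 0 ≤ 1 / 3 * (s - t) ^ 2 * (s + 2 * t) := by
        have : 0 ≤ s := ht0.trans hts
        positivity
      have h4 : (s ^ 2 - t ^ 2) * (s - t) ≤ 1 * (s - t) :=
        mul_le_mul_of_nonneg_right hd1 (by linarith)
      nlinarith
    constructor <;> linarith

/-- A weighted Mertens sum over primes `p ≡ 1 (mod 4)`. -/
lemma exists_abs_sum_log_div_mul_sqrt_sub_le : ∃ B : ℝ, 1 ≤ B ∧ ∀ L : ℝ, 0 ≤ L →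
    |∑ p ∈ Ioc 0 ⌊Real.exp L⌋₊ with p.Prime ∧ p % 4 = 1, Real.log p / p * √(L - Real.log p)
      - L * √L / 3| ≤ B * (1 + √L) := by
  obtain ⟨B, hB⟩ := exists_abs_sum_log_div_sub_le
  have hB0 : 0 ≤ B := (abs_nonneg _).trans (hB 1 le_rfl)
  refine ⟨B + 1, by linarith, fun L hL => ?_⟩
  set N := ⌊Real.exp L⌋₊ with hN
  have hN1 : 1 ≤ N := (Nat.one_le_floor_iff _).mpr (Real.one_le_exp hL)
  have hN0 : (0 : ℝ) < N := by positivity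
  have hNL : Real.log N ≤ L := by
    rw [Real.log_le_iff_le_exp hN0]
    exact Nat.floor_le (Real.exp_pos L).le
  set a : ℕ → ℝ := fun n => if n.Prime ∧ n % 4 = 1 then Real.log n / n else 0 with ha
  have ha1 : a 1 = 0 := by simp [ha]
  have hsplit : ∀ (f : ℕ → ℝ) {k : ℕ}, 1 ≤ k → f 1 = 0 →
      ∑ n ∈ Ioc 0 k, f n = ∑ n ∈ Ioc 1 k, f n := fun f k hk h1 => by
    have e : Ioc 0 1 = {1} := rfl
    rw [← sum_Ioc_consecutive f (Nat.zero_le 1) hk, e, sum_singleton, h1, zero_add]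
  have htel : ∀ k : ℕ, 1 ≤ k →
      ∑ n ∈ Ioc 1 k, (Real.log n - Real.log (n - 1 : ℕ)) = Real.log k := fun k hk => by
    induction k, hk using Nat.le_induction with
    | base => simp
    | succ k hk ih => rw [sum_Ioc_succ_top (by omega), ih, Nat.add_sub_cancel]; ring
  -- Compare the prime weight with half the increment of log. The partial sums of the difference are
  -- bounded by Mertens, and the square root is a decreasing weight, equal to 0 once log n exceeds
  -- L.
  have hc : ∀ k, |∑ n ∈ Ioc 1 k, (a n - (Real.log n - Real.log (n - 1 : ℕ)) / 2)| ≤ B := by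
    intro k
    rcases Nat.eq_zero_or_pos k with rfl | hk
    · simpa using hB0
    · have h1 := hB k (by exact_mod_cast hk)
      rw [Nat.floor_natCast, sum_filter, hsplit _ hk ha1] at h1
      rw [sum_sub_distrib, ← Finset.sum_div, htel k hk]
      exact h1
  have h1 := abs_sum_mul_le_of_antitone (φ := fun n : ℕ => √(L - Real.log n)) hc
    (fun n => Real.sqrt_nonneg _) (fun n hn => Real.sqrt_le_sqrt (by
      have : Real.log n ≤ Real.log (n + 1 : ℕ) :=
        Real.log_le_log (by positivity) (by push_cast; linarith)
      linarith)) N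
  have h2 : √(L - Real.log (1 + 1 : ℕ)) ≤ √L :=
    Real.sqrt_le_sqrt (by linarith [Real.log_natCast_nonneg (1 + 1)])
  obtain ⟨h3, h4⟩ := sum_log_sub_mul_sqrt L hN1 hNL
  set S := ∑ n ∈ Ioc 1 N, (Real.log n - Real.log (n - 1 : ℕ)) * √(L - Real.log n) with hS
  set T := √(L - Real.log N) with hT
  have hT0 : 0 ≤ T := Real.sqrt_nonneg _
  have hT1 : T ≤ 1 := by
    refine Real.sqrt_le_iff.mpr ⟨zero_le_one, ?_⟩
    have h5 : Real.exp L ≤ 2 * N := by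
      have := Nat.lt_floor_add_one (Real.exp L)
      rw [← hN] at this
      have : (1 : ℝ) ≤ N := by exact_mod_cast hN1
      linarith
    have h6 := (Real.le_log_iff_exp_le (by positivity)).mpr h5
    rw [Real.log_mul (by norm_num) hN0.ne'] at h6
    have := Real.log_two_lt_d9
    norm_num
    linarith
  have hT3 : T ^ 3 ≤ 1 := pow_le_one₀ hT0 hT1
  have hT30 : 0 ≤ T ^ 3 := by positivity
  have hL3 : √L ^ 3 = L * √L := by rw [pow_succ, Real.sq_sqrt hL]
  rw [hL3] at h3 h4
  have e1 : ∑ p ∈ Ioc 0 N with p.Prime ∧ p % 4 = 1, Real.log p / p * √(L - Real.log p)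
      = ∑ n ∈ Ioc 1 N, a n * √(L - Real.log n) := by
    rw [sum_filter, ← hsplit (fun n => a n * √(L - Real.log n)) hN1 (by simp [ha1])]
    exact sum_congr rfl fun n _ => by simp only [ha]; split_ifs <;> simp
  have e2 : ∑ n ∈ Ioc 1 N, (a n - (Real.log n - Real.log (n - 1 : ℕ)) / 2) * √(L - Real.log n)
      = ∑ n ∈ Ioc 1 N, a n * √(L - Real.log n) - S / 2 := by
    rw [hS, Finset.sum_div, ← sum_sub_distrib]
    exact sum_congr rfl fun n _ => by ring
  rw [e2] at h1
  have h7 : B * √(L - Real.log (1 + 1 : ℕ)) ≤ B * √L := mul_le_mul_of_nonneg_left h2 hB0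
  have h8 := abs_le.mp (h1.trans h7)
  have hs0 := Real.sqrt_nonneg L
  rw [e1, abs_le]
  constructor <;> nlinarith

end SumTwoSquaresSieve
end

/-! ### Uniform bounds and the contribution of one prime to Z⁽²⁾ -/

section
namespace SumTwoSquaresSieve
open Finset Filter Topology

lemma le_mm (z : ℕ) : 8 * landauA / Real.pi ≤ mm z := by
  have hA := landauA_pos_and_sq.1
  have hg := gz_pos z
  have hpi := Real.pi_pos
  rw [mm]
  exact div_le_div_of_nonneg_left (by positivity) (by positivity)
    (mul_le_of_le_one_right hpi.le (gz_le_one z))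

lemma le_ka (z : ℕ) : 128 * landauA ^ 3 / Real.pi ^ 2 ≤ ka z := by
  have hA := landauA_pos_and_sq.1
  have hg := gz_pos z
  have hpi := Real.pi_pos
  rw [ka]
  exact div_le_div_of_nonneg_left (by positivity) (by positivity)
    (mul_le_of_le_one_right (by positivity) (pow_le_one₀ hg.le (gz_le_one z)))

lemma mm_pos (z : ℕ) : 0 < mm z :=
  lt_of_lt_of_le (div_pos (mul_pos (by norm_num) landauA_pos_and_sq.1) Real.pi_pos) (le_mm z)

lemma ka_pos (z : ℕ) : 0 < ka z :=
  lt_of_lt_of_le (div_pos (mul_pos (by norm_num) (pow_pos landauA_pos_and_sq.1 3))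
    (pow_pos Real.pi_pos 2)) (le_ka z)

/-- Turns an additive error into a relative error 1/D; this is possible uniformly in z because the
main constants are bounded below by some m > 0. -/
lemma error_le_of_le {B m b h r D s κ : ℝ} (hm : 0 < m) (hB : 1 + b / m ≤ B) (hh : 0 ≤ h)
    (hr : 0 ≤ r) (hD : 0 < D) (hs : B * h * r * D ≤ s) (hκ : m ≤ κ) (hs0 : 0 ≤ s) :
    b * h * r ≤ κ * s / D := by
  rw [le_div_iff₀ hD]
  have h1 : b / m * (h * r * D) ≤ s := by
    refine le_trans ?_ hs
    have : b / m ≤ B := by linarith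
    calc b / m * (h * r * D) ≤ B * (h * r * D) := by gcongr
      _ = _ := by ring
  have h2 : b * h * r * D = m * (b / m * (h * r * D)) := by field_simp
  rw [h2]
  exact (mul_le_mul_of_nonneg_left h1 hm.le).trans (mul_le_mul_of_nonneg_right hκ hs0)

lemma exists_tt_bounds : ∃ B : ℝ, 1 ≤ B ∧ ∀ (z : ℕ) (L D : ℝ), 1 ≤ L → 1 ≤ D →
    B * hz z ^ 3 * (1 + L) ^ (1 / 4 : ℝ) * D ≤ √L →
    (∀ u, 0 ≤ u → u ≤ L → |tt z (Real.exp u) - mm z * √u| ≤ mm z * √L / D) ∧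
    ∀ n : ℕ, |tt z (Real.exp L / n)| ≤ 2 * (mm z * √L) := by
  obtain ⟨b, hb1, hb⟩ := exists_abs_tt_sub_le
  have hm : 0 < 8 * landauA / Real.pi :=
    div_pos (mul_pos (by norm_num) landauA_pos_and_sq.1) Real.pi_pos
  have hbm : 0 < b / (8 * landauA / Real.pi) := div_pos (by linarith) hm
  refine ⟨1 + b / (8 * landauA / Real.pi), by linarith, fun z L D hL hD h => ?_⟩
  have hH := one_le_hz z
  have hE := error_le_of_le hm le_rfl (by positivity) (by positivity) (by linarith) h (le_mm z)
    (Real.sqrt_nonneg L)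
  have hM := mm_pos z
  have h1 : ∀ u, 0 ≤ u → u ≤ L → |tt z (Real.exp u) - mm z * √u| ≤ mm z * √L / D :=
    fun u hu huL => by
      refine (hb z u hu).trans (le_trans ?_ hE)
      gcongr
  refine ⟨h1, fun n => ?_⟩
  set x := Real.exp L / n with hx
  have hsL : 0 ≤ mm z * √L := by positivity
  rcases lt_or_ge x 1 with hx1 | hx1
  · rw [tt_of_lt z hx1, abs_zero]
    linarith
  · have hn : 1 ≤ (n : ℝ) := by
      have := (one_le_div_cast_iff (Real.exp_pos L).le).mp hx1
      exact_mod_cast this.1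
    have hu0 := Real.log_nonneg hx1
    have hxu : Real.exp (Real.log x) = x := Real.exp_log (by linarith)
    have huL : Real.log x ≤ L := by
      rw [Real.log_le_iff_le_exp (by linarith)]
      exact div_le_self (Real.exp_pos L).le hn
    have h2 := h1 _ hu0 huL
    rw [hxu] at h2
    have h3 : mm z * √L / D ≤ mm z * √L := div_le_self hsL hD
    have h4 : mm z * √(Real.log x) ≤ mm z * √L := by gcongr
    have h5 : 0 ≤ mm z * √(Real.log x) := by positivity
    have h6 := abs_le.mp h2
    rw [abs_le]
    constructor <;> linarith

lemma exists_th_bounds : ∃ B : ℝ, 1 ≤ B ∧ ∀ (z : ℕ) (L D : ℝ), 1 ≤ L → 1 ≤ D →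
    B * hz z ^ 3 * (1 + L) ^ (1 / 4 : ℝ) * D ≤ √L →
    (∀ u v, 0 ≤ u → u ≤ v → v ≤ L →
      |th z (Real.exp u) (Real.exp v) - ka z * √u| ≤ ka z * √L / D) ∧
    ∀ t, |thf z (Real.exp L) t| ≤ 2 * (ka z * √L) := by
  obtain ⟨b, hb1, hb⟩ := exists_abs_th_sub_le
  have hm : 0 < 128 * landauA ^ 3 / Real.pi ^ 2 :=
    div_pos (mul_pos (by norm_num) (pow_pos landauA_pos_and_sq.1 3)) (pow_pos Real.pi_pos 2)
  have hbm : 0 < b / (128 * landauA ^ 3 / Real.pi ^ 2) := div_pos (by linarith) hm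
  refine ⟨1 + b / (128 * landauA ^ 3 / Real.pi ^ 2), by linarith, fun z L D hL hD h => ?_⟩
  have hH := one_le_hz z
  have hE := error_le_of_le hm le_rfl (by positivity) (by positivity) (by linarith) h (le_ka z)
    (Real.sqrt_nonneg L)
  have hM := ka_pos z
  have h1 : ∀ u v, 0 ≤ u → u ≤ v → v ≤ L →
      |th z (Real.exp u) (Real.exp v) - ka z * √u| ≤ ka z * √L / D := fun u v hu huv hvL => by
    refine (hb z u v hu huv).trans (le_trans ?_ hE)
    gcongr
    linarith
  refine ⟨h1, ?_⟩
  have hsL : 0 ≤ ka z * √L := by positivity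
  have key : ∀ x y : ℝ, 1 ≤ x → x ≤ y → y ≤ Real.exp L → |th z x y| ≤ 2 * (ka z * √L) := by
    intro x y hx1 hxy hyL
    have hu0 := Real.log_nonneg hx1
    have hxu : Real.exp (Real.log x) = x := Real.exp_log (by linarith)
    have hyv : Real.exp (Real.log y) = y := Real.exp_log (by linarith)
    have huv : Real.log x ≤ Real.log y := Real.log_le_log (by linarith) hxy
    have hvL : Real.log y ≤ L := by rwa [Real.log_le_iff_le_exp (by linarith)]
    have h2 := h1 _ _ hu0 huv hvL
    rw [hxu, hyv] at h2
    have h3 : ka z * √L / D ≤ ka z * √L := div_le_self hsL hD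
    have h4 : ka z * √(Real.log x) ≤ ka z * √L := by
      gcongr
      linarith
    have h5 : 0 ≤ ka z * √(Real.log x) := by positivity
    have h6 := abs_le.mp h2
    rw [abs_le]
    constructor <;> linarith
  have hle : ∀ n : ℕ, 1 ≤ Real.exp L / n → Real.exp L / n ≤ Real.exp L := fun n hn => by
    refine div_le_self (Real.exp_pos L).le ?_
    exact_mod_cast ((one_le_div_cast_iff (Real.exp_pos L).le).mp hn).1
  intro t
  rw [thf]
  rcases lt_or_ge (Real.exp L / t.1) 1 with hx1 | hx1
  · rw [th_of_lt_left z _ hx1, abs_zero]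
    linarith
  rcases lt_or_ge (Real.exp L / t.2) 1 with hy1 | hy1
  · rw [th_of_lt_right z _ hy1 (by positivity), abs_zero]
    linarith
  rcases le_total (Real.exp L / t.1) (Real.exp L / t.2) with hxy | hxy
  · exact key _ _ hx1 hxy (hle _ hy1)
  · rw [th_comm z (by positivity) (by positivity)]
    exact key _ _ hy1 hxy (hle _ hx1)

/-- Finite support lets |F| attain its maximum at some s. There |F(s)| ≤ K + ½|F(s)|, which gives
the bound. -/
lemma abs_le_two_mul_of_act {N : ℕ} {F : ℕ × ℕ → ℝ} (hF : F ∈ finSupp N) {ξ : Dil}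
    (hξ : NormLE ξ (1 / 2)) {K : ℝ} (hK : ∀ t, |act (1 + ξ) F t| ≤ K) (t : ℕ × ℕ) :
    |F t| ≤ 2 * K := by
  have hK0 : 0 ≤ K := (abs_nonneg _).trans (hK t)
  rcases (Icc 1 N ×ˢ Icc 1 N).eq_empty_or_nonempty with h | h
  · rw [hF t fun ht => ?_, abs_zero]
    · linarith
    · have : t ∈ Icc 1 N ×ˢ Icc 1 N := mem_product.mpr ⟨mem_Icc.mpr ht.1, mem_Icc.mpr ht.2⟩
      rw [h] at this
      exact notMem_empty _ this
  · obtain ⟨s, -, hs⟩ := exists_max_image (Icc 1 N ×ˢ Icc 1 N) (fun t => |F t|) h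
    have hmax : ∀ t, |F t| ≤ |F s| := fun t => by
      by_cases ht : (1 ≤ t.1 ∧ t.1 ≤ N) ∧ 1 ≤ t.2 ∧ t.2 ≤ N
      · exact hs t (mem_product.mpr ⟨mem_Icc.mpr ht.1, mem_Icc.mpr ht.2⟩)
      · rw [hF t ht, abs_zero]
        exact abs_nonneg _
    have h1 := hξ.2 F _ hmax s
    have h2 := hK s
    rw [act_add, act_one] at h2
    have h3 := abs_sub_abs_le_abs_sub (F s + act ξ F s) (act ξ F s)
    have h4 := abs_sub (F s + act ξ F s) (act ξ F s)
    rw [add_sub_cancel_right] at h4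
    have := hmax t
    linarith

lemma abs_g₆_sub_le {q : ℕ} (hq : 2 ≤ q) (hq4 : q % 4 = 1) :
    |g₆ q - Real.log q / 2| ≤ 2 * (Real.log q / q) ∧ |g₆ q| ≤ 2 * Real.log q := by
  have hq2 : (2 : ℝ) ≤ q := by exact_mod_cast hq
  have hlog : 0 ≤ Real.log q := Real.log_natCast_nonneg q
  have hd : 0 < 4 * (q : ℝ) ^ 2 - 3 * q + 1 := by nlinarith
  have e : g₆ q - Real.log q / 2 = -(Real.log q * ((7 * (q : ℝ) ^ 2 - 2 * q - 1)
      / (2 * (q + 1) * (4 * (q : ℝ) ^ 2 - 3 * q + 1)))) := by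
    rw [g₆, if_pos hq4]
    generalize hd' : 4 * (q : ℝ) ^ 2 - 3 * q + 1 = d at hd ⊢
    have : (q : ℝ) + 1 ≠ 0 := by positivity
    field_simp
    rw [← hd']
    ring
  have h1 : (7 * (q : ℝ) ^ 2 - 2 * q - 1) / (2 * (q + 1) * (4 * (q : ℝ) ^ 2 - 3 * q + 1))
      ≤ 2 / q := by
    rw [div_le_div_iff₀ (by positivity) (by positivity)]
    have : 2 * (q : ℝ) ^ 2 ≤ 4 * (q : ℝ) ^ 2 - 3 * q + 1 := by nlinarith
    nlinarith [mul_nonneg (sq_nonneg (q : ℝ)) (by linarith : (0 : ℝ) ≤ q)]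
  have h0 : 0 ≤ (7 * (q : ℝ) ^ 2 - 2 * q - 1) / (2 * (q + 1) * (4 * (q : ℝ) ^ 2 - 3 * q + 1)) :=
    div_nonneg (by nlinarith) (by positivity)
  have h2 : |g₆ q - Real.log q / 2| ≤ 2 * (Real.log q / q) := by
    rw [e, abs_neg, abs_mul, abs_of_nonneg hlog, abs_of_nonneg h0]
    calc _ ≤ Real.log q * (2 / q) := mul_le_mul_of_nonneg_left h1 hlog
      _ = _ := by ring
  refine ⟨h2, ?_⟩
  have h3 : Real.log q / q ≤ Real.log q / 2 := div_le_div_of_nonneg_left hlog (by norm_num) hq2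
  have h4 := abs_le.mp h2
  rw [abs_le]
  constructor <;> linarith

lemma abs_hcoef_le {q : ℝ} (hq : 2 ≤ q) : |hcoef q| ≤ 5 / q ∧ |jcoef q| ≤ 3 / q := by
  have h1 := abs_le.mp (abs_hcoef_sub_le hq)
  have h2 := abs_le.mp (abs_jcoef_sub_le hq)
  have h3 : 1 / q ^ 2 ≤ 1 / q * (1 / 2) := by
    rw [sq, ← one_div_mul_one_div]
    gcongr
  have h4 : 0 < 1 / q := by positivity
  have e1 : 5 / q ^ 2 = 5 * (1 / q ^ 2) := by ring
  have e2 : 3 / q ^ 2 = 3 * (1 / q ^ 2) := by ring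
  have e3 : 2 / q = 2 * (1 / q) := by ring
  have e4 : 5 / q = 5 * (1 / q) := by ring
  have e5 : 3 / q = 3 * (1 / q) := by ring
  rw [e1, e3] at h1
  rw [e2] at h2
  rw [e4, e5, abs_le, abs_le]
  refine ⟨⟨?_, ?_⟩, ?_, ?_⟩ <;> linarith

lemma locz_sub_one (q : ℕ) : locz q - 1 = MonoidAlgebra.single (q, 1) (-hcoef q)
    + MonoidAlgebra.single (1, q) (-hcoef q) + MonoidAlgebra.single (q, q) (jcoef q) := by
  rw [locz, loc_eq, ← MonoidAlgebra.one_def]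
  abel

lemma normLE_locz_sub_one {q : ℕ} (hq : 2 ≤ q) : NormLE (locz q - 1) (13 / q) := by
  obtain ⟨h1, h2⟩ := abs_hcoef_le (q := q) (by exact_mod_cast hq)
  rw [locz_sub_one]
  rw [← abs_neg] at h1
  refine ((((NormLE.single _ _).mono h1).add ((NormLE.single _ _).mono h1)).add
    ((NormLE.single _ _).mono h2)).mono (le_of_eq ?_)
  ring

/-- The contribution of a single prime `q` to `Z2`. -/
lemma abs_act_locz_sub_one_mul_le {N : ℕ} {P : Finset ℕ} {q : ℕ} (hqP : q ∈ P) (hq : 26 ≤ q)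
    {Ψ Θ : ℕ × ℕ → ℝ} (hΨ : Ψ ∈ finSupp N) {ε K : ℝ}
    (hε : ∀ t, |act (∏ p ∈ P, locz p) Ψ t - Θ t| ≤ ε)
    (hK : ∀ t, |act (∏ p ∈ P, locz p) Ψ t| ≤ K) :
    |act ((locz q - 1) * ∏ p ∈ P.erase q, locz p) Ψ (1, 1)
      - 1 / q * (Θ (q, q) - 2 * Θ (q, 1) - 2 * Θ (1, q))| ≤ 351 * K * (1 / q) ^ 2 + 5 * ε * (1 / q) := by
  have hq26 : (26 : ℝ) ≤ q := by exact_mod_cast hq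
  have hn := normLE_locz_sub_one (q := q) (by omega)
  set G := act (∏ p ∈ P, locz p) Ψ with hG
  set G' := act (∏ p ∈ P.erase q, locz p) Ψ with hG'
  have hG'mem : G' ∈ finSupp N := act_mem_finSupp _ hΨ
  have hGG' : G = act (1 + (locz q - 1)) G' := by
    rw [hG', ← act_mul, add_sub_cancel, mul_prod_erase P _ hqP]
  have hK0 : 0 ≤ K := (abs_nonneg _).trans (hK (1, 1))
  have hε0 : 0 ≤ ε := (abs_nonneg _).trans (hε (1, 1))
  have hsup : ∀ t, |G' t| ≤ 2 * K := fun t => by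
    refine abs_le_two_mul_of_act hG'mem (hn.mono ?_) (fun s => ?_) t
    · rw [div_le_div_iff₀ (by linarith) (by norm_num)]
      linarith
    · rw [← hGG']
      exact hK s
  -- As G is the full product and G' lacks the factor at q, (locz q − 1)G' = (locz q − 1)G − (locz q
  -- − 1)²G'. The last term is at most (13/q)² · 2K, and G may then be replaced by Θ.
  have h1 : act ((locz q - 1) * ∏ p ∈ P.erase q, locz p) Ψ (1, 1)
      = act (locz q - 1) G (1, 1) - act ((locz q - 1) * (locz q - 1)) G' (1, 1) := by
    have e : (locz q - 1) * (1 + (locz q - 1))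
        = (locz q - 1) + (locz q - 1) * (locz q - 1) := by ring
    rw [act_mul, ← hG', hGG', ← act_mul (locz q - 1) (1 + (locz q - 1)), e, act_add, add_sub_cancel_right]
  have h2 := (hn.mul hn).2 G' _ hsup (1, 1)
  have h3 : act (locz q - 1) G (1, 1)
      = -hcoef q * G (q, 1) + -hcoef q * G (1, q) + jcoef q * G (q, q) := by
    rw [locz_sub_one, act_add, act_add, act_single, act_single, act_single]
    simp
  have key : ∀ (c m d : ℝ) (t : ℕ × ℕ), |c - m * (1 / q)| ≤ d * (1 / q) ^ 2 → |m| ≤ 2 →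
      |c * G t - m * (1 / q) * Θ t| ≤ d * (1 / q) ^ 2 * K + 2 * (1 / q) * ε := by
    intro c m d t hc hm
    have e : c * G t - m * (1 / q) * Θ t = (c - m * (1 / q)) * G t + m * (1 / q) * (G t - Θ t) := by
      ring
    rw [e]
    refine (abs_add_le _ _).trans (add_le_add ?_ ?_)
    · rw [abs_mul]
      exact mul_le_mul hc (hK t) (abs_nonneg _) ((abs_nonneg _).trans hc)
    · rw [abs_mul, abs_mul, abs_of_pos (by positivity : (0 : ℝ) < 1 / q)]
      have := hε t
      gcongr
  have hh := abs_hcoef_sub_le (p := q) (by linarith)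
  have hj := abs_jcoef_sub_le (p := q) (by linarith)
  have hh' : |hcoef q - 2 * (1 / q)| ≤ 5 * (1 / (q : ℝ)) ^ 2 := by
    have e1 : 2 * (1 / (q : ℝ)) = 2 / q := by ring
    have e2 : 5 * (1 / (q : ℝ)) ^ 2 = 5 / (q : ℝ) ^ 2 := by ring
    rwa [e1, e2]
  have hj' : |jcoef q - 1 * (1 / q)| ≤ 3 * (1 / (q : ℝ)) ^ 2 := by
    have e2 : 3 * (1 / (q : ℝ)) ^ 2 = 3 / (q : ℝ) ^ 2 := by ring
    rwa [one_mul, e2]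
  have k1 := key _ 2 5 (q, 1) hh' (by norm_num)
  have k2 := key _ 2 5 (1, q) hh' (by norm_num)
  have k3' : |jcoef q * G (q, q) - 1 * (1 / q) * Θ (q, q)|
      ≤ 3 * (1 / (q : ℝ)) ^ 2 * K + 1 * (1 / q) * ε := by
    have e : jcoef q * G (q, q) - 1 * (1 / q) * Θ (q, q)
        = (jcoef q - 1 * (1 / q)) * G (q, q) + 1 * (1 / q) * (G (q, q) - Θ (q, q)) := by ring
    rw [e]
    refine (abs_add_le _ _).trans (add_le_add ?_ ?_)
    · rw [abs_mul]
      exact mul_le_mul hj' (hK _) (abs_nonneg _) ((abs_nonneg _).trans hj')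
    · rw [abs_mul, abs_of_pos (by positivity : (0 : ℝ) < 1 * (1 / q))]
      have := hε (q, q)
      gcongr
  have e13 : 13 / (q : ℝ) * (13 / q) * (2 * K) = 338 * K * (1 / q) ^ 2 := by ring
  rw [e13] at h2
  rw [h1, h3]
  rw [abs_le] at k1 k2 k3' h2 ⊢
  constructor <;> nlinarith

end SumTwoSquaresSieve
end

/-! ### Relative errors for the model quantities -/

section
namespace SumTwoSquaresSieve
open Finset Filter Topology

/-- The two-dimensional sum with the local factors for `Z1`. -/
noncomputable def zz (z : ℕ) (v : ℝ) : ℕ × ℕ → ℝ :=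
  act (∏ p ∈ bigPrimes z ⌊v⌋₊, locz p) (tens v lg lg)

lemma one_div_le_two_div {z : ℕ} (hz : 800 ≤ z) {D : ℝ} (hzD : (z : ℝ) ≤ D) (hD : D ≤ 2 * z) :
    1 / (z : ℝ) ≤ 2 / D := by
  have hz0 : (800 : ℝ) ≤ z := by exact_mod_cast hz
  rw [div_le_div_iff₀ (by linarith) (by linarith)]
  linarith

lemma exists_tt_rel : ∃ B : ℝ, 1 ≤ B ∧ ∀ (z : ℕ) (L D : ℝ), 800 ≤ z → 1 ≤ L → (z : ℝ) ≤ D →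
    D ≤ 2 * z → B * hz z ^ 3 * (1 + L) ^ (1 / 4 : ℝ) * D ≤ √L →
    |tt z (Real.exp L) - mm z * √L| ≤ 1 / D * (mm z * √L) ∧
    |act (∏ p ∈ bigPrimes z ⌊Real.exp L⌋₊, loc p (1 / (p + 1)) 0) (tens (Real.exp L) lg lg) (1, 1)
      - mm z ^ 2 * L| ≤ 12803 / D * (mm z ^ 2 * L) := by
  obtain ⟨B, hB1, hB⟩ := exists_tt_bounds
  refine ⟨B, hB1, fun z L D hz hL hzD hDz h => ?_⟩
  have hz0 : (800 : ℝ) ≤ z := by exact_mod_cast hz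
  have hD1 : 1 ≤ D := by linarith
  obtain ⟨h1, h2⟩ := hB z L D hL hD1 h
  have h3 := h1 L (by linarith) le_rfl
  have e1 : mm z * √L / D = 1 / D * (mm z * √L) := by ring
  rw [e1] at h3
  refine ⟨h3, ?_⟩
  have hM : 0 ≤ mm z * √L := mul_nonneg (mm_pos z).le (Real.sqrt_nonneg L)
  have hM2 : (mm z * √L) ^ 2 = mm z ^ 2 * L := by rw [mul_pow, Real.sq_sqrt (by linarith)]
  set M := mm z * √L with hMdef
  have h4 := abs_act_prod_loc_sub_tens_le hz (Real.exp_pos L).le (K := (2 * M) * (2 * M))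
    (fun t => by
      rw [tens, abs_mul]
      exact mul_le_mul (h2 _) (h2 _) (abs_nonneg _) (by positivity)) (1, 1)
  have h5 := one_div_le_two_div hz hzD hDz
  have e2 : tens (Real.exp L) (tt z) (tt z) (1, 1) = tt z (Real.exp L) ^ 2 := by
    rw [tens, sq]
    simp
  have h6 : 1600 / (z : ℝ) * (2 * M * (2 * M)) ≤ 12800 / D * M ^ 2 := by
    have e3 : 1600 / (z : ℝ) * (2 * M * (2 * M)) = 6400 * M ^ 2 * (1 / z) := by ring
    have e4 : 12800 / D * M ^ 2 = 6400 * M ^ 2 * (2 / D) := by ring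
    rw [e3, e4]
    gcongr
  rw [e2] at h4
  have h7 : |tt z (Real.exp L) ^ 2 - M ^ 2| ≤ 3 / D * M ^ 2 := by
    have e5 : tt z (Real.exp L) ^ 2 - M ^ 2
        = (tt z (Real.exp L) - M) * (tt z (Real.exp L) + M) := by ring
    have h8 := h2 1
    rw [Nat.cast_one, div_one] at h8
    have h9 : |tt z (Real.exp L) + M| ≤ 3 * M := by
      refine (abs_add_le _ _).trans ?_
      rw [abs_of_nonneg hM]
      linarith
    rw [e5, abs_mul]
    calc _ ≤ 1 / D * M * (3 * M) := mul_le_mul h3 h9 (abs_nonneg _) (by positivity)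
      _ = _ := by ring
  rw [← hM2]
  have h10 := abs_sub_le (act (∏ p ∈ bigPrimes z ⌊Real.exp L⌋₊, loc p (1 / (p + 1)) 0)
    (tens (Real.exp L) lg lg) (1, 1)) (tt z (Real.exp L) ^ 2) (M ^ 2)
  calc _ ≤ _ := h10
    _ ≤ 12800 / D * M ^ 2 + 3 / D * M ^ 2 := add_le_add (h4.trans h6) h7
    _ = _ := by ring

lemma abs_zz_sub_le {z : ℕ} {L D M : ℝ} (hz : 800 ≤ z) (hzD : (z : ℝ) ≤ D) (hDz : D ≤ 2 * z)
    (hM : 0 ≤ M) (h : ∀ t, |thf z (Real.exp L) t| ≤ 2 * M) (t : ℕ × ℕ) :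
    |zz z (Real.exp L) t - thf z (Real.exp L) t| ≤ 6400 / D * M ∧ |zz z (Real.exp L) t| ≤ 6 * M := by
  have hz0 : (800 : ℝ) ≤ z := by exact_mod_cast hz
  have h1 := abs_act_prod_loc_sub_thf_le hz (Real.exp_pos L).le h t
  have h5 := one_div_le_two_div hz hzD hDz
  have h2 : 1600 / (z : ℝ) * (2 * M) ≤ 6400 / D * M := by
    have e3 : 1600 / (z : ℝ) * (2 * M) = 3200 * M * (1 / z) := by ring
    have e4 : 6400 / D * M = 3200 * M * (2 / D) := by ring
    rw [e3, e4]
    gcongr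
  have h3 : 1600 / (z : ℝ) * (2 * M) ≤ 4 * M := by
    have : 1600 / (z : ℝ) ≤ 2 := by rw [div_le_iff₀ (by linarith)]; linarith
    nlinarith
  refine ⟨h1.trans h2, ?_⟩
  have h4 := abs_sub_abs_le_abs_sub (zz z (Real.exp L) t) (thf z (Real.exp L) t)
  have h6 : |zz z (Real.exp L) t - thf z (Real.exp L) t| ≤ 4 * M := h1.trans h3
  linarith [h t]

lemma exists_zz_rel : ∃ B : ℝ, 1 ≤ B ∧ ∀ (z : ℕ) (L D : ℝ), 800 ≤ z → 1 ≤ L → (z : ℝ) ≤ D →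
    D ≤ 2 * z → B * hz z ^ 3 * (1 + L) ^ (1 / 4 : ℝ) * D ≤ √L →
    |zz z (Real.exp L) (1, 1) - ka z * √L| ≤ 6401 / D * (ka z * √L) := by
  obtain ⟨B, hB1, hB⟩ := exists_th_bounds
  refine ⟨B, hB1, fun z L D hz hL hzD hDz h => ?_⟩
  have hz0 : (800 : ℝ) ≤ z := by exact_mod_cast hz
  obtain ⟨h1, h2⟩ := hB z L D hL (by linarith) h
  have h3 := h1 L L (by linarith) le_rfl le_rfl
  have hM : 0 ≤ ka z * √L := mul_nonneg (ka_pos z).le (Real.sqrt_nonneg L)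
  have h4 := (abs_zz_sub_le hz hzD hDz hM h2 (1, 1)).1
  have e : thf z (Real.exp L) (1, 1) = th z (Real.exp L) (Real.exp L) := by simp [thf]
  rw [e] at h4
  calc _ ≤ _ := abs_sub_le _ _ _
    _ ≤ _ := add_le_add h4 h3
    _ = _ := by ring

lemma bigPrimes_eq (z N : ℕ) :
    bigPrimes z N = ((Ioc 0 N).filter fun p => p.Prime ∧ p % 4 = 1).filter fun p => z < p := by
  ext p
  simp only [mem_bigPrimes, mem_filter, mem_Ioc]
  constructor
  · rintro ⟨⟨h1, h2⟩, h3⟩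
    exact ⟨⟨⟨by omega, h2⟩, h3⟩, h1⟩
  · rintro ⟨⟨⟨_, h2⟩, h3⟩, h1⟩
    exact ⟨⟨h1, h2⟩, h3⟩

/-- The primes up to z are discarded with the crude bound (z + b)√L for their part. This is harmless
since z will be a power of log log N. -/
lemma exists_abs_sum_bigPrimes_le : ∃ B : ℝ, 1 ≤ B ∧ ∀ (z : ℕ) (L : ℝ), 1 ≤ z → 1 ≤ L →
    ∑ p ∈ bigPrimes z ⌊Real.exp L⌋₊, Real.log p / p ≤ B * L ∧
    |∑ p ∈ bigPrimes z ⌊Real.exp L⌋₊, Real.log p / p * √(L - Real.log p) - L * √L / 3|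
      ≤ (z + B) * √L := by
  obtain ⟨b, hb⟩ := exists_abs_sum_log_div_sub_le
  obtain ⟨b2, hb21, hb2⟩ := exists_abs_sum_log_div_mul_sqrt_sub_le
  have hb0 : 0 ≤ b := (abs_nonneg _).trans (hb 1 le_rfl)
  refine ⟨1 + b + 2 * b2, by linarith, fun z L hz hL => ?_⟩
  have hz1 : (1 : ℝ) ≤ z := by exact_mod_cast hz
  set N := ⌊Real.exp L⌋₊ with hN
  set Q := (Ioc 0 N).filter fun p => p.Prime ∧ p % 4 = 1 with hQ
  have hnn : ∀ p : ℕ, 0 ≤ Real.log p / p := fun p =>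
    div_nonneg (Real.log_natCast_nonneg p) (Nat.cast_nonneg p)
  have hL1 : 1 ≤ √L := Real.one_le_sqrt.mpr hL
  constructor
  · have h1 := (abs_le.mp (hb (Real.exp L) (Real.one_le_exp (by linarith)))).2
    rw [Real.log_exp, ← hN, ← hQ] at h1
    have h2 : ∑ p ∈ bigPrimes z N, Real.log p / p ≤ ∑ p ∈ Q, Real.log p / p := by
      rw [bigPrimes_eq]
      exact sum_le_sum_of_subset_of_nonneg (filter_subset _ _) fun p _ _ => hnn p
    nlinarith
  · have h1 := hb2 L (by linarith)
    rw [← hN, ← hQ, ← sum_filter_add_sum_filter_not Q (fun p => z < p), ← bigPrimes_eq] at h1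
    set S := ∑ p ∈ Q with ¬ z < p, Real.log p / p * √(L - Real.log p) with hS
    have hS0 : 0 ≤ S := sum_nonneg fun p _ => mul_nonneg (hnn p) (Real.sqrt_nonneg _)
    have hS1 : S ≤ (z + b) * √L := by
      calc S ≤ ∑ p ∈ Q with ¬ z < p, Real.log p / p * √L := by
            refine sum_le_sum fun p _ => mul_le_mul_of_nonneg_left (Real.sqrt_le_sqrt ?_) (hnn p)
            linarith [Real.log_natCast_nonneg p]
        _ ≤ ∑ p ∈ Ioc 0 z with p.Prime ∧ p % 4 = 1, Real.log p / p * √L := by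
            refine sum_le_sum_of_subset_of_nonneg (fun p hp => ?_) fun p _ _ =>
              mul_nonneg (hnn p) (Real.sqrt_nonneg _)
            obtain ⟨h2, h3⟩ := mem_filter.mp hp
            obtain ⟨h4, h5⟩ := mem_filter.mp h2
            have := (mem_Ioc.mp h4).1
            exact mem_filter.mpr ⟨mem_Ioc.mpr ⟨this, by omega⟩, h5⟩
        _ ≤ _ := by
            rw [← Finset.sum_mul]
            refine mul_le_mul_of_nonneg_right ?_ (Real.sqrt_nonneg _)
            have h2 := (abs_le.mp (hb z hz1)).2
            rw [Nat.floor_natCast] at h2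
            have h3 := Real.log_le_sub_one_of_pos (by linarith : (0 : ℝ) < z)
            linarith
    have h2 := abs_le.mp h1
    rw [abs_le]
    constructor <;> nlinarith

/-- Each q contributes about g₆(q)·(−3/q)·ka·√(L − log q) with g₆(q) ≈ ½ log q. The weighted Mertens
sum has main term L^{3/2}/3, and (3/2)(1/3) = 1/2. -/
lemma exists_zz_sum_rel : ∃ B C : ℝ, 1 ≤ B ∧ 1 ≤ C ∧ ∀ (z : ℕ) (L D : ℝ), 800 ≤ z → 1 ≤ L →
    (z : ℝ) ≤ D → D ≤ 2 * z → B * hz z ^ 3 * (1 + L) ^ (1 / 4 : ℝ) * D ≤ √L → (z + B) * D ≤ L →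
    |∑ q ∈ bigPrimes z ⌊Real.exp L⌋₊, g₆ q *
      act ((locz q - 1) * ∏ p ∈ (bigPrimes z ⌊Real.exp L⌋₊).erase q, locz p)
        (tens (Real.exp L) lg lg) (1, 1) + ka z * (L * √L) / 2|
      ≤ C / D * (ka z * (L * √L) / 2) := by
  obtain ⟨B1, hB11, hB1⟩ := exists_th_bounds
  obtain ⟨B2, hB21, hB2⟩ := exists_abs_sum_bigPrimes_le
  refine ⟨max B1 B2, 2 * (3 / 2 + 73000 * B2), le_max_of_le_left hB11, by linarith,
    fun z L D hz hL hzD hDz h h' => ?_⟩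
  have hz0 : (800 : ℝ) ≤ z := by exact_mod_cast hz
  have hD0 : 0 < D := by linarith
  have hH := one_le_hz z
  have hr := one_le_rpow_quarter (by linarith : 0 ≤ L)
  obtain ⟨h1, h2⟩ := hB1 z L D hL (by linarith) (le_trans (by gcongr; exact le_max_left _ _) h)
  obtain ⟨h3, h4⟩ := hB2 z L (by omega) hL
  have hk := ka_pos z
  have hL1 : 1 ≤ √L := Real.one_le_sqrt.mpr hL
  set k := ka z with hkdef
  set M := k * √L with hM
  have hM0 : 0 ≤ M := by positivity
  have hzz := abs_zz_sub_le hz hzD hDz hM0 h2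
  set v := Real.exp L with hv
  have hv0 : 0 ≤ v := (Real.exp_pos L).le
  set P := bigPrimes z ⌊v⌋₊ with hP
  set T : ℕ → ℝ := fun q => act ((locz q - 1) * ∏ p ∈ P.erase q, locz p) (tens v lg lg) (1, 1)
    with hT
  have hq : ∀ q ∈ P, |g₆ q * T q + 3 / 2 * k * (Real.log q / q * √(L - Real.log q))|
      ≤ 73000 * (M / D) * (Real.log q / q) := by
    intro q hqP
    obtain ⟨⟨hzq, hqv⟩, hqp, hq4⟩ := mem_bigPrimes.mp hqP
    have hq0 : (0 : ℝ) < q := by exact_mod_cast hqp.pos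
    have hlog : 0 ≤ Real.log q := Real.log_natCast_nonneg q
    have hlogL : Real.log q ≤ L := by
      rw [Real.log_le_iff_le_exp hq0]
      exact (Nat.le_floor_iff hv0).mp hqv
    have hexp : Real.exp (L - Real.log q) = v / q := by rw [Real.exp_sub, Real.exp_log hq0]
    have hqD : 1 / (q : ℝ) ≤ 2 / D := by
      refine le_trans ?_ (one_div_le_two_div hz hzD hDz)
      have : (z : ℝ) ≤ q := by exact_mod_cast hzq.le
      exact one_div_le_one_div_of_le (by linarith) this
    have k1 := abs_act_locz_sub_one_mul_le hqP (by omega)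
      (tens_mem_finSupp hv0 (fun _ => lg_of_lt) fun _ => lg_of_lt)
      (fun t => (hzz t).1) fun t => (hzz t).2
    -- The main term of `th` depends only on its smaller argument. So Θ(q,1), Θ(1,q) and Θ(q,q) all
    -- have main term ka·√(L − log q), and they combine with coefficients −2, −2, 1.
    have t1 := h1 (L - Real.log q) L (by linarith) (by linarith) le_rfl
    have t2 := h1 (L - Real.log q) (L - Real.log q) (by linarith) le_rfl (by linarith)
    rw [hexp] at t1 t2
    rw [← hv] at t1
    have e1 : thf z v (q, 1) = th z (v / q) v := by simp [thf]
    have e2 : thf z v (1, q) = th z (v / q) v := by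
      rw [th_comm z (by positivity) hv0]; simp [thf]
    have e3 : thf z v (q, q) = th z (v / q) (v / q) := rfl
    rw [e1, e2, e3] at k1
    set s := √(L - Real.log q) with hs
    set x := 1 / (q : ℝ) with hx
    have hx0 : 0 < x := by positivity
    have hsL : s ≤ √L := Real.sqrt_le_sqrt (by linarith)
    have hs0 : 0 ≤ s := Real.sqrt_nonneg _
    have k2 : |th z (v / q) (v / q) - 2 * th z (v / q) v - 2 * th z (v / q) v + 3 * (k * s)|
        ≤ 5 * (M / D) := by
      rw [abs_le] at t1 t2 ⊢
      constructor <;> linarith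
    have k3 : |T q + x * (3 * (k * s))| ≤ 36300 * (M / D) * x := by
      have e4 : T q + x * (3 * (k * s))
          = (T q - x * (th z (v / q) (v / q) - 2 * th z (v / q) v - 2 * th z (v / q) v))
          + x * (th z (v / q) (v / q) - 2 * th z (v / q) v - 2 * th z (v / q) v + 3 * (k * s)) := by
        ring
      have k4 : 351 * (6 * M) * x ^ 2 ≤ 4212 * (M / D) * x := by
        have : x ^ 2 ≤ x * (2 / D) := by rw [sq]; gcongr
        calc 351 * (6 * M) * x ^ 2 ≤ 351 * (6 * M) * (x * (2 / D)) := by gcongr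
          _ = _ := by ring
      have k5 : x * |th z (v / q) (v / q) - 2 * th z (v / q) v - 2 * th z (v / q) v + 3 * (k * s)|
          ≤ x * (5 * (M / D)) := mul_le_mul_of_nonneg_left k2 hx0.le
      have k6 : 0 ≤ M / D * x := by positivity
      have e5 : 5 * (6400 / D * M) * x = 32000 * (M / D * x) := by ring
      rw [e4]
      refine (abs_add_le _ _).trans ?_
      rw [abs_mul x, abs_of_pos hx0]
      rw [e5] at k1
      have k7 := add_le_add k1 k5
      refine k7.trans ?_
      linarith
    obtain ⟨g1, g2⟩ := abs_g₆_sub_le hqp.two_le hq4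
    have e6 : g₆ q * T q + 3 / 2 * k * (Real.log q / q * s)
        = g₆ q * (T q + x * (3 * (k * s))) - (g₆ q - Real.log q / 2) * (x * (3 * (k * s))) := by
      rw [hx]; ring
    have k8 : |g₆ q| * |T q + x * (3 * (k * s))| ≤ 2 * Real.log q * (36300 * (M / D) * x) :=
      mul_le_mul g2 k3 (abs_nonneg _) (by positivity)
    have k9 : |g₆ q - Real.log q / 2| * |x * (3 * (k * s))|
        ≤ 2 * (Real.log q / q) * (2 / D * (3 * M)) := by
      refine mul_le_mul g1 ?_ (abs_nonneg _) (by positivity)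
      rw [abs_of_nonneg (by positivity)]
      gcongr
      exact mul_le_mul_of_nonneg_left hsL hk.le
    rw [e6]
    refine (abs_sub _ _).trans ?_
    rw [abs_mul, abs_mul]
    have e7 : 2 * Real.log q * (36300 * (M / D) * x) = 72600 * (M / D) * (Real.log q / q) := by
      rw [hx]; ring
    have e8 : 2 * (Real.log q / q) * (2 / D * (3 * M)) = 12 * (M / D) * (Real.log q / q) := by ring
    have k10 : 0 ≤ M / D * (Real.log q / q) := by positivity
    rw [e7] at k8
    rw [e8] at k9
    linarith
  have hsum : |∑ q ∈ P, g₆ q * T q + 3 / 2 * k * ∑ q ∈ P, Real.log q / q * √(L - Real.log q)|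
      ≤ 73000 * (M / D) * (B2 * L) := by
    rw [Finset.mul_sum, ← sum_add_distrib]
    refine (abs_sum_le_sum_abs _ _).trans ((sum_le_sum hq).trans ?_)
    rw [← Finset.mul_sum]
    gcongr
  have hmain : 3 / 2 * k * |∑ q ∈ P, Real.log q / q * √(L - Real.log q) - L * √L / 3|
      ≤ 3 / 2 * k * (L / D * √L) := by
    refine mul_le_mul_of_nonneg_left (h4.trans ?_) (by positivity)
    gcongr
    rw [le_div_iff₀ hD0]
    exact le_trans (by gcongr; exact le_max_right _ _) h'
  have e9 : ∑ q ∈ P, g₆ q * T q + k * (L * √L) / 2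
      = (∑ q ∈ P, g₆ q * T q + 3 / 2 * k * ∑ q ∈ P, Real.log q / q * √(L - Real.log q))
        - 3 / 2 * k * (∑ q ∈ P, Real.log q / q * √(L - Real.log q) - L * √L / 3) := by ring
  rw [e9]
  refine (abs_sub _ _).trans ?_
  rw [abs_mul (3 / 2 * k), abs_of_pos (by positivity : 0 < 3 / 2 * k)]
  refine (add_le_add hsum hmain).trans (le_of_eq ?_)
  rw [hM]
  field_simp
  ring

end SumTwoSquaresSieve
end

/-! ### Size conditions on N and the relative form of the estimates -/

section
namespace SumTwoSquaresSieve
open Finset Filter Topology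

lemma g₁_W₁ (N : ℕ) : g₁ (W₁ N) = gz ⌊D₀ N⌋₊ := by
  have h : (smallPrimes N).filter (fun p => p % 4 = 1) = onePrimes ⌊D₀ N⌋₊ := by
    ext p
    simp only [smallPrimes, onePrimes, mem_filter, mem_range, mem_Ioc]
    constructor
    · rintro ⟨⟨h1, h2⟩, h3⟩
      exact ⟨⟨h2.pos, by omega⟩, h2, h3⟩
    · rintro ⟨⟨_, h1⟩, h2, h3⟩
      exact ⟨⟨by omega, h2⟩, h3⟩
  have hp : ∀ p ∈ onePrimes ⌊D₀ N⌋₊, p.Prime := fun p hp => (mem_filter.1 hp).2.1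
  rw [g₁, multExt, W₁, h, Nat.primeFactors_prod hp, gz]
  refine Finset.prod_congr rfl fun p hp => ?_
  have h4 := (mem_filter.1 hp).2.2
  rw [ZMod.χ₄_nat_one_mod_four h4]
  norm_num

lemma relApprox_of_abs_sub_le {C D S M : ℝ} (hM : M ≠ 0) (h : |S - M| ≤ C / D * |M|) :
    RelApprox C D⁻¹ S M := by
  refine ⟨(S - M) / M, ?_, ?_⟩
  · rw [abs_div, div_le_iff₀ (abs_pos.2 hM)]
    simpa [div_eq_mul_inv] using h
  · field_simp
    ring

/-- Powers of `ℓ` and `exp (72 ℓ^{3/4})` are negligible against `exp (ℓ / 4)`. -/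
lemma eventually_cube_mul_exp_le (K : ℝ) :
    ∀ᶠ l : ℝ in atTop, K * (l ^ 3 * Real.exp (72 * l ^ (3 / 4 : ℝ))) ≤ Real.exp (l / 4) := by
  have h1 : ∀ᶠ l : ℝ in atTop, 72 * l ^ (3 / 4 : ℝ) ≤ l / 8 := by
    -- The inequality 72 l^{3/4} ≤ l/8 amounts to l^{1/4} ≥ 576 = 8 · 72.
    have h := tendsto_rpow_atTop (y := (1 / 4 : ℝ)) (by norm_num)
    filter_upwards [h.eventually_ge_atTop 576, eventually_gt_atTop 0] with l hl h0
    have e : l = l ^ (3 / 4 : ℝ) * l ^ (1 / 4 : ℝ) := by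
      rw [← Real.rpow_add h0]; norm_num
    have h3 : 0 ≤ l ^ (3 / 4 : ℝ) := by positivity
    nlinarith [mul_le_mul_of_nonneg_left hl h3]
  have h2 : ∀ᶠ l : ℝ in atTop, |K| * l ^ 3 ≤ Real.exp (l / 8) := by
    have h := (Real.tendsto_exp_div_pow_atTop 3).comp
      (tendsto_id.atTop_div_const (show (0 : ℝ) < 8 by norm_num))
    filter_upwards [h.eventually_ge_atTop (512 * |K|), eventually_gt_atTop 0] with l hl h0
    simp only [Function.comp, id] at hl
    rw [le_div_iff₀ (by positivity)] at hl
    refine le_trans (le_of_eq ?_) hl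
    ring
  filter_upwards [h1, h2, eventually_gt_atTop 0] with l a b h0
  calc K * (l ^ 3 * Real.exp (72 * l ^ (3 / 4 : ℝ)))
      ≤ |K| * (l ^ 3 * Real.exp (72 * l ^ (3 / 4 : ℝ))) := by
        gcongr
        exact le_abs_self K
    _ = (|K| * l ^ 3) * Real.exp (72 * l ^ (3 / 4 : ℝ)) := by ring
    _ ≤ Real.exp (l / 8) * Real.exp (l / 8) := by gcongr
    _ = Real.exp (l / 4) := by rw [← Real.exp_add]; ring_nf

/-- The size conditions relating the sieving limit to the length of the sums. -/
lemma eventually_size_conditions {B B' θ : ℝ} (hB : 1 ≤ B) (hθ : 0 < θ) :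
    ∀ᶠ N : ℕ in atTop, 800 ≤ ⌊D₀ N⌋₊ ∧ 1 ≤ θ * Real.log N ∧ ((⌊D₀ N⌋₊ : ℕ) : ℝ) ≤ D₀ N ∧
      D₀ N ≤ 2 * (⌊D₀ N⌋₊ : ℕ) ∧
      B * hz ⌊D₀ N⌋₊ ^ 3 * (1 + θ * Real.log N) ^ (1 / 4 : ℝ) * D₀ N ≤ √(θ * Real.log N) ∧
      ((⌊D₀ N⌋₊ : ℕ) + B') * D₀ N ≤ θ * Real.log N := by
  obtain ⟨H, hH0, hH⟩ := exists_hz_le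
  have hlog : Tendsto (fun N : ℕ => Real.log N) atTop atTop :=
    Real.tendsto_log_atTop.comp tendsto_natCast_atTop_atTop
  have hll : Tendsto (fun N : ℕ => Real.log (Real.log N)) atTop atTop :=
    Real.tendsto_log_atTop.comp hlog
  have hD : Tendsto (fun N : ℕ => D₀ N) atTop atTop := by
    exact (tendsto_pow_atTop (by norm_num)).comp hll
  set K := B * H ^ 3 * 2 / θ ^ (1 / 4 : ℝ) with hK
  have hpoly : ∀ᶠ l : ℝ in atTop, (l ^ 3 + B') * l ^ 3 ≤ θ * Real.exp l := by
    have h := Real.tendsto_exp_div_pow_atTop 6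
    filter_upwards [h.eventually_ge_atTop ((1 + |B'|) / θ), eventually_ge_atTop 1] with l hl h1
    rw [le_div_iff₀ (by positivity), div_mul_eq_mul_div, div_le_iff₀ hθ] at hl
    have h3 : 1 ≤ l ^ 3 := one_le_pow₀ h1
    have h4 := le_abs_self B'
    have h5 : B' ≤ |B'| * l ^ 3 := h4.trans (le_mul_of_one_le_right (abs_nonneg _) h3)
    calc (l ^ 3 + B') * l ^ 3 ≤ (l ^ 3 + |B'| * l ^ 3) * l ^ 3 := by gcongr
      _ = (1 + |B'|) * l ^ 6 := by ring
      _ ≤ _ := by linarith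
  filter_upwards [hD.eventually_ge_atTop 800, hlog.eventually_ge_atTop (1 / θ),
    hlog.eventually_gt_atTop 0, hll.eventually_gt_atTop 0,
    hll.eventually (eventually_cube_mul_exp_le K), hll.eventually hpoly]
    with N h1 h2 h3 h4 h5 h6
  have hz8 : 800 ≤ ⌊D₀ N⌋₊ := Nat.le_floor (by exact_mod_cast h1)
  have hfl : ((⌊D₀ N⌋₊ : ℕ) : ℝ) ≤ D₀ N := Nat.floor_le (by linarith)
  have hL : 1 ≤ θ * Real.log N := by
    rw [div_le_iff₀ hθ] at h2; linarith
  rw [Real.exp_log h3] at h6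
  have hz' : (800 : ℝ) ≤ (⌊D₀ N⌋₊ : ℕ) := by exact_mod_cast hz8
  refine ⟨hz8, hL, hfl, ?_, ?_, ?_⟩
  · have := Nat.lt_floor_add_one (D₀ N)
    linarith
  · set l := Real.log (Real.log N) with hl
    set L := θ * Real.log N with hLd
    have hDl : D₀ N = l ^ 3 := rfl
    -- With l = log log N one has D₀^{1/4} = l^{3/4}, so hz³ = O(exp(72 l^{3/4})). This is absorbed
    -- by (log N)^{1/4} = e^{l/4}, the room left between L^{1/4} and √L.
    have e1 : ((⌊D₀ N⌋₊ : ℕ) : ℝ) ^ (1 / 4 : ℝ) ≤ l ^ (3 / 4 : ℝ) := by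
      refine (Real.rpow_le_rpow (by positivity) hfl (by norm_num)).trans (le_of_eq ?_)
      rw [hDl, ← Real.rpow_natCast, ← Real.rpow_mul h4.le]
      norm_num
    have e2 : hz ⌊D₀ N⌋₊ ^ 3 ≤ H ^ 3 * Real.exp (72 * l ^ (3 / 4 : ℝ)) := by
      have h0 := zero_le_one.trans (one_le_hz ⌊D₀ N⌋₊)
      have : hz ⌊D₀ N⌋₊ ≤ H * Real.exp (24 * l ^ (3 / 4 : ℝ)) :=
        (hH _).trans (by gcongr)
      refine (pow_le_pow_left₀ h0 this 3).trans (le_of_eq ?_)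
      rw [mul_pow, ← Real.exp_nat_mul]
      congr 2
      push_cast; ring
    have e3 : (1 + L) ^ (1 / 4 : ℝ) ≤ 2 * L ^ (1 / 4 : ℝ) := by
      calc (1 + L) ^ (1 / 4 : ℝ) ≤ (2 * L) ^ (1 / 4 : ℝ) := by
            apply Real.rpow_le_rpow <;> linarith
        _ = (2 : ℝ) ^ (1 / 4 : ℝ) * L ^ (1 / 4 : ℝ) := by
            rw [Real.mul_rpow (by norm_num) (by linarith)]
        _ ≤ (2 : ℝ) ^ (1 : ℝ) * L ^ (1 / 4 : ℝ) := by
            have : 0 ≤ L ^ (1 / 4 : ℝ) := Real.rpow_nonneg (by linarith) _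
            refine mul_le_mul_of_nonneg_right ?_ this
            exact Real.rpow_le_rpow_of_exponent_le (by norm_num) (by norm_num)
        _ = _ := by norm_num
    have e4 : Real.exp (l / 4) = Real.log N ^ (1 / 4 : ℝ) := by
      rw [Real.rpow_def_of_pos h3]; congr 1; ring
    have e5 : L ^ (1 / 4 : ℝ) = θ ^ (1 / 4 : ℝ) * Real.log N ^ (1 / 4 : ℝ) :=
      Real.mul_rpow hθ.le h3.le
    have hθ4 : 0 < θ ^ (1 / 4 : ℝ) := by positivity
    have hL4 : 0 ≤ L ^ (1 / 4 : ℝ) := Real.rpow_nonneg (by linarith) _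
    have hL4' : 0 ≤ (1 + L) ^ (1 / 4 : ℝ) := Real.rpow_nonneg (by linarith) _
    have hl3 : 0 ≤ l ^ 3 := by positivity
    calc B * hz ⌊D₀ N⌋₊ ^ 3 * (1 + L) ^ (1 / 4 : ℝ) * D₀ N
        ≤ B * (H ^ 3 * Real.exp (72 * l ^ (3 / 4 : ℝ))) * (2 * L ^ (1 / 4 : ℝ)) * l ^ 3 := by
          rw [← hDl] at hl3 ⊢
          gcongr
      _ = θ ^ (1 / 4 : ℝ) * L ^ (1 / 4 : ℝ) *
            (K * (l ^ 3 * Real.exp (72 * l ^ (3 / 4 : ℝ)))) := by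
          rw [hK]; field_simp
      _ ≤ θ ^ (1 / 4 : ℝ) * L ^ (1 / 4 : ℝ) * Real.exp (l / 4) := by gcongr
      _ = L ^ (1 / 4 : ℝ) * L ^ (1 / 4 : ℝ) := by rw [e4, e5]; ring
      _ = √L := by
          rw [← Real.rpow_add (by linarith), Real.sqrt_eq_rpow]; norm_num
  · refine le_trans ?_ h6
    have hDl : D₀ N = Real.log (Real.log N) ^ 3 := rfl
    rw [← hDl]
    gcongr

end SumTwoSquaresSieve
end

/-! ### Assembly of the four estimates -/

section
namespace SumTwoSquaresSieve

/-- The four asymptotic formulas, with the sieving limit and the length in explicit form. -/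
lemma exists_abs_sub_main_le : ∃ B C : ℝ, 1 ≤ B ∧ 12803 ≤ C ∧ ∀ (N : ℕ) (L : ℝ),
    800 ≤ ⌊D₀ N⌋₊ → 1 ≤ L → (⌊D₀ N⌋₊ : ℝ) ≤ D₀ N → D₀ N ≤ 2 * (⌊D₀ N⌋₊ : ℕ) →
    B * hz ⌊D₀ N⌋₊ ^ 3 * (1 + L) ^ (1 / 4 : ℝ) * D₀ N ≤ √L → (⌊D₀ N⌋₊ + B) * D₀ N ≤ L →
    |X (Real.exp L) (W N) - mm ⌊D₀ N⌋₊ * √L| ≤ C / D₀ N * (mm ⌊D₀ N⌋₊ * √L) ∧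
    |Y (Real.exp L) (W N) - mm ⌊D₀ N⌋₊ ^ 2 * L| ≤ C / D₀ N * (mm ⌊D₀ N⌋₊ ^ 2 * L) ∧
    |Z1 (Real.exp L) (W N) - ka ⌊D₀ N⌋₊ * √L| ≤ C / D₀ N * (ka ⌊D₀ N⌋₊ * √L) ∧
    |Z2 (Real.exp L) (W N) + ka ⌊D₀ N⌋₊ * (L * √L) / 2|
      ≤ C / D₀ N * (ka ⌊D₀ N⌋₊ * (L * √L) / 2) := by
  obtain ⟨B1, hB1, h1⟩ := exists_tt_rel
  obtain ⟨B2, hB2, h2⟩ := exists_zz_rel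
  obtain ⟨B3, C, hB3, hC, h3⟩ := exists_zz_sum_rel
  refine ⟨max B1 (max B2 B3), max 12803 C, le_max_of_le_left hB1, le_max_left _ _,
    fun N L hz8 hL hzD hDz h h' => ?_⟩
  set z := ⌊D₀ N⌋₊ with hzN
  have hz0 : (800 : ℝ) ≤ z := by exact_mod_cast hz8
  have hD0 : 0 < D₀ N := by linarith
  have hv : 0 ≤ Real.exp L := (Real.exp_pos L).le
  have hm := mm_pos z
  have hk := ka_pos z
  have hH := zero_le_one.trans (one_le_hz z)
  have hmono : ∀ B', B' ≤ max B1 (max B2 B3) →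
      B' * hz z ^ 3 * (1 + L) ^ (1 / 4 : ℝ) * D₀ N ≤ √L := fun B' hB' => by
    refine le_trans ?_ h
    have : 0 ≤ (1 + L) ^ (1 / 4 : ℝ) := Real.rpow_nonneg (by linarith) _
    gcongr
  have hmono' : ∀ c M : ℝ, c ≤ max 12803 C → 0 ≤ M → c / D₀ N * M ≤ max 12803 C / D₀ N * M :=
    fun c M hc hM => by gcongr
  obtain ⟨a1, a2⟩ := h1 z L (D₀ N) hz8 hL hzD hDz (hmono _ (le_max_left _ _))
  have a3 := h2 z L (D₀ N) hz8 hL hzD hDz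
    (hmono _ ((le_max_left _ _).trans (le_max_right _ _)))
  have hB3' : B3 ≤ max B1 (max B2 B3) := (le_max_right _ _).trans (le_max_right _ _)
  have a4 := h3 z L (D₀ N) hz8 hL hzD hDz (hmono _ hB3') (le_trans (by gcongr) h')
  rw [X_eq hzN, Y_eq hzN hv, Z1_eq hzN hv, Z2_eq hzN hv]
  exact ⟨a1.trans (hmono' _ _ (le_max_of_le_left (by norm_num)) (by positivity)),
    a2.trans (hmono' _ _ (le_max_left _ _) (by positivity)),
    a3.trans (hmono' _ _ (le_max_of_le_left (by norm_num)) (by positivity)),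
    a4.trans (hmono' _ _ (le_max_right _ _) (by positivity))⟩

end SumTwoSquaresSieve
end

theorem mainTheorem9 :
    ∃ C : ℝ, 0 < C ∧ ∀ θ : ℝ, 0 < θ → ∃ N₀ : ℕ, ∀ N : ℕ, N₀ ≤ N → ∀ v : ℝ, v = (N : ℝ) ^ θ →
      RelApprox C (D₀ N)⁻¹ (X v (W N))
        (8 * landauA * Real.log v ^ (1 / 2 : ℝ) / (Real.pi * g₁ (W₁ N))) ∧
      RelApprox C (D₀ N)⁻¹ (Y v (W N))
        (64 * landauA ^ 2 * Real.log v / (Real.pi ^ 2 * g₁ (W₁ N) ^ 2)) ∧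
      RelApprox C (D₀ N)⁻¹ (Z1 v (W N))
        (128 * landauA ^ 3 * Real.log v ^ (1 / 2 : ℝ) / (Real.pi ^ 2 * g₁ (W₁ N) ^ 3)) ∧
      RelApprox C (D₀ N)⁻¹ (Z2 v (W N))
        (-(64 * landauA ^ 3 * Real.log v ^ (3 / 2 : ℝ) / (Real.pi ^ 2 * g₁ (W₁ N) ^ 3))) := by
  obtain ⟨B, C, hB, hC, h⟩ := exists_abs_sub_main_le
  refine ⟨C, by linarith, fun θ hθ => ?_⟩
  obtain ⟨N₀, hN₀⟩ := Filter.eventually_atTop.1 (eventually_size_conditions (B' := B) hB hθ)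
  -- Positivity of N is needed to write N^θ = exp(θ log N). Only this threshold depends on θ; the
  -- constant C was fixed before.
  refine ⟨max 1 N₀, fun N hN v hv => ?_⟩
  obtain ⟨c1, c2, c3, c4, c5, c6⟩ := hN₀ N ((le_max_right _ _).trans hN)
  have hN0 : (0 : ℝ) < N := by exact_mod_cast (le_max_left _ _).trans hN
  obtain ⟨L, hL⟩ : ∃ L, L = θ * Real.log N := ⟨_, rfl⟩
  have hvL : v = Real.exp L := by
    rw [hv, Real.rpow_def_of_pos hN0, hL, mul_comm]
  rw [← hL] at c2 c5 c6
  obtain ⟨a1, a2, a3, a4⟩ := h N L c1 c2 c3 c4 c5 c6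
  have hL0 : 0 < L := by linarith
  have hm := mm_pos ⌊D₀ N⌋₊
  have hk := ka_pos ⌊D₀ N⌋₊
  have hg := gz_pos ⌊D₀ N⌋₊
  have hr : L ^ (3 / 2 : ℝ) = L * √L := by
    rw [Real.sqrt_eq_rpow, ← Real.rpow_one_add' hL0.le (by norm_num)]
    norm_num
  have e1 : 8 * landauA * √L / (Real.pi * gz ⌊D₀ N⌋₊) = mm ⌊D₀ N⌋₊ * √L := by
    rw [mm]; ring
  have e2 : 64 * landauA ^ 2 * L / (Real.pi ^ 2 * gz ⌊D₀ N⌋₊ ^ 2) = mm ⌊D₀ N⌋₊ ^ 2 * L := by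
    rw [mm]; ring
  have e3 : 128 * landauA ^ 3 * √L / (Real.pi ^ 2 * gz ⌊D₀ N⌋₊ ^ 3) = ka ⌊D₀ N⌋₊ * √L := by
    rw [ka]; ring
  have e4 : 64 * landauA ^ 3 * (L * √L) / (Real.pi ^ 2 * gz ⌊D₀ N⌋₊ ^ 3)
      = ka ⌊D₀ N⌋₊ * (L * √L) / 2 := by
    rw [ka]; ring
  rw [hvL, Real.log_exp, g₁_W₁, hr, ← Real.sqrt_eq_rpow, e1, e2, e3, e4]
  have p1 : 0 < mm ⌊D₀ N⌋₊ * √L := by positivity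
  have p2 : 0 < mm ⌊D₀ N⌋₊ ^ 2 * L := by positivity
  have p3 : 0 < ka ⌊D₀ N⌋₊ * √L := by positivity
  have p4 : 0 < ka ⌊D₀ N⌋₊ * (L * √L) / 2 := by positivity
  refine ⟨relApprox_of_abs_sub_le p1.ne' ?_, relApprox_of_abs_sub_le p2.ne' ?_,
    relApprox_of_abs_sub_le p3.ne' ?_, relApprox_of_abs_sub_le (neg_ne_zero.2 p4.ne') ?_⟩
  · rwa [abs_of_pos p1]
  · rwa [abs_of_pos p2]
  · rwa [abs_of_pos p3]
  · rwa [abs_neg, abs_of_pos p4, sub_neg_eq_add]
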